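/- **Setting.** Let $\mathcal R$ be a discrete valuation ring with fraction field $K$, uniformizer $s$, residue field $k$ and normalized valuation $\mathrm{val}$, and let $X=\mathbb Z^r$, $X_{\mathbb R}=\mathbb R^r$. Let $a:X\to K^*$ be a function such that $b(x,y)=a(x+y)a(x)^{-1}a(y)^{-1}$ is bilinear and $b(x,x)\in (s)$ for all $x\neq0$ (degeneration data of a principally polarized family with maximal degeneration). Put $A=\mathrm{val}\,a$, $B=\mathrm{val}\,b$; then $A(x)=B(x,x)/2+l(x)/2$ for a linear form $l$, $B$ is positive definite, and for $\alpha\in X_{\mathbb R}$ we write $dA(\alpha)=B(\alpha,\cdot)+l/2\in X_{\mathbb R}^*$. *Cells.* A Delaunay cell is the convex hull $\sigma$ of the lattice points that are nearest, for the norm of $B$, to some $\alpha\in X_{\mathbb R}$; its dual Voronoi cell $\hat\sigma$ is the closure of the set of all $\alpha$ that define $\sigma$. For a set $W\subset X_{\mathbb R}$ let $D(W)$ be the convex hull of the lattice points that are nearest to every $\beta\in W$. A cell $\sigma$ is maximal if $\dim\sigma=r$; it is then defined by a unique $\alpha=\alpha(\sigma)$, its hole. *Scheme.* Let ${}_1R\subset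 K[\vartheta,w^x;x\in X]$ be the $\mathcal R$-subalgebra generated by the $a(x)w^x\vartheta$, let $R$ be its saturation, i.e. the $\mathcal R$-module spanned by the monomials $s^nw^x\vartheta^d$ a positive power of which lies in ${}_1R$ (graded by $\vartheta$), and put $\widetilde P=\mathrm{Proj}\,R$, $\widetilde{\mathcal L}=\mathcal O(1)$. Let $\widetilde P_0=\widetilde P\times_{\mathcal R}k$ be the central fiber. The torus $T_0=\mathrm{Spec}\,k[X]$ acts on $\widetilde P_0$, with a linearization of $\widetilde{\mathcal L}|_{\widetilde P_0}$, by the $X$-grading of $R$; action and linearization exist and are unique. For $W\subset X_{\mathbb R}$ let $R_W=\bigoplus_x \mathcal R\langle s^nw^x : n\in\mathbb Z,\ n\ge dA(\beta)(x)\ \forall\beta\in W\rangle$. If $c\in X$ is nearest to all $\beta \in W$, then $w^x\vartheta^d\mapsto s^{-d\cdot A(c)}w^{x-dc}$ defines a morphism $\mathrm{Spec}\,R_W\to\widetilde P$. For a Delaunay cell $\sigma$ put $R(\sigma)=R_{\hat\sigma}$, and let $U(\sigma)\subset\widetilde P$ be the image of $\mathrm{Spec}\,R(\sigma)$ under these morphisms.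 Let $U(\emptyset)$ be the image of $\mathrm{Spec}\,R_\emptyset=\mathrm{Spec}\,K[X]$ (the generic torus). Let $\mathrm{orb}(\sigma)\subset\widetilde P_0$ be the set of points of $U(\sigma)$ that do not lie in $U(\tau)$ for any Delaunay cell $\tau\supsetneq\sigma$, and let $\widetilde V(\sigma)$ be its closure with the reduced structure. **Theorem.** (i) For each Delaunay cell $\sigma$ the morphisms $\mathrm{Spec}\,R(\sigma)\to\widetilde P$ belonging to the lattice points $c\in\sigma$ all exist and coincide, and they are an open immersion with image $U(\sigma)$. For Delaunay cells $\sigma_1,\sigma_2$ with $\hat\sigma_1\cap\hat\sigma_2\ne\emptyset$, $D(\hat\sigma_1\cap\hat\sigma_2)$ is a Delaunay cell with dual Voronoi cell $\hat\sigma_1\cap\hat\sigma_2$, and $U(\sigma_1)\cap U(\sigma_2)=U(D(\hat\sigma_1\cap\hat\sigma_2))$; if $\hat\sigma_1\cap\hat\sigma_2=\emptyset$, then $U(\sigma_1)\cap U(\sigma_2)=U(\emptyset)$. (ii) For a Delaunay cell $\sigma$ and a lattice point $c\in\sigma$, the ring $R(\sigma)$ contains $R(c)=R(\{c\})$ and is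 its localization at the monomials $\zeta_{d,c}=s^{\lceil\eta(d,c)\rceil}w^d$, $d\in X\cap\mathbb R_{\ge0}(\sigma-c)$ with $\eta(d,c)\in\mathbb Z$, where $\eta(d,c)=\max\, dA(\alpha(\tau))(d)$ over the maximal Delaunay cells $\tau\ni c$. (iii) The map $\sigma\mapsto\mathrm{orb}(\sigma)$ is a bijection from the Delaunay cells to the $T_0$-orbits in $\widetilde P_0$, and $\dim\mathrm{orb}(\sigma)=\dim\sigma$. The map $\sigma\mapsto\overline{\mathrm{orb}(\sigma)}$ is a bijection from the maximal Delaunay cells to the irreducible components of $\widetilde P_0$. (iv) For each Delaunay cell $\sigma$, $\widetilde V(\sigma)$ is integral, carries a unique $T_0$-action with a linearization of $\widetilde{\mathcal L}|_{\widetilde V(\sigma)}$ given by the $X$-grading, is projective over $k$ with $\widetilde{\mathcal L}|_{\widetilde V(\sigma)}$ ample, and is isomorphic, $T_0$-equivariantly and compatibly with the linearized line bundles, to the projective toric variety $(\mathrm{Proj}\,k[C_\sigma],\mathcal O(1))$ of the polytope $\sigma$. Here $C_\sigma\subset\mathbb N\times X$ is the graded semigroup of all $(d,x)$ such that $x\in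 d\sigma$ (with $x=0$ if $d=0$) and $d\cdot A(c)+dA(\alpha)(x-dc)\in\mathbb Z$ for all $\alpha\in\hat\sigma$ and all lattice points $c\in\sigma$. The second condition holds automatically if $dA(\alpha(\tau))$ is integral on $X$ for some maximal $\tau\supset\sigma$, so that $C_\sigma$ is then the semigroup of all lattice points of the multiples $d\sigma$. (v) For Delaunay cells $\sigma_1,\sigma_2$: if $\sigma_1\cap\sigma_2=\emptyset$, then $\widetilde V(\sigma_1)\cap\widetilde V(\sigma_2)=\emptyset$. Otherwise $\sigma_1\cap\sigma_2$ is a Delaunay cell and $\widetilde V(\sigma_1)\cap\widetilde V(\sigma_2)=\widetilde V(\sigma_1\cap\sigma_2)$, as sets and as closed subschemes. (vi) For a maximal Delaunay cell $\sigma$, the multiplicity of $\widetilde V(\sigma)$ in $\widetilde P_0$ (the length of the local ring of $\widetilde P_0$ at the generic point of $\widetilde V(\sigma)$) is the denominator of $dA(\alpha(\sigma))\in X^*_{\mathbb Q}$, i.e. the least integer $m>0$ such that $m\,dA(\alpha(\sigma))$ is integral on $X$. -/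

import Mathlib

open CategoryTheory AlgebraicGeometry TopologicalSpace Opposite
set_option linter.unusedVariables false
open scoped Pointwise

universe u

/-- A multiplicative system of `R`-submodules of a field `F`, indexed by a commutative monoid `G`. It
describes the subalgebra of `F[G]` of those polynomials whose coefficient at `g` belongs to
`coeff g`. -/
structure CoeffSystem (R F : Type u) [CommRing R] [Field F] [Algebra R F]
    (G : Type) [AddCommMonoid G] where
  coeff : G → Submodule R F
  one_mem : (1 : F) ∈ coeff 0
  mul_mem : ∀ g h : G, ∀ a ∈ coeff g, ∀ b ∈ coeff h, a * b ∈ coeff (g + h)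

namespace CoeffSystem

section
variable {R F : Type u} [CommRing R] [Field F] [Algebra R F] {G : Type} [AddCommMonoid G]

/-- The `R`-subalgebra of `F[G]` described by the system. -/
def toSubalgebra (Q : CoeffSystem R F G) : Subalgebra R (AddMonoidAlgebra F G) where
  carrier := {f | ∀ g, f.coeff g ∈ Q.coeff g}
  mul_mem' := by
    classical
    intro f h hf hh g
    rw [AddMonoidAlgebra.mul_def]
    simp only [AddMonoidAlgebra.coeff_sum, Finsupp.sum, Finsupp.coe_finsetSum,
      Finset.sum_apply, AddMonoidAlgebra.coeff_single]
    refine Submodule.sum_mem _ fun a _ => Submodule.sum_mem _ fun b _ => ?_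
    rw [Finsupp.single_apply]
    split_ifs with e
    · subst e; exact Q.mul_mem _ _ _ (hf a) _ (hh b)
    · exact Submodule.zero_mem _
  add_mem' := by
    intro f h hf hh g
    simpa using Submodule.add_mem _ (hf g) (hh g)
  algebraMap_mem' := by
    classical
    intro r g
    have : (algebraMap R (AddMonoidAlgebra F G) r) = AddMonoidAlgebra.single 0 (algebraMap R F r) := by
      simp
    rw [this, AddMonoidAlgebra.coeff_single, Finsupp.single_apply]
    split_ifs with e
    · subst e
      rw [Algebra.algebraMap_eq_smul_one]
      exact Submodule.smul_mem _ _ Q.one_mem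
    · exact Submodule.zero_mem _

end

section
variable {R F : Type u} [CommRing R] [Field F] [Algebra R F] {E : Type} [AddCommGroup E]

theorem filter_mem {G : Type} [AddCommMonoid G] (Q : CoeffSystem R F G) (p : G → Prop)
    [DecidablePred p] {f : AddMonoidAlgebra F G} (hf : f ∈ Q.toSubalgebra) :
    AddMonoidAlgebra.ofCoeff (f.coeff.filter p) ∈ Q.toSubalgebra := by
  intro g
  by_cases h : p g
  · simpa [Finsupp.filter_apply_pos p _ h] using hf g
  · simp [Finsupp.filter_apply_neg p _ h]

/-- The homogeneous elements of degree `d`; the degree is the first component of the exponent. -/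
def grading (Q : CoeffSystem R F (ℕ × E)) (d : ℕ) : Submodule R Q.toSubalgebra where
  carrier := {f | ∀ p : ℕ × E, f.1.coeff p ≠ 0 → p.1 = d}
  zero_mem' := by intro p hp; simp at hp
  add_mem' := by
    intro f g hf hg p hp
    by_contra h
    have h1 : f.1.coeff p = 0 := by by_contra h1; exact h (hf p h1)
    have h2 : g.1.coeff p = 0 := by by_contra h1; exact h (hg p h1)
    exact hp (by simp [h1, h2])
  smul_mem' := by
    intro r f hf p hp
    refine hf p fun h => hp ?_
    simp [h]

/-- The homogeneous component of degree `d`. -/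
def component (Q : CoeffSystem R F (ℕ × E)) (d : ℕ) : Q.toSubalgebra →+ Q.grading d where
  toFun f := ⟨⟨.ofCoeff (f.1.coeff.filter fun p => p.1 = d), Q.filter_mem _ f.2⟩, by
    intro p hp
    by_contra h
    exact hp (Finsupp.filter_apply_neg _ _ h)⟩
  map_zero' := by
    apply Subtype.ext; apply Subtype.ext
    exact congrArg AddMonoidAlgebra.ofCoeff (Finsupp.filter_zero _)
  map_add' f g := by
    apply Subtype.ext; apply Subtype.ext
    simp [Finsupp.filter_add]

theorem component_apply (Q : CoeffSystem R F (ℕ × E)) (d : ℕ) (f : Q.toSubalgebra) (p : ℕ × E) :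
    (Q.component d f).1.1.coeff p = if p.1 = d then f.1.coeff p else 0 := by
  change (f.1.coeff.filter fun p => p.1 = d) p = _
  rw [Finsupp.filter_apply]

instance (Q : CoeffSystem R F (ℕ × E)) : SetLike.GradedMonoid Q.grading where
  one_mem := by
    classical
    intro p hp
    have : ((1 : Q.toSubalgebra) : AddMonoidAlgebra F (ℕ × E)) = AddMonoidAlgebra.single 0 1 := rfl
    rw [this, AddMonoidAlgebra.coeff_single, Finsupp.single_apply] at hp
    split_ifs at hp with h
    · rw [← h]; rfl
    · exact absurd rfl hp
  mul_mem := by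
    classical
    intro i j f g hf hg p hp
    have hp' : p ∈ (f.1 * g.1).coeff.support := by simpa using hp
    obtain ⟨a, ha, b, hb, rfl⟩ := Finset.mem_add.1 (AddMonoidAlgebra.support_coeff_mul_subset _ _ hp')
    have h1 := hf a (by simpa using ha)
    have h2 := hg b (by simpa using hb)
    simp [h1, h2]

open DirectSum in
noncomputable instance (Q : CoeffSystem R F (ℕ × E)) : GradedAlgebra Q.grading := by
  classical
  let D (f : Q.toSubalgebra) : ⨁ d, Q.grading d :=
    ∑ d ∈ f.1.coeff.support.image Prod.fst, DirectSum.of (fun d => Q.grading d) d (Q.component d f)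
  have hD (f : Q.toSubalgebra) (i : ℕ) : D f i = Q.component i f := by
    simp only [D, DirectSum.sum_apply, DirectSum.of_apply]
    rw [Finset.sum_eq_single i]
    · simp
    · intro b _ hb; simp [hb]
    · intro hi
      simp only [dite_true]
      apply Subtype.ext; apply Subtype.ext; ext p
      change (Q.component i f).1.1.coeff p = 0
      rw [component_apply]
      split_ifs with h
      · by_contra h2
        exact hi (Finset.mem_image.2 ⟨p, by simpa using h2, h⟩)
      · rfl
  refine { decompose' := D, left_inv := ?_, right_inv := ?_ }
  · intro f
    simp only [D, map_sum, DirectSum.coeAddMonoidHom_of]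
    apply Subtype.ext; ext p
    simp only [AddSubmonoidClass.coe_finsetSum, AddMonoidAlgebra.coeff_sum,
      Finsupp.coe_finsetSum, Finset.sum_apply, component_apply]
    rw [Finset.sum_ite_eq]
    split_ifs with h
    · rfl
    · by_contra h2
      exact h (Finset.mem_image.2 ⟨p, by simpa using Ne.symm h2, rfl⟩)
  · intro x
    apply DFinsupp.ext
    intro i
    refine (hD _ i).trans ?_
    induction x using DirectSum.induction_on with
    | zero => simp
    | of j y =>
      rw [DirectSum.coeAddMonoidHom_of]
      apply Subtype.ext; apply Subtype.ext; ext p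
      rw [component_apply, DirectSum.of_apply]
      by_cases hij : j = i
      · subst hij
        simp only [dite_true]
        split_ifs with h
        · rfl
        · by_contra h2
          exact h (y.2 p (Ne.symm h2))
      · simp only [hij, dite_false]
        split_ifs with h
        · by_contra h2
          exact hij ((y.2 p h2).symm.trans h)
        · rfl
    | add x y hx hy =>
      rw [map_add, map_add, hx, hy]; rfl

end
end CoeffSystem

/-! ### The twisting sheaves `𝒪(n)` on `Proj` -/

namespace SerreTwist
noncomputable section
variable {A : Type u} {σ : Type*} [CommRing A] [SetLike σ A] [AddSubgroupClass σ A]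
  (𝒜 : ℕ → σ) [GradedRing 𝒜]

/-- The homogeneous prime ideal of a point of `Proj 𝒜`. -/
def idealAt (x : ProjectiveSpectrum.top 𝒜) : Ideal A :=
  (ProjectiveSpectrum.asHomogeneousIdeal (𝒜 := 𝒜) x).toIdeal

instance (x : ProjectiveSpectrum.top 𝒜) : (idealAt 𝒜 x).IsPrime :=
  ProjectiveSpectrum.isPrime (𝒜 := 𝒜) x

/-- The localization of the graded ring at the prime ideal of a point. -/
abbrev Fiber (x : ProjectiveSpectrum.top 𝒜) : Type u := Localization.AtPrime (idealAt 𝒜 x)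

/-- A family of elements of the localizations is given by a fraction `a / b` of degree `n`, whose
denominator does not vanish. -/
def fractionPrelocal (n : ℕ) : TopCat.PrelocalPredicate (Fiber 𝒜) where
  pred {U} f := ∃ (i : ℕ) (a : 𝒜 (i + n)) (b : 𝒜 i) (hb : ∀ x : U, (b : A) ∉ idealAt 𝒜 x.1),
    ∀ x : U, f x = Localization.mk (a : A) (⟨b, hb x⟩ : (idealAt 𝒜 x.1).primeCompl)
  res := by
    rintro V U i f ⟨j, a, b, hb, w⟩
    exact ⟨j, a, b, (hb <| i ·), (w <| i ·)⟩

/-- A family is locally given by fractions of degree `n`. -/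
def localFraction (n : ℕ) : TopCat.LocalPredicate (Fiber 𝒜) := (fractionPrelocal 𝒜 n).sheafify

/-- The sections of `𝒪(n)` over `U`. -/
def sections (n : ℕ) (U : Opens (ProjectiveSpectrum.top 𝒜)) :
    AddSubgroup ((x : U) → Fiber 𝒜 x.1) where
  carrier := {f | (localFraction 𝒜 n).pred f}
  zero_mem' := fun x => ⟨U, x.2, 𝟙 U, 0, ⟨0, zero_mem _⟩, ⟨1, SetLike.GradedOne.one_mem⟩,
    fun y => (Ideal.ne_top_iff_one _).1 (Ideal.IsPrime.ne_top inferInstance),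
    fun y => (Localization.mk_zero _).symm⟩
  neg_mem' := by
    intro f hf x
    obtain ⟨V, hx, i, d, a, b, hb, w⟩ := hf x
    refine ⟨V, hx, i, d, -a, b, hb, fun y => ?_⟩
    have h1 : f (i y) = _ := w y
    change - f (i y) = _
    rw [h1, Localization.neg_mk]
    rfl
  add_mem' := by
    intro f g hf hg x
    obtain ⟨V, hx, i, d, a, b, hb, w⟩ := hf x
    obtain ⟨V', hx', i', d', a', b', hb', w'⟩ := hg x
    refine ⟨V ⊓ V', ⟨hx, hx'⟩, Opens.infLELeft _ _ ≫ i, d + d',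
      ⟨b' * a + b * a', ?_⟩, ⟨b * b', SetLike.GradedMul.mul_mem b.2 b'.2⟩, fun y => ?_, fun y => ?_⟩
    · refine add_mem ?_ ?_
      · have := SetLike.GradedMul.mul_mem b'.2 a.2
        rwa [show d' + (d + n) = d + d' + n by ring] at this
      · have := SetLike.GradedMul.mul_mem b.2 a'.2
        rwa [show d + (d' + n) = d + d' + n by ring] at this
    · exact (idealAt 𝒜 y.1).primeCompl.mul_mem (hb ⟨y.1, y.2.1⟩) (hb' ⟨y.1, y.2.2⟩)
    · have h1 : f ⟨y.1, _⟩ = _ := w ⟨y.1, y.2.1⟩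
      have h2 : g ⟨y.1, _⟩ = _ := w' ⟨y.1, y.2.2⟩
      change f ⟨y.1, _⟩ + g ⟨y.1, _⟩ = _
      rw [h1, h2, Localization.add_mk, add_comm]
      congr 1

/-- The value of a regular function at a point, in the localization. -/
def eval {U : Opens (ProjectiveSpectrum.top 𝒜)} (x : U) :
    (ProjectiveSpectrum.Proj.structureSheaf 𝒜).1.obj (op U) →+* Fiber 𝒜 x.1 where
  toFun r := HomogeneousLocalization.val (r.1 x)
  map_one' := HomogeneousLocalization.val_one
  map_zero' := HomogeneousLocalization.val_zero
  map_mul' _ _ := HomogeneousLocalization.val_mul _ _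
  map_add' _ _ := HomogeneousLocalization.val_add _ _

theorem smul_mem {n : ℕ} {U : Opens (ProjectiveSpectrum.top 𝒜)}
    (r : (ProjectiveSpectrum.Proj.structureSheaf 𝒜).1.obj (op U)) (f : sections 𝒜 n U) :
    (fun x : U => eval 𝒜 x r * f.1 x) ∈ sections 𝒜 n U := by
  intro x
  obtain ⟨V, hx, i, d, a, b, hb, w⟩ := f.2 x
  obtain ⟨V', hx', i', d', a', b', hb', w'⟩ := r.2 x
  refine ⟨V ⊓ V', ⟨hx, hx'⟩, Opens.infLELeft _ _ ≫ i, d' + d,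
    ⟨a' * a, ?_⟩, ⟨b' * b, SetLike.GradedMul.mul_mem b'.2 b.2⟩, fun y => ?_, fun y => ?_⟩
  · have := SetLike.GradedMul.mul_mem a'.2 a.2
    rwa [← add_assoc] at this
  · exact (idealAt 𝒜 y.1).primeCompl.mul_mem (hb' ⟨y.1, y.2.2⟩) (hb ⟨y.1, y.2.1⟩)
  · have h1 : f.1 ⟨y.1, i.le y.2.1⟩ = _ := w ⟨y.1, y.2.1⟩
    have h2 : eval 𝒜 ⟨y.1, i.le y.2.1⟩ r =
        Localization.mk (a' : A) (⟨b', hb' ⟨y.1, y.2.2⟩⟩ : (idealAt 𝒜 y.1).primeCompl) :=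
      (congrArg HomogeneousLocalization.val (w' ⟨y.1, y.2.2⟩)).trans
        (HomogeneousLocalization.val_mk _)
    change eval 𝒜 ⟨y.1, i.le y.2.1⟩ r * f.1 ⟨y.1, i.le y.2.1⟩ = _
    rw [h1, h2]
    exact Localization.mk_mul _ _ _ _

instance (n : ℕ) (U : Opens (ProjectiveSpectrum.top 𝒜)) :
    Module ((ProjectiveSpectrum.Proj.structureSheaf 𝒜).1.obj (op U)) (sections 𝒜 n U) where
  smul r f := ⟨fun x : U => eval 𝒜 x r * f.1 x, smul_mem 𝒜 r f⟩
  one_smul f := Subtype.ext <| funext fun x =>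
    (congrArg (· * f.1 x) (map_one (eval 𝒜 x))).trans (one_mul _)
  mul_smul r s f := Subtype.ext <| funext fun x =>
    (congrArg (· * f.1 x) (map_mul (eval 𝒜 x) r s)).trans (mul_assoc _ _ _)
  smul_zero r := Subtype.ext <| funext fun x => mul_zero _
  smul_add r f g := Subtype.ext <| funext fun x => mul_add _ _ _
  add_smul r s f := Subtype.ext <| funext fun x =>
    (congrArg (· * f.1 x) (map_add (eval 𝒜 x) r s)).trans (add_mul _ _ _)
  zero_smul f := Subtype.ext <| funext fun x =>
    (congrArg (· * f.1 x) (map_zero (eval 𝒜 x))).trans (zero_mul _)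

/-- The presheaf of abelian groups underlying `𝒪(n)`. -/
def abPresheaf (n : ℕ) : TopCat.Presheaf Ab (ProjectiveSpectrum.top 𝒜) where
  obj U := AddCommGrpCat.of (sections 𝒜 n U.unop)
  map {U V} i := AddCommGrpCat.ofHom
    { toFun := fun f => ⟨fun x => f.1 (i.unop x), (localFraction 𝒜 n).res i.unop _ f.2⟩
      map_zero' := rfl
      map_add' := fun _ _ => rfl }

theorem abPresheaf_isSheaf (n : ℕ) : (abPresheaf 𝒜 n).IsSheaf :=
  (TopCat.Presheaf.isSheaf_iff_isSheaf_comp (forget AddCommGrpCat) (abPresheaf 𝒜 n)).2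
    (TopCat.subsheafToTypes (localFraction 𝒜 n)).2

instance moduleObj (n : ℕ) (X : (Opens (ProjectiveSpectrum.top 𝒜))ᵒᵖ) :
    Module ((Proj 𝒜).ringCatSheaf.obj.obj X) ((abPresheaf 𝒜 n).obj X) :=
  inferInstanceAs (Module ((ProjectiveSpectrum.Proj.structureSheaf 𝒜).1.obj (op X.unop))
        (sections 𝒜 n X.unop))

/-- The twisting sheaf `𝒪(n)` on `Proj 𝒜`. -/
def _root_.serreTwist (n : ℕ) : (Proj 𝒜).Modules where
  val :=
    @PresheafOfModules.ofPresheaf _ _ (Proj 𝒜).ringCatSheaf.obj (abPresheaf 𝒜 n)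
      (fun X => moduleObj 𝒜 n X) fun _ _ _ _ _ => rfl
  isSheaf := abPresheaf_isSheaf 𝒜 n

/-- The global section of `𝒪(n)` given by a homogeneous element of degree `n`. -/
def _root_.serreTwistSection (n : ℕ) (a : 𝒜 n) : Γ(serreTwist 𝒜 n, ⊤) :=
  show sections 𝒜 n ⊤ from
  ⟨fun x => algebraMap A _ a, fun x => ⟨⊤, trivial, 𝟙 _, 0, ⟨a, by simp⟩, ⟨1, SetLike.GradedOne.one_mem⟩,
    fun y => (Ideal.ne_top_iff_one _).1 (Ideal.IsPrime.ne_top inferInstance),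
    fun y => (Localization.mk_one_eq_algebraMap _).symm⟩⟩

end
end SerreTwist

noncomputable section
open Limits

section
variable {A : Type u} {σ : Type*} [CommRing A] [SetLike σ A] [AddSubgroupClass σ A]

/-- The `S`-valued point of `Proj 𝒜` whose homogeneous coordinates are given by a ring homomorphism
`φ : A → S` that maps the irrelevant ideal onto the unit ideal. -/
def projPoint (𝒜 : ℕ → σ) [GradedRing 𝒜] {S : CommRingCat.{u}} (φ : A →+* S)
    (hφ : (HomogeneousIdeal.irrelevant 𝒜).toIdeal.map φ = ⊤) : Spec S ⟶ Proj 𝒜 :=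
  Proj.fromOfGlobalSections 𝒜 ((Scheme.ΓSpecIso S).inv.hom.comp φ)
    (by rw [← Ideal.map_map, hφ, Ideal.map_top])

/-- The `S`-valued point `p` of `Proj 𝒜` has the homogeneous coordinates `φ`. -/
def HasCoords (𝒜 : ℕ → σ) [GradedRing 𝒜] {S : CommRingCat.{u}} (p : Spec S ⟶ Proj 𝒜)
    (φ : A →+* S) : Prop :=
  ∃ hφ : (HomogeneousIdeal.irrelevant 𝒜).toIdeal.map φ = ⊤, p = projPoint 𝒜 φ hφ

end

/-- The structure morphism of `Proj` of a graded `R`-algebra. -/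
def projToSpec {R A : Type u} [CommRing R] [CommRing A] [Algebra R A] (𝒜 : ℕ → Submodule R A)
    [GradedAlgebra 𝒜] : Proj 𝒜 ⟶ Spec (.of R) :=
  Proj.toSpecZero 𝒜 ≫ Spec.map (CommRingCat.ofHom (algebraMap R (𝒜 0)))

/-- The pullback of a global section. -/
def pullSection {Y Z : Scheme.{u}} (f : Y ⟶ Z) {M : Z.Modules} (s : Γ(M, ⊤)) :
    Γ((Scheme.Modules.pullback f).obj M, ⊤) :=
  ((Scheme.Modules.pullbackPushforwardAdjunction f).unit.app M).app ⊤ s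

/-- The structure morphism of the split torus `Spec k[E]` with the character group `E`. -/
def torusToSpec (k : Type u) [CommRing k] (E : Type) [AddCommGroup E] :
    Spec (.of (AddMonoidAlgebra k E)) ⟶ Spec (.of k) :=
  Spec.map (CommRingCat.ofHom (algebraMap k (AddMonoidAlgebra k E)))

namespace CoeffSystem
variable {R F : Type u} [CommRing R] [Field F] [Algebra R F] {E : Type} [AddCommGroup E]

/-- The element `f` has the weight `x` for the `E`-grading. -/
def IsWeight (Q : CoeffSystem R F (ℕ × E)) (x : E) (f : Q.toSubalgebra) : Prop :=
  ∀ p : ℕ × E, f.1.coeff p ≠ 0 → p.2 = x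

/-! In the following, `Z` is a scheme over `k` with a morphism `j` to `Proj` (in the applications, `j` is
an immersion), and the torus is `Spec k[E]`. -/

variable (Q : CoeffSystem R F (ℕ × E)) (k : Type u) [CommRing k] {Z : Scheme.{u}}
  (j : Z ⟶ Proj Q.grading) (q : Z ⟶ Spec (.of k))

/-- The morphism `act` is the torus action defined by the `E`-grading: for a point `t` of the torus and a
point `p` of `Z` with values in `S`, the coordinates of `t • p` are obtained from those of `p` by
multiplying the coordinates of weight `x` by the value of the character `x` at `t`. -/
def IsTorusAction (act : pullback (torusToSpec k E) q ⟶ Z) : Prop :=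
  ∀ (S : CommRingCat.{u}) (t : AddMonoidAlgebra k E →+* S) (p : Spec S ⟶ Z)
    (hp : Spec.map (CommRingCat.ofHom t) ≫ torusToSpec k E = p ≫ q) (φ : Q.toSubalgebra →+* S),
    HasCoords Q.grading (p ≫ j) φ →
    ∃ φ' : Q.toSubalgebra →+* S,
      (∀ (x : E) (f : Q.toSubalgebra), Q.IsWeight x f → φ' f = t (AddMonoidAlgebra.single x 1) * φ f) ∧
      HasCoords Q.grading (pullback.lift (Spec.map (CommRingCat.ofHom t)) p hp ≫ act ≫ j) φ'

/-- The restriction of `𝒪(n)` to `Z`. -/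
def lineBundle (n : ℕ) : Z.Modules := (Scheme.Modules.pullback j).obj (serreTwist Q.grading n)

instance gradedPolynomials (k : Type u) [CommRing k] (n : ℕ) :
    GradedAlgebra (MvPolynomial.homogeneousSubmodule (Fin (n + 1)) k) := MvPolynomial.gradedAlgebra

/-- `Z` is projective over `k`, and the restriction of `𝒪(1)` to `Z` is ample: for some `m > 0` there is
a closed immersion of `Z` into a projective space over `k` for which the twisting sheaf `𝒪(1)` of
the projective space pulls back to the restriction of `𝒪(m)`. When the open sets `D₊(f)` with `f` of
degree one cover `Proj`, as they do for all algebras below, `𝒪(m)` is the `m`-th tensor power of the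
invertible sheaf `𝒪(1)`. -/
def IsAmple : Prop :=
  ∃ m n : ℕ, 0 < m ∧ ∃ ι : Z ⟶ Proj (MvPolynomial.homogeneousSubmodule (Fin (n + 1)) k),
    IsClosedImmersion ι ∧
    ι ≫ projToSpec (MvPolynomial.homogeneousSubmodule (Fin (n + 1)) k) = q ∧
    Nonempty ((Scheme.Modules.pullback ι).obj
      (serreTwist (MvPolynomial.homogeneousSubmodule (Fin (n + 1)) k) 1) ≅ Q.lineBundle j m)

/-- The character `x` as a function on the product of the torus with `Z`. -/
def character (x : E) : Γ(pullback (torusToSpec k E) q, ⊤) :=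
  (pullback.fst (torusToSpec k E) q).appTop
    ((Scheme.ΓSpecIso (.of (AddMonoidAlgebra k E))).inv (AddMonoidAlgebra.single x 1))

/-- The isomorphism `Φ` from the pullback of `𝒪(1)` by the action to its pullback by the projection is
the linearization defined by the `E`-grading: the section given by an element of degree one and
weight `x` is multiplied by the character `x`. -/
def IsTorusLinearization (act : pullback (torusToSpec k E) q ⟶ Z)
    (Φ : (Scheme.Modules.pullback act).obj (Q.lineBundle j 1) ≅
      (Scheme.Modules.pullback (pullback.snd (torusToSpec k E) q)).obj (Q.lineBundle j 1)) : Prop :=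
  ∀ (x : E) (f : Q.grading 1), Q.IsWeight x f.1 →
    Φ.hom.app ⊤ (pullSection act (pullSection j (serreTwistSection Q.grading 1 f))) =
      character k q x • pullSection (pullback.snd (torusToSpec k E) q)
        (pullSection j (serreTwistSection Q.grading 1 f))

/-- A torus action on `Z` and a linearization of `𝒪(1)`, both given by the `E`-grading. -/
structure TorusStructure where
  /-- the action -/
  act : pullback (torusToSpec k E) q ⟶ Z
  act_over : act ≫ q = pullback.snd (torusToSpec k E) q ≫ q
  isTorusAction : Q.IsTorusAction k j q act
  /-- the linearization -/
  lin : (Scheme.Modules.pullback act).obj (Q.lineBundle j 1) ≅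
      (Scheme.Modules.pullback (pullback.snd (torusToSpec k E) q)).obj (Q.lineBundle j 1)
  isTorusLinearization : Q.IsTorusLinearization k j q act lin

end CoeffSystem

/-- The orbit of a point `z`: the image of `T × {z}` under the action. -/
def torusOrbit {k : Type u} [CommRing k] {E : Type} [AddCommGroup E] {Z : Scheme.{u}}
    {q : Z ⟶ Spec (.of k)} (act : pullback (torusToSpec k E) q ⟶ Z) (z : Z) : Set Z :=
  act '' (pullback.snd (torusToSpec k E) q ⁻¹' {z})

/-- The product of the identity of the torus with a morphism `e`. -/
def torusProdMap {k : Type u} [CommRing k] (E : Type) [AddCommGroup E] {Z Z' : Scheme.{u}}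
    {q : Z ⟶ Spec (.of k)} {q' : Z' ⟶ Spec (.of k)} (e : Z ⟶ Z') (he : e ≫ q' = q) :
    pullback (torusToSpec k E) q ⟶ pullback (torusToSpec k E) q' :=
  pullback.map _ _ _ _ (𝟙 _) e (𝟙 _) (by simp) (by simp [he])

theorem torusProdMap_snd {k : Type u} [CommRing k] (E : Type) [AddCommGroup E] {Z Z' : Scheme.{u}}
    {q : Z ⟶ Spec (.of k)} {q' : Z' ⟶ Spec (.of k)} (e : Z ⟶ Z') (he : e ≫ q' = q) :
    torusProdMap E e he ≫ pullback.snd (torusToSpec k E) q' =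
      pullback.snd (torusToSpec k E) q ≫ e := by
  unfold torusProdMap; exact pullback.lift_snd _ _ _

/-- An isomorphism of schemes with a torus action and a linearized sheaf: an isomorphism over `k` that
commutes with the actions, with an isomorphism of the sheaves that commutes with the
linearizations. -/
structure LinearizedIso {k : Type u} [CommRing k] {E : Type} [AddCommGroup E] {Z Z' : Scheme.{u}}
    {q : Z ⟶ Spec (.of k)} {q' : Z' ⟶ Spec (.of k)}
    {act : pullback (torusToSpec k E) q ⟶ Z} {act' : pullback (torusToSpec k E) q' ⟶ Z'}
    {L : Z.Modules} {L' : Z'.Modules}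
    (lin : (Scheme.Modules.pullback act).obj L ≅ (Scheme.Modules.pullback (pullback.snd (torusToSpec k E) q)).obj L)
    (lin' : (Scheme.Modules.pullback act').obj L' ≅ (Scheme.Modules.pullback (pullback.snd (torusToSpec k E) q')).obj L')
    where
  /-- the isomorphism of schemes -/
  e : Z ≅ Z'
  e_comp : e.hom ≫ q' = q
  equivariant : act ≫ e.hom = torusProdMap E e.hom e_comp ≫ act'
  /-- the isomorphism of sheaves -/
  bundle : L ≅ (Scheme.Modules.pullback e.hom).obj L'
  bundle_equivariant :
    (Scheme.Modules.pullback act).map bundle.hom ≫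
      (Scheme.Modules.pullbackComp act e.hom).hom.app L' ≫ (Scheme.Modules.pullbackCongr equivariant).hom.app L' ≫
      (Scheme.Modules.pullbackComp (torusProdMap E e.hom e_comp) act').inv.app L' ≫
      (Scheme.Modules.pullback (torusProdMap E e.hom e_comp)).map lin'.hom ≫
      (Scheme.Modules.pullbackComp (torusProdMap E e.hom e_comp) _).hom.app L' ≫
      (Scheme.Modules.pullbackCongr (torusProdMap_snd E e.hom e_comp)).hom.app L' ≫
      (Scheme.Modules.pullbackComp (pullback.snd (torusToSpec k E) q) e.hom).inv.app L' =
    lin.hom ≫ (Scheme.Modules.pullback (pullback.snd (torusToSpec k E) q)).map bundle.hom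
/-! ### Degeneration data -/

section Degeneration
variable {O K : Type u} [CommRing O] [IsDomain O] [IsDiscreteValuationRing O] [Field K]
  [Algebra O K] [IsFractionRing O K] {r : ℕ}

variable (O) in
/-- The normalized (additive) discrete valuation of the fraction field `K` of `O`, with the junk
value `0` at `0`. -/
def ord (z : K) : ℤ :=
  -WithZero.log ((IsDiscreteValuationRing.maximalIdeal O).valuation K z)

theorem ord_mul {z w : K} (hz : z ≠ 0) (hw : w ≠ 0) : ord O (z * w) = ord O z + ord O w := by
  unfold ord
  rw [map_mul, WithZero.log_mul ((Valuation.ne_zero_iff _).2 hz) ((Valuation.ne_zero_iff _).2 hw)]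
  ring

theorem ord_algebraMap_nonneg (c : O) : 0 ≤ ord O (algebraMap O K c) := by
  unfold ord
  by_cases hc : algebraMap O K c = 0
  · simp [hc]
  have h := (IsDiscreteValuationRing.maximalIdeal O).valuation_le_one (K := K) c
  have := (WithZero.log_le_log ((Valuation.ne_zero_iff _).2 hc) one_ne_zero).2 h
  rw [WithZero.log_one] at this
  linarith

theorem le_ord_add {z w : K} {t : ℝ} (hz : z ≠ 0 → t ≤ ord O z) (hw : w ≠ 0 → t ≤ ord O w)
    (h : z + w ≠ 0) : t ≤ ord O (z + w) := by
  by_cases z0 : z = 0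
  · subst z0; simp only [zero_add] at h ⊢; exact hw h
  by_cases w0 : w = 0
  · subst w0; simp only [add_zero] at h ⊢; exact hz h
  have key := ((IsDiscreteValuationRing.maximalIdeal O).valuation K).map_add z w
  have nz {y : K} (hy : y ≠ 0) : (IsDiscreteValuationRing.maximalIdeal O).valuation K y ≠ 0 :=
    (Valuation.ne_zero_iff _).2 hy
  rcases le_max_iff.1 key with k | k
  · have := (WithZero.log_le_log (nz h) (nz z0)).2 k
    refine (hz z0).trans ?_
    unfold ord; exact_mod_cast neg_le_neg this
  · have := (WithZero.log_le_log (nz h) (nz w0)).2 k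
    refine (hw w0).trans ?_
    unfold ord; exact_mod_cast neg_le_neg this

theorem ord_zpow {s : O} (hs : Irreducible s) (n : ℤ) : ord O ((algebraMap O K s) ^ n) = n := by
  unfold ord
  have h : (IsDiscreteValuationRing.maximalIdeal O).valuation K (algebraMap O K s) =
      WithZero.exp (-1) :=
    (IsDedekindDomain.HeightOneSpectrum.valuation_of_algebraMap _ s).trans
      (IsDedekindDomain.HeightOneSpectrum.intValuation_singleton _ hs.ne_zero hs.maximalIdeal_eq)
  rw [map_zpow₀, h, WithZero.log_zpow, WithZero.log_exp]
  simp

theorem exists_zpow_eq {s : O} (hs : Irreducible s) {z : K} (hz : z ≠ 0) :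
    ∃ c : O, algebraMap O K c * z = (algebraMap O K s) ^ ord O z := by
  have hs0 : algebraMap O K s ≠ 0 := by simpa using hs.ne_zero
  obtain ⟨c, hc⟩ := IsDiscreteValuationRing.exists_lift_of_le_one (A := O)
    (x := (algebraMap O K s) ^ ord O z * z⁻¹) (by
      have hw : (algebraMap O K s) ^ ord O z * z⁻¹ ≠ 0 :=
        mul_ne_zero (zpow_ne_zero _ hs0) (inv_ne_zero hz)
      rw [← WithZero.log_le_log ((Valuation.ne_zero_iff _).2 hw) one_ne_zero, WithZero.log_one]
      have h1 : ord O ((algebraMap O K s) ^ ord O z * z⁻¹) = 0 := by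
        have h2 := ord_mul (O := O) hw hz
        rw [mul_assoc, inv_mul_cancel₀ hz, mul_one, ord_zpow hs] at h2
        linarith
      exact (neg_eq_zero.1 h1).le)
  exact ⟨c, by rw [hc, mul_assoc, inv_mul_cancel₀ hz, mul_one]⟩

/-- The point of `ℝ ^ r` given by a point of the lattice `ℤ ^ r`. -/
def toReal (x : Fin r → ℤ) : Fin r → ℝ := fun i => x i

theorem toReal_add (x y : Fin r → ℤ) : toReal (x + y) = toReal x + toReal y := by
  ext i; simp [toReal]

variable (O K r) in
/-- Degeneration data of a maximally degenerate principally polarized family over a discrete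
valuation ring `O` with fraction field `K`, for the character lattice `X = ℤ ^ r`; the lattice of
periods is identified with `X` by the polarization. -/
structure DegenerationData where
  /-- a uniformizer -/
  s : O
  irreducible_s : Irreducible s
  /-- the quadratic function -/
  a : (Fin r → ℤ) → Kˣ
  /-- the bilinear function -/
  b : (Fin r → ℤ) → (Fin r → ℤ) → Kˣ
  b_add_left : ∀ x y z, b (x + y) z = b x z * b y z
  b_add_right : ∀ x y z, b x (y + z) = b x y * b x z
  b_eq : ∀ x y, b x y = a (x + y) * (a x)⁻¹ * (a y)⁻¹
  positive : ∀ x, x ≠ 0 → ∃ m ∈ IsLocalRing.maximalIdeal O, algebraMap O K m = b x x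

namespace DegenerationData
variable (D : DegenerationData O K r)

/-- The power `s ^ n` of the uniformizer. -/
def sPow (n : ℤ) : K := (algebraMap O K D.s) ^ n

theorem sPow_ne_zero (n : ℤ) : D.sPow n ≠ 0 :=
  zpow_ne_zero _ (by simpa using D.irreducible_s.ne_zero)

theorem sPow_add (m n : ℤ) : D.sPow (m + n) = D.sPow m * D.sPow n :=
  zpow_add₀ (by simpa using D.irreducible_s.ne_zero) m n

theorem ord_sPow (n : ℤ) : ord O (D.sPow n) = n := ord_zpow D.irreducible_s n

/-- `A = val a`. -/
def A (x : Fin r → ℤ) : ℤ := ord O (D.a x : K)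

/-- `B = val b`. -/
def B (x y : Fin r → ℤ) : ℤ := ord O (D.b x y : K)

/-- The real bilinear extension of `B`. -/
def BReal (u v : Fin r → ℝ) : ℝ :=
  ∑ i, ∑ j, u i * v j * D.B (Pi.single i 1) (Pi.single j 1)

/-- The real linear extension of the linear form `l x = 2 A(x) - B(x, x)`. -/
def lReal (v : Fin r → ℝ) : ℝ :=
  ∑ i, v i * (2 * D.A (Pi.single i 1) - D.B (Pi.single i 1) (Pi.single i 1))

/-- The differential `dA(α) = B(α, ·) + l / 2` of `A` at `α`. -/
def dA (α v : Fin r → ℝ) : ℝ := D.BReal α v + D.lReal v / 2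

theorem B_add_left (x y z : Fin r → ℤ) : D.B (x + y) z = D.B x z + D.B y z := by
  simp only [B, D.b_add_left, Units.val_mul]
  exact ord_mul (Units.ne_zero _) (Units.ne_zero _)

theorem B_add_right (x y z : Fin r → ℤ) : D.B x (y + z) = D.B x y + D.B x z := by
  simp only [B, D.b_add_right, Units.val_mul]
  exact ord_mul (Units.ne_zero _) (Units.ne_zero _)

theorem A_add (x y : Fin r → ℤ) : D.A (x + y) = D.A x + D.A y + D.B x y := by
  have h : D.a (x + y) = D.a x * D.a y * D.b x y := by
    rw [D.b_eq]; group; simp [mul_comm, mul_left_comm]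
  simp only [A, B, h, Units.val_mul]
  rw [ord_mul (mul_ne_zero (Units.ne_zero _) (Units.ne_zero _)) (Units.ne_zero _),
    ord_mul (Units.ne_zero _) (Units.ne_zero _)]

theorem B_comm (x y : Fin r → ℤ) : D.B x y = D.B y x := by
  have h1 := D.A_add x y
  have h2 := D.A_add y x
  rw [add_comm] at h2
  linarith

theorem BReal_comm (u v : Fin r → ℝ) : D.BReal u v = D.BReal v u := by
  unfold BReal
  rw [Finset.sum_comm]
  refine Finset.sum_congr rfl fun i _ => Finset.sum_congr rfl fun j _ => ?_
  rw [D.B_comm]; ring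

theorem BReal_add_left (u v w : Fin r → ℝ) : D.BReal (u + v) w = D.BReal u w + D.BReal v w := by
  simp only [BReal, ← Finset.sum_add_distrib, Pi.add_apply]
  refine Finset.sum_congr rfl fun i _ => Finset.sum_congr rfl fun j _ => ?_
  ring

theorem BReal_smul_left (c : ℝ) (u w : Fin r → ℝ) : D.BReal (c • u) w = c * D.BReal u w := by
  simp only [BReal, Finset.mul_sum, Pi.smul_apply, smul_eq_mul]
  refine Finset.sum_congr rfl fun i _ => Finset.sum_congr rfl fun j _ => ?_
  ring

theorem lReal_add (u v : Fin r → ℝ) : D.lReal (u + v) = D.lReal u + D.lReal v := by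
  simp only [lReal, ← Finset.sum_add_distrib, Pi.add_apply]
  refine Finset.sum_congr rfl fun i _ => ?_
  ring

theorem lReal_smul (c : ℝ) (u : Fin r → ℝ) : D.lReal (c • u) = c * D.lReal u := by
  simp only [lReal, Finset.mul_sum, Pi.smul_apply, smul_eq_mul]
  refine Finset.sum_congr rfl fun i _ => ?_
  ring

theorem dA_add (α u v : Fin r → ℝ) : D.dA α (u + v) = D.dA α u + D.dA α v := by
  simp only [dA, D.BReal_comm α, D.BReal_add_left, D.lReal_add]; ring

theorem dA_smul (α : Fin r → ℝ) (c : ℝ) (u : Fin r → ℝ) : D.dA α (c • u) = c * D.dA α u := by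
  simp only [dA, D.BReal_comm α, D.BReal_smul_left, D.lReal_smul]; ring

/-- an additive function on the lattice is given by its values on the standard basis -/
theorem additive_eq_sum (f : (Fin r → ℤ) → ℤ) (hf : ∀ x y, f (x + y) = f x + f y)
    (x : Fin r → ℤ) : f x = ∑ i, x i * f (Pi.single i 1) := by
  let g : (Fin r → ℤ) →+ ℤ := AddMonoidHom.mk' f hf
  have hx : x = ∑ i, x i • Pi.single i (1 : ℤ) := by
    ext j; simp [Finset.sum_apply, Pi.single_apply]
  have : g x = ∑ i, x i * g (Pi.single i 1) := by
    conv_lhs => rw [hx]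
    rw [map_sum]
    exact Finset.sum_congr rfl fun i _ => by rw [map_zsmul, smul_eq_mul]
  exact this

theorem BReal_toReal (x y : Fin r → ℤ) : D.BReal (toReal x) (toReal y) = D.B x y := by
  have h1 := additive_eq_sum (fun z => D.B z y) (fun u v => D.B_add_left u v y) x
  have h2 (i : Fin r) := additive_eq_sum (fun z => D.B (Pi.single i 1) z)
    (fun u v => D.B_add_right _ u v) y
  rw [h1]
  push_cast
  unfold BReal
  refine Finset.sum_congr rfl fun i _ => ?_
  rw [h2 i]
  push_cast
  rw [Finset.mul_sum]
  refine Finset.sum_congr rfl fun j _ => ?_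
  simp only [toReal]; ring

theorem lReal_toReal (x : Fin r → ℤ) : D.lReal (toReal x) = 2 * D.A x - D.B x x := by
  have h := additive_eq_sum (fun z => 2 * D.A z - D.B z z) (fun u v => by
    simp only [D.A_add, D.B_add_left, D.B_add_right, D.B_comm v u]; ring) x
  have h' : ((2 * D.A x - D.B x x : ℤ) : ℝ) = _ := congrArg _ h
  push_cast at h'
  rw [h']
  rfl

/-- `A(x) = B(x, x) / 2 + l x / 2` -/
theorem A_eq (x : Fin r → ℤ) :
    (D.A x : ℝ) = D.BReal (toReal x) (toReal x) / 2 + D.lReal (toReal x) / 2 := by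
  rw [D.lReal_toReal, D.BReal_toReal]; ring

/-! ### Delaunay and Voronoi cells -/

/-- The dimension of a convex set. -/
def _root_.cellDim (σ : Set (Fin r → ℝ)) : ℕ := Module.finrank ℝ (vectorSpan ℝ σ)

/-- The square of the distance from `x` to `α` for the norm of `B`. -/
def distSq (x : Fin r → ℤ) (α : Fin r → ℝ) : ℝ := D.BReal (toReal x - α) (toReal x - α)

/-- The lattice points that are `α`-nearest. -/
def nearest (α : Fin r → ℝ) : Set (Fin r → ℤ) := {x | ∀ x', D.distSq x α ≤ D.distSq x' α}

/-- The Delaunay cell defined by `α`. -/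
def delCell (α : Fin r → ℝ) : Set (Fin r → ℝ) := convexHull ℝ (toReal '' D.nearest α)

def IsDelaunay (σ : Set (Fin r → ℝ)) : Prop := ∃ α, σ = D.delCell α

/-- The Voronoi cell dual to a Delaunay cell `σ`. -/
def voronoi (σ : Set (Fin r → ℝ)) : Set (Fin r → ℝ) := closure {α | D.delCell α = σ}

/-- The Delaunay cell `D(W)` dual to a Voronoi cell `W`: the convex hull of the lattice points
that are `β`-nearest for all `β` in `W`. -/
def dualDel (W : Set (Fin r → ℝ)) : Set (Fin r → ℝ) :=
  convexHull ℝ (toReal '' {x | ∀ β ∈ W, x ∈ D.nearest β})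

/-- The linear pieces of the support function of the cone over the paraboloid are bounded by its
values at the lattice points. -/
theorem dA_sub_le {β : Fin r → ℝ} {c : Fin r → ℤ} (hc : c ∈ D.nearest β) (x : Fin r → ℤ) :
    (D.A c : ℝ) + D.dA β (toReal x - toReal c) ≤ D.A x := by
  have h := hc x
  simp only [distSq] at h
  have e (u v w : Fin r → ℝ) : D.BReal w (u - v) = D.BReal w u - D.BReal w v := by
    rw [D.BReal_comm, sub_eq_add_neg, D.BReal_add_left, ← neg_one_smul ℝ v, D.BReal_smul_left,
      D.BReal_comm u, D.BReal_comm v]; ring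
  have e' (u v w : Fin r → ℝ) : D.BReal (u - v) w = D.BReal u w - D.BReal v w := by
    rw [D.BReal_comm, e, D.BReal_comm w, D.BReal_comm w]
  have l' (u v : Fin r → ℝ) : D.lReal (u - v) = D.lReal u - D.lReal v := by
    rw [sub_eq_add_neg, D.lReal_add, ← neg_one_smul ℝ v, D.lReal_smul]; ring
  simp only [e, e'] at h
  simp only [dA, D.A_eq, e, l']
  rw [D.BReal_comm (toReal c) β, D.BReal_comm (toReal x) β] at h
  linarith

/-! ### The scheme `P̃` -/

/-- The algebra `₁R`, the `O`-subalgebra of `K[ϑ, w^x]` generated by the `a(x) w^x ϑ`; the monomial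
`w^x ϑ^d` has the exponent `(d, x)`. -/
def preAlgebra : Subalgebra O (AddMonoidAlgebra K (ℕ × (Fin r → ℤ))) :=
  Algebra.adjoin O (Set.range fun x => AddMonoidAlgebra.single (1, x) (D.a x : K))

/-- The monomial `s^n w^x ϑ^d`, with `p = (d, x)`, belongs to the saturation of `₁R`. -/
def InSaturation (p : ℕ × (Fin r → ℤ)) (n : ℤ) : Prop :=
  ∃ N : ℕ, 0 < N ∧ AddMonoidAlgebra.single p (D.sPow n) ^ N ∈ D.preAlgebra

/-- The saturation `R` of `₁R`. -/
def saturation : CoeffSystem O K (ℕ × (Fin r → ℤ)) where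
  coeff p := Submodule.span O {z | ∃ n, D.InSaturation p n ∧ z = D.sPow n}
  one_mem := Submodule.subset_span ⟨0, ⟨1, one_pos, by
    have : AddMonoidAlgebra.single (0 : ℕ × (Fin r → ℤ)) (D.sPow 0) = 1 := by
      simp [sPow, AddMonoidAlgebra.one_def]
    rw [this, one_pow]; exact one_mem _⟩, by simp [sPow]⟩
  mul_mem g h y hy z hz := by
    have := Submodule.mul_mem_mul hy hz
    rw [Submodule.span_mul_span] at this
    refine Submodule.span_mono ?_ this
    rintro _ ⟨_, ⟨m, ⟨M, hM, hm⟩, rfl⟩, _, ⟨n, ⟨N, hN, hn⟩, rfl⟩, rfl⟩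
    refine ⟨m + n, ⟨M * N, Nat.mul_pos hM hN, ?_⟩, (D.sPow_add m n).symm⟩
    rw [D.sPow_add, ← AddMonoidAlgebra.single_mul_single, mul_pow, pow_mul, mul_comm M N, pow_mul]
    exact mul_mem (pow_mem hm _) (pow_mem hn _)

/-- The graded ring `R`. -/
abbrev R : Subalgebra O (AddMonoidAlgebra K (ℕ × (Fin r → ℤ))) := D.saturation.toSubalgebra

/-- `P̃ = Proj R`. -/
abbrev P : Scheme.{u} := Proj D.saturation.grading

/-- The structure morphism of `P̃`. -/
abbrev toBase : D.P ⟶ Spec (.of O) := projToSpec D.saturation.grading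

/-- For a set `W` of points of `ℝ ^ r`: the semigroup algebra over `O` generated by the monomials
`s^n w^x` with `n ≥ dA(β)(x)` for all `β ∈ W`, i.e. by the lattice points of the dual of the cone
over `(1, -dA(W))`. -/
def coneSystem (W : Set (Fin r → ℝ)) : CoeffSystem O K (Fin r → ℤ) where
  coeff x := Submodule.span O {z | ∃ n : ℤ, (∀ β ∈ W, D.dA β (toReal x) ≤ n) ∧ z = D.sPow n}
  one_mem := Submodule.subset_span ⟨0, fun β _ => by
    have : toReal (0 : Fin r → ℤ) = (0 : ℝ) • (0 : Fin r → ℝ) := by ext; simp [toReal]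
    rw [this, D.dA_smul]; simp, by simp [sPow]⟩
  mul_mem g h y hy z hz := by
    have := Submodule.mul_mem_mul hy hz
    rw [Submodule.span_mul_span] at this
    refine Submodule.span_mono ?_ this
    rintro _ ⟨_, ⟨m, hm, rfl⟩, _, ⟨n, hn, rfl⟩, rfl⟩
    refine ⟨m + n, fun β hβ => ?_, (D.sPow_add m n).symm⟩
    rw [toReal_add, D.dA_add]; push_cast
    exact add_le_add (hm β hβ) (hn β hβ)

/-- The ring of the cone over `W`; for the Voronoi cell dual to `σ` this is the ring `R(σ)`. -/
abbrev coneRing (W : Set (Fin r → ℝ)) : Subalgebra O (AddMonoidAlgebra K (Fin r → ℤ)) :=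
  (D.coneSystem W).toSubalgebra

/-- The polynomials whose coefficients satisfy `ord f_p ≥ L(p)` form a subalgebra. -/
theorem preAlgebra_le {L : ℕ × (Fin r → ℤ) → ℝ} (L0 : L 0 = 0) (Ladd : ∀ p q, L (p + q) = L p + L q)
    (hL : ∀ x, L (1, x) ≤ D.A x) {f : AddMonoidAlgebra K (ℕ × (Fin r → ℤ))}
    (hf : f ∈ D.preAlgebra) (p : ℕ × (Fin r → ℤ)) (hp : f.coeff p ≠ 0) :
    L p ≤ ord O (f.coeff p) := by
  classical
  let C : CoeffSystem O K (ℕ × (Fin r → ℤ)) :=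
    { coeff := fun p =>
        { carrier := {z | z ≠ 0 → L p ≤ ord O z}
          zero_mem' := fun h => absurd rfl h
          add_mem' := fun hz hw => le_ord_add hz hw
          smul_mem' := fun c z hz h => by
            rw [Algebra.smul_def] at h ⊢
            rw [ord_mul (left_ne_zero_of_mul h) (right_ne_zero_of_mul h)]
            have h1 : (0 : ℝ) ≤ ord O (algebraMap O K c) := by exact_mod_cast ord_algebraMap_nonneg c
            have h2 := hz (right_ne_zero_of_mul h)
            push_cast; linarith }
      one_mem := fun _ => by
        have := ord_zpow (O := O) (K := K) D.irreducible_s 0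
        rw [zpow_zero] at this
        rw [this, L0]; simp
      mul_mem := fun g h y hy z hz hyz => by
        rw [ord_mul (left_ne_zero_of_mul hyz) (right_ne_zero_of_mul hyz), Ladd]
        push_cast
        exact add_le_add (hy (left_ne_zero_of_mul hyz)) (hz (right_ne_zero_of_mul hyz)) }
  have hle : D.preAlgebra ≤ C.toSubalgebra := by
    refine Algebra.adjoin_le ?_
    rintro _ ⟨x, rfl⟩ q hq
    rw [AddMonoidAlgebra.coeff_single, Finsupp.single_apply] at hq ⊢
    split_ifs at hq ⊢ with e
    · subst e; exact hL x
    · exact absurd rfl hq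
  exact hle hf p hp

theorem InSaturation.le {p : ℕ × (Fin r → ℤ)} {n : ℤ} (h : D.InSaturation p n)
    {W : Set (Fin r → ℝ)} {c : Fin r → ℤ} (hc : ∀ β ∈ W, c ∈ D.nearest β) :
    ∀ β ∈ W, D.dA β (toReal (p.2 - p.1 • c)) ≤ (n - p.1 * D.A c : ℤ) := by
  intro β hβ
  obtain ⟨N, hN, h⟩ := h
  have tr (q : ℕ × (Fin r → ℤ)) : toReal (q.2 - q.1 • c) = toReal q.2 - (q.1 : ℝ) • toReal c := by
    ext i; simp [toReal]
  let L : ℕ × (Fin r → ℤ) → ℝ := fun q => q.1 * D.A c + D.dA β (toReal (q.2 - q.1 • c))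
  have Ladd (p q) : L (p + q) = L p + L q := by
    simp only [L, Prod.fst_add, Prod.snd_add]
    rw [show p.2 + q.2 - (p.1 + q.1) • c = (p.2 - p.1 • c) + (q.2 - q.1 • c) by
      rw [add_smul]; abel, toReal_add, D.dA_add]
    push_cast; ring
  have L0 : L 0 = 0 := by have := Ladd 0 0; rw [add_zero] at this; linarith
  have Lmul (m : ℕ) (q) : L (m • q) = m * L q := by
    induction m with
    | zero => simp [L0]
    | succ m ih => rw [succ_nsmul, Ladd, ih]; push_cast; ring
  have key := D.preAlgebra_le L0 Ladd (fun x => by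
    simp only [L, tr]; simpa using D.dA_sub_le (hc β hβ) x) h (N • p)
  rw [AddMonoidAlgebra.single_pow, AddMonoidAlgebra.coeff_single, Finsupp.single_eq_same] at key
  have hpow : D.sPow n ^ N = D.sPow (N * n) := by
    rw [sPow, sPow, mul_comm, zpow_mul, zpow_natCast]
  rw [hpow, Lmul, D.ord_sPow] at key
  have k := key (D.sPow_ne_zero _)
  have hN' : (0 : ℝ) < N := by exact_mod_cast hN
  push_cast at k
  have k2 := le_of_mul_le_mul_left k hN'
  simp only [L] at k2
  push_cast; linarith

/-- The substitution `ζ_c ↦ 1`, that is `w^x ϑ^d ↦ s^(-d A(c)) w^(x - d c)`. -/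
def dehomogenize (c : Fin r → ℤ) :
    AddMonoidAlgebra K (ℕ × (Fin r → ℤ)) →ₐ[K] AddMonoidAlgebra K (Fin r → ℤ) :=
  AddMonoidAlgebra.lift K _ _
    { toFun := fun p => AddMonoidAlgebra.single (p.toAdd.2 - p.toAdd.1 • c)
        (D.sPow (-(p.toAdd.1 * D.A c)))
      map_one' := by simp [sPow, AddMonoidAlgebra.one_def]
      map_mul' := fun p q => by
        rw [AddMonoidAlgebra.single_mul_single, ← D.sPow_add]
        congr 1
        · simp only [toAdd_mul, Prod.snd_add, Prod.fst_add, add_smul]; abel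
        · congr 1; simp only [toAdd_mul, Prod.fst_add]; push_cast; ring }

theorem dehomogenize_single (c : Fin r → ℤ) (p : ℕ × (Fin r → ℤ)) (z : K) :
    D.dehomogenize c (AddMonoidAlgebra.single p z) =
      AddMonoidAlgebra.single (p.2 - p.1 • c) (z * D.sPow (-(p.1 * D.A c))) := by
  unfold dehomogenize
  rw [AddMonoidAlgebra.lift_single]
  simp [AddMonoidAlgebra.smul_single]

theorem dehomogenize_mem {W : Set (Fin r → ℝ)} {c : Fin r → ℤ} (hc : ∀ β ∈ W, c ∈ D.nearest β)
    {f : AddMonoidAlgebra K (ℕ × (Fin r → ℤ))} (hf : f ∈ D.R) :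
    D.dehomogenize c f ∈ D.coneRing W := by
  classical
  have hf' : f = ∑ p ∈ f.coeff.support, AddMonoidAlgebra.single p (f.coeff p) := by
    conv_lhs => rw [← AddMonoidAlgebra.sum_coeff_single f]
    rfl
  rw [hf', map_sum]
  refine sum_mem fun p _ => ?_
  rw [dehomogenize_single]
  intro x
  rw [AddMonoidAlgebra.coeff_single, Finsupp.single_apply]
  split_ifs with e
  · subst e
    have := hf p
    generalize f.coeff p = z at this
    induction this using Submodule.span_induction with
    | mem z hz =>
      obtain ⟨n, hn, rfl⟩ := hz
      refine Submodule.subset_span ⟨n - p.1 * D.A c, InSaturation.le D hn hc, ?_⟩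
      rw [sub_eq_add_neg, D.sPow_add]
    | zero => rw [zero_mul]; exact zero_mem _
    | add y z _ _ hy hz => rw [add_mul]; exact add_mem hy hz
    | smul t y _ hy => rw [smul_mul_assoc]; exact Submodule.smul_mem _ _ hy
  · exact zero_mem _

/-- The homomorphism `R → R(W)` with `ζ_c ↦ 1`. -/
def chartHom (W : Set (Fin r → ℝ)) (c : Fin r → ℤ) (hc : ∀ β ∈ W, c ∈ D.nearest β) :
    D.R →+* D.coneRing W :=
  ((D.dehomogenize c).toRingHom.comp D.R.toSubring.subtype).codRestrict (D.coneRing W).toSubring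
    fun f => D.dehomogenize_mem hc f.2

/-- The element `ζ_c = s^A(c) w^c ϑ`. -/
def zeta (c : Fin r → ℤ) : D.R :=
  ⟨AddMonoidAlgebra.single (1, c) (D.sPow (D.A c)), by
    classical
    intro p
    rw [AddMonoidAlgebra.coeff_single, Finsupp.single_apply]
    split_ifs with e
    · subst e
      refine Submodule.subset_span ⟨D.A c, ⟨1, one_pos, ?_⟩, rfl⟩
      obtain ⟨t, ht⟩ := exists_zpow_eq D.irreducible_s (D.a c).ne_zero
      have : AddMonoidAlgebra.single ((1, c) : ℕ × (Fin r → ℤ)) (D.sPow (D.A c)) =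
          t • AddMonoidAlgebra.single (1, c) (D.a c : K) := by
        rw [AddMonoidAlgebra.smul_single, Algebra.smul_def, ht]; rfl
      rw [pow_one, this]
      exact Subalgebra.smul_mem _ (Algebra.subset_adjoin (Set.mem_range_self c)) t
    · exact zero_mem _⟩

theorem zeta_mem (c : Fin r → ℤ) : D.zeta c ∈ D.saturation.grading 1 := by
  classical
  intro p hp
  change (AddMonoidAlgebra.single ((1, c) : ℕ × (Fin r → ℤ)) (D.sPow (D.A c))).coeff p ≠ 0 at hp
  rw [AddMonoidAlgebra.coeff_single, Finsupp.single_apply] at hp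
  split_ifs at hp with e
  · rw [← e]
  · exact absurd rfl hp

theorem map_irrelevant (W : Set (Fin r → ℝ)) (c : Fin r → ℤ) (hc : ∀ β ∈ W, c ∈ D.nearest β) :
    (HomogeneousIdeal.irrelevant D.saturation.grading).toIdeal.map (D.chartHom W c hc) = ⊤ := by
  rw [Ideal.eq_top_iff_one]
  have h1 : D.chartHom W c hc (D.zeta c) = 1 := by
    apply Subtype.ext
    change D.dehomogenize c (AddMonoidAlgebra.single (1, c) (D.sPow (D.A c))) = 1
    rw [dehomogenize_single, ← D.sPow_add]
    simp [sPow, AddMonoidAlgebra.one_def]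
  rw [← h1]
  refine Ideal.mem_map_of_mem _ ?_
  change D.zeta c ∈ HomogeneousIdeal.irrelevant D.saturation.grading
  rw [HomogeneousIdeal.mem_irrelevant_iff, GradedRing.proj_apply,
    DirectSum.decompose_of_mem_ne _ (D.zeta_mem c) one_ne_zero]

/-- The morphism from the spectrum of the ring of the cone over `W` to `P̃` on which the coordinate
`ζ_c` is `1`. -/
def chart (W : Set (Fin r → ℝ)) (c : Fin r → ℤ) (hc : ∀ β ∈ W, c ∈ D.nearest β) :
    Spec (.of (D.coneRing W)) ⟶ D.P :=
  projPoint D.saturation.grading (S := .of (D.coneRing W)) (D.chartHom W c hc)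
    (D.map_irrelevant W c hc)

/-- The subset of `P̃` covered by the charts of the cone over `W`. For `W = ∅` this is the cone
`{0}`, and the subset is the generic torus `Spec K[X]`. -/
def coneOpen (W : Set (Fin r → ℝ)) : Set D.P :=
  {z | ∃ (c : Fin r → ℤ) (hc : ∀ β ∈ W, c ∈ D.nearest β), z ∈ Set.range (D.chart W c hc)}

/-- `U(σ)` -/
def U (σ : Set (Fin r → ℝ)) : Set D.P := D.coneOpen (D.voronoi σ)

/-- The number `η(x, c)`: the maximum of `dA(α(τ))(x)` over the maximal-dimensional Delaunay cells
`τ` that contain `c`. -/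
def eta (x c : Fin r → ℤ) : ℝ :=
  sSup {t | ∃ α, cellDim (D.delCell α) = r ∧ toReal c ∈ D.delCell α ∧ t = D.dA α (toReal x)}

/-- The elements `ζ_{d,c} = s^⌈η(d,c)⌉ w^d` of `R(c)` with `d` in the lattice, in the cone spanned by
`σ - c`, and `η(d,c)` an integer, generate this multiplicative set. -/
def facetMonoid (σ : Set (Fin r → ℝ)) (c : Fin r → ℤ) :
    Submonoid (D.coneRing (D.voronoi {toReal c})) :=
  Submonoid.closure {f | ∃ d : Fin r → ℤ,
    (∃ t : ℝ, 0 ≤ t ∧ ∃ v ∈ σ, toReal d = t • (v - toReal c)) ∧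
    (∃ m : ℤ, D.eta d c = m) ∧
    (f : AddMonoidAlgebra K (Fin r → ℤ)) = AddMonoidAlgebra.single d (D.sPow ⌈D.eta d c⌉)}

/-- The residue field of `O`. -/
abbrev k (D : DegenerationData O K r) : Type u := IsLocalRing.ResidueField O

/-- The closed point of the base. -/
abbrev closedPoint : Spec (.of D.k) ⟶ Spec (.of O) :=
  Spec.map (CommRingCat.ofHom (IsLocalRing.residue O))

/-- The central fiber `P̃₀`. -/
abbrev P₀ : Scheme.{u} := pullback D.toBase D.closedPoint

/-- The inclusion of the central fiber. -/
abbrev incl : D.P₀ ⟶ D.P := pullback.fst D.toBase D.closedPoint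

/-- The structure morphism of the central fiber. -/
abbrev toResidue : D.P₀ ⟶ Spec (.of D.k) := pullback.snd D.toBase D.closedPoint

/-- The stratum `orb(σ)` of the central fiber: the points of `U(σ)` that do not belong to `U(τ)` for
a Delaunay cell `τ` strictly larger than `σ`. -/
def orb (σ : Set (Fin r → ℝ)) : Set D.P₀ :=
  {z | D.incl z ∈ D.U σ ∧ ∀ τ, D.IsDelaunay τ → σ ⊂ τ → D.incl z ∉ D.U τ}

/-- The closure of `orb(σ)`, as a closed subset. -/
def closureOrb (σ : Set (Fin r → ℝ)) : Closeds D.P₀ := ⟨closure (D.orb σ), isClosed_closure⟩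

/-- The ideal sheaf of the closure of `orb(σ)` with its reduced structure. -/
def idealOrb (σ : Set (Fin r → ℝ)) : D.P₀.IdealSheafData :=
  Scheme.IdealSheafData.vanishingIdeal (D.closureOrb σ)

/-- `Ṽ(σ)`, the closure of `orb(σ)` with its reduced structure. -/
def V (σ : Set (Fin r → ℝ)) : Scheme.{u} := (D.idealOrb σ).subscheme

/-- The inclusion of `Ṽ(σ)` into `P̃₀`. -/
def inclV (σ : Set (Fin r → ℝ)) : D.V σ ⟶ D.P₀ := (D.idealOrb σ).subschemeι

/-- The inclusion of `Ṽ(σ)` into `P̃`. -/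
def inclVP (σ : Set (Fin r → ℝ)) : D.V σ ⟶ D.P := D.inclV σ ≫ D.incl

/-- The structure morphism of `Ṽ(σ)`. -/
def VToResidue (σ : Set (Fin r → ℝ)) : D.V σ ⟶ Spec (.of D.k) := D.inclV σ ≫ D.toResidue

/-- The pair `(d, x)` belongs to the lattice of the torus `orb(σ)`: the function
`d A(c) + dA(α)(x - d c)` is integral at it, for `α` in the dual Voronoi cell and `c` in `σ`. -/
def InLattice (σ : Set (Fin r → ℝ)) (p : ℕ × (Fin r → ℤ)) : Prop :=
  ∀ α ∈ D.voronoi σ, ∀ c : Fin r → ℤ, toReal c ∈ σ →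
    ∃ n : ℤ, p.1 * D.A c + D.dA α (toReal (p.2 - p.1 • c)) = n

/-- The graded semigroup of lattice points `(d, x)` with `x ∈ d σ`. -/
def polytopeMonoid {σ : Set (Fin r → ℝ)} (hσ : D.IsDelaunay σ) :
    AddSubmonoid (ℕ × (Fin r → ℤ)) where
  carrier := {p | (p = 0 ∨ toReal p.2 ∈ (p.1 : ℝ) • σ) ∧ D.InLattice σ p}
  zero_mem' := ⟨Or.inl rfl, fun α _ c _ => ⟨0, by
    have h0 : toReal (0 : Fin r → ℤ) = 0 := by ext; simp [toReal]
    have h1 : D.dA α 0 = 0 := by simpa using D.dA_smul α 0 0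
    simp [h0, h1]⟩⟩
  add_mem' := by
    rintro p q ⟨hp, lp⟩ ⟨hq, lq⟩
    refine ⟨?_, fun α hα c hc => ?_⟩
    · rcases hp with rfl | hp
      · rw [zero_add]; exact hq
      rcases hq with rfl | hq
      · rw [add_zero]; exact Or.inr hp
      right
      have hcv : Convex ℝ σ := by
        obtain ⟨α, rfl⟩ := hσ; exact convex_convexHull ℝ _
      rw [Prod.snd_add, Prod.fst_add, toReal_add, Nat.cast_add,
        hcv.add_smul (Nat.cast_nonneg _) (Nat.cast_nonneg _)]
      exact Set.add_mem_add hp hq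
    · obtain ⟨m, hm⟩ := lp α hα c hc
      obtain ⟨n, hn⟩ := lq α hα c hc
      refine ⟨m + n, ?_⟩
      rw [Prod.snd_add, Prod.fst_add, show p.2 + q.2 - (p.1 + q.1) • c =
        (p.2 - p.1 • c) + (q.2 - q.1 • c) by rw [add_smul]; abel, toReal_add, D.dA_add]
      push_cast
      rw [← hm, ← hn]; ring

/-- The graded semigroup algebra over the residue field `k` of the lattice polytope `σ`. -/
def polytopeSystem {σ : Set (Fin r → ℝ)} (hσ : D.IsDelaunay σ) :
    CoeffSystem D.k D.k (ℕ × (Fin r → ℤ)) where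
  coeff p := Submodule.span D.k {z | p ∈ D.polytopeMonoid hσ ∧ z = 1}
  one_mem := Submodule.subset_span ⟨zero_mem _, rfl⟩
  mul_mem g h y hy z hz := by
    have := Submodule.mul_mem_mul hy hz
    rw [Submodule.span_mul_span] at this
    refine Submodule.span_mono ?_ this
    rintro _ ⟨_, ⟨h1, rfl⟩, _, ⟨h2, rfl⟩, rfl⟩
    exact ⟨add_mem h1 h2, one_mul _⟩

/-- The projective toric variety of the lattice polytope `σ`. -/
abbrev toricVariety {σ : Set (Fin r → ℝ)} (hσ : D.IsDelaunay σ) : Scheme.{u} :=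
  Proj (D.polytopeSystem hσ).grading

/-- Torus actions on a scheme over the central fiber for which `P̃` has the coordinates given by the
grading, with linearizations of `𝒪(1)`. -/
abbrev Torus {Z : Scheme.{u}} (i : Z ⟶ D.P₀) :=
  D.saturation.TorusStructure D.k (i ≫ D.incl) (i ≫ D.toResidue)

end DegenerationData
end Degeneration
end

universe v

noncomputable section ProjCoordinates
open Limits

namespace ProjCoord
variable {A : Type u} {σ : Type*} [CommRing A] [SetLike σ A] [AddSubgroupClass σ A]
  (𝒜 : ℕ → σ) [GradedRing 𝒜]

/-- The extension of a ring homomorphism to the homogeneous localization. -/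
def awayLift {S : Type u} [CommRing S] (f : A →+* S) {r : A} (hr : IsUnit (f r)) :
    HomogeneousLocalization.Away 𝒜 r →+* S :=
  (IsLocalization.Away.lift r hr).comp
    (algebraMap (HomogeneousLocalization.Away 𝒜 r) (Localization.Away r))

theorem awayLift_mk {S : Type u} [CommRing S] (f : A →+* S) {r : A} (hr : IsUnit (f r)) {n : ℕ}
    (hn : r ∈ 𝒜 n) (d : ℕ) (a : A) (ha : a ∈ 𝒜 (d • n)) :
    awayLift 𝒜 f hr (.mk 𝒜 hn d a ha) * f r ^ d = f a := by
  have h : algebraMap (HomogeneousLocalization.Away 𝒜 r) (Localization.Away r)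
      (.mk 𝒜 hn d a ha) * algebraMap A _ r ^ d = algebraMap A _ a := by
    rw [HomogeneousLocalization.algebraMap_apply, HomogeneousLocalization.Away.val_mk,
      ← Localization.mk_one_eq_algebraMap, ← Localization.mk_one_eq_algebraMap, Localization.mk_pow,
      Localization.mk_mul, Localization.mk_eq_mk_iff, Localization.r_iff_exists]
    exact ⟨1, by simp [mul_comm]⟩
  have h2 := congrArg (IsLocalization.Away.lift (S := Localization.Away r) r hr) h
  rw [map_mul, map_pow, IsLocalization.Away.lift_eq, IsLocalization.Away.lift_eq] at h2
  exact h2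

theorem awayHom_ext {S : Type u} [CommRing S] {r : A} {n : ℕ} (hn : r ∈ 𝒜 n)
    {f g : HomogeneousLocalization.Away 𝒜 r →+* S}
    (h : ∀ d a ha, f (.mk 𝒜 hn d a ha) = g (.mk 𝒜 hn d a ha)) : f = g := by
  ext x
  obtain ⟨d, a, ha, rfl⟩ := HomogeneousLocalization.Away.mk_surjective 𝒜 hn x
  exact h d a ha

theorem awayLift_comp {S T : Type u} [CommRing S] [CommRing T] (f : A →+* S) (g : S →+* T) {r : A}
    (hr : IsUnit (f r)) (hr' : IsUnit ((g.comp f) r)) :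
    awayLift 𝒜 (g.comp f) hr' = g.comp (awayLift 𝒜 f hr) := by
  unfold awayLift
  rw [← RingHom.comp_assoc]
  congr 1
  refine IsLocalization.ringHom_ext (.powers r) ?_
  ext a
  simp [IsLocalization.Away.lift_eq]

variable {X Y : Scheme.{u}} (f : A →+* Γ(X, ⊤))
  (hf : (HomogeneousIdeal.irrelevant 𝒜).toIdeal.map f = ⊤)

theorem comp_fromOfGlobalSections_away (g : Y ⟶ X) {r : A} {n : ℕ} (hn : 0 < n) (hr : r ∈ 𝒜 n)
    (hu : IsUnit ((g.appTop.hom.comp f) r)) :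
    g ≫ Proj.fromOfGlobalSections 𝒜 f hf =
      Y.toSpecΓ ≫ Spec.map (CommRingCat.ofHom (awayLift 𝒜 (g.appTop.hom.comp f) hu)) ≫
        Proj.awayι 𝒜 r hr hn := by
  have hrange : Set.range g ⊆ Set.range (X.basicOpen (f r)).ι := by
    rw [Scheme.Opens.range_ι]
    rintro _ ⟨y, rfl⟩
    change y ∈ g ⁻¹ᵁ (X.basicOpen (f r))
    rw [Scheme.preimage_basicOpen]
    have := Scheme.basicOpen_of_isUnit Y hu
    exact this.ge trivial
  let g' := IsOpenImmersion.lift (X.basicOpen (f r)).ι g hrange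
  have hg : g' ≫ (X.basicOpen (f r)).ι = g := IsOpenImmersion.lift_fac _ _ _
  have h1 : (X.basicOpen (f r)).ι ≫ Proj.fromOfGlobalSections 𝒜 f hf =
      Proj.toBasicOpenOfGlobalSections 𝒜 f rfl hn hr ≫ Scheme.Opens.ι _ :=
    (Proj.openCoverOfMapIrrelevantEqTop 𝒜 f hf).ι_glueMorphisms _ _ ⟨_, _, hn, hr⟩
  have h0 : g ≫ Proj.fromOfGlobalSections 𝒜 f hf =
      g' ≫ Proj.toBasicOpenOfGlobalSections 𝒜 f rfl hn hr ≫ Scheme.Opens.ι _ := by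
    rw [← h1, ← Category.assoc, hg]
  rw [h0]
  unfold Proj.toBasicOpenOfGlobalSections
  simp only [Category.assoc, Proj.basicOpenIsoSpec_inv_ι]
  have hu' : IsUnit (g.appTop.hom (f r)) := hu
  let l : Localization.Away (f r) →+* Γ(Y, ⊤) := IsLocalization.Away.lift (f r) hu'
  have h2 : g' ≫ (X.isoOfEq (X.toSpecΓ_preimage_basicOpen (f r))).inv ≫
      X.toSpecΓ ∣_ (PrimeSpectrum.basicOpen (f r)) ≫ (basicOpenIsoSpecAway (f r)).hom =
      Y.toSpecΓ ≫ Spec.map (CommRingCat.ofHom l) := by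
    have hl : CommRingCat.ofHom (algebraMap Γ(X, ⊤) (Localization.Away (f r))) ≫
        CommRingCat.ofHom l = g.appTop := by
      ext x
      exact IsLocalization.Away.lift_eq (S := Localization.Away (f r)) (f r) hu' x
    have : IsOpenImmersion (Spec.map (CommRingCat.ofHom
      (algebraMap Γ(X, ⊤) (Localization.Away (f r))))) := inferInstance
    rw [← cancel_mono (Spec.map (CommRingCat.ofHom
      (algebraMap Γ(X, ⊤) (Localization.Away (f r)))))]
    simp only [Category.assoc]
    rw [← Spec.map_comp, hl, ← Scheme.toSpecΓ_naturality, basicOpenIsoSpecAway,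
      IsOpenImmersion.isoOfRangeEq_hom_fac]
    refine (congrArg (g' ≫ (X.isoOfEq _).inv ≫ ·)
      (morphismRestrict_ι X.toSpecΓ (PrimeSpectrum.basicOpen (f r)))).trans ?_
    rw [← hg, Category.assoc, Scheme.isoOfEq_inv_ι_assoc]
  rw [reassoc_of% h2, ← Spec.map_comp_assoc]
  refine congrArg (fun z => Y.toSpecΓ ≫ Spec.map z ≫ Proj.awayι 𝒜 r hr hn) ?_
  ext x
  have key : l.comp (IsLocalization.map (M := .powers r) (T := .powers (f r))
      (Localization.Away (f r)) f (by
        rw [← Submonoid.map_le_iff_le_comap, Submonoid.map_powers])) =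
      IsLocalization.Away.lift (S := Localization.Away r) r hu := by
    refine IsLocalization.ringHom_ext (.powers r) ?_
    ext a
    simp only [RingHom.comp_apply, IsLocalization.map_eq]
    exact (IsLocalization.Away.lift_eq (S := Localization.Away (f r)) (f r) hu' _).trans
      (IsLocalization.Away.lift_eq (S := Localization.Away r) r hu a).symm
  exact RingHom.congr_fun key (algebraMap (HomogeneousLocalization.Away 𝒜 r) (Localization.Away r) x)

theorem fromOfGlobalSections_away {r : A} {n : ℕ} (hn : 0 < n) (hr : r ∈ 𝒜 n)
    (hu : IsUnit (f r)) :
    Proj.fromOfGlobalSections 𝒜 f hf =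
      X.toSpecΓ ≫ Spec.map (CommRingCat.ofHom (awayLift 𝒜 f hu)) ≫ Proj.awayι 𝒜 r hr hn := by
  have h := comp_fromOfGlobalSections_away 𝒜 f hf (𝟙 X) hn hr (by simpa using hu)
  rw [Category.id_comp] at h
  rw [h]
  congr 3

theorem isUnit_appTop_basicOpen_ι (s : Γ(X, ⊤)) : IsUnit ((X.basicOpen s).ι.appTop s) := by
  have h := (RingedSpace.isUnit_res_basicOpen X.toRingedSpace s).map
    (X.presheaf.map (homOfLE (show (X.basicOpen s).ι ''ᵁ ⊤ ≤ X.basicOpen s by simp)).op).hom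
  rw [Scheme.Opens.ι_appTop]
  have e : X.presheaf.map (homOfLE (show (X.basicOpen s).ι ''ᵁ ⊤ ≤ ⊤ from le_top)).op =
      X.presheaf.map (homOfLE (X.basicOpen_le s)).op ≫
        X.presheaf.map (homOfLE (show (X.basicOpen s).ι ''ᵁ ⊤ ≤ X.basicOpen s by simp)).op :=
    (X.presheaf.map_comp _ _)
  exact (congrArg IsUnit (congrArg (fun m => m.hom s) e)).mpr h
theorem isUnit_of_basicOpen_eq_top {s : Γ(X, ⊤)} (h : X.basicOpen s = ⊤) : IsUnit s :=
  RingedSpace.isUnit_of_isUnit_germ X.toRingedSpace ⊤ s fun x hx =>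
    (Scheme.mem_basicOpen X s x hx).1 (h.ge hx)

include hf in
/-- Morphisms from `X` agree when they agree on the open sets where the given coordinates are
invertible. -/
theorem hom_ext_of_isUnit {Z : Scheme.{u}} {p q : X ⟶ Z}
    (h : ∀ (W : X.Opens) (n : ℕ) (r : A), 0 < n → r ∈ 𝒜 n → IsUnit ((W.ι.appTop.hom.comp f) r) →
      W.ι ≫ p = W.ι ≫ q) : p = q := by
  refine (Proj.openCoverOfMapIrrelevantEqTop 𝒜 f hf).hom_ext _ _ fun x ↦ ?_
  exact h (X.basicOpen (f x.2.1)) x.1 x.2.1 x.2.2.1 x.2.2.2 (isUnit_appTop_basicOpen_ι _)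

include hf in
theorem map_irrelevant_comp (g : Y ⟶ X) :
    (HomogeneousIdeal.irrelevant 𝒜).toIdeal.map (g.appTop.hom.comp f) = ⊤ := by
  rw [← Ideal.map_map, hf, Ideal.map_top]

theorem comp_fromOfGlobalSections (g : Y ⟶ X) :
    g ≫ Proj.fromOfGlobalSections 𝒜 f hf =
      Proj.fromOfGlobalSections 𝒜 (g.appTop.hom.comp f) (map_irrelevant_comp 𝒜 f hf g) := by
  refine hom_ext_of_isUnit 𝒜 _ (map_irrelevant_comp 𝒜 f hf g) fun W n r hn hr hu => ?_
  rw [comp_fromOfGlobalSections_away 𝒜 _ _ W.ι hn hr hu, ← Category.assoc,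
    comp_fromOfGlobalSections_away 𝒜 f hf (W.ι ≫ g) hn hr hu]
  rfl

theorem awayLift_eq_awayLift {S : Type u} [CommRing S] {f f' : A →+* S} {r : A} {n : ℕ}
    (hr : r ∈ 𝒜 n) (hu : IsUnit (f r)) (hu' : IsUnit (f' r))
    (h : ∀ d, ∀ a ∈ 𝒜 (d • n), f' a * f r ^ d = f a * f' r ^ d) :
    awayLift 𝒜 f hu = awayLift 𝒜 f' hu' := by
  refine awayHom_ext 𝒜 hr fun d a ha => ?_
  have h1 := awayLift_mk 𝒜 f hu hr d a ha
  have h2 := awayLift_mk 𝒜 f' hu' hr d a ha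
  refine ((hu.pow d).mul (hu'.pow d)).mul_right_cancel ?_
  rw [← mul_assoc, h1, mul_comm (f r ^ d), ← mul_assoc, h2, h d a ha]

theorem fromOfGlobalSections_eq_of_smul {f f' : A →+* Γ(X, ⊤)}
    (hf : (HomogeneousIdeal.irrelevant 𝒜).toIdeal.map f = ⊤)
    (hf' : (HomogeneousIdeal.irrelevant 𝒜).toIdeal.map f' = ⊤) {u : Γ(X, ⊤)} (hu : IsUnit u)
    (h : ∀ d, ∀ a ∈ 𝒜 d, f' a = u ^ d * f a) :
    Proj.fromOfGlobalSections 𝒜 f hf = Proj.fromOfGlobalSections 𝒜 f' hf' := by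
  refine hom_ext_of_isUnit 𝒜 f hf fun W n r hn hr hr1 => ?_
  have hr2 : IsUnit ((W.ι.appTop.hom.comp f') r) := by
    simp only [RingHom.comp_apply] at hr1 ⊢
    rw [h n r hr, map_mul, map_pow]
    exact ((hu.map _).pow _).mul hr1
  rw [comp_fromOfGlobalSections_away 𝒜 _ _ W.ι hn hr hr1,
    comp_fromOfGlobalSections_away 𝒜 _ _ W.ι hn hr hr2, awayLift_eq_awayLift 𝒜 hr hr1 hr2]
  intro d a ha
  simp only [RingHom.comp_apply]
  rw [h _ a ha, h _ r hr]
  simp only [map_mul, map_pow, smul_eq_mul]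
  ring

theorem toSpecΓ_comp_injective {S : Type u} [CommRing S] {p q : S →+* Γ(X, ⊤)}
    (h : X.toSpecΓ ≫ Spec.map (CommRingCat.ofHom p) = X.toSpecΓ ≫ Spec.map (CommRingCat.ofHom q)) :
    p = q := by
  have key (p : S →+* Γ(X, ⊤)) : CommRingCat.ofHom p = (Scheme.ΓSpecIso (.of S)).inv ≫
      (X.toSpecΓ ≫ Spec.map (CommRingCat.ofHom p)).appTop := by
    rw [Scheme.Hom.comp_appTop, ← Category.assoc, ← Scheme.ΓSpecIso_inv_naturality, Category.assoc,
      Scheme.toSpecΓ_appTop, Iso.inv_hom_id, Category.comp_id]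
  have := key p
  rw [h, ← key q] at this
  exact congrArg CommRingCat.Hom.hom this

theorem eq_smul_of_fromOfGlobalSections_eq {f f' : A →+* Γ(X, ⊤)}
    {hf : (HomogeneousIdeal.irrelevant 𝒜).toIdeal.map f = ⊤}
    {hf' : (HomogeneousIdeal.irrelevant 𝒜).toIdeal.map f' = ⊤}
    (h : Proj.fromOfGlobalSections 𝒜 f hf = Proj.fromOfGlobalSections 𝒜 f' hf') {r : A} {n : ℕ}
    (hn : 0 < n) (hr : r ∈ 𝒜 n) (hu : IsUnit (f r)) :
    IsUnit (f' r) ∧ ∀ d, ∀ a ∈ 𝒜 (d • n), f' a * f r ^ d = f a * f' r ^ d := by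
  have hu' : IsUnit (f' r) := by
    refine isUnit_of_basicOpen_eq_top ?_
    rw [← Proj.fromOfGlobalSections_preimage_basicOpen 𝒜 f' hf' hn hr, ← h,
      Proj.fromOfGlobalSections_preimage_basicOpen 𝒜 f hf hn hr, Scheme.basicOpen_of_isUnit X hu]
  refine ⟨hu', fun d a ha => ?_⟩
  rw [fromOfGlobalSections_away 𝒜 f hf hn hr hu, fromOfGlobalSections_away 𝒜 f' hf' hn hr hu',
    ← Category.assoc, ← Category.assoc, cancel_mono] at h
  have h1 := toSpecΓ_comp_injective h
  rw [← awayLift_mk 𝒜 f hu hr d a ha, ← awayLift_mk 𝒜 f' hu' hr d a ha, h1]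
  ring

theorem fromOfGlobalSections_projToSpec {R : Type u} [CommRing R] [Algebra R A]
    (ℬ : ℕ → Submodule R A) [GradedAlgebra ℬ] (f : A →+* Γ(X, ⊤))
    (hf : (HomogeneousIdeal.irrelevant ℬ).toIdeal.map f = ⊤) :
    Proj.fromOfGlobalSections ℬ f hf ≫ projToSpec ℬ =
      X.toSpecΓ ≫ Spec.map (CommRingCat.ofHom (f.comp (algebraMap R A))) := by
  unfold projToSpec
  rw [Proj.fromOfGlobalSections_toSpecZero_assoc, ← Spec.map_comp]
  rfl

variable {S T : CommRingCat.{u}}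

theorem projPoint_eq (φ : A →+* S) (hφ : (HomogeneousIdeal.irrelevant 𝒜).toIdeal.map φ = ⊤) :
    projPoint 𝒜 φ hφ = Proj.fromOfGlobalSections 𝒜 ((Scheme.ΓSpecIso S).inv.hom.comp φ)
      (by rw [← Ideal.map_map, hφ, Ideal.map_top]) := rfl

theorem toSpecΓ_comp_ΓSpecIso_inv {B : Type u} [CommRing B] (ψ : B →+* S) :
    (Spec S).toSpecΓ ≫ Spec.map (CommRingCat.ofHom (S := Γ(Spec S, ⊤))
      ((Scheme.ΓSpecIso S).inv.hom.comp ψ)) = Spec.map (CommRingCat.ofHom ψ) := by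
  rw [CommRingCat.ofHom_comp, Spec.map_comp, CommRingCat.ofHom_hom, toSpecΓ_SpecMap_ΓSpecIso_inv_assoc]

theorem projPoint_away (φ : A →+* S) (hφ : (HomogeneousIdeal.irrelevant 𝒜).toIdeal.map φ = ⊤)
    {r : A} {n : ℕ} (hn : 0 < n) (hr : r ∈ 𝒜 n) (hu : IsUnit (φ r)) :
    projPoint 𝒜 φ hφ =
      Spec.map (CommRingCat.ofHom (awayLift 𝒜 φ hu)) ≫ Proj.awayι 𝒜 r hr hn := by
  have hu' : IsUnit (((Scheme.ΓSpecIso S).inv.hom.comp φ) r) := hu.map (Scheme.ΓSpecIso S).inv.hom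
  rw [projPoint_eq, fromOfGlobalSections_away 𝒜 _ _ hn hr hu',
    awayLift_comp 𝒜 φ (Scheme.ΓSpecIso S).inv.hom hu hu', ← Category.assoc,
    toSpecΓ_comp_ΓSpecIso_inv]

theorem projPoint_preimage (φ : A →+* S) (hφ : (HomogeneousIdeal.irrelevant 𝒜).toIdeal.map φ = ⊤)
    {r : A} {n : ℕ} (hn : 0 < n) (hr : r ∈ 𝒜 n) :
    projPoint 𝒜 φ hφ ⁻¹ᵁ Proj.basicOpen 𝒜 r = PrimeSpectrum.basicOpen (φ r) := by
  rw [projPoint_eq, Proj.fromOfGlobalSections_preimage_basicOpen 𝒜 _ _ hn hr]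
  exact basicOpen_eq_of_affine' _ |>.trans (by simp; rfl)

theorem comp_projPoint {φ : A →+* S} (hφ : (HomogeneousIdeal.irrelevant 𝒜).toIdeal.map φ = ⊤)
    (g : S ⟶ T) (hφ' : (HomogeneousIdeal.irrelevant 𝒜).toIdeal.map (g.hom.comp φ) = ⊤) :
    Spec.map g ≫ projPoint 𝒜 φ hφ = projPoint 𝒜 (g.hom.comp φ) hφ' := by
  rw [projPoint_eq, projPoint_eq, comp_fromOfGlobalSections]
  congr 1
  rw [← RingHom.comp_assoc, ← RingHom.comp_assoc, ← CommRingCat.hom_comp,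
    ← Scheme.ΓSpecIso_inv_naturality]
  rfl

theorem _root_.HasCoords.comp {p : Spec S ⟶ Proj 𝒜} {φ : A →+* S} (h : HasCoords 𝒜 p φ) (g : S ⟶ T) :
    HasCoords 𝒜 (Spec.map g ≫ p) (g.hom.comp φ) := by
  obtain ⟨hφ, rfl⟩ := h
  have : (HomogeneousIdeal.irrelevant 𝒜).toIdeal.map (g.hom.comp φ) = ⊤ := by
    rw [← Ideal.map_map, hφ, Ideal.map_top]
  exact ⟨this, comp_projPoint 𝒜 hφ g this⟩

theorem _root_.HasCoords.smul {p : Spec S ⟶ Proj 𝒜} {φ φ' : A →+* S} (h : HasCoords 𝒜 p φ) {u : S}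
    (hu : IsUnit u) (h' : ∀ d, ∀ a ∈ 𝒜 d, φ' a = u ^ d * φ a) : HasCoords 𝒜 p φ' := by
  obtain ⟨hφ, rfl⟩ := h
  have e : (HomogeneousIdeal.irrelevant 𝒜).toIdeal.map φ' = ⊤ := by
    rw [← top_le_iff, ← hφ, Ideal.map_le_iff_le_comap]
    intro a ha
    rw [Ideal.mem_comap]
    classical
    rw [← DirectSum.sum_support_decompose 𝒜 a, map_sum]
    refine sum_mem fun d hd => ?_
    have hd0 : ((DirectSum.decompose 𝒜 a d : 𝒜 d) : A) ∈ (HomogeneousIdeal.irrelevant 𝒜).toIdeal :=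
      (HomogeneousIdeal.irrelevant 𝒜).isHomogeneous d ha
    have h1 := h' d _ (DirectSum.decompose 𝒜 a d).2
    have h2 := (hu.pow d).unit.inv_mul_eq_iff_eq_mul.2 h1
    rw [← h2]
    exact Ideal.mul_mem_left _ _ (Ideal.mem_map_of_mem _ hd0)
  refine ⟨e, ?_⟩
  rw [projPoint_eq, projPoint_eq]
  refine fromOfGlobalSections_eq_of_smul 𝒜 _ _ (hu.map (Scheme.ΓSpecIso S).inv.hom) ?_
  intro d a ha
  simp [h' d a ha]

theorem _root_.HasCoords.isUnit {p : Spec S ⟶ Proj 𝒜} {φ φ' : A →+* S} (h : HasCoords 𝒜 p φ)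
    (h' : HasCoords 𝒜 p φ') {r : A} {n : ℕ} (hn : 0 < n) (hr : r ∈ 𝒜 n) (hu : IsUnit (φ r)) :
    IsUnit (φ' r) ∧ ∀ d, ∀ a ∈ 𝒜 (d • n), φ' a * φ r ^ d = φ a * φ' r ^ d := by
  obtain ⟨hφ, rfl⟩ := h
  obtain ⟨hφ', e⟩ := h'
  have inj : Function.Injective (Scheme.ΓSpecIso S).inv.hom :=
    (Scheme.ΓSpecIso S).symm.commRingCatIsoToRingEquiv.injective
  obtain ⟨h1, h2⟩ := eq_smul_of_fromOfGlobalSections_eq 𝒜 e hn hr (hu.map (Scheme.ΓSpecIso S).inv.hom)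
  refine ⟨?_, fun d a ha => inj ?_⟩
  · have := h1.map (Scheme.ΓSpecIso S).hom.hom
    simpa using this
  · simpa using h2 d a ha

theorem _root_.HasCoords.projToSpec {R : Type u} [CommRing R] [Algebra R A]
    (ℬ : ℕ → Submodule R A) [GradedAlgebra ℬ] {p : Spec S ⟶ Proj ℬ} {φ : A →+* S}
    (h : HasCoords ℬ p φ) :
    p ≫ projToSpec ℬ = Spec.map (CommRingCat.ofHom (φ.comp (algebraMap R A))) := by
  obtain ⟨hφ, rfl⟩ := h
  rw [projPoint_eq, fromOfGlobalSections_projToSpec, RingHom.comp_assoc, toSpecΓ_comp_ΓSpecIso_inv]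

end ProjCoord
end ProjCoordinates

noncomputable section ProjCovers
open Limits

/-- An affine open cover of `X` that is subordinate to the pullback of an open cover of `Y`. -/
theorem exists_affineOpenCover_lift {X Y : Scheme.{u}} (p : X ⟶ Y) (𝒰 : Scheme.OpenCover.{v} Y) :
    ∃ 𝒲 : Scheme.AffineOpenCover.{max v u, u} X, ∀ a, ∃ (i : 𝒰.I₀) (g : Spec (𝒲.X a) ⟶ 𝒰.X i),
      𝒲.f a ≫ p = g ≫ 𝒰.f i := by
  refine ⟨Scheme.OpenCover.affineRefinement
    (show X.OpenCover from Precoverage.ZeroHypercover.pullback₁ p 𝒰), fun a => ?_⟩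
  refine ⟨a.1, (pullback p (𝒰.f a.1)).affineOpenCover.f a.2 ≫ pullback.snd p (𝒰.f a.1), ?_⟩
  change ((pullback p (𝒰.f a.1)).affineOpenCover.f a.2 ≫ pullback.fst p (𝒰.f a.1)) ≫ p = _
  exact (Category.assoc _ _ _).trans ((congrArg (_ ≫ ·) pullback.condition).trans
    (Category.assoc _ _ _).symm)

theorem hom_ext_of_affine {X Y : Scheme.{u}} {f g : X ⟶ Y}
    (h : ∀ (S : CommRingCat.{u}) (p : Spec S ⟶ X), p ≫ f = p ≫ g) : f = g :=
  X.affineOpenCover.openCover.hom_ext _ _ fun a => h _ _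

/-- A morphism is given by its values on affine-valued points, once these are unique, stable under
base change and exist locally. -/
theorem exists_hom_of_affine_points {Y Z : Scheme.{u}}
    (Rel : ∀ {S : CommRingCat.{u}}, (Spec S ⟶ Y) → (Spec S ⟶ Z) → Prop)
    (stable : ∀ {S T : CommRingCat.{u}} (g : S ⟶ T) (p : Spec S ⟶ Y) (m : Spec S ⟶ Z),
      Rel p m → Rel (Spec.map g ≫ p) (Spec.map g ≫ m))
    (unique : ∀ {S : CommRingCat.{u}} (p : Spec S ⟶ Y) (m m' : Spec S ⟶ Z),
      Rel p m → Rel p m' → m = m')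
    (𝒰 : Scheme.AffineOpenCover.{v} Y) (hex : ∀ a, ∃ m, Rel (𝒰.f a) m) :
    ∃ T : Y ⟶ Z, ∀ {S : CommRingCat.{u}} (p : Spec S ⟶ Y) (m : Spec S ⟶ Z), Rel p m →
      p ≫ T = m := by
  choose m hm using hex
  have stable' {S T : CommRingCat.{u}} (g : Spec T ⟶ Spec S) (p : Spec S ⟶ Y) (m : Spec S ⟶ Z)
      (h : Rel p m) : Rel (g ≫ p) (g ≫ m) := by
    have := stable (Spec.preimage g) p m h
    rwa [Spec.map_preimage] at this
  let T : Y ⟶ Z := 𝒰.openCover.glueMorphisms m (by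
    intro a b
    refine hom_ext_of_affine fun S q => ?_
    let qa : Spec S ⟶ Spec (𝒰.X a) := q ≫ pullback.fst (𝒰.openCover.f a) (𝒰.openCover.f b)
    let qb : Spec S ⟶ Spec (𝒰.X b) := q ≫ pullback.snd (𝒰.openCover.f a) (𝒰.openCover.f b)
    have e : qa ≫ 𝒰.f a = qb ≫ 𝒰.f b :=
      (Category.assoc q _ (𝒰.openCover.f a)).trans ((congrArg (q ≫ ·) pullback.condition).trans
        (Category.assoc q _ (𝒰.openCover.f b)).symm)
    have := unique (qa ≫ 𝒰.f a) (qa ≫ m a) (qb ≫ m b) (stable' _ _ _ (hm a))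
      (by rw [e]; exact stable' _ _ _ (hm b))
    exact (Category.assoc q _ (m a)).symm.trans (this.trans (Category.assoc q _ (m b))))
  refine ⟨T, fun {S} p m' hpm => ?_⟩
  obtain ⟨𝒲, h𝒲⟩ := exists_affineOpenCover_lift p 𝒰.openCover
  refine 𝒲.openCover.hom_ext _ _ fun b => ?_
  obtain ⟨i, g, hg⟩ := h𝒲 b
  change 𝒲.f b ≫ p ≫ T = 𝒲.f b ≫ m'
  have h1 : 𝒲.f b ≫ p ≫ T = g ≫ m i := by
    rw [← Category.assoc, hg, Category.assoc]
    exact congrArg (g ≫ ·) (𝒰.openCover.ι_glueMorphisms m _ i)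
  rw [h1]
  refine unique (𝒲.f b ≫ p) _ _ ?_ (stable' _ _ _ hpm)
  rw [hg]
  exact stable' g (𝒰.f i) (m i) (hm i)

namespace ProjCoord
open DirectSum
variable {A : Type u} {σ : Type*} [CommRing A] [SetLike σ A] [AddSubgroupClass σ A]
  (𝒜 : ℕ → σ) [GradedRing 𝒜]

/-- The map `a ↦ a / z ^ d` on the elements of degree `d`. -/
def dehomAux {z : A} (hz : z ∈ 𝒜 1) (d : ℕ) : 𝒜 d →+ HomogeneousLocalization.Away 𝒜 z where
  toFun a := HomogeneousLocalization.Away.mk 𝒜 hz d a (by simp)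
  map_zero' := by
    apply HomogeneousLocalization.val_injective
    rw [HomogeneousLocalization.Away.val_mk, ZeroMemClass.coe_zero, Localization.mk_zero,
      HomogeneousLocalization.val_zero]
  map_add' a b := by
    apply HomogeneousLocalization.val_injective
    rw [HomogeneousLocalization.val_add]
    simp only [HomogeneousLocalization.Away.val_mk, AddMemClass.coe_add]
    rw [Localization.add_mk_self]

theorem dehomAux_val {z : A} (hz : z ∈ 𝒜 1) (d : ℕ) (a : 𝒜 d) :
    (dehomAux 𝒜 hz d a).val = Localization.mk (a : A) (⟨z ^ d, d, rfl⟩ : Submonoid.powers z) :=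
  HomogeneousLocalization.Away.val_mk (hf := hz) ..

/-- The homomorphism that maps `a` of degree `d` to `a / z ^ d`. -/
def dehom {z : A} (hz : z ∈ 𝒜 1) : A →+* HomogeneousLocalization.Away 𝒜 z :=
  (DirectSum.toSemiring (A := fun d => 𝒜 d) (dehomAux 𝒜 hz)
    (by
      apply HomogeneousLocalization.val_injective
      rw [dehomAux_val, HomogeneousLocalization.val_one]
      exact Localization.mk_self (⟨z ^ 0, _⟩ : Submonoid.powers z) |>.symm ▸ (by
        congr 1; simp))
    (fun {i j} a b => by
      apply HomogeneousLocalization.val_injective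
      rw [HomogeneousLocalization.val_mul, dehomAux_val, dehomAux_val, dehomAux_val,
        Localization.mk_mul]
      congr 1
      exact Subtype.ext (pow_add z i j))).comp (DirectSum.decomposeRingEquiv 𝒜).toRingHom

theorem dehom_apply {z : A} (hz : z ∈ 𝒜 1) {d : ℕ} {a : A} (ha : a ∈ 𝒜 d)
    (ha' : a ∈ 𝒜 (d • 1)) : dehom 𝒜 hz a = .mk 𝒜 hz d a ha' := by
  unfold dehom
  rw [RingHom.comp_apply]
  change DirectSum.toSemiring _ _ _ (DirectSum.decompose 𝒜 a) = _
  rw [DirectSum.decompose_of_mem 𝒜 ha, DirectSum.toSemiring_of]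
  rfl

theorem dehom_self {z : A} (hz : z ∈ 𝒜 1) : dehom 𝒜 hz z = 1 := by
  rw [dehom_apply 𝒜 hz hz (by simpa using hz)]
  apply HomogeneousLocalization.val_injective
  rw [HomogeneousLocalization.Away.val_mk, HomogeneousLocalization.val_one]
  simp only [pow_one]
  exact Localization.mk_self (⟨z, _⟩ : Submonoid.powers z)

theorem map_irrelevant_eq_top {S : Type u} [CommRing S] {φ : A →+* S} {z : A} {n : ℕ} (hn : 0 < n)
    (hz : z ∈ 𝒜 n) (hu : IsUnit (φ z)) : (HomogeneousIdeal.irrelevant 𝒜).toIdeal.map φ = ⊤ := by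
  refine Ideal.eq_top_of_isUnit_mem _ (Ideal.mem_map_of_mem φ ?_) hu
  change z ∈ HomogeneousIdeal.irrelevant 𝒜
  rw [HomogeneousIdeal.mem_irrelevant_iff, GradedRing.proj_apply,
    DirectSum.decompose_of_mem_ne _ hz hn.ne']

theorem hasCoords_awayι {z : A} (hz : z ∈ 𝒜 1) :
    HasCoords 𝒜 (S := .of (HomogeneousLocalization.Away 𝒜 z)) (Proj.awayι 𝒜 z hz one_pos)
      (dehom 𝒜 hz) := by
  have hu : IsUnit (dehom 𝒜 hz z) := by rw [dehom_self]; exact isUnit_one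
  have h0 := map_irrelevant_eq_top 𝒜 (φ := dehom 𝒜 hz) one_pos hz hu
  refine ⟨h0, ?_⟩
  rw [projPoint_away 𝒜 (S := .of (HomogeneousLocalization.Away 𝒜 z)) (dehom 𝒜 hz) h0 one_pos hz hu]
  have : awayLift 𝒜 (dehom 𝒜 hz) hu = RingHom.id _ := by
    refine awayHom_ext 𝒜 hz fun d a ha => ?_
    have := awayLift_mk 𝒜 (dehom 𝒜 hz) hu hz d a ha
    rw [dehom_self, one_pow, mul_one, dehom_apply 𝒜 hz (d := d) (by simpa using ha) ha] at this
    exact this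
  rw [this]
  exact (Category.id_comp _).symm.trans (congrArg (· ≫ _) (Spec.map_id _).symm)

variable {ι : Type v} (z : ι → A) (hz : ∀ i, z i ∈ 𝒜 1)
  (hcov : ⨆ i, Proj.basicOpen 𝒜 (z i) = ⊤)

/-- The cover by the open sets where an element of degree one does not vanish. -/
def degOneCover : (Proj 𝒜).AffineOpenCover where
  I₀ := ι
  X i := .of (HomogeneousLocalization.Away 𝒜 (z i))
  f i := Proj.awayι 𝒜 (z i) (hz i) one_pos
  idx x := (Opens.mem_iSup.mp (hcov.ge (Set.mem_univ x))).choose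
  covers x := by
    change x ∈ (Proj.awayι 𝒜 _ _ _).opensRange
    rw [Proj.opensRange_awayι]
    exact (Opens.mem_iSup.mp (hcov.ge (Set.mem_univ x))).choose_spec

include hz hcov in
theorem exists_cover_hasCoords {Y : Scheme.{u}} (h : Y ⟶ Proj 𝒜) :
    ∃ 𝒰 : Scheme.AffineOpenCover.{max v u, u} Y, ∀ a, ∃ (i : ι) (φ : A →+* 𝒰.X a),
      HasCoords 𝒜 (𝒰.f a ≫ h) φ ∧ φ (z i) = 1 := by
  obtain ⟨𝒲, h𝒲⟩ := exists_affineOpenCover_lift h (degOneCover 𝒜 z hz hcov).openCover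
  refine ⟨𝒲, fun a => ?_⟩
  obtain ⟨i, g, hg⟩ := h𝒲 a
  let g' : Spec (𝒲.X a) ⟶ Spec (.of (HomogeneousLocalization.Away 𝒜 (z i))) := g
  have := HasCoords.comp 𝒜 (hasCoords_awayι 𝒜 (hz i)) (Spec.preimage g')
  rw [Spec.map_preimage] at this
  rw [hg]
  refine ⟨i, _, this, ?_⟩
  change (Spec.preimage g').hom (dehom 𝒜 (hz i) (z i)) = 1
  rw [dehom_self, map_one]

end ProjCoord
end ProjCovers

noncomputable section MonomialElements
open Limits

namespace CoeffSystem

section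
variable {R F : Type u} [CommRing R] [Field F] [Algebra R F] {G : Type} [AddCommMonoid G]
  (Q : CoeffSystem R F G)

theorem single_mem {p : G} {a : F} (ha : a ∈ Q.coeff p) :
    AddMonoidAlgebra.single p a ∈ Q.toSubalgebra := by
  classical
  intro g
  rw [AddMonoidAlgebra.coeff_single, Finsupp.single_apply]
  split_ifs with e
  · exact e ▸ ha
  · exact Submodule.zero_mem _

/-- The element `a w^p`. -/
def mono (p : G) (a : Q.coeff p) : Q.toSubalgebra := ⟨AddMonoidAlgebra.single p a.1, Q.single_mem a.2⟩

theorem mono_add (p : G) (a b : Q.coeff p) : Q.mono p (a + b) = Q.mono p a + Q.mono p b :=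
  Subtype.ext (AddMonoidAlgebra.single_add ..)

theorem mono_zero (p : G) : Q.mono p 0 = 0 := Subtype.ext (AddMonoidAlgebra.single_zero ..)

theorem mono_mul (p q : G) (a : Q.coeff p) (b : Q.coeff q) :
    Q.mono p a * Q.mono q b = Q.mono (p + q) ⟨a.1 * b.1, Q.mul_mem _ _ _ a.2 _ b.2⟩ :=
  Subtype.ext (AddMonoidAlgebra.single_mul_single ..)

theorem mono_one : Q.mono 0 ⟨1, Q.one_mem⟩ = 1 := rfl

/-- The coefficient as an element of the module of admissible coefficients. -/
def coeffAt (f : Q.toSubalgebra) (p : G) : Q.coeff p := ⟨f.1.coeff p, f.2 p⟩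

theorem sum_mono (f : Q.toSubalgebra) :
    ∑ p ∈ f.1.coeff.support, Q.mono p (Q.coeffAt f p) = f := by
  apply Subtype.ext
  rw [AddSubmonoidClass.coe_finsetSum]
  conv_rhs => rw [← AddMonoidAlgebra.sum_coeff_single f.1]
  rfl

theorem mono_induction {P : Q.toSubalgebra → Prop} (zero : P 0)
    (add : ∀ f g, P f → P g → P (f + g)) (mono : ∀ p a, P (Q.mono p a)) (f : Q.toSubalgebra) :
    P f := by
  rw [← Q.sum_mono f]
  exact Finset.sum_induction _ P add zero fun p _ => mono p _

theorem addHom_ext {S : Type*} [AddCommMonoid S] {φ ψ : Q.toSubalgebra →+ S}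
    (h : ∀ p a, φ (Q.mono p a) = ψ (Q.mono p a)) : φ = ψ := by
  ext f
  refine Q.mono_induction (P := fun f => φ f = ψ f) ?_ ?_ h f
  · simp
  · intro f g hf hg; rw [map_add, map_add, hf, hg]

theorem ringHom_ext {S : Type*} [Semiring S] {φ ψ : Q.toSubalgebra →+* S}
    (h : ∀ p a, φ (Q.mono p a) = ψ (Q.mono p a)) : φ = ψ := by
  have := Q.addHom_ext (φ := φ.toAddMonoidHom) (ψ := ψ.toAddMonoidHom) h
  ext f
  exact DFunLike.congr_fun this f

theorem coeffAt_mono (p : G) (a : Q.coeff p) : Q.coeffAt (Q.mono p a) p = a :=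
  Subtype.ext (Finsupp.single_eq_same)

theorem coeffAt_mono_ne {p q : G} (h : q ≠ p) (a : Q.coeff p) : Q.coeffAt (Q.mono p a) q = 0 :=
  Subtype.ext (Finsupp.single_eq_of_ne h)

/-- The additive map with given values on monomials. -/
def liftAdd {S : Type*} [AddCommMonoid S] (g : ∀ p, Q.coeff p →+ S) : Q.toSubalgebra →+ S where
  toFun f := ∑ᶠ p, g p (Q.coeffAt f p)
  map_zero' := by
    have h (p : G) : g p (Q.coeffAt 0 p) = 0 := map_zero (g p)
    simp [h]
  map_add' f h := by
    have fin (f : Q.toSubalgebra) : (Function.support fun p => g p (Q.coeffAt f p)).Finite := by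
      refine f.1.coeff.hasFiniteSupport.subset fun p hp hf => hp ?_
      have : Q.coeffAt f p = 0 := Subtype.ext hf
      simp [this]
    rw [← finsum_add_distrib (fin f) (fin h)]
    refine finsum_congr fun p => ?_
    rw [← map_add]
    rfl

theorem liftAdd_mono {S : Type*} [AddCommMonoid S] (g : ∀ p, Q.coeff p →+ S) (p : G)
    (a : Q.coeff p) : Q.liftAdd g (Q.mono p a) = g p a := by
  change ∑ᶠ q, g q (Q.coeffAt (Q.mono p a) q) = _
  rw [finsum_eq_single _ p fun q hq => by rw [Q.coeffAt_mono_ne hq, map_zero], coeffAt_mono]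

/-- The ring homomorphism with given values on monomials. -/
def lift {S : Type*} [Semiring S] (g : ∀ p, Q.coeff p →+ S) (one : g 0 ⟨1, Q.one_mem⟩ = 1)
    (mul : ∀ p q a b, g (p + q) ⟨a.1 * b.1, Q.mul_mem _ _ _ a.2 _ b.2⟩ = g p a * g q b) :
    Q.toSubalgebra →+* S where
  __ := Q.liftAdd g
  map_one' := by
    change Q.liftAdd g (Q.mono 0 ⟨1, Q.one_mem⟩) = 1
    rw [liftAdd_mono, one]
  map_mul' f h := by
    change Q.liftAdd g (f * h) = Q.liftAdd g f * Q.liftAdd g h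
    refine Q.mono_induction (P := fun f => Q.liftAdd g (f * h) = Q.liftAdd g f * Q.liftAdd g h)
      (by simp) (fun a b ha hb => by rw [add_mul, map_add, ha, hb, map_add, add_mul])
      (fun p a => ?_) f
    refine Q.mono_induction (P := fun h => Q.liftAdd g (_ * h) = Q.liftAdd g _ * Q.liftAdd g h)
      (by simp) (fun a b ha hb => by rw [mul_add, map_add, ha, hb, map_add, mul_add])
      (fun q b => ?_) h
    rw [mono_mul, liftAdd_mono, liftAdd_mono, liftAdd_mono, mul]

theorem lift_mono {S : Type*} [Semiring S] (g : ∀ p, Q.coeff p →+ S)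
    (one : g 0 ⟨1, Q.one_mem⟩ = 1)
    (mul : ∀ p q a b, g (p + q) ⟨a.1 * b.1, Q.mul_mem _ _ _ a.2 _ b.2⟩ = g p a * g q b) (p : G)
    (a : Q.coeff p) : Q.lift g one mul (Q.mono p a) = g p a := Q.liftAdd_mono g p a

end

section
variable {R F : Type u} [CommRing R] [Field F] [Algebra R F] {E : Type} [AddCommGroup E]
  (Q : CoeffSystem R F (ℕ × E))

theorem mono_mem_grading (p : ℕ × E) (a : Q.coeff p) : Q.mono p a ∈ Q.grading p.1 := by
  classical
  intro q hq
  change (Finsupp.single p a.1) q ≠ 0 at hq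
  rw [Finsupp.single_apply] at hq
  split_ifs at hq with e
  · rw [e]
  · exact absurd rfl hq

theorem isWeight_mono (p : ℕ × E) (a : Q.coeff p) : Q.IsWeight p.2 (Q.mono p a) := by
  classical
  intro q hq
  change (Finsupp.single p a.1) q ≠ 0 at hq
  rw [Finsupp.single_apply] at hq
  split_ifs at hq with e
  · rw [e]
  · exact absurd rfl hq

variable {S T : Type u} [CommRing S] [CommRing T]

/-- The coordinates that are obtained by multiplying the coordinates of weight `x` by the value of a
character. -/
def tw (φ : Q.toSubalgebra →+* S) (χ : Multiplicative E →* S) : Q.toSubalgebra →+* S :=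
  Q.lift (fun p =>
    { toFun := fun a => χ (.ofAdd p.2) * φ (Q.mono p a)
      map_zero' := by rw [mono_zero, map_zero, mul_zero]
      map_add' := fun a b => by rw [mono_add, map_add, mul_add] })
    (by
      change χ (.ofAdd 0) * φ (Q.mono 0 ⟨1, _⟩) = 1
      rw [mono_one, map_one, ofAdd_zero, map_one, mul_one])
    (fun p q a b => by
      change χ (.ofAdd (p.2 + q.2)) * φ (Q.mono (p + q) _) =
        (χ (.ofAdd p.2) * φ (Q.mono p a)) * (χ (.ofAdd q.2) * φ (Q.mono q b))
      rw [← mono_mul, map_mul, ofAdd_add, map_mul]; ring)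

theorem tw_mono (φ : Q.toSubalgebra →+* S) (χ : Multiplicative E →* S) (p : ℕ × E) (a : Q.coeff p) :
    Q.tw φ χ (Q.mono p a) = χ (.ofAdd p.2) * φ (Q.mono p a) := Q.lift_mono ..

theorem tw_of_isWeight (φ : Q.toSubalgebra →+* S) (χ : Multiplicative E →* S) {x : E}
    {f : Q.toSubalgebra} (hf : Q.IsWeight x f) : Q.tw φ χ f = χ (.ofAdd x) * φ f := by
  rw [← Q.sum_mono f, map_sum, map_sum, Finset.mul_sum]
  refine Finset.sum_congr rfl fun p hp => ?_
  rw [tw_mono, hf p (Finsupp.mem_support_iff.1 hp)]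

theorem eq_tw {φ φ' : Q.toSubalgebra →+* S} {χ : Multiplicative E →* S}
    (h : ∀ x f, Q.IsWeight x f → φ' f = χ (.ofAdd x) * φ f) : φ' = Q.tw φ χ :=
  Q.ringHom_ext fun p a => by rw [tw_mono, h p.2 _ (Q.isWeight_mono p a)]

theorem comp_tw (φ : Q.toSubalgebra →+* S) (χ : Multiplicative E →* S) (g : S →+* T) :
    g.comp (Q.tw φ χ) = Q.tw (g.comp φ) ((g : S →* T).comp χ) :=
  Q.ringHom_ext fun p a => by
    rw [RingHom.comp_apply, tw_mono, tw_mono, map_mul]; rfl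

theorem isUnit_character (χ : Multiplicative E →* S) (x : Multiplicative E) : IsUnit (χ x) :=
  (Group.isUnit x).map χ

theorem mono_mem_irrelevant {p : ℕ × E} (hp : p.1 ≠ 0) (a : Q.coeff p) :
    Q.mono p a ∈ (HomogeneousIdeal.irrelevant Q.grading).toIdeal := by
  change Q.mono p a ∈ HomogeneousIdeal.irrelevant Q.grading
  rw [HomogeneousIdeal.mem_irrelevant_iff, GradedRing.proj_apply,
    DirectSum.decompose_of_mem_ne _ (Q.mono_mem_grading p a) hp]

theorem mono_coeffAt_mem_of_mem_irrelevant {f : Q.toSubalgebra}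
    (hf : f ∈ (HomogeneousIdeal.irrelevant Q.grading).toIdeal) (p : ℕ × E) (hp : p.1 = 0) :
    f.1.coeff p = 0 := by
  change f ∈ HomogeneousIdeal.irrelevant Q.grading at hf
  rw [HomogeneousIdeal.mem_irrelevant_iff, GradedRing.proj_apply] at hf
  by_contra hne
  have h1 : f = ((DirectSum.decompose Q.grading f 0 : Q.grading 0) : Q.toSubalgebra) +
      (f - (DirectSum.decompose Q.grading f 0 : Q.grading 0)) := by abel
  classical
  have h2 := DirectSum.sum_support_decompose Q.grading f
  have h3 : f.1.coeff p = ∑ i ∈ (DirectSum.decompose Q.grading f).support,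
      ((DirectSum.decompose Q.grading f i : Q.grading i) : Q.toSubalgebra).1.coeff p := by
    conv_lhs => rw [← h2]
    rw [AddSubmonoidClass.coe_finsetSum, AddMonoidAlgebra.coeff_sum, Finsupp.coe_finsetSum,
      Finset.sum_apply]
  rw [Finset.sum_eq_zero] at h3
  · exact hne h3
  · intro i _
    by_contra h4
    have h5 := (DirectSum.decompose Q.grading f i).2 p h4
    rw [hp] at h5
    subst h5
    rw [hf] at h4
    exact h4 rfl

theorem map_irrelevant_tw {φ : Q.toSubalgebra →+* S} (χ : Multiplicative E →* S)
    (h : (HomogeneousIdeal.irrelevant Q.grading).toIdeal.map φ = ⊤) :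
    (HomogeneousIdeal.irrelevant Q.grading).toIdeal.map (Q.tw φ χ) = ⊤ := by
  rw [← top_le_iff, ← h, Ideal.map_le_iff_le_comap]
  intro f hf
  rw [Ideal.mem_comap, ← Q.sum_mono f, map_sum]
  refine sum_mem fun p hp => ?_
  have hp0 : p.1 ≠ 0 := fun h0 =>
    (Finsupp.mem_support_iff.1 hp) (Q.mono_coeffAt_mem_of_mem_irrelevant hf p h0)
  have h1 := Ideal.mem_map_of_mem (Q.tw φ χ) (Q.mono_mem_irrelevant hp0 (Q.coeffAt f p))
  rw [tw_mono] at h1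
  exact (Ideal.unit_mul_mem_iff_mem _ (isUnit_character χ _)).1 h1

theorem hasCoords_tw_of_hasCoords {S : CommRingCat.{u}} {p m : Spec S ⟶ Proj Q.grading}
    {φ φ' : Q.toSubalgebra →+* S} (h : HasCoords Q.grading p φ) (h' : HasCoords Q.grading p φ')
    {z : Q.toSubalgebra} (hz : z ∈ Q.grading 1) (hu : φ z = 1) {χ : Multiplicative E →* S}
    (hm : HasCoords Q.grading m (Q.tw φ χ)) : HasCoords Q.grading m (Q.tw φ' χ) := by
  obtain ⟨h1, h2⟩ := h.isUnit Q.grading h' one_pos hz (by rw [hu]; exact isUnit_one)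
  refine hm.smul Q.grading h1 fun d a ha => ?_
  rw [← Q.sum_mono a, map_sum, map_sum, Finset.mul_sum]
  refine Finset.sum_congr rfl fun p hp => ?_
  have hd : p.1 = d := ha p (Finsupp.mem_support_iff.1 hp)
  have h3 := h2 d (Q.mono p (Q.coeffAt a p)) (by
    rw [smul_eq_mul, mul_one, ← hd]; exact Q.mono_mem_grading _ _)
  rw [hu, one_pow, mul_one] at h3
  rw [tw_mono, tw_mono, h3]; ring

/-- The character of the torus given by a point of the torus. -/
def charOf {k : Type u} [CommRing k] {S : CommRingCat.{u}}
    (τ : Spec S ⟶ Spec (.of (AddMonoidAlgebra k E))) : Multiplicative E →* S :=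
  (((Spec.preimage τ).hom : AddMonoidAlgebra k E →+* S) : _ →* S).comp (AddMonoidAlgebra.of k E)

theorem charOf_comp {k : Type u} [CommRing k] {S T : CommRingCat.{u}}
    (τ : Spec S ⟶ Spec (.of (AddMonoidAlgebra k E))) (g : S ⟶ T) :
    charOf (Spec.map g ≫ τ) = ((g.hom : S →+* T) : S →* T).comp (charOf τ) := by
  unfold charOf
  have : Spec.preimage (Spec.map g ≫ τ) = Spec.preimage τ ≫ g := by
    apply Spec.map_injective; simp
  rw [this]
  rfl

theorem charOf_map {k : Type u} [CommRing k] {S : CommRingCat.{u}}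
    (t : AddMonoidAlgebra k E →+* S) (x : E) :
    charOf (Spec.map (CommRingCat.ofHom t)) (.ofAdd x) = t (AddMonoidAlgebra.single x 1) := by
  unfold charOf
  rw [Spec.preimage_map]
  rfl

variable {ι : Type v} (z : ι → Q.toSubalgebra) (hz : ∀ i, z i ∈ Q.grading 1)
  (hcov : ⨆ i, Proj.basicOpen Q.grading (z i) = ⊤)

/-- The morphism `T` is the translate of `h` by `τ`: the coordinates of weight `x` are multiplied
by the value of the character `x`. -/
def IsTwist {k : Type u} [CommRing k] {Y : Scheme.{u}} (h T : Y ⟶ Proj Q.grading)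
    (τ : Y ⟶ Spec (.of (AddMonoidAlgebra k E))) : Prop :=
  ∀ (S : CommRingCat.{u}) (p : Spec S ⟶ Y) (φ : Q.toSubalgebra →+* S),
    HasCoords Q.grading (p ≫ h) φ → HasCoords Q.grading (p ≫ T) (Q.tw φ (charOf (p ≫ τ)))

variable {Q} in
theorem IsTwist.comp {k : Type u} [CommRing k] {Y Y' : Scheme.{u}} {h T : Y ⟶ Proj Q.grading}
    {τ : Y ⟶ Spec (.of (AddMonoidAlgebra k E))} (H : Q.IsTwist h T τ) (g : Y' ⟶ Y) :
    Q.IsTwist (g ≫ h) (g ≫ T) (g ≫ τ) := by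
  intro S p φ hφ
  have := H S (p ≫ g) φ (by rwa [Category.assoc])
  simpa only [Category.assoc] using this

include hz hcov in
theorem IsTwist.unique {k : Type u} [CommRing k] {Y : Scheme.{u}} {h T T' : Y ⟶ Proj Q.grading}
    {τ : Y ⟶ Spec (.of (AddMonoidAlgebra k E))} (H : Q.IsTwist h T τ) (H' : Q.IsTwist h T' τ) :
    T = T' := by
  obtain ⟨𝒰, h𝒰⟩ := ProjCoord.exists_cover_hasCoords Q.grading z hz hcov h
  refine 𝒰.openCover.hom_ext _ _ fun a => ?_
  obtain ⟨i, φ, hφ, -⟩ := h𝒰 a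
  obtain ⟨h1, h2⟩ := H _ _ _ hφ
  obtain ⟨h3, h4⟩ := H' _ _ _ hφ
  exact h2.trans h4.symm

include hz hcov in
theorem exists_isTwist {k : Type u} [CommRing k] {Y : Scheme.{u}} (h : Y ⟶ Proj Q.grading)
    (τ : Y ⟶ Spec (.of (AddMonoidAlgebra k E))) : ∃ T, Q.IsTwist h T τ := by
  obtain ⟨𝒰, h𝒰⟩ := ProjCoord.exists_cover_hasCoords Q.grading z hz hcov h
  obtain ⟨T, hT⟩ := exists_hom_of_affine_points (Y := Y) (Z := Proj Q.grading)
    (fun {S} p m => ∃ (φ : Q.toSubalgebra →+* S) (i : ι), HasCoords Q.grading (p ≫ h) φ ∧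
      φ (z i) = 1 ∧ HasCoords Q.grading m (Q.tw φ (charOf (p ≫ τ))))
    (fun {S T} g p m => by
      rintro ⟨φ, i, h1, h2, h3⟩
      refine ⟨g.hom.comp φ, i, ?_, ?_, ?_⟩
      · rw [Category.assoc]; exact h1.comp Q.grading g
      · rw [RingHom.comp_apply, h2, map_one]
      · rw [Category.assoc, charOf_comp, ← comp_tw]
        exact h3.comp Q.grading g)
    (fun {S} p m m' => by
      rintro ⟨φ, i, h1, h2, h3⟩ ⟨φ', i', h1', h2', h3'⟩
      obtain ⟨_, e⟩ := Q.hasCoords_tw_of_hasCoords h1 h1' (hz i) h2 h3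
      obtain ⟨_, e'⟩ := h3'
      exact e.trans e'.symm)
    𝒰 (fun a => by
      obtain ⟨i, φ, hφ, hi⟩ := h𝒰 a
      have h0 := Q.map_irrelevant_tw (charOf (𝒰.f a ≫ τ)) hφ.choose
      exact ⟨projPoint Q.grading _ h0, φ, i, hφ, hi, h0, rfl⟩)
  refine ⟨T, fun S p φ hφ => ?_⟩
  have h0 := Q.map_irrelevant_tw (charOf (p ≫ τ)) hφ.choose
  refine ⟨h0, ?_⟩
  have hφ' : HasCoords Q.grading (projPoint Q.grading _ h0) (Q.tw φ (charOf (p ≫ τ))) := ⟨h0, rfl⟩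
  obtain ⟨𝒲, h𝒲⟩ := ProjCoord.exists_cover_hasCoords Q.grading z hz hcov (p ≫ h)
  refine 𝒲.openCover.hom_ext _ _ fun b => ?_
  obtain ⟨i, ψ, hψ, hi⟩ := h𝒲 b
  let g := Spec.preimage (𝒲.f b)
  have hg : 𝒲.f b = Spec.map g := (Spec.map_preimage _).symm
  have h1 : HasCoords Q.grading (𝒲.f b ≫ p ≫ h) (g.hom.comp φ) := by
    rw [hg]; exact hφ.comp Q.grading g
  have h2 : HasCoords Q.grading (𝒲.f b ≫ projPoint Q.grading _ h0)
      (Q.tw (g.hom.comp φ) (charOf ((𝒲.f b ≫ p) ≫ τ))) := by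
    rw [hg, Category.assoc, charOf_comp, ← comp_tw]
    exact hφ'.comp Q.grading g
  have h3 := Q.map_irrelevant_tw (charOf ((𝒲.f b ≫ p) ≫ τ)) hψ.choose
  have h4 := hT (𝒲.f b ≫ p) (projPoint Q.grading _ h3)
    ⟨ψ, i, by rwa [Category.assoc], hi, h3, rfl⟩
  obtain ⟨_, e⟩ := Q.hasCoords_tw_of_hasCoords hψ h1 (hz i) hi
    (χ := charOf ((𝒲.f b ≫ p) ≫ τ)) ⟨h3, rfl⟩
  obtain ⟨_, e'⟩ := h2
  exact ((Category.assoc _ _ _).symm.trans h4).trans (e.trans e'.symm)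

include hz hcov in
theorem IsTwist.comp_projToSpec {k : Type u} [CommRing k] {Y : Scheme.{u}}
    {h T : Y ⟶ Proj Q.grading} {τ : Y ⟶ Spec (.of (AddMonoidAlgebra k E))} (H : Q.IsTwist h T τ) :
    T ≫ projToSpec Q.grading = h ≫ projToSpec Q.grading := by
  obtain ⟨𝒰, h𝒰⟩ := ProjCoord.exists_cover_hasCoords Q.grading z hz hcov h
  refine 𝒰.openCover.hom_ext _ _ fun a => ?_
  obtain ⟨i, φ, hφ, -⟩ := h𝒰 a
  have h1 := (H _ _ _ hφ).projToSpec Q.grading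
  have h2 := hφ.projToSpec Q.grading
  refine (Category.assoc _ _ _).symm.trans (h1.trans (Eq.trans ?_ (h2.symm.trans (Category.assoc _ _ _))))
  congr 2
  ext c
  have hw : Q.IsWeight 0 (algebraMap R Q.toSubalgebra c) := by
    have hc : algebraMap R F c ∈ Q.coeff 0 := by
      rw [Algebra.algebraMap_eq_smul_one]; exact Submodule.smul_mem _ _ Q.one_mem
    have : algebraMap R Q.toSubalgebra c = Q.mono 0 ⟨algebraMap R F c, hc⟩ := by
      apply Subtype.ext
      change algebraMap R (AddMonoidAlgebra F (ℕ × E)) c = AddMonoidAlgebra.single 0 (algebraMap R F c)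
      simp
    rw [this]; exact Q.isWeight_mono 0 _
  rw [RingHom.comp_apply, Q.tw_of_isWeight _ _ hw, ofAdd_zero, map_one, one_mul]
  rfl

end
end CoeffSystem
end MonomialElements

noncomputable section ModuleFrames
open Limits

namespace ModuleFrame
variable {X Y Z : Scheme.{u}}

/-- The restriction of functions. -/
def resO {U V : X.Opens} (h : V ≤ U) : Γ(X, U) →+* Γ(X, V) := (X.presheaf.map (homOfLE h).op).hom

theorem resO_resO {U V W : X.Opens} (h : V ≤ U) (h' : W ≤ V) (a : Γ(X, U)) :
    resO h' (resO h a) = resO (h'.trans h) a := by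
  have := X.presheaf.map_comp (homOfLE h).op (homOfLE h').op
  exact (congrArg (fun m => m.hom a) this).symm

theorem resO_self {U : X.Opens} (h : U ≤ U) (a : Γ(X, U)) : resO h a = a :=
  congrArg (fun m => m.hom a) (X.presheaf.map_id (op U))

theorem app_resO (f : X ⟶ Y) {U V : Y.Opens} (h : V ≤ U) (a : Γ(Y, U)) :
    f.app V (resO h a) = resO (X := X) (U := f ⁻¹ᵁ U) (V := f ⁻¹ᵁ V) (fun _ hx => h hx) (f.app U a) :=
  congrArg (fun m => m.hom a) (f.naturality (homOfLE h).op)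

/-- The restriction of sections. -/
def resM (M : X.Modules) {U V : X.Opens} (h : V ≤ U) : Γ(M, U) →+ Γ(M, V) :=
  (M.presheaf.map (homOfLE h).op).hom

variable (M N : X.Modules)

theorem resM_resM {U V W : X.Opens} (h : V ≤ U) (h' : W ≤ V) (a : Γ(M, U)) :
    resM M h' (resM M h a) = resM M (h'.trans h) a := by
  have := M.presheaf.map_comp (homOfLE h).op (homOfLE h').op
  exact (congrArg (fun m => m.hom a) this).symm

theorem resM_smul {U V : X.Opens} (h : V ≤ U) (r : Γ(X, U)) (a : Γ(M, U)) :
    resM M h (r • a) = resO h r • resM M h a := M.map_smul (homOfLE h) r a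

variable {M N} in
theorem app_resM (φ : M ⟶ N) {U V : X.Opens} (h : V ≤ U) (a : Γ(M, U)) :
    φ.app V (resM M h a) = resM N h (φ.app U a) :=
  congrArg (fun m => m.hom a) (φ.mapPresheaf.naturality (homOfLE h).op)

theorem resM_ext {ι : Type v} {U : X.Opens} (V : ι → X.Opens) (hV : ∀ i, V i ≤ U) (hU : U ≤ iSup V)
    {a b : Γ(M, U)} (h : ∀ i, resM M (hV i) a = resM M (hV i) b) : a = b :=
  TopCat.Sheaf.eq_of_locally_eq' ⟨M.presheaf, M.isSheaf⟩ V U (fun i => homOfLE (hV i)) hU a b h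

theorem exists_glue {ι : Type v} {U : X.Opens} (V : ι → X.Opens) (hV : ∀ i, V i ≤ U)
    (hU : U ≤ iSup V) (a : ∀ i, Γ(M, V i))
    (h : ∀ i j, resM M (inf_le_left : V i ⊓ V j ≤ V i) (a i) =
      resM M (inf_le_right : V i ⊓ V j ≤ V j) (a j)) :
    ∃ b : Γ(M, U), ∀ i, resM M (hV i) b = a i :=
  (TopCat.Sheaf.existsUnique_gluing' ⟨M.presheaf, M.isSheaf⟩ V U (fun i => homOfLE (hV i)) hU a
    h).exists

/-- The global sections `s i` generate `M` freely over the sets `W i`, with the transition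
functions `c i j`. This is expressed by the universal property. -/
structure IsFrame {ι : Type v} (W : ι → X.Opens) (s : ι → Γ(M, ⊤)) (c : ∀ i j : ι, Γ(X, W i)) :
    Prop where
  res : ∀ i j, resM M (le_top : W i ≤ ⊤) (s j) = c i j • resM M le_top (s i)
  desc : ∀ (N : X.Modules) (t : ι → Γ(N, ⊤)),
    (∀ i j, resM N (le_top : W i ≤ ⊤) (t j) = c i j • resM N le_top (t i)) →
      ∃ φ : M ⟶ N, ∀ i, φ.app ⊤ (s i) = t i
  hom_ext : ∀ (N : X.Modules) (φ ψ : M ⟶ N), (∀ i, φ.app ⊤ (s i) = ψ.app ⊤ (s i)) → φ = ψ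

variable {M} in
theorem isFrame_of_basis {ι : Type v} {W : ι → X.Opens} {s : ι → Γ(M, ⊤)}
    {c : ∀ i j : ι, Γ(X, W i)} (hW : ⨆ i, W i = ⊤)
    (res : ∀ i j, resM M (le_top : W i ≤ ⊤) (s j) = c i j • resM M le_top (s i))
    (basis : ∀ i (V : X.Opens), V ≤ W i → ∀ g : Γ(M, V), ∃! a : Γ(X, V), a • resM M le_top (s i) = g) :
    IsFrame M W s c := by
  have cov (U : X.Opens) : U ≤ ⨆ i, U ⊓ W i := by
    rw [← inf_iSup_eq, hW, inf_top_eq]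
  refine ⟨res, fun N t ht => ?_, fun N φ ψ h => ?_⟩
  · have ex (U : X.Opens) (g : Γ(M, U)) : ∃ m : Γ(N, U), ∀ i (V : X.Opens) (hVU : V ≤ U)
        (hVW : V ≤ W i) (a : Γ(X, V)), a • resM M le_top (s i) = resM M hVU g →
          resM N hVU m = a • resM N le_top (t i) := by
      choose α hα _ using fun i => basis i (U ⊓ W i) inf_le_right (resM M inf_le_left g)
      have key (i j) (V : X.Opens) (hV : V ≤ U ⊓ W i) (hj : V ≤ W j) (a : Γ(X, V))
          (ha : a • resM M le_top (s j) = resM M (hV.trans inf_le_left) g) :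
          resM N hV (α i • resM N le_top (t i)) = a • resM N le_top (t j) := by
        have h1 := congrArg (resM M hV) (hα i)
        simp only [resM_smul, resM_resM] at h1
        have h2 := congrArg (resM M (hV.trans inf_le_right)) (res i j)
        have h3 := congrArg (resM N (hV.trans inf_le_right)) (ht i j)
        simp only [resM_smul, resM_resM] at h2 h3 ⊢
        rw [h3, smul_smul]
        congr 1
        refine (basis i V (hV.trans inf_le_right) (resM M (hV.trans inf_le_left) g)).unique h1 ?_
        rw [← ha, h2, smul_smul]
      obtain ⟨m, hm⟩ := exists_glue N (fun i => U ⊓ W i) (fun i => inf_le_left) (cov U)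
        (fun i => α i • resM N le_top (t i)) (fun i j => by
          have h1 := congrArg (resM M (inf_le_right : (U ⊓ W i) ⊓ (U ⊓ W j) ≤ _)) (hα j)
          simp only [resM_smul, resM_resM] at h1
          refine (key i j _ inf_le_left (inf_le_right.trans inf_le_right) _ h1).trans ?_
          simp only [resM_smul, resM_resM])
      refine ⟨m, fun i V hVU hVW a ha => ?_⟩
      rw [← key i i V (le_inf hVU hVW) hVW a ha, ← hm i, resM_resM]
    have uniq (U : X.Opens) (g : Γ(M, U)) (m m' : Γ(N, U))
        (h : ∀ i (V : X.Opens) (hVU : V ≤ U) (hVW : V ≤ W i) (a : Γ(X, V)),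
          a • resM M le_top (s i) = resM M hVU g → resM N hVU m = a • resM N le_top (t i))
        (h' : ∀ i (V : X.Opens) (hVU : V ≤ U) (hVW : V ≤ W i) (a : Γ(X, V)),
          a • resM M le_top (s i) = resM M hVU g → resM N hVU m' = a • resM N le_top (t i)) :
        m = m' := by
      refine resM_ext N (fun i => U ⊓ W i) (fun i => inf_le_left) (cov U) fun i => ?_
      obtain ⟨a, ha, _⟩ := basis i (U ⊓ W i) inf_le_right (resM M inf_le_left g)
      rw [h i _ inf_le_left inf_le_right a ha, h' i _ inf_le_left inf_le_right a ha]
    choose F hF using ex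
    have Fadd (U : X.Opens) (g g' : Γ(M, U)) : F U (g + g') = F U g + F U g' := by
      refine uniq U (g + g') _ _ (hF U _) fun i V hVU hVW a ha => ?_
      obtain ⟨b, hb, _⟩ := basis i V hVW (resM M hVU g)
      obtain ⟨b', hb', _⟩ := basis i V hVW (resM M hVU g')
      have e : a = b + b' := (basis i V hVW _).unique ha (by rw [add_smul, hb, hb', map_add])
      rw [map_add, hF U g i V hVU hVW b hb, hF U g' i V hVU hVW b' hb', e, add_smul]
    have Fsmul (U : X.Opens) (r : Γ(X, U)) (g : Γ(M, U)) : F U (r • g) = r • F U g := by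
      refine uniq U (r • g) _ _ (hF U _) fun i V hVU hVW a ha => ?_
      obtain ⟨b, hb, _⟩ := basis i V hVW (resM M hVU g)
      have e : a = resO hVU r * b :=
        (basis i V hVW _).unique ha (by rw [mul_smul, hb, resM_smul])
      rw [resM_smul, hF U g i V hVU hVW b hb, e, mul_smul]
    have Fres (U U' : X.Opens) (h : U' ≤ U) (g : Γ(M, U)) :
        F U' (resM M h g) = resM N h (F U g) := by
      refine uniq U' (resM M h g) _ _ (hF U' _) fun i V hVU hVW a ha => ?_
      rw [resM_resM] at ha ⊢
      exact hF U g i V _ hVW a ha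
    let Φ : M.presheaf ⟶ N.presheaf :=
      { app := fun U => AddCommGrpCat.ofHom (AddMonoidHom.mk' (F U.unop) (Fadd U.unop))
        naturality := fun U V i => by
          ext g
          exact Fres U.unop V.unop i.unop.le g }
    let φ : M ⟶ N := ⟨PresheafOfModules.homMk Φ fun U r m => Fsmul U.unop r m⟩
    refine ⟨φ, fun i => ?_⟩
    refine uniq ⊤ (s i) (F ⊤ (s i)) (t i) (hF ⊤ (s i)) fun j V hVU hVW a ha => ?_
    have h2 := congrArg (resM M hVW) (res j i)
    have h3 := congrArg (resM N hVW) (ht j i)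
    simp only [resM_smul, resM_resM] at h2 h3
    rw [h3, (basis j V hVW _).unique ha h2.symm]
  · refine Scheme.Modules.hom_ext _ _ fun U => ?_
    ext g
    refine resM_ext N (fun i => U ⊓ W i) (fun i => inf_le_left) (cov U) fun i => ?_
    obtain ⟨a, ha, _⟩ := basis i (U ⊓ W i) inf_le_right (resM M inf_le_left g)
    have h1 (φ : M ⟶ N) : resM N inf_le_left (φ.app U g) =
        a • resM N (le_top : U ⊓ W i ≤ ⊤) (φ.app ⊤ (s i)) := by
      rw [← app_resM, ← ha, Scheme.Modules.Hom.app_smul, app_resM]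
    rw [h1 φ, h1 ψ, h i]

variable {M N}

theorem homEquiv_app (f : Y ⟶ X) {N : Y.Modules} (φ : (Scheme.Modules.pullback f).obj M ⟶ N)
    (s : Γ(M, ⊤)) :
    (((Scheme.Modules.pullbackPushforwardAdjunction f).homEquiv M N φ).app ⊤ s : Γ(N, ⊤)) =
      φ.app ⊤ (pullSection f s) := by
  rw [Adjunction.homEquiv_unit]
  rfl

theorem pullSection_smul (f : Y ⟶ X) (r : Γ(X, ⊤)) (s : Γ(M, ⊤)) :
    pullSection f (r • s) = f.appTop r • pullSection f s :=
  Scheme.Modules.Hom.app_smul ((Scheme.Modules.pullbackPushforwardAdjunction f).unit.app M) r s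

theorem pullSection_map (f : Y ⟶ X) (φ : M ⟶ N) (s : Γ(M, ⊤)) :
    ((Scheme.Modules.pullback f).map φ).app ⊤ (pullSection f s) = pullSection f (φ.app ⊤ s) := by
  have := (Scheme.Modules.pullbackPushforwardAdjunction f).unit.naturality φ
  exact (congrArg (fun m => (Scheme.Modules.Hom.app m ⊤).hom s) this).symm

theorem pullSection_congr {f g : Y ⟶ X} (h : f = g) (s : Γ(M, ⊤)) :
    ((Scheme.Modules.pullbackCongr h).hom.app M).app ⊤ (pullSection f s) = pullSection g s := by
  subst h
  rfl

theorem pullSection_comp_inv (f : Z ⟶ Y) (g : Y ⟶ X) (s : Γ(M, ⊤)) :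
    ((Scheme.Modules.pullbackComp f g).inv.app M).app ⊤ (pullSection (f ≫ g) s) =
      pullSection f (pullSection g s) := by
  have h := Scheme.Modules.conjugateEquiv_pullbackComp_inv f g
  have h2 := unit_conjugateEquiv ((Scheme.Modules.pullbackPushforwardAdjunction g).comp
    (Scheme.Modules.pullbackPushforwardAdjunction f))
    (Scheme.Modules.pullbackPushforwardAdjunction (f ≫ g)) (Scheme.Modules.pullbackComp f g).inv M
  rw [h] at h2
  exact (congrArg (fun m => (Scheme.Modules.Hom.app m ⊤).hom s) h2).symm

theorem pullSection_comp_hom (f : Z ⟶ Y) (g : Y ⟶ X) (s : Γ(M, ⊤)) :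
    ((Scheme.Modules.pullbackComp f g).hom.app M).app ⊤ (pullSection f (pullSection g s)) =
      pullSection (f ≫ g) s := by
  rw [← pullSection_comp_inv]
  have := (Scheme.Modules.pullbackComp f g).inv_hom_id_app M
  exact congrArg (fun m => (Scheme.Modules.Hom.app m ⊤).hom (pullSection (f ≫ g) s)) this

theorem IsFrame.pullback {ι : Type v} {W : ι → X.Opens} {s : ι → Γ(M, ⊤)}
    {c : ∀ i j : ι, Γ(X, W i)} (h : IsFrame M W s c) (f : Y ⟶ X) :
    IsFrame ((Scheme.Modules.pullback f).obj M) (fun i => f ⁻¹ᵁ W i) (fun i => pullSection f (s i))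
      (fun i j => f.app (W i) (c i j)) := by
  refine ⟨fun i j => ?_, fun N t ht => ?_, fun N φ ψ hφψ => ?_⟩
  · let η : M ⟶ (Scheme.Modules.pushforward f).obj ((Scheme.Modules.pullback f).obj M) :=
      (Scheme.Modules.pullbackPushforwardAdjunction f).unit.app M
    have e (k : ι) := app_resM η (le_top : W i ≤ ⊤) (s k)
    have h1 := (e j).symm
    rw [h.res i j, Scheme.Modules.Hom.app_smul, e i] at h1
    exact h1
  · obtain ⟨φ, hφ⟩ := h.desc ((Scheme.Modules.pushforward f).obj N) t ht
    refine ⟨((Scheme.Modules.pullbackPushforwardAdjunction f).homEquiv M N).symm φ, fun i => ?_⟩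
    rw [← homEquiv_app, Equiv.apply_symm_apply, hφ]
  · refine ((Scheme.Modules.pullbackPushforwardAdjunction f).homEquiv M N).injective ?_
    refine h.hom_ext _ _ _ fun i => ?_
    exact (homEquiv_app f φ (s i)).trans ((hφψ i).trans (homEquiv_app f ψ (s i)).symm)

/-- Sheaves with frames that have related transition functions are isomorphic. -/
theorem IsFrame.exists_iso {ι : Type v} {W W' : ι → X.Opens} {s : ι → Γ(M, ⊤)}
    {s' : ι → Γ(N, ⊤)} {c : ∀ i j : ι, Γ(X, W i)} {c' : ∀ i j : ι, Γ(X, W' i)}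
    (h : IsFrame M W s c) (h' : IsFrame N W' s' c') (hW : ∀ i, W i = W' i) (v : ι → Γ(X, ⊤)ˣ)
    (hc : ∀ i j, c i j * resO le_top (v i : Γ(X, ⊤)) =
      resO le_top (v j : Γ(X, ⊤)) * resO (hW i).le (c' i j)) :
    ∃ Φ : M ≅ N, ∀ i, Φ.hom.app ⊤ (s i) = (v i : Γ(X, ⊤)) • s' i := by
  obtain rfl : W = W' := funext hW
  simp only [resO_self] at hc
  have hc' (i j) : c' i j * resO (le_top : W i ≤ ⊤) (↑(v i)⁻¹ : Γ(X, ⊤)) =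
      resO le_top (↑(v j)⁻¹ : Γ(X, ⊤)) * c i j := by
    have e (k) : resO (le_top : W i ≤ ⊤) (↑(v k)⁻¹ : Γ(X, ⊤)) *
        resO (le_top : W i ≤ ⊤) (v k : Γ(X, ⊤)) = 1 := by
      rw [← map_mul, Units.inv_mul, map_one]
    calc _ = (resO (le_top : W i ≤ ⊤) (↑(v j)⁻¹ : Γ(X, ⊤)) *
          resO (le_top : W i ≤ ⊤) (v j : Γ(X, ⊤))) * c' i j *
            resO (le_top : W i ≤ ⊤) (↑(v i)⁻¹ : Γ(X, ⊤)) := by rw [e]; ring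
      _ = resO (le_top : W i ≤ ⊤) (↑(v j)⁻¹ : Γ(X, ⊤)) *
          (c i j * resO (le_top : W i ≤ ⊤) (v i : Γ(X, ⊤))) *
            resO (le_top : W i ≤ ⊤) (↑(v i)⁻¹ : Γ(X, ⊤)) := by rw [hc]; ring
      _ = resO (le_top : W i ≤ ⊤) (↑(v j)⁻¹ : Γ(X, ⊤)) * c i j *
          (resO (le_top : W i ≤ ⊤) (↑(v i)⁻¹ : Γ(X, ⊤)) *
            resO (le_top : W i ≤ ⊤) (v i : Γ(X, ⊤))) := by ring
      _ = _ := by rw [e, mul_one]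
  obtain ⟨φ, hφ⟩ := h.desc N (fun i => (v i : Γ(X, ⊤)) • s' i) fun i j => by
    rw [resM_smul, resM_smul, h'.res i j, smul_smul, smul_smul, hc]
  obtain ⟨ψ, hψ⟩ := h'.desc M (fun i => (↑(v i)⁻¹ : Γ(X, ⊤)) • s i) fun i j => by
    rw [resM_smul, resM_smul, h.res i j, smul_smul, smul_smul, hc']
  refine ⟨⟨φ, ψ, h.hom_ext _ _ _ fun i => ?_, h'.hom_ext _ _ _ fun i => ?_⟩, hφ⟩
  · have : ψ.app ⊤ (φ.app ⊤ (s i)) = s i := by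
      rw [hφ, Scheme.Modules.Hom.app_smul, hψ, smul_smul, Units.mul_inv, one_smul]
    exact this
  · have : φ.app ⊤ (ψ.app ⊤ (s' i)) = s' i := by
      rw [hψ, Scheme.Modules.Hom.app_smul, hφ, smul_smul, Units.inv_mul, one_smul]
    exact this

end ModuleFrame
end ModuleFrames

noncomputable section SerreTwistFrames
open Limits ModuleFrame

namespace SerreTwist
variable {A : Type u} {σ : Type*} [CommRing A] [SetLike σ A] [AddSubgroupClass σ A]
  (𝒜 : ℕ → σ) [GradedRing 𝒜]

instance (x : Proj 𝒜) : (idealAt 𝒜 x).IsPrime := ProjectiveSpectrum.isPrime (𝒜 := 𝒜) x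

/-- The fraction `a / e` as a function on `D₊(e)`. -/
def ratio {n : ℕ} (a e : 𝒜 n) : Γ(Proj 𝒜, Proj.basicOpen 𝒜 (e : A)) :=
  Proj.awayToSection 𝒜 (e : A) (HomogeneousLocalization.Away.mk 𝒜 e.2 1 (a : A)
    (by rw [one_smul]; exact a.2))

theorem not_mem_idealAt {n : ℕ} {e : 𝒜 n} {x : Proj 𝒜} (hx : x ∈ Proj.basicOpen 𝒜 (e : A)) :
    (e : A) ∉ idealAt 𝒜 x := hx

theorem isUnit_fiber {n : ℕ} {e : 𝒜 n} {x : Proj 𝒜} (hx : x ∈ Proj.basicOpen 𝒜 (e : A)) :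
    IsUnit (algebraMap A (Fiber 𝒜 x) (e : A)) :=
  IsLocalization.map_units (Fiber 𝒜 x) (⟨e, not_mem_idealAt 𝒜 hx⟩ : (idealAt 𝒜 x).primeCompl)

theorem eval_ratio {n : ℕ} (a e : 𝒜 n) (x : Proj.basicOpen 𝒜 (e : A)) :
    eval 𝒜 x (ratio 𝒜 a e) * algebraMap A (Fiber 𝒜 x.1) (e : A) = algebraMap A _ (a : A) := by
  have h := ProjectiveSpectrum.Proj.awayToSection_apply 𝒜 (e : A)
    (HomogeneousLocalization.Away.mk 𝒜 e.2 1 (a : A) (by rw [one_smul]; exact a.2)) x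
  have h' : eval 𝒜 x (ratio 𝒜 a e) = _ := h
  rw [h', HomogeneousLocalization.Away.val_mk, Localization.mk_eq_mk', IsLocalization.map_mk']
  have := IsLocalization.mk'_spec (Fiber 𝒜 x.1) (RingHom.id A (a : A))
    (⟨(RingHom.id A) ((e : A) ^ 1), by
      rw [pow_one]; exact not_mem_idealAt 𝒜 x.2⟩ : (idealAt 𝒜 x.1).primeCompl)
  simp only [RingHom.id_apply, pow_one] at this ⊢
  exact this

theorem structureSheaf_ext {U : (Proj 𝒜).Opens} {a b : Γ(Proj 𝒜, U)}
    (h : ∀ x : U, eval 𝒜 x a = eval 𝒜 x b) : a = b :=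
  Subtype.ext <| funext fun x => HomogeneousLocalization.val_injective _ (h x)

theorem exists_smul_eq {n : ℕ} (e : 𝒜 n) {V : (Proj 𝒜).Opens} (hV : V ≤ Proj.basicOpen 𝒜 (e : A))
    (g : sections 𝒜 n V) : ∃ a : Γ(Proj 𝒜, V), ∀ x : V,
      eval 𝒜 x a * algebraMap A (Fiber 𝒜 x.1) (e : A) = g.1 x := by
  have key {W : (Proj 𝒜).Opens} (x : V) (d : ℕ) (a : 𝒜 (d + n)) (b : 𝒜 d)
      (hb : (b : A) ∉ idealAt 𝒜 x.1) (hbe : (b * e : A) ∉ idealAt 𝒜 x.1) :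
      Localization.mk (a : A) (⟨b * e, hbe⟩ : (idealAt 𝒜 x.1).primeCompl) *
        algebraMap A (Fiber 𝒜 x.1) (e : A) =
      Localization.mk (a : A) (⟨b, hb⟩ : (idealAt 𝒜 x.1).primeCompl) := by
    rw [← Localization.mk_one_eq_algebraMap, Localization.mk_mul, Localization.mk_eq_mk_iff,
      Localization.r_iff_exists]
    exact ⟨1, by simp; ring⟩
  have hbe {x : V} {d : ℕ} {b : 𝒜 d} (hb : (b : A) ∉ idealAt 𝒜 x.1) :
      (b * e : A) ∉ idealAt 𝒜 x.1 :=
    (idealAt 𝒜 x.1).primeCompl.mul_mem hb (not_mem_idealAt 𝒜 (hV x.2))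
  have ex (x : V) : ∃ α : HomogeneousLocalization.AtPrime 𝒜 (idealAt 𝒜 x.1),
      α.val * algebraMap A (Fiber 𝒜 x.1) (e : A) = g.1 x := by
    obtain ⟨V', hx, i, d, a, b, hb, w⟩ := g.2 x
    have w' : g.1 x = _ := w ⟨x.1, hx⟩
    refine ⟨.mk ⟨d + n, a, ⟨b * e, SetLike.GradedMul.mul_mem b.2 e.2⟩, hbe (hb ⟨x.1, hx⟩)⟩, ?_⟩
    rw [HomogeneousLocalization.val_mk, w']
    exact key (W := V) x d a b (hb ⟨x.1, hx⟩) _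
  choose α hα using ex
  refine ⟨⟨α, fun x => ?_⟩, hα⟩
  obtain ⟨V', hx, i, d, a, b, hb, w⟩ := g.2 x
  refine ⟨V', hx, i, d + n, a, ⟨b * e, SetLike.GradedMul.mul_mem b.2 e.2⟩,
    fun y => hbe (x := ⟨y.1, i.le y.2⟩) (hb y), fun y => HomogeneousLocalization.val_injective _ ?_⟩
  let y' : V := ⟨y.1, i.le y.2⟩
  refine (isUnit_fiber 𝒜 (hV y'.2)).mul_right_cancel ?_
  have w' : g.1 y' = _ := w y
  exact (hα y').trans <| w'.trans (key (W := V) y' d a b (hb y) _).symm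

/-- The twisting sheaf `𝒪(n)` is generated freely over `D₊(e)` by the section given by an element `e`
of degree `n`. -/
theorem isFrame {ι : Type v} {n : ℕ} (e : ι → 𝒜 n)
    (hcov : ⨆ i, Proj.basicOpen 𝒜 (e i : A) = ⊤) :
    IsFrame (serreTwist 𝒜 n) (fun i => Proj.basicOpen 𝒜 (e i : A))
      (fun i => serreTwistSection 𝒜 n (e i)) (fun i j => ratio 𝒜 (e j) (e i)) := by
  refine isFrame_of_basis hcov (fun i j => ?_) fun i V hV g => ?_
  · refine Subtype.ext (funext fun x => ?_)
    exact (eval_ratio 𝒜 (e j) (e i) x).symm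
  · obtain ⟨a, ha⟩ := exists_smul_eq 𝒜 (e i) hV g
    refine ⟨a, Subtype.ext (funext ha), fun b hb => structureSheaf_ext 𝒜 fun x => ?_⟩
    have h1 : eval 𝒜 x b * algebraMap A (Fiber 𝒜 x.1) (e i : A) = g.1 x :=
      congrFun (congrArg Subtype.val hb) x
    exact (isUnit_fiber 𝒜 (hV x.2)).mul_right_cancel (h1.trans (ha x).symm)

variable {𝒜} in
theorem awayι_app {n : ℕ} (hn : 0 < n) {e : A} (he : e ∈ 𝒜 n) (a : HomogeneousLocalization.Away 𝒜 e) :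
    (Proj.awayι 𝒜 e he hn).app (Proj.basicOpen 𝒜 e) (Proj.awayToSection 𝒜 e a) =
      resO (X := Spec (.of (HomogeneousLocalization.Away 𝒜 e))) le_top
        ((Scheme.ΓSpecIso (.of (HomogeneousLocalization.Away 𝒜 e))).inv a) := by
  let q := Proj.basicOpenToSpec 𝒜 e
  have hq : q ≫ Proj.awayι 𝒜 e he hn = (Proj.basicOpen 𝒜 e).ι := by
    rw [Proj.awayι, ← Category.assoc]
    change ((Proj.basicOpenIsoSpec 𝒜 e he hn).hom ≫ _) ≫ _ = _
    rw [Iso.hom_inv_id, Category.id_comp]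
  have : IsIso q := by
    change IsIso (Proj.basicOpenIsoSpec 𝒜 e he hn).hom
    infer_instance
  let D := Proj.basicOpen 𝒜 e
  have inj : Function.Injective (q.app (Proj.awayι 𝒜 e he hn ⁻¹ᵁ D)) :=
    (ConcreteCategory.bijective_of_isIso (q.app (Proj.awayι 𝒜 e he hn ⁻¹ᵁ D))).injective
  apply inj
  rw [app_resO]
  have h1 : q.app ⊤ ((Scheme.ΓSpecIso (.of (HomogeneousLocalization.Away 𝒜 e))).inv a) =
      D.topIso.inv (Proj.awayToSection 𝒜 e a) := by
    have := congrArg (fun m => m.hom ((Scheme.ΓSpecIso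
      (.of (HomogeneousLocalization.Away 𝒜 e))).inv a)) (Proj.basicOpenToSpec_app_top 𝒜 e)
    exact this.trans (congrArg (fun m => D.topIso.inv (Proj.awayToSection 𝒜 e (m.hom a)))
      (Scheme.ΓSpecIso (.of (HomogeneousLocalization.Away 𝒜 e))).inv_hom_id)
  have h2 : q.app (Proj.awayι 𝒜 e he hn ⁻¹ᵁ D) ((Proj.awayι 𝒜 e he hn).app D
      (Proj.awayToSection 𝒜 e a)) = (q ≫ Proj.awayι 𝒜 e he hn).app D (Proj.awayToSection 𝒜 e a) := by
    rw [Scheme.Hom.comp_app]; rfl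
  refine h2.trans (Eq.trans ?_ (congrArg (resO le_top) h1).symm)
  have h3 := congrArg (fun m => m.hom (Proj.awayToSection 𝒜 e a)) (Scheme.Hom.congr_app hq D)
  refine h3.trans ?_
  rw [Scheme.Opens.ι_app]
  have h4 : (Proj 𝒜).presheaf.map (homOfLE (D.ι.image_preimage_eq_opensRange_inf D ▸
      inf_le_right : D.ι ''ᵁ (D.ι ⁻¹ᵁ D) ≤ D)).op ≫
      D.toScheme.presheaf.map (eqToHom (congrArg (· ⁻¹ᵁ D) hq)).op = D.topIso.inv ≫
        D.toScheme.presheaf.map (homOfLE (le_top : q ⁻¹ᵁ (Proj.awayι 𝒜 e he hn ⁻¹ᵁ D) ≤ ⊤)).op :=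
    ((Proj 𝒜).presheaf.map_comp _ _).symm.trans ((Proj 𝒜).presheaf.map_comp _ _)
  exact congrArg (fun m => m.hom (Proj.awayToSection 𝒜 e a)) h4

variable {𝒜} in
/-- The value of the function `a / e` at a point with the coordinates `φ`. -/
theorem app_ratio {n : ℕ} (hn : 0 < n) {S : CommRingCat.{u}} {p : Spec S ⟶ Proj 𝒜} {φ : A →+* S}
    (h : HasCoords 𝒜 p φ) (a e : 𝒜 n) (hu : IsUnit (φ e)) :
    p.app (Proj.basicOpen 𝒜 (e : A)) (ratio 𝒜 a e) *
      resO (X := Spec S) le_top ((Scheme.ΓSpecIso S).inv (φ e)) =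
      resO (X := Spec S) le_top ((Scheme.ΓSpecIso S).inv (φ a)) := by
  obtain ⟨hφ, rfl⟩ := h
  rw [ProjCoord.projPoint_away 𝒜 φ hφ hn e.2 hu]
  let ψ := CommRingCat.ofHom (ProjCoord.awayLift 𝒜 φ hu)
  have h1 : (Spec.map ψ ≫ Proj.awayι 𝒜 (e : A) e.2 hn).app (Proj.basicOpen 𝒜 (e : A))
      (ratio 𝒜 a e) = resO (X := Spec S) le_top ((Scheme.ΓSpecIso S).inv (ψ
        (HomogeneousLocalization.Away.mk 𝒜 e.2 1 (a : A) (by rw [one_smul]; exact a.2)))) := by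
    rw [Scheme.Hom.comp_app]
    refine (congrArg ((Spec.map ψ).app _) (awayι_app hn e.2 _)).trans ?_
    rw [app_resO]
    exact congrArg (resO (X := Spec S) le_top) (congrArg (fun m => m.hom
      (HomogeneousLocalization.Away.mk 𝒜 e.2 1 (a : A) (by rw [one_smul]; exact a.2)))
      (Scheme.ΓSpecIso_inv_naturality ψ)).symm
  refine (congrArg (· * _) h1).trans ?_
  have h2 := ProjCoord.awayLift_mk 𝒜 φ hu e.2 1 (a : A) (by rw [one_smul]; exact a.2)
  rw [pow_one] at h2
  rw [← h2, map_mul, map_mul]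
  rfl

end SerreTwist

end SerreTwistFrames

noncomputable section TorusStructures
open Limits ModuleFrame SerreTwist

namespace ModuleFrame

theorem eq_of_affine_points {Y : Scheme.{u}} (𝒰 : Scheme.AffineOpenCover.{v} Y) {W : Y.Opens}
    {a b : Γ(Y, W)} (h : ∀ (S : CommRingCat.{u}) (i : 𝒰.I₀) (q : Spec S ⟶ Spec (𝒰.X i)),
      (q ≫ 𝒰.f i) ⁻¹ᵁ W = ⊤ → (q ≫ 𝒰.f i).app W a = (q ≫ 𝒰.f i).app W b) : a = b := by
  have ex (x : W) : ∃ (V : Y.Opens) (i : 𝒰.I₀), IsAffineOpen V ∧ x.1 ∈ V ∧ V ≤ W ∧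
      V ≤ (𝒰.f i).opensRange := by
    obtain ⟨V, hV, hx, hV'⟩ := exists_isAffineOpen_mem_and_subset
      (U := W ⊓ (𝒰.f (𝒰.idx x.1)).opensRange) ⟨x.2, 𝒰.covers x.1⟩
    exact ⟨V, _, hV, hx, fun y hy => (hV' hy).1, fun y hy => (hV' hy).2⟩
  choose V i hV hxV hVW hVi using ex
  refine TopCat.Sheaf.eq_of_locally_eq' Y.sheaf V W (fun x => homOfLE (hVW x))
    (fun x hx => Opens.mem_iSup.2 ⟨⟨x, hx⟩, hxV ⟨x, hx⟩⟩) _ _ fun x => ?_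
  have h1 : (hV x).fromSpec ⁻¹ᵁ W = ⊤ := by
    rw [eq_top_iff, ← (hV x).fromSpec_preimage_self]
    exact fun y hy => hVW x hy
  let q := IsOpenImmersion.lift (𝒰.f (i x)) (hV x).fromSpec (by
    rw [IsAffineOpen.range_fromSpec]; exact hVi x)
  have hq : q ≫ 𝒰.f (i x) = (hV x).fromSpec := IsOpenImmersion.lift_fac _ _ _
  have h2 := h _ (i x) q (by rw [hq]; exact h1)
  rw [hq, (hV x).fromSpec_app_of_le W (hVW x)] at h2
  have e : IsIso ((Scheme.ΓSpecIso Γ(Y, V x)).inv ≫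
      (Spec Γ(Y, V x)).presheaf.map (homOfLE (le_top : (hV x).fromSpec ⁻¹ᵁ W ≤ ⊤)).op) := by
    have : IsIso (homOfLE (le_top : (hV x).fromSpec ⁻¹ᵁ W ≤ ⊤)).op := by
      rw [show homOfLE (le_top : (hV x).fromSpec ⁻¹ᵁ W ≤ ⊤) = eqToHom h1 from rfl]
      infer_instance
    infer_instance
  have inj := (ConcreteCategory.bijective_of_isIso ((Scheme.ΓSpecIso Γ(Y, V x)).inv ≫
      (Spec Γ(Y, V x)).presheaf.map (homOfLE (le_top : (hV x).fromSpec ⁻¹ᵁ W ≤ ⊤)).op)).injective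
  exact inj h2

/-- The value of a function at a point. -/
def valueAt {Y : Scheme.{u}} {S : CommRingCat.{u}} (p : Spec S ⟶ Y) : Γ(Y, ⊤) →+* S :=
  (Scheme.ΓSpecIso S).hom.hom.comp p.appTop.hom

theorem valueAt_comp {Y : Scheme.{u}} {S T : CommRingCat.{u}} (p : Spec S ⟶ Y) (g : S ⟶ T)
    (v : Γ(Y, ⊤)) : valueAt (Spec.map g ≫ p) v = g (valueAt p v) :=
  congrArg (fun m => m.hom (p.appTop v)) (Scheme.ΓSpecIso_naturality g)

theorem inv_valueAt {Y : Scheme.{u}} {S : CommRingCat.{u}} (p : Spec S ⟶ Y) (v : Γ(Y, ⊤)) :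
    (Scheme.ΓSpecIso S).inv (valueAt p v) = p.appTop v :=
  congrArg (fun m => m.hom (p.appTop v)) (Scheme.ΓSpecIso S).hom_inv_id

variable {A : Type u} {σ : Type*} [CommRing A] [SetLike σ A] [AddSubgroupClass σ A]
  {𝒜 : ℕ → σ} [GradedRing 𝒜] {B : Type u} {σ' : Type*} [CommRing B] [SetLike σ' B]
  [AddSubgroupClass σ' B] {ℬ : ℕ → σ'} [GradedRing ℬ]

theorem isUnit_of_basicOpen_eq_top {S : Type*} [CommRing S] {x : S}
    (h : PrimeSpectrum.basicOpen x = ⊤) : IsUnit x := by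
  by_contra hx
  obtain ⟨m, hm, hxm⟩ := exists_max_ideal_of_mem_nonunits hx
  have : (⟨m, hm.isPrime⟩ : PrimeSpectrum S) ∈ PrimeSpectrum.basicOpen x := h ▸ trivial
  exact this hxm

theorem preimage_basicOpen_of_hasCoords {S : CommRingCat.{u}} {p : Spec S ⟶ Proj 𝒜} {φ : A →+* S}
    (h : HasCoords 𝒜 p φ) {r : A} {n : ℕ} (hn : 0 < n) (hr : r ∈ 𝒜 n) :
    p ⁻¹ᵁ Proj.basicOpen 𝒜 r = PrimeSpectrum.basicOpen (φ r) := by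
  obtain ⟨hφ, rfl⟩ := h
  exact ProjCoord.projPoint_preimage 𝒜 φ hφ hn hr

/-- Line bundles that are pulled back from projective spectra are isomorphic if the coordinates are
proportional. -/
theorem exists_iso_of_coords {Y : Scheme.{u}} (f : Y ⟶ Proj 𝒜) (g : Y ⟶ Proj ℬ) {n n' : ℕ}
    (hn : 0 < n) (hn' : 0 < n') {ι : Type*} {e : ι → 𝒜 n} {e' : ι → ℬ n'} {M N : Y.Modules}
    {s : ι → Γ(M, ⊤)} {s' : ι → Γ(N, ⊤)}
    (hM : IsFrame M (fun i => f ⁻¹ᵁ Proj.basicOpen 𝒜 (e i : A)) s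
      fun i j => f.app _ (ratio 𝒜 (e j) (e i)))
    (hN : IsFrame N (fun i => g ⁻¹ᵁ Proj.basicOpen ℬ (e' i : B)) s'
      fun i j => g.app _ (ratio ℬ (e' j) (e' i))) (v : ι → Γ(Y, ⊤)ˣ)
    (𝒰 : Scheme.AffineOpenCover.{v} Y)
    (H : ∀ a, ∃ (φ : A →+* 𝒰.X a) (φ' : B →+* 𝒰.X a) (w : 𝒰.X a), HasCoords 𝒜 (𝒰.f a ≫ f) φ ∧
      HasCoords ℬ (𝒰.f a ≫ g) φ' ∧ IsUnit w ∧
      ∀ i, φ (e i) * w = valueAt (𝒰.f a) (v i) * φ' (e' i)) :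
    ∃ Φ : M ≅ N, ∀ i, Φ.hom.app ⊤ (s i) = (v i : Γ(Y, ⊤)) • s' i := by
  have unitV {S : CommRingCat.{u}} (p : Spec S ⟶ Y) (i : ι) : IsUnit (valueAt p (v i)) :=
    (v i).isUnit.map (valueAt p)
  have hW (i : ι) : f ⁻¹ᵁ Proj.basicOpen 𝒜 (e i : A) = g ⁻¹ᵁ Proj.basicOpen ℬ (e' i : B) := by
    ext y
    obtain ⟨x, hx⟩ := 𝒰.covers y
    obtain ⟨φ, φ', w, h1, h2, hw, h3⟩ := H (𝒰.idx y)
    have k1 := preimage_basicOpen_of_hasCoords h1 hn (e i).2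
    have k2 := preimage_basicOpen_of_hasCoords h2 hn' (e' i).2
    have k3 : φ (e i) ∈ x.asIdeal ↔ φ' (e' i) ∈ x.asIdeal := by
      rw [← Ideal.mul_unit_mem_iff_mem _ hw, h3 i, Ideal.unit_mul_mem_iff_mem _ (unitV _ i)]
    have l1 := congrArg (x ∈ ·) k1
    have l2 := congrArg (x ∈ ·) k2
    have l3 : (x ∈ PrimeSpectrum.basicOpen (φ (e i))) = (x ∈ PrimeSpectrum.basicOpen (φ' (e' i))) :=
      propext (not_congr k3)
    have l4 := (l1.trans (l3.trans l2.symm)).to_iff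
    rw [← hx]
    exact l4
  refine hM.exists_iso hN hW v fun i j => ?_
  refine eq_of_affine_points 𝒰 fun S a q hq => ?_
  obtain ⟨φ, φ', w, h1, h2, hw, h3⟩ := H a
  let γ := Spec.preimage q
  have hγ : q = Spec.map γ := (Spec.map_preimage q).symm
  have h1' : HasCoords 𝒜 ((q ≫ 𝒰.f a) ≫ f) (γ.hom.comp φ) := by
    rw [hγ, Category.assoc]; exact h1.comp 𝒜 γ
  have h2' : HasCoords ℬ ((q ≫ 𝒰.f a) ≫ g) (γ.hom.comp φ') := by
    rw [hγ, Category.assoc]; exact h2.comp ℬ γ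
  have h3' (i) : (γ.hom.comp φ) (e i) * γ.hom w =
      valueAt (q ≫ 𝒰.f a) (v i) * (γ.hom.comp φ') (e' i) := by
    have := congrArg γ.hom (h3 i)
    rw [map_mul, map_mul] at this
    rw [hγ, valueAt_comp]
    exact this
  generalize γ.hom.comp φ = ψ at h1' h3'
  generalize γ.hom.comp φ' = ψ' at h2' h3'
  have hw' : IsUnit (γ.hom w) := hw.map _
  generalize γ.hom w = w' at hw' h3'
  generalize q ≫ 𝒰.f a = p at *
  have u1 : IsUnit (ψ (e i)) := by
    have k1 := preimage_basicOpen_of_hasCoords h1' hn (e i).2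
    exact isUnit_of_basicOpen_eq_top (k1.symm.trans hq)
  have u2 : IsUnit (ψ' (e' i)) := by
    have := u1.mul hw'
    rw [h3' i] at this
    exact isUnit_of_mul_isUnit_right this
  let R : S →+* Γ(Spec S, p ⁻¹ᵁ f ⁻¹ᵁ Proj.basicOpen 𝒜 (e i : A)) :=
    (resO (X := Spec S) le_top).comp (Scheme.ΓSpecIso S).inv.hom
  have r1 : p.app _ (f.app _ (ratio 𝒜 (e j) (e i))) * R (ψ (e i)) = R (ψ (e j)) := by
    have := app_ratio hn h1' (e j) (e i) u1
    rw [Scheme.Hom.comp_app] at this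
    exact this
  have r2 : p.app (f ⁻¹ᵁ Proj.basicOpen 𝒜 (e i : A)) (resO (hW i).le
      (g.app _ (ratio ℬ (e' j) (e' i)))) * R (ψ' (e' i)) = R (ψ' (e' j)) := by
    let R' : S →+* Γ(Spec S, p ⁻¹ᵁ g ⁻¹ᵁ Proj.basicOpen ℬ (e' i : B)) :=
      (resO (X := Spec S) le_top).comp (Scheme.ΓSpecIso S).inv.hom
    have h4 : p.app _ (g.app _ (ratio ℬ (e' j) (e' i))) * R' (ψ' (e' i)) = R' (ψ' (e' j)) := by
      have := app_ratio hn' h2' (e' j) (e' i) u2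
      rw [Scheme.Hom.comp_app] at this
      exact this
    have h5 := congrArg (resO (X := Spec S) (U := p ⁻¹ᵁ g ⁻¹ᵁ Proj.basicOpen ℬ (e' i : B))
      (V := p ⁻¹ᵁ f ⁻¹ᵁ Proj.basicOpen 𝒜 (e i : A)) (fun y hy => (hW i).le hy)) h4
    rw [map_mul] at h5
    rw [app_resO]
    refine Eq.trans ?_ (h5.trans (resO_resO _ _ _))
    exact congrArg (_ * ·) (resO_resO (X := Spec S) (U := ⊤)
      (V := p ⁻¹ᵁ g ⁻¹ᵁ Proj.basicOpen ℬ (e' i : B)) le_top (fun y hy => (hW i).le hy)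
      ((Scheme.ΓSpecIso S).inv (ψ' (e' i)))).symm
  have rv (k) : p.app (f ⁻¹ᵁ Proj.basicOpen 𝒜 (e i : A)) (resO le_top (v k : Γ(Y, ⊤))) =
      R (valueAt p (v k)) := by
    rw [app_resO]
    exact congrArg (resO (X := Spec S) le_top) (inv_valueAt p (v k)).symm
  rw [map_mul, map_mul, rv, rv]
  refine ((u1.map R).mul (u2.map R)).mul_right_cancel ?_
  have e1 := congrArg R (h3' i)
  have e2 := congrArg R (h3' j)
  simp only [map_mul] at e1 e2
  calc _ = (p.app _ (f.app _ (ratio 𝒜 (e j) (e i))) * R (ψ (e i))) *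
        (R (valueAt p (v i)) * R (ψ' (e' i))) := by ring
    _ = (R (ψ (e j)) * R w') * R (ψ (e i)) := by rw [r1, ← e1]; ring
    _ = R (valueAt p (v j)) * (p.app (f ⁻¹ᵁ Proj.basicOpen 𝒜 (e i : A)) (resO (hW i).le
      (g.app _ (ratio ℬ (e' j) (e' i)))) * R (ψ' (e' i))) * R (ψ (e i)) := by rw [e2, r2]
    _ = _ := by ring

end ModuleFrame

namespace CoeffSystem
variable {R F : Type u} [CommRing R] [Field F] [Algebra R F] {E : Type} [AddCommGroup E]
  (Q : CoeffSystem R F (ℕ × E)) (k : Type u) [CommRing k] {Z : Scheme.{u}}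
  (j : Z ⟶ Proj Q.grading) (q : Z ⟶ Spec (.of k))

theorem isFrame_lineBundle {ι : Type v} {n : ℕ} (e : ι → Q.grading n)
    (hcov : ⨆ i, Proj.basicOpen Q.grading (e i : Q.toSubalgebra) = ⊤) :
    IsFrame (Q.lineBundle j n) (fun i => j ⁻¹ᵁ Proj.basicOpen Q.grading (e i : Q.toSubalgebra))
      (fun i => pullSection j (serreTwistSection Q.grading n (e i)))
      (fun i l => j.app _ (ratio Q.grading (e l) (e i))) :=
  (SerreTwist.isFrame Q.grading e hcov).pullback j

theorem isFrame_pullback_lineBundle {Y : Scheme.{u}} (f : Y ⟶ Z) {ι : Type v} {n : ℕ}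
    (e : ι → Q.grading n) (hcov : ⨆ i, Proj.basicOpen Q.grading (e i : Q.toSubalgebra) = ⊤) :
    IsFrame ((Scheme.Modules.pullback f).obj (Q.lineBundle j n))
      (fun i => (f ≫ j) ⁻¹ᵁ Proj.basicOpen Q.grading (e i : Q.toSubalgebra))
      (fun i => pullSection f (pullSection j (serreTwistSection Q.grading n (e i))))
      (fun i l => (f ≫ j).app _ (ratio Q.grading (e l) (e i))) := by
  have := (Q.isFrame_lineBundle j e hcov).pullback f
  have h (i l) : (f ≫ j).app _ (ratio Q.grading (e l) (e i)) =
      f.app _ (j.app _ (ratio Q.grading (e l) (e i))) := by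
    rw [Scheme.Hom.comp_app]; rfl
  simp only [h]
  exact this

/-- The weight vectors of degree one. -/
abbrev WeightVector := {w : E × Q.grading 1 // Q.IsWeight w.1 w.2.1}

variable {Q} in
theorem iSup_weightVector {ι : Type v} {z : ι → Q.grading 1} {x : ι → E}
    (hz : ∀ i, Q.IsWeight (x i) (z i).1)
    (hcov : ⨆ i, Proj.basicOpen Q.grading (z i : Q.toSubalgebra) = ⊤) :
    ⨆ w : Q.WeightVector, Proj.basicOpen Q.grading (w.1.2 : Q.toSubalgebra) = ⊤ := by
  rw [eq_top_iff, ← hcov]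
  exact iSup_le fun i => le_iSup (fun w : Q.WeightVector =>
    Proj.basicOpen Q.grading (w.1.2 : Q.toSubalgebra)) ⟨(x i, z i), hz i⟩

theorem valueAt_character {S : CommRingCat.{u}} (p : Spec S ⟶ pullback (torusToSpec k E) q) (x : E) :
    valueAt p (character k q x) =
      charOf (p ≫ pullback.fst (torusToSpec k E) q) (.ofAdd x) := by
  obtain ⟨g, hg⟩ := Spec.map_surjective (p ≫ pullback.fst (torusToSpec k E) q)
  have h1 : charOf (p ≫ pullback.fst (torusToSpec k E) q) (.ofAdd x) =
      g.hom (AddMonoidAlgebra.single x 1) := by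
    unfold charOf
    rw [← hg, Spec.preimage_map]
    rfl
  rw [h1]
  have h2 : valueAt p (character k q x) = valueAt (p ≫ pullback.fst (torusToSpec k E) q)
      ((Scheme.ΓSpecIso (.of (AddMonoidAlgebra k E))).inv (AddMonoidAlgebra.single x 1)) := by
    unfold valueAt character
    rw [RingHom.comp_apply, RingHom.comp_apply, Scheme.Hom.comp_appTop]
    rfl
  rw [h2, ← hg]
  have h3 := congrArg (fun m => (Scheme.ΓSpecIso S).hom.hom (m.hom (AddMonoidAlgebra.single x 1)))
    (Scheme.ΓSpecIso_inv_naturality g)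
  exact h3.symm.trans (congrArg (fun m => m.hom (g.hom (AddMonoidAlgebra.single x 1)))
    (Scheme.ΓSpecIso S).inv_hom_id)

/-- The character as an invertible function. -/
def characterUnit (x : E) : Γ(pullback (torusToSpec k E) q, ⊤)ˣ :=
  Units.map (((pullback.fst (torusToSpec k E) q).appTop.hom.comp
    (Scheme.ΓSpecIso (.of (AddMonoidAlgebra k E))).inv.hom).toMonoidHom.comp
      (AddMonoidAlgebra.of k E)) (toUnits (Multiplicative.ofAdd x))

theorem characterUnit_val (x : E) :
    (characterUnit k q x : Γ(pullback (torusToSpec k E) q, ⊤)) = character k q x := rfl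

theorem lift_fst_snd {S : CommRingCat.{u}} (p : Spec S ⟶ pullback (torusToSpec k E) q)
    (t : AddMonoidAlgebra k E →+* S)
    (ht : Spec.map (CommRingCat.ofHom t) = p ≫ pullback.fst (torusToSpec k E) q)
    (h : Spec.map (CommRingCat.ofHom t) ≫ torusToSpec k E =
      (p ≫ pullback.snd (torusToSpec k E) q) ≫ q) :
    pullback.lift (Spec.map (CommRingCat.ofHom t)) (p ≫ pullback.snd (torusToSpec k E) q) h = p := by
  refine pullback.hom_ext ?_ ?_
  · rw [pullback.lift_fst, ht]
  · rw [pullback.lift_snd]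

theorem isTorusAction_iff (act : pullback (torusToSpec k E) q ⟶ Z) :
    Q.IsTorusAction k j q act ↔
      Q.IsTwist (pullback.snd (torusToSpec k E) q ≫ j) (act ≫ j) (pullback.fst (torusToSpec k E) q) := by
  constructor
  · intro h S p φ hφ
    obtain ⟨g, hg⟩ := Spec.map_surjective (p ≫ pullback.fst (torusToSpec k E) q)
    let t : AddMonoidAlgebra k E →+* S := g.hom
    have ht : Spec.map (CommRingCat.ofHom t) = p ≫ pullback.fst (torusToSpec k E) q := hg
    have hp : Spec.map (CommRingCat.ofHom t) ≫ torusToSpec k E =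
        (p ≫ pullback.snd (torusToSpec k E) q) ≫ q := by
      rw [ht, Category.assoc, Category.assoc, pullback.condition]
    obtain ⟨φ', h1, h2⟩ := h S t (p ≫ pullback.snd (torusToSpec k E) q) hp φ
      (by rwa [Category.assoc])
    rw [lift_fst_snd k q p t ht hp] at h2
    have : φ' = Q.tw φ (charOf (p ≫ pullback.fst (torusToSpec k E) q)) := by
      refine Q.eq_tw fun x f hf => ?_
      rw [h1 x f hf, ← ht, charOf_map]
    rwa [← this]
  · intro h S t p hp φ hφ
    have h1 := h S (pullback.lift (Spec.map (CommRingCat.ofHom t)) p hp) φ (by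
      rwa [pullback.lift_snd_assoc])
    refine ⟨_, fun x f hf => ?_, h1⟩
    rw [Q.tw_of_isWeight _ _ hf, pullback.lift_fst, charOf_map]

variable {ι : Type v} {z : ι → Q.grading 1} {x : ι → E}
    (hz : ∀ i, Q.IsWeight (x i) (z i).1)
    (hcov : ⨆ i, Proj.basicOpen Q.grading (z i : Q.toSubalgebra) = ⊤)

include hz hcov in
theorem exists_torusStructure (act : pullback (torusToSpec k E) q ⟶ Z)
    (hact : act ≫ q = pullback.snd (torusToSpec k E) q ≫ q)
    (h : Q.IsTwist (pullback.snd (torusToSpec k E) q ≫ j) (act ≫ j)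
      (pullback.fst (torusToSpec k E) q)) :
    ∃ S : Q.TorusStructure k j q, S.act = act := by
  have hw := iSup_weightVector hz hcov
  obtain ⟨𝒰, h𝒰⟩ := ProjCoord.exists_cover_hasCoords Q.grading (fun i => (z i).1)
    (fun i => (z i).2) hcov (pullback.snd (torusToSpec k E) q ≫ j)
  obtain ⟨Φ, hΦ⟩ := exists_iso_of_coords (act ≫ j) (pullback.snd (torusToSpec k E) q ≫ j)
    one_pos one_pos (Q.isFrame_pullback_lineBundle j act (fun w : Q.WeightVector => w.1.2) hw)
    (Q.isFrame_pullback_lineBundle j (pullback.snd (torusToSpec k E) q)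
      (fun w : Q.WeightVector => w.1.2) hw) (fun w => characterUnit k q w.1.1) 𝒰 (fun a => by
        obtain ⟨i, φ, hφ, -⟩ := h𝒰 a
        refine ⟨_, φ, 1, h _ _ _ hφ, hφ, isUnit_one, fun w => ?_⟩
        rw [mul_one, Q.tw_of_isWeight _ _ w.2, characterUnit_val, valueAt_character])
  exact ⟨⟨act, hact, (Q.isTorusAction_iff k j q act).2 h, Φ, fun x f hf => hΦ ⟨(x, f), hf⟩⟩, rfl⟩

include hz hcov in
theorem torusStructure_unique [Mono j] (S S' : Q.TorusStructure k j q) : S = S' := by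
  have hact : S.act = S'.act := by
    have h1 := (Q.isTorusAction_iff k j q S.act).1 S.isTorusAction
    have h2 := (Q.isTorusAction_iff k j q S'.act).1 S'.isTorusAction
    exact (cancel_mono j).1 (h1.unique Q (fun i => (z i).1) (fun i => (z i).2) hcov h2)
  obtain ⟨act, h1, h2, Φ, h3⟩ := S
  obtain ⟨act', h1', h2', Φ', h3'⟩ := S'
  obtain rfl : act = act' := hact
  congr 1
  ext1
  refine (Q.isFrame_pullback_lineBundle j act z hcov).hom_ext _ _ _ fun i => ?_
  rw [h3 (x i) (z i) (hz i), h3' (x i) (z i) (hz i)]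

end CoeffSystem
end TorusStructures

noncomputable section TorusTransport
open Limits ModuleFrame SerreTwist

theorem ModuleFrame.transport_section {T T' Z Z' : Scheme.{u}} {a b : T ⟶ Z} {a' b' : T' ⟶ Z'}
    {e : Z ⟶ Z'} {g : T ⟶ T'} (ha : a ≫ e = g ≫ a') (hb : g ≫ b' = b ≫ e) {L : Z.Modules}
    {L' : Z'.Modules} (l : (Scheme.Modules.pullback a).obj L ⟶ (Scheme.Modules.pullback b).obj L)
    (l' : (Scheme.Modules.pullback a').obj L' ⟶ (Scheme.Modules.pullback b').obj L')
    (Φ : L ⟶ (Scheme.Modules.pullback e).obj L') {s : Γ(L, ⊤)} {s' : Γ(L', ⊤)} {c : Γ(T, ⊤)}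
    {c' : Γ(T', ⊤)} (h1 : l.app ⊤ (pullSection a s) = c • pullSection b s)
    (h2 : Φ.app ⊤ s = pullSection e s') (h3 : l'.app ⊤ (pullSection a' s') = c' • pullSection b' s')
    (hc : g.appTop c' = c) :
    ((Scheme.Modules.pullback a).map Φ ≫ (Scheme.Modules.pullbackComp a e).hom.app L' ≫
      (Scheme.Modules.pullbackCongr ha).hom.app L' ≫ (Scheme.Modules.pullbackComp g a').inv.app L' ≫
      (Scheme.Modules.pullback g).map l' ≫ (Scheme.Modules.pullbackComp g b').hom.app L' ≫
      (Scheme.Modules.pullbackCongr hb).hom.app L' ≫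
      (Scheme.Modules.pullbackComp b e).inv.app L').app ⊤ (pullSection a s) =
      (l ≫ (Scheme.Modules.pullback b).map Φ).app ⊤ (pullSection a s) := by
  have comp {A B C : T.Modules} (φ : A ⟶ B) (ψ : B ⟶ C) (x : Γ(A, ⊤)) :
      (φ ≫ ψ).app ⊤ x = ψ.app ⊤ (φ.app ⊤ x) := rfl
  rw [comp, comp, comp, comp, comp, comp, comp, comp, h1, Scheme.Modules.Hom.app_smul, pullSection_map, pullSection_map, h2, pullSection_comp_hom,
    pullSection_congr, pullSection_comp_inv, pullSection_map, h3, pullSection_smul,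
    Scheme.Modules.Hom.app_smul, Scheme.Modules.Hom.app_smul, Scheme.Modules.Hom.app_smul,
    pullSection_comp_hom, pullSection_congr, pullSection_comp_inv, hc]

theorem ModuleFrame.transport_hom {T T' Z Z' : Scheme.{u}} {a b : T ⟶ Z} {a' b' : T' ⟶ Z'}
    {e : Z ⟶ Z'} {g : T ⟶ T'} (ha : a ≫ e = g ≫ a') (hb : g ≫ b' = b ≫ e) {L : Z.Modules}
    {L' : Z'.Modules} (l : (Scheme.Modules.pullback a).obj L ⟶ (Scheme.Modules.pullback b).obj L)
    (l' : (Scheme.Modules.pullback a').obj L' ⟶ (Scheme.Modules.pullback b').obj L')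
    (Φ : L ⟶ (Scheme.Modules.pullback e).obj L') {ι : Type v} {s : ι → Γ(L, ⊤)}
    {s' : ι → Γ(L', ⊤)} {c : ι → Γ(T, ⊤)} {c' : ι → Γ(T', ⊤)} {W : ι → T.Opens}
    {d : ∀ i j : ι, Γ(T, W i)}
    (H : IsFrame ((Scheme.Modules.pullback a).obj L) W (fun i => pullSection a (s i)) d)
    (h1 : ∀ i, l.app ⊤ (pullSection a (s i)) = c i • pullSection b (s i))
    (h2 : ∀ i, Φ.app ⊤ (s i) = pullSection e (s' i))
    (h3 : ∀ i, l'.app ⊤ (pullSection a' (s' i)) = c' i • pullSection b' (s' i))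
    (hc : ∀ i, g.appTop (c' i) = c i) :
    (Scheme.Modules.pullback a).map Φ ≫ (Scheme.Modules.pullbackComp a e).hom.app L' ≫
      (Scheme.Modules.pullbackCongr ha).hom.app L' ≫ (Scheme.Modules.pullbackComp g a').inv.app L' ≫
      (Scheme.Modules.pullback g).map l' ≫ (Scheme.Modules.pullbackComp g b').hom.app L' ≫
      (Scheme.Modules.pullbackCongr hb).hom.app L' ≫
      (Scheme.Modules.pullbackComp b e).inv.app L' =
      l ≫ (Scheme.Modules.pullback b).map Φ :=
  H.hom_ext _ _ _ fun i => transport_section ha hb l l' Φ (h1 i) (h2 i) (h3 i) (hc i)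

namespace CoeffSystem
variable {R F R' F' : Type u} [CommRing R] [Field F] [Algebra R F] [CommRing R'] [Field F']
  [Algebra R' F'] {E : Type} [AddCommGroup E]
  {Q : CoeffSystem R F (ℕ × E)} {Q' : CoeffSystem R' F' (ℕ × E)}
  {π : Q'.toSubalgebra →+* Q.toSubalgebra}

/-- The homomorphism maps monomials to monomials of the same exponent. -/
def IsMonomial (π : Q'.toSubalgebra →+* Q.toSubalgebra) : Prop :=
  ∀ p a, ∃ b, π (Q'.mono p a) = Q.mono p b

theorem IsMonomial.tw_comp (hπ : IsMonomial π) {S : Type u} [CommRing S]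
    (φ : Q.toSubalgebra →+* S) (χ : Multiplicative E →* S) :
    (Q.tw φ χ).comp π = Q'.tw (φ.comp π) χ :=
  Q'.ringHom_ext fun p a => by
    obtain ⟨b, hb⟩ := hπ p a
    rw [tw_mono, RingHom.comp_apply, RingHom.comp_apply, hb, tw_mono]

theorem IsMonomial.mem_grading (hπ : IsMonomial π) {d : ℕ} {f : Q'.toSubalgebra}
    (hf : f ∈ Q'.grading d) : π f ∈ Q.grading d := by
  rw [← Q'.sum_mono f, map_sum]
  refine sum_mem fun p hp => ?_
  obtain ⟨b, hb⟩ := hπ p (Q'.coeffAt f p)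
  rw [hb, ← hf p (Finsupp.mem_support_iff.1 hp)]
  exact Q.mono_mem_grading p b

theorem IsWeight.sum {κ : Type*} {x : E} (s : Finset κ) (f : κ → Q.toSubalgebra)
    (h : ∀ i ∈ s, Q.IsWeight x (f i)) : Q.IsWeight x (∑ i ∈ s, f i) := by
  intro p hp
  rw [AddSubmonoidClass.coe_finsetSum, AddMonoidAlgebra.coeff_sum, Finsupp.coe_finsetSum,
    Finset.sum_apply] at hp
  obtain ⟨i, hi, h1⟩ := Finset.exists_ne_zero_of_sum_ne_zero hp
  exact h i hi p h1

theorem IsMonomial.isWeight (hπ : IsMonomial π) {x : E} {f : Q'.toSubalgebra}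
    (hf : Q'.IsWeight x f) : Q.IsWeight x (π f) := by
  rw [← Q'.sum_mono f, map_sum]
  refine IsWeight.sum _ _ fun p hp => ?_
  obtain ⟨b, hb⟩ := hπ p (Q'.coeffAt f p)
  rw [hb, ← hf p (Finsupp.mem_support_iff.1 hp)]
  exact Q.isWeight_mono p b

variable {k : Type u} [CommRing k] {Z Z' : Scheme.{u}} {j : Z ⟶ Proj Q.grading}
  {q : Z ⟶ Spec (.of k)} {j' : Z' ⟶ Proj Q'.grading} {q' : Z' ⟶ Spec (.of k)}

theorem torusProdMap_fst {e : Z ⟶ Z'} (he : e ≫ q' = q) :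
    torusProdMap E e he ≫ pullback.fst (torusToSpec k E) q' = pullback.fst (torusToSpec k E) q := by
  unfold torusProdMap
  exact (pullback.lift_fst _ _ _).trans (Category.comp_id _)

theorem torusProdMap_hom_inv (e : Z ≅ Z') (he : e.hom ≫ q' = q) (he' : e.inv ≫ q = q') :
    torusProdMap E e.inv he' ≫ torusProdMap E e.hom he = 𝟙 _ := by
  refine pullback.hom_ext ?_ ?_
  · rw [Category.assoc, torusProdMap_fst, torusProdMap_fst, Category.id_comp]
  · rw [Category.assoc, torusProdMap_snd, ← Category.assoc, torusProdMap_snd, Category.assoc,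
      e.inv_hom_id, Category.comp_id, Category.id_comp]

theorem appTop_character {e : Z ⟶ Z'} (he : e ≫ q' = q) (x : E) :
    (torusProdMap E e he).appTop (character k q' x) = character k q x := by
  unfold character
  have := torusProdMap_fst (E := E) he
  rw [← this, Scheme.Hom.comp_appTop]
  rfl

theorem bundle_equivariant_of_sections {e : Z ⟶ Z'} (he : e ≫ q' = q) {ι : Type v}
    {z : ι → Q'.grading 1} {z' : ι → Q.grading 1} {x : ι → E} (hz : ∀ i, Q'.IsWeight (x i) (z i).1)
    (hz' : ∀ i, Q.IsWeight (x i) (z' i).1)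
    (hcov : ⨆ i, Proj.basicOpen Q.grading (z' i : Q.toSubalgebra) = ⊤)
    (SX : Q.TorusStructure k j q) (SV : Q'.TorusStructure k j' q')
    (hequiv : SX.act ≫ e = torusProdMap E e he ≫ SV.act)
    {Φ : Q.lineBundle j 1 ⟶ (Scheme.Modules.pullback e).obj (Q'.lineBundle j' 1)}
    (hΦ : ∀ i, Φ.app ⊤ (pullSection j (serreTwistSection Q.grading 1 (z' i))) =
      pullSection e (pullSection j' (serreTwistSection Q'.grading 1 (z i)))) :
    (Scheme.Modules.pullback SX.act).map Φ ≫
      (Scheme.Modules.pullbackComp SX.act e).hom.app (Q'.lineBundle j' 1) ≫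
      (Scheme.Modules.pullbackCongr hequiv).hom.app (Q'.lineBundle j' 1) ≫
      (Scheme.Modules.pullbackComp (torusProdMap E e he) SV.act).inv.app (Q'.lineBundle j' 1) ≫
      (Scheme.Modules.pullback (torusProdMap E e he)).map SV.lin.hom ≫
      (Scheme.Modules.pullbackComp (torusProdMap E e he) _).hom.app (Q'.lineBundle j' 1) ≫
      (Scheme.Modules.pullbackCongr (torusProdMap_snd E e he)).hom.app (Q'.lineBundle j' 1) ≫
      (Scheme.Modules.pullbackComp (pullback.snd (torusToSpec k E) q) e).inv.app
        (Q'.lineBundle j' 1) =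
    SX.lin.hom ≫ (Scheme.Modules.pullback (pullback.snd (torusToSpec k E) q)).map Φ :=
  transport_hom hequiv (torusProdMap_snd E e he) SX.lin.hom SV.lin.hom Φ
    (Q.isFrame_pullback_lineBundle j SX.act z' hcov)
    (fun i => SX.isTorusLinearization (x i) (z' i) (hz' i)) hΦ
    (fun i => SV.isTorusLinearization (x i) (z i) (hz i)) fun i => appTop_character he (x i)

theorem exists_linearizedIso [Mono j'] (hπ : IsMonomial π) (e : Z ≅ Z') (he : e.hom ≫ q' = q)
    (hC : ∀ (S : CommRingCat.{u}) (p : Spec S ⟶ Z) (φ : Q.toSubalgebra →+* S),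
      HasCoords Q.grading (p ≫ j) φ → HasCoords Q'.grading (p ≫ e.hom ≫ j') (φ.comp π))
    {ι : Type v} {z : ι → Q'.grading 1} {x : ι → E} (hz : ∀ i, Q'.IsWeight (x i) (z i).1)
    (hcov : ⨆ i, Proj.basicOpen Q'.grading (z i : Q'.toSubalgebra) = ⊤)
    (hcov' : ⨆ i, Proj.basicOpen Q.grading (π (z i)) = ⊤) (SX : Q.TorusStructure k j q) :
    ∃ SV : Q'.TorusStructure k j' q', Nonempty (LinearizedIso SX.lin SV.lin) := by
  have he' : e.inv ≫ q = q' := by rw [← he, e.inv_hom_id_assoc]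
  let z' : ι → Q.grading 1 := fun i => ⟨π (z i), hπ.mem_grading (z i).2⟩
  have hz' (i) : Q.IsWeight (x i) (z' i).1 := hπ.isWeight (hz i)
  let g := torusProdMap E e.hom he
  let act' := torusProdMap E e.inv he' ≫ SX.act ≫ e.hom
  have hg : torusProdMap E e.inv he' ≫ g = 𝟙 _ := torusProdMap_hom_inv e he he'
  have hg' : g ≫ torusProdMap E e.inv he' = 𝟙 _ := torusProdMap_hom_inv e.symm he' he
  have hact' : act' ≫ q' = pullback.snd (torusToSpec k E) q' ≫ q' := by
    simp only [act', Category.assoc]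
    rw [he, SX.act_over, ← Category.assoc, torusProdMap_snd, Category.assoc, he']
  have hX := (Q.isTorusAction_iff k j q SX.act).1 SX.isTorusAction
  have htw : Q'.IsTwist (pullback.snd (torusToSpec k E) q' ≫ j') (act' ≫ j')
      (pullback.fst (torusToSpec k E) q') := by
    obtain ⟨T, hT⟩ := Q'.exists_isTwist (fun i => (z i).1) (fun i => (z i).2) hcov
      (pullback.snd (torusToSpec k E) q' ≫ j') (pullback.fst (torusToSpec k E) q')
    have hTg := hT.comp g
    have e1 : g ≫ pullback.snd (torusToSpec k E) q' ≫ j' =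
        pullback.snd (torusToSpec k E) q ≫ e.hom ≫ j' := by
      rw [← Category.assoc, torusProdMap_snd, Category.assoc]
    rw [e1, torusProdMap_fst] at hTg
    have : SX.act ≫ e.hom ≫ j' = g ≫ T := by
      obtain ⟨𝒰, h𝒰⟩ := ProjCoord.exists_cover_hasCoords Q.grading (fun i => (z' i).1)
        (fun i => (z' i).2) hcov' (pullback.snd (torusToSpec k E) q ≫ j)
      refine 𝒰.openCover.hom_ext _ _ fun a => ?_
      obtain ⟨i, φ, hφ, -⟩ := h𝒰 a
      have h1 := hC _ (𝒰.f a ≫ pullback.snd (torusToSpec k E) q) φ (by rwa [Category.assoc])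
      rw [Category.assoc] at h1
      have h2 := hTg _ _ _ h1
      have h3 := hX _ _ _ hφ
      rw [← Category.assoc] at h3
      have h4 := hC _ _ _ h3
      rw [hπ.tw_comp, Category.assoc] at h4
      obtain ⟨_, e2⟩ := h2
      obtain ⟨_, e4⟩ := h4
      exact e4.trans e2.symm
    have e2 : act' ≫ j' = T := by
      simp only [act', Category.assoc]
      rw [this, ← Category.assoc, hg, Category.id_comp]
    rwa [e2]
  obtain ⟨SV, hSV⟩ := Q'.exists_torusStructure k j' q' hz hcov act' hact' htw
  refine ⟨SV, ?_⟩
  have hequiv : SX.act ≫ e.hom = g ≫ SV.act := by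
    rw [hSV]
    simp only [act']
    rw [← Category.assoc, hg', Category.id_comp]
  obtain ⟨𝒰, h𝒰⟩ := ProjCoord.exists_cover_hasCoords Q.grading (fun i => (z' i).1)
    (fun i => (z' i).2) hcov' j
  obtain ⟨Φ, hΦ⟩ := exists_iso_of_coords j (e.hom ≫ j') one_pos one_pos
    (Q.isFrame_lineBundle j z' hcov') (Q'.isFrame_pullback_lineBundle j' e.hom z hcov)
    (fun _ => 1) 𝒰 (fun a => by
      obtain ⟨i, φ, hφ, -⟩ := h𝒰 a
      exact ⟨φ, φ.comp π, 1, hφ, hC _ _ _ hφ, isUnit_one, fun i => by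
        rw [Units.val_one, map_one, one_mul, mul_one]; rfl⟩)
  simp only [Units.val_one, one_smul] at hΦ
  exact ⟨⟨e, he, hequiv, Φ, bundle_equivariant_of_sections he hz hz' hcov' SX SV hequiv hΦ⟩⟩

end CoeffSystem
end TorusTransport


section
variable {O K : Type u} [CommRing O] [IsDomain O] [IsDiscreteValuationRing O] [Field K]
  [Algebra O K] [IsFractionRing O K] {r : ℕ}

theorem toReal_zero : toReal (0 : Fin r → ℤ) = 0 := by ext; simp [toReal]

theorem toReal_neg (x : Fin r → ℤ) : toReal (-x) = -toReal x := by ext; simp [toReal]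

theorem toReal_sub (x y : Fin r → ℤ) : toReal (x - y) = toReal x - toReal y := by
  ext; simp [toReal]

theorem toReal_nsmul (n : ℕ) (x : Fin r → ℤ) : toReal (n • x) = (n : ℝ) • toReal x := by
  ext; simp [toReal]

theorem toReal_sum {ι : Type*} (s : Finset ι) (f : ι → Fin r → ℤ) :
    toReal (∑ i ∈ s, f i) = ∑ i ∈ s, toReal (f i) := by
  ext j; simp [toReal]

theorem toReal_injective : Function.Injective (toReal (r := r)) := fun x y h => by
  ext i; exact Int.cast_injective (α := ℝ) (congrFun h i)

namespace DegenerationData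
variable (D : DegenerationData O K r)

/-- The form `B` on `ℝ ^ r` as a bilinear map. -/
noncomputable def bilin : LinearMap.BilinForm ℝ (Fin r → ℝ) :=
  LinearMap.mk₂ ℝ D.BReal D.BReal_add_left D.BReal_smul_left
    (fun u v w => by rw [D.BReal_comm, D.BReal_add_left, D.BReal_comm v, D.BReal_comm w])
    (fun c u v => by rw [D.BReal_comm, D.BReal_smul_left, D.BReal_comm v]; rfl)

theorem bilin_apply (u v : Fin r → ℝ) : D.bilin u v = D.BReal u v := rfl

/-- The differential `dA(α)` as a linear form. -/
noncomputable def dALin (α : Fin r → ℝ) : (Fin r → ℝ) →ₗ[ℝ] ℝ where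
  toFun := D.dA α
  map_add' := D.dA_add α
  map_smul' := D.dA_smul α

theorem dALin_apply (α v : Fin r → ℝ) : D.dALin α v = D.dA α v := rfl

theorem dA_zero (α : Fin r → ℝ) : D.dA α 0 = 0 := (D.dALin α).map_zero

theorem dA_sub (α u v : Fin r → ℝ) : D.dA α (u - v) = D.dA α u - D.dA α v :=
  (D.dALin α).map_sub u v

theorem dA_neg (α v : Fin r → ℝ) : D.dA α (-v) = -D.dA α v := (D.dALin α).map_neg v

theorem dA_add_smul (α u v : Fin r → ℝ) (t : ℝ) :
    D.dA (α + t • u) v = D.dA α v + t * D.BReal u v := by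
  simp only [dA, D.BReal_add_left, D.BReal_smul_left]; ring

theorem dA_combo (α β v : Fin r → ℝ) {s t : ℝ} (h : s + t = 1) :
    D.dA (s • α + t • β) v = s * D.dA α v + t * D.dA β v := by
  simp only [dA, D.BReal_add_left, D.BReal_smul_left]
  linear_combination (-(D.lReal v) / 2) * h

theorem dA_sub_left (α β v : Fin r → ℝ) : D.dA α v - D.dA β v = D.BReal (α - β) v := by
  have : D.BReal (α - β) v = D.BReal α v - D.BReal β v := by
    simp only [← bilin_apply, map_sub, LinearMap.sub_apply]
  rw [this]; simp only [dA]; ring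

theorem continuous_BReal : Continuous fun p : (Fin r → ℝ) × (Fin r → ℝ) => D.BReal p.1 p.2 := by
  unfold BReal; fun_prop

theorem continuous_dA (v : Fin r → ℝ) : Continuous fun α => D.dA α v := by
  unfold dA BReal; fun_prop

theorem B_self_pos {x : Fin r → ℤ} (hx : x ≠ 0) : 0 < D.B x x := by
  obtain ⟨m, hm, h⟩ := D.positive x hx
  have hm0 : algebraMap O K m ≠ 0 := by rw [h]; exact Units.ne_zero _
  rw [D.irreducible_s.maximalIdeal_eq, Ideal.mem_span_singleton] at hm
  obtain ⟨c, rfl⟩ := hm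
  rw [map_mul] at hm0
  unfold B
  rw [← h, map_mul, ord_mul (left_ne_zero_of_mul hm0) (right_ne_zero_of_mul hm0)]
  have h1 := ord_zpow (K := K) D.irreducible_s 1
  rw [zpow_one] at h1
  have := ord_algebraMap_nonneg (K := K) c
  linarith

theorem BReal_toReal_self_nonneg (x : Fin r → ℤ) : 0 ≤ D.BReal (toReal x) (toReal x) := by
  rw [D.BReal_toReal]
  by_cases hx : x = 0
  · subst hx
    have := D.B_add_left 0 0 0
    rw [add_zero] at this
    have : D.B 0 0 = 0 := by linarith
    simp [this]
  · exact_mod_cast (D.B_self_pos hx).le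

theorem BReal_self_nonneg (v : Fin r → ℝ) : 0 ≤ D.BReal v v := by
  have hq (q : Fin r → ℚ) : 0 ≤ D.BReal (fun i => (q i : ℝ)) (fun i => (q i : ℝ)) := by
    let N : ℕ := ∏ i, (q i).den
    have hN : (0 : ℝ) < N := by
      exact_mod_cast Finset.prod_pos fun i _ => (q i).den_pos
    have hx (i : Fin r) : ∃ z : ℤ, (z : ℝ) = N * q i := by
      obtain ⟨c, hc⟩ : (q i).den ∣ N := Finset.dvd_prod_of_mem (fun i => (q i).den) (Finset.mem_univ i)
      refine ⟨c * (q i).num, ?_⟩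
      have h1 : (q i : ℝ) * (q i).den = (q i).num := by exact_mod_cast Rat.mul_den_eq_num (q i)
      rw [hc]; push_cast; rw [← h1]; ring
    choose x hx using hx
    have e : toReal x = (N : ℝ) • fun i => (q i : ℝ) := by ext i; simp [toReal, hx]
    have h := D.BReal_toReal_self_nonneg x
    rw [e, D.BReal_smul_left, D.BReal_comm, D.BReal_smul_left] at h
    exact nonneg_of_mul_nonneg_right (nonneg_of_mul_nonneg_right h hN) hN
  have hd : DenseRange fun q : Fin r → ℚ => fun i => (q i : ℝ) :=
    DenseRange.piMap fun _ => Rat.denseRange_cast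
  refine hd.induction_on v ?_ hq
  exact isClosed_Ici.preimage (D.continuous_BReal.comp (continuous_id.prodMk continuous_id))

theorem BReal_self_pos {v : Fin r → ℝ} (hv : v ≠ 0) : 0 < D.BReal v v := by
  refine lt_of_le_of_ne (D.BReal_self_nonneg v) fun h => ?_
  have h0 (w : Fin r → ℝ) : D.BReal w v = 0 := by
    have h1 := D.bilin.apply_sq_le_of_symm D.BReal_self_nonneg ⟨fun x y => D.BReal_comm x y⟩ w v
    simp only [bilin_apply, ← h, mul_zero] at h1
    exact pow_eq_zero_iff two_ne_zero |>.1 (le_antisymm h1 (sq_nonneg _))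
  let G : Matrix (Fin r) (Fin r) ℤ := fun i j => D.B (Pi.single i 1) (Pi.single j 1)
  have hG : (G.map (Int.castRingHom ℝ)).mulVec v = 0 := by
    ext i
    have := h0 (Pi.single i 1)
    unfold BReal at this
    rw [Finset.sum_eq_single i (fun j _ hj => by simp [Pi.single_eq_of_ne hj]) (by simp)] at this
    simp only [Pi.single_eq_same, one_mul] at this
    rw [Pi.zero_apply, ← this]
    simp only [Matrix.mulVec, dotProduct]
    exact Finset.sum_congr rfl fun j _ => mul_comm (G i j : ℝ) (v j)
  have hdet : (G.map (Int.castRingHom ℝ)).det = 0 := Matrix.exists_mulVec_eq_zero_iff.1 ⟨v, hv, hG⟩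
  have hdet' : G.det = 0 := by
    rw [← RingHom.mapMatrix_apply, ← RingHom.map_det] at hdet
    exact Int.cast_injective (α := ℝ) (hdet.trans Int.cast_zero.symm)
  obtain ⟨w, hw, hGw⟩ := Matrix.exists_mulVec_eq_zero_iff.2 hdet'
  have h2 := D.B_self_pos hw
  have h3 : D.BReal (toReal w) (toReal w) = 0 := by
    unfold BReal
    refine Finset.sum_eq_zero fun i _ => ?_
    have := congrFun hGw i
    simp only [Matrix.mulVec, dotProduct, Pi.zero_apply, G] at this
    have h4 : ((∑ j, D.B (Pi.single i 1) (Pi.single j 1) * w j : ℤ) : ℝ) = 0 := by rw [this]; simp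
    push_cast at h4
    rw [show ∑ j, toReal w i * toReal w j * (D.B (Pi.single i 1) (Pi.single j 1) : ℝ) =
      toReal w i * ∑ j, (D.B (Pi.single i 1) (Pi.single j 1) : ℝ) * w j by
        rw [Finset.mul_sum]; exact Finset.sum_congr rfl fun j _ => by simp only [toReal]; ring, h4,
      mul_zero]
  rw [D.BReal_toReal] at h3
  exact h2.ne' (by exact_mod_cast h3)

theorem exists_BReal_ge : ∃ ε : ℝ, 0 < ε ∧ ∀ v : Fin r → ℝ, ε * ‖v‖ ^ 2 ≤ D.BReal v v := by
  by_cases hne : (Metric.sphere (0 : Fin r → ℝ) 1).Nonempty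
  · obtain ⟨u, hu, hmin⟩ := (isCompact_sphere (0 : Fin r → ℝ) 1).exists_isMinOn hne
      (f := fun v => D.BReal v v)
      (D.continuous_BReal.comp (continuous_id.prodMk continuous_id)).continuousOn
    have hu0 : u ≠ 0 := by rintro rfl; simp at hu
    refine ⟨_, D.BReal_self_pos hu0, fun v => ?_⟩
    by_cases hv : v = 0
    · subst hv; simpa using D.BReal_self_nonneg 0
    have hv' : 0 < ‖v‖ := norm_pos_iff.2 hv
    have h : D.BReal u u ≤ D.BReal (‖v‖⁻¹ • v) (‖v‖⁻¹ • v) := by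
      refine hmin ?_
      rw [mem_sphere_zero_iff_norm, norm_smul, norm_inv, norm_norm, inv_mul_cancel₀ hv'.ne']
    rw [D.BReal_smul_left, D.BReal_comm v, D.BReal_smul_left] at h
    calc _ ≤ (‖v‖⁻¹ * (‖v‖⁻¹ * D.BReal v v)) * ‖v‖ ^ 2 := by gcongr
      _ = _ := by field_simp
  · refine ⟨1, one_pos, fun v => ?_⟩
    have hv : v = 0 := by
      by_contra hv
      refine hne ⟨‖v‖⁻¹ • v, ?_⟩
      rw [mem_sphere_zero_iff_norm, norm_smul, norm_inv, norm_norm,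
        inv_mul_cancel₀ (norm_pos_iff.2 hv).ne']
    subst hv; simpa using D.BReal_self_nonneg 0

/-- The amount by which `A` exceeds the linear form `dA(α)`. -/
noncomputable def excess (α : Fin r → ℝ) (x : Fin r → ℤ) : ℝ := D.A x - D.dA α (toReal x)

theorem distSq_eq (x : Fin r → ℤ) (α : Fin r → ℝ) :
    D.distSq x α = 2 * D.excess α x + D.BReal α α := by
  unfold distSq excess
  simp only [← bilin_apply, map_sub, LinearMap.sub_apply]
  simp only [bilin_apply, D.A_eq, dA, D.BReal_comm (toReal x) α]
  ring

theorem mem_nearest_iff {α : Fin r → ℝ} {x : Fin r → ℤ} :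
    x ∈ D.nearest α ↔ ∀ y, D.excess α x ≤ D.excess α y := by
  change (∀ y, _) ↔ _
  simp only [distSq_eq]
  exact forall_congr' fun y => ⟨fun h => by linarith, fun h => by linarith⟩

theorem distSq_nonneg (x : Fin r → ℤ) (α : Fin r → ℝ) : 0 ≤ D.distSq x α := D.BReal_self_nonneg _

theorem finite_setOf_norm_le (C : ℝ) : {x : Fin r → ℤ | ‖toReal x‖ ≤ C}.Finite := by
  refine (Set.Finite.pi' fun _ : Fin r => Set.finite_Icc (-⌈C⌉) ⌈C⌉).subset fun x hx i => ?_
  have h : |(x i : ℝ)| ≤ C := (norm_le_pi_norm (toReal x) i).trans hx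
  have h' := abs_le.1 (h.trans (Int.le_ceil C))
  exact ⟨by exact_mod_cast h'.1, by exact_mod_cast h'.2⟩

theorem exists_norm_le : ∃ f : ℝ → ℝ, ∀ (x : Fin r → ℤ) (α : Fin r → ℝ) (C : ℝ),
    D.distSq x α ≤ C → ‖toReal x - α‖ ≤ f C := by
  obtain ⟨ε, hε, h⟩ := D.exists_BReal_ge
  refine ⟨fun C => √(C / ε), fun x α C hC => Real.le_sqrt_of_sq_le ?_⟩
  rw [le_div_iff₀ hε, mul_comm]
  exact (h _).trans hC

theorem nearest_nonempty (α : Fin r → ℝ) : (D.nearest α).Nonempty := by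
  obtain ⟨f, hf⟩ := D.exists_norm_le
  have hfin : {x | D.distSq x α ≤ D.distSq 0 α}.Finite :=
    (finite_setOf_norm_le (f (D.distSq 0 α) + ‖α‖)).subset fun x hx => by
      have h1 := hf x α _ hx
      have h2 := norm_sub_norm_le (toReal x) α
      simp only [Set.mem_ofPred_eq]; linarith
  obtain ⟨x, hx, hmin⟩ := hfin.exists_minimalFor (fun x => D.distSq x α) _ ⟨0, le_refl (D.distSq 0 α)⟩
  refine ⟨x, fun y => ?_⟩
  by_cases hy : D.distSq y α ≤ D.distSq 0 α
  · by_contra hlt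
    exact hlt (hmin hy (not_le.1 hlt).le)
  · exact le_trans hx (not_le.1 hy).le

theorem exists_distSq_le : ∃ C : ℝ, ∀ α, ∀ x ∈ D.nearest α, D.distSq x α ≤ C := by
  obtain ⟨C, hC⟩ := (isCompact_Icc (a := (0 : Fin r → ℝ)) (b := 1)).exists_bound_of_continuousOn
    (f := fun v => D.BReal v v) (D.continuous_BReal.comp (continuous_id.prodMk continuous_id)).continuousOn
  refine ⟨C, fun α x hx => (hx fun i => ⌊α i⌋).trans ?_⟩
  have h1 : D.distSq (fun i => ⌊α i⌋) α =
      D.BReal (fun i => Int.fract (α i)) (fun i => Int.fract (α i)) := by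
    unfold distSq
    rw [show toReal (fun i => ⌊α i⌋) - α = (-1 : ℝ) • fun i => Int.fract (α i) by
      ext i; simp [toReal, ← Int.self_sub_floor], D.BReal_smul_left, D.BReal_comm, D.BReal_smul_left]
    ring
  rw [h1]
  exact (le_abs_self _).trans (hC _ ⟨fun i => Int.fract_nonneg _, fun i => (Int.fract_lt_one _).le⟩)

/-- Lattice points nearest to a point lie at a bounded distance. -/
theorem exists_covering_radius : ∃ ρ : ℝ, ∀ α, ∀ x ∈ D.nearest α, ‖toReal x - α‖ ≤ ρ := by
  obtain ⟨f, hf⟩ := D.exists_norm_le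
  obtain ⟨C, hC⟩ := D.exists_distSq_le
  exact ⟨f C, fun α x hx => hf x α C (hC α x hx)⟩

theorem finite_nearest (α : Fin r → ℝ) : (D.nearest α).Finite := by
  obtain ⟨ρ, hρ⟩ := D.exists_covering_radius
  refine (finite_setOf_norm_le (ρ + ‖α‖)).subset fun x hx => ?_
  have h2 := norm_sub_norm_le (toReal x) α
  have := hρ α x hx
  simp only [Set.mem_ofPred_eq]; linarith

theorem nearest_toReal (c : Fin r → ℤ) : D.nearest (toReal c) = {c} := by
  have h0 : D.distSq c (toReal c) = 0 := by
    unfold distSq; rw [sub_self, ← bilin_apply, map_zero]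
  ext x
  rw [Set.mem_singleton_iff]
  refine ⟨fun h => ?_, fun h y => ?_⟩
  · by_contra hne
    have h1 := h c
    rw [h0] at h1
    refine h1.not_gt (D.BReal_self_pos fun h2 => hne (toReal_injective (sub_eq_zero.1 h2)))
  · rw [h, h0]; exact D.distSq_nonneg y _

/-- The value at `1` of the support function: the minimum of `A - dA(α)`. -/
noncomputable def supp (α : Fin r → ℝ) : ℝ := D.excess α (D.nearest_nonempty α).some

theorem supp_le (α : Fin r → ℝ) (x : Fin r → ℤ) : D.supp α ≤ D.excess α x :=
  D.mem_nearest_iff.1 (D.nearest_nonempty α).some_mem x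

theorem mem_nearest {α : Fin r → ℝ} {x : Fin r → ℤ} : x ∈ D.nearest α ↔ D.excess α x = D.supp α :=
  ⟨fun h => le_antisymm (D.mem_nearest_iff.1 h _) (D.supp_le α x),
    fun h => D.mem_nearest_iff.2 fun y => h.le.trans (D.supp_le α y)⟩

theorem excess_combo {α β : Fin r → ℝ} {s t : ℝ} (h : s + t = 1) (x : Fin r → ℤ) :
    D.excess (s • α + t • β) x = s * D.excess α x + t * D.excess β x := by
  unfold excess
  rw [D.dA_combo _ _ _ h]; linear_combination (-(D.A x : ℝ)) * h

/-- The lattice points nearest to an inner point of a segment. -/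
theorem nearest_combo {α β : Fin r → ℝ} {s t : ℝ} (hs : 0 < s) (ht : 0 < t) (h : s + t = 1)
    (hne : (D.nearest α ∩ D.nearest β).Nonempty) :
    D.nearest (s • α + t • β) = D.nearest α ∩ D.nearest β := by
  have hmem : ∀ c ∈ D.nearest α ∩ D.nearest β, c ∈ D.nearest (s • α + t • β) := by
    intro c hc
    refine D.mem_nearest_iff.2 fun y => ?_
    rw [D.excess_combo h, D.excess_combo h]
    gcongr
    · exact D.mem_nearest_iff.1 hc.1 y
    · exact D.mem_nearest_iff.1 hc.2 y
  obtain ⟨c, hc⟩ := hne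
  refine Set.Subset.antisymm (fun x hx => ?_) hmem
  have h1 := D.mem_nearest_iff.1 hx c
  rw [D.excess_combo h, D.excess_combo h, D.mem_nearest.1 hc.1, D.mem_nearest.1 hc.2] at h1
  have h2 := D.supp_le α x
  have h3 := D.supp_le β x
  have h4 : s * D.supp α ≤ s * D.excess α x := by gcongr
  have h5 : t * D.supp β ≤ t * D.excess β x := by gcongr
  refine ⟨D.mem_nearest.2 ?_, D.mem_nearest.2 ?_⟩
  · exact le_antisymm (le_of_mul_le_mul_left (by linarith) hs) h2
  · exact le_antisymm (le_of_mul_le_mul_left (by linarith) ht) h3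

theorem convex_setOf_BReal_le (α : Fin r → ℝ) (C : ℝ) :
    Convex ℝ {v | D.BReal (v - α) (v - α) ≤ C} := by
  intro x hx y hy s t hs ht hst
  have e : s • x + t • y - α = s • (x - α) + t • (y - α) := by
    have : α = s • α + t • α := by rw [← add_smul, hst, one_smul]
    conv_lhs => rw [this]
    rw [smul_sub, smul_sub]; abel
  simp only [Set.mem_ofPred_eq] at hx hy ⊢
  rw [e]
  have h0 := D.BReal_self_nonneg ((x - α) - (y - α))
  have e2 : D.BReal (s • (x - α) + t • (y - α)) (s • (x - α) + t • (y - α)) =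
      s * D.BReal (x - α) (x - α) + t * D.BReal (y - α) (y - α) -
        s * t * D.BReal ((x - α) - (y - α)) ((x - α) - (y - α)) := by
    generalize x - α = u
    generalize y - α = v
    simp only [← bilin_apply, map_sub, map_add, map_smul, LinearMap.sub_apply, LinearMap.add_apply,
      LinearMap.smul_apply, smul_eq_mul]
    simp only [bilin_apply, D.BReal_comm v u]
    have hs' : s = 1 - t := by linarith
    subst hs'; ring
  rw [e2]
  calc _ ≤ s * C + t * C := by nlinarith [mul_nonneg hs ht, mul_nonneg (mul_nonneg hs ht) h0,
          mul_le_mul_of_nonneg_left hx hs, mul_le_mul_of_nonneg_left hy ht]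
    _ = C := by rw [← add_mul, hst, one_mul]

theorem toReal_mem_delCell {α : Fin r → ℝ} {x : Fin r → ℤ} :
    toReal x ∈ D.delCell α ↔ x ∈ D.nearest α := by
  refine ⟨fun h y => ?_, fun h => subset_convexHull ℝ _ ⟨x, h, rfl⟩⟩
  have := convexHull_min (t := {v | D.BReal (v - α) (v - α) ≤ D.distSq y α})
    (by rintro _ ⟨c, hc, rfl⟩; exact hc y) (D.convex_setOf_BReal_le α _) h
  exact this

theorem delCell_subset_iff {α β : Fin r → ℝ} :
    D.delCell α ⊆ D.delCell β ↔ D.nearest α ⊆ D.nearest β :=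
  ⟨fun h x hx => D.toReal_mem_delCell.1 (h (D.toReal_mem_delCell.2 hx)),
    fun h => convexHull_mono (Set.image_mono h)⟩

theorem delCell_eq_iff {α β : Fin r → ℝ} :
    D.delCell α = D.delCell β ↔ D.nearest α = D.nearest β := by
  rw [subset_antisymm_iff, subset_antisymm_iff, D.delCell_subset_iff, D.delCell_subset_iff]

theorem delCell_nonempty (α : Fin r → ℝ) : (D.delCell α).Nonempty :=
  ((D.nearest_nonempty α).image toReal).convexHull

/-- The points to which all points of `S` are nearest. -/
def vor (S : Set (Fin r → ℤ)) : Set (Fin r → ℝ) := {β | S ⊆ D.nearest β}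

theorem isClosed_vor (S : Set (Fin r → ℤ)) : IsClosed (D.vor S) := by
  have : D.vor S = ⋂ x ∈ S, ⋂ y, {β | D.excess β x ≤ D.excess β y} := by
    ext β; simp only [vor, Set.mem_ofPred_eq, Set.mem_iInter, Set.subset_def, D.mem_nearest_iff]
  rw [this]
  refine isClosed_biInter fun x _ => isClosed_iInter fun y => isClosed_le ?_ ?_ <;>
  · unfold excess; exact continuous_const.sub (D.continuous_dA _)

theorem convex_vor {S : Set (Fin r → ℤ)} : Convex ℝ (D.vor S) := by
  intro α hα β hβ s t hs ht hst x hx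
  refine D.mem_nearest_iff.2 fun y => ?_
  rw [D.excess_combo hst, D.excess_combo hst]
  gcongr
  · exact D.mem_nearest_iff.1 (hα hx) y
  · exact D.mem_nearest_iff.1 (hβ hx) y

theorem isCompact_vor {S : Set (Fin r → ℤ)} (hS : S.Nonempty) : IsCompact (D.vor S) := by
  obtain ⟨c, hc⟩ := hS
  obtain ⟨ρ, hρ⟩ := D.exists_covering_radius
  refine Metric.isCompact_of_isClosed_isBounded (D.isClosed_vor S)
    ((Metric.isBounded_closedBall (x := toReal c) (r := ρ)).subset fun β hβ => ?_)
  rw [mem_closedBall_iff_norm']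
  exact hρ β c (hβ hc)

theorem vor_mono {S T : Set (Fin r → ℤ)} (h : S ⊆ T) : D.vor T ⊆ D.vor S := fun _ hβ => h.trans hβ

theorem vor_union (S T : Set (Fin r → ℤ)) : D.vor (S ∪ T) = D.vor S ∩ D.vor T := by
  ext β; exact Set.union_subset_iff

theorem mem_vor_nearest (α : Fin r → ℝ) : α ∈ D.vor (D.nearest α) :=
  Set.Subset.refl (D.nearest α)

theorem voronoi_delCell (α : Fin r → ℝ) : D.voronoi (D.delCell α) = D.vor (D.nearest α) := by
  refine Set.Subset.antisymm (closure_minimal ?_ (D.isClosed_vor _)) fun β hβ => ?_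
  · intro β hβ
    exact (D.delCell_eq_iff.1 hβ).symm.subset
  · have hc : Continuous fun t : ℝ => (1 - t) • β + t • α := by fun_prop
    have h1 := hc.continuousWithinAt (s := Set.Ioo 0 1) (x := 0)
    have h0 : (0 : ℝ) ∈ closure (Set.Ioo 0 1) := by
      rw [closure_Ioo zero_ne_one]; exact ⟨le_rfl, zero_le_one⟩
    have h2 := h1.mem_closure h0 (t := {γ | D.delCell γ = D.delCell α}) fun t ht => by
      refine D.delCell_eq_iff.2 ?_
      rw [D.nearest_combo (by linarith [ht.2]) ht.1 (by ring)
        (by rw [Set.inter_eq_right.2 hβ]; exact D.nearest_nonempty α), Set.inter_eq_right.2 hβ]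
    rwa [sub_zero, one_smul, zero_smul, add_zero] at h2

theorem delCell_toReal (c : Fin r → ℤ) : D.delCell (toReal c) = {toReal c} := by
  unfold delCell; rw [D.nearest_toReal, Set.image_singleton, convexHull_singleton]

theorem voronoi_singleton (c : Fin r → ℤ) : D.voronoi {toReal c} = D.vor {c} := by
  rw [← D.delCell_toReal, D.voronoi_delCell, D.nearest_toReal]

/-- A nonempty `vor S` has a point that is nearest to as few lattice points as possible. -/
theorem exists_vor_eq {S : Set (Fin r → ℤ)} (hS : S.Nonempty) (hne : (D.vor S).Nonempty) :
    ∃ α ∈ D.vor S, ∀ β ∈ D.vor S, D.nearest α ⊆ D.nearest β := by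
  classical
  obtain ⟨n, ⟨α, hα, hn⟩, hmin⟩ := WellFounded.has_min (wellFounded_lt (α := ℕ))
    {n | ∃ α ∈ D.vor S, (D.nearest α).ncard = n} ⟨_, _, hne.some_mem, rfl⟩
  refine ⟨α, hα, fun β hβ => ?_⟩
  have hne' : (D.nearest α ∩ D.nearest β).Nonempty := hS.mono (Set.subset_inter hα hβ)
  have h := D.nearest_combo (s := 1 / 2) (t := 1 / 2) (by norm_num) (by norm_num) (by norm_num) hne'
  have h1 := hmin _ ⟨_, D.convex_vor hα hβ (a := 1 / 2) (b := 1 / 2) (by norm_num) (by norm_num)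
    (by norm_num), rfl⟩
  rw [h, ← hn] at h1
  have := Set.eq_of_subset_of_ncard_le Set.inter_subset_left (not_lt.1 h1) (D.finite_nearest α)
  exact Set.inter_eq_left.1 this

theorem dualDel_vor {S : Set (Fin r → ℤ)} (hS : S.Nonempty) (hne : (D.vor S).Nonempty) :
    ∃ α, D.vor (D.nearest α) = D.vor S ∧ S ⊆ D.nearest α ∧ D.dualDel (D.vor S) = D.delCell α := by
  obtain ⟨α, hα, h⟩ := D.exists_vor_eq hS hne
  refine ⟨α, Set.Subset.antisymm (D.vor_mono hα) h, hα, ?_⟩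
  unfold dualDel delCell
  congr 2
  ext x
  exact ⟨fun hx => hx α hα, fun hx β hβ => h β hβ hx⟩

end DegenerationData
end


section
variable {O K : Type u} [CommRing O] [IsDomain O] [IsDiscreteValuationRing O] [Field K]
  [Algebra O K] [IsFractionRing O K] {r : ℕ}

namespace DegenerationData
variable (D : DegenerationData O K r)

/-- The linear piece of the support function at `α`. -/
noncomputable def lin (α : Fin r → ℝ) (p : ℕ × (Fin r → ℤ)) : ℝ :=
  p.1 * D.supp α + D.dA α (toReal p.2)

theorem lin_zero (α : Fin r → ℝ) : D.lin α 0 = 0 := by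
  simp [lin, toReal_zero, D.dA_zero]

theorem lin_add (α : Fin r → ℝ) (p q : ℕ × (Fin r → ℤ)) :
    D.lin α (p + q) = D.lin α p + D.lin α q := by
  simp only [lin, Prod.fst_add, Prod.snd_add, toReal_add, D.dA_add]; push_cast; ring

theorem lin_nsmul (α : Fin r → ℝ) (n : ℕ) (p : ℕ × (Fin r → ℤ)) :
    D.lin α (n • p) = n * D.lin α p := by
  simp only [lin, Prod.smul_fst, Prod.smul_snd, toReal_nsmul, D.dA_smul, smul_eq_mul]
  push_cast; ring

theorem lin_one_le (α : Fin r → ℝ) (x : Fin r → ℤ) : D.lin α (1, x) ≤ D.A x := by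
  have := D.supp_le α x
  simp only [lin, excess] at *; push_cast; linarith

theorem lin_one_eq_iff {α : Fin r → ℝ} {x : Fin r → ℤ} : D.lin α (1, x) = D.A x ↔ x ∈ D.nearest α := by
  rw [D.mem_nearest]
  simp only [lin, excess]; push_cast
  constructor <;> intro h <;> linarith

theorem lin_eq {α : Fin r → ℝ} {c : Fin r → ℤ} (hc : c ∈ D.nearest α) (p : ℕ × (Fin r → ℤ)) :
    D.lin α p = p.1 * D.A c + D.dA α (toReal (p.2 - p.1 • c)) := by
  rw [D.mem_nearest] at hc
  rw [toReal_sub, toReal_nsmul, D.dA_sub, D.dA_smul, lin, ← hc, excess]; ring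

theorem dA_sub_of_mem {α : Fin r → ℝ} {c c' : Fin r → ℤ} (hc : c ∈ D.nearest α)
    (hc' : c' ∈ D.nearest α) : D.dA α (toReal (c' - c)) = D.A c' - D.A c := by
  have h := D.lin_eq hc (1, c')
  rw [D.lin_one_eq_iff.2 hc'] at h
  simp only [one_smul] at h; push_cast at h; linarith

theorem dA_sub_le_of_mem {α : Fin r → ℝ} {c : Fin r → ℤ} (hc : c ∈ D.nearest α) (c' : Fin r → ℤ) :
    D.dA α (toReal (c' - c)) ≤ D.A c' - D.A c := by
  have := D.dA_sub_le hc c'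
  rw [toReal_sub]; linarith

theorem eventually_nearest_subset (α : Fin r → ℝ) : ∀ᶠ β in nhds α, D.nearest β ⊆ D.nearest α := by
  obtain ⟨ρ, hρ⟩ := D.exists_covering_radius
  obtain ⟨c, hc⟩ := D.nearest_nonempty α
  have hfin : {x : Fin r → ℤ | ‖toReal x‖ ≤ ρ + (‖α‖ + 1)}.Finite := finite_setOf_norm_le _
  have hcont (x : Fin r → ℤ) : Continuous fun β => D.excess β x :=
    continuous_const.sub (D.continuous_dA _)
  have h1 : ∀ᶠ β in nhds α, ∀ y ∈ {x : Fin r → ℤ | ‖toReal x‖ ≤ ρ + (‖α‖ + 1)}, y ∉ D.nearest α →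
      D.excess β c < D.excess β y := by
    rw [Filter.eventually_all_finite hfin]
    intro y _
    by_cases hy : y ∈ D.nearest α
    · exact Filter.Eventually.of_forall fun β h => absurd hy h
    have h2 : D.excess α c < D.excess α y := by
      rw [D.mem_nearest.1 hc]
      exact lt_of_le_of_ne (D.supp_le α y) fun h => hy (D.mem_nearest.2 h.symm)
    filter_upwards [(hcont c).continuousAt.eventually_lt (hcont y).continuousAt h2] with β hβ _
    exact hβ
  filter_upwards [h1, Metric.ball_mem_nhds α one_pos] with β hβ hball x hx
  by_contra hxα
  refine (hβ x ?_ hxα).not_ge (D.mem_nearest_iff.1 hx c)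
  have h3 := hρ β x hx
  have h4 := norm_sub_norm_le (toReal x) β
  have h5 := norm_sub_norm_le β α
  rw [mem_ball_iff_norm] at hball
  change ‖toReal x‖ ≤ _
  linarith

theorem eventually_nearest_add_smul {α v : Fin r → ℝ}
    (h : ∀ c ∈ D.nearest α, ∀ c' ∈ D.nearest α, D.BReal v (toReal c) = D.BReal v (toReal c')) :
    ∀ᶠ t in nhds (0 : ℝ), D.nearest (α + t • v) = D.nearest α := by
  have hc : Filter.Tendsto (fun t : ℝ => α + t • v) (nhds 0) (nhds α) := by
    have : Continuous fun t : ℝ => α + t • v := by fun_prop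
    simpa using this.tendsto 0
  filter_upwards [hc.eventually (D.eventually_nearest_subset α)] with t ht
  refine ht.antisymm fun x hx => ?_
  obtain ⟨c, hc⟩ := D.nearest_nonempty (α + t • v)
  have h1 := D.mem_nearest.1 (ht hc)
  rw [← D.mem_nearest.1 hx] at h1
  rw [D.mem_nearest, ← D.mem_nearest.1 hc]
  simp only [excess, D.dA_add_smul] at h1 ⊢
  rw [h x hx c (ht hc)]; linarith

theorem exists_BReal_eq (f : (Fin r → ℝ) →ₗ[ℝ] ℝ) : ∃ v, ∀ w, f w = D.BReal v w := by
  have hinj : Function.Injective D.bilin := by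
    rw [injective_iff_map_eq_zero]
    intro v hv
    by_contra hne
    exact (D.BReal_self_pos hne).ne' (by rw [← bilin_apply, hv]; rfl)
  have hsurj := (LinearMap.injective_iff_surjective_of_finrank_eq_finrank
    (Subspace.dual_finrank_eq (K := ℝ) (V := Fin r → ℝ)).symm (f := D.bilin)).1 hinj
  obtain ⟨v, hv⟩ := hsurj f
  exact ⟨v, fun w => by rw [← hv]; rfl⟩

/-! ### Maximal linear pieces -/

theorem mem_delCell_of_forall_le {α y : Fin r → ℝ}
    (h : ∀ β, D.supp β + D.dA β y ≤ D.supp α + D.dA α y) : y ∈ D.delCell α := by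
  by_contra hy
  have hcl : IsClosed (D.delCell α) := ((D.finite_nearest α).image toReal).isClosed_convexHull ℝ
  obtain ⟨f, u, hu, hf⟩ := geometric_hahn_banach_point_closed (convex_convexHull ℝ _) hcl hy
  obtain ⟨v, hv⟩ := D.exists_BReal_eq (-f).toLinearMap
  have hpos : ∀ x ∈ D.nearest α, 0 < D.BReal v (y - toReal x) := by
    intro x hx
    rw [← hv]
    have := hf _ (D.toReal_mem_delCell.2 hx)
    simp only [ContinuousLinearMap.coe_coe, map_sub, neg_apply]
    linarith
  have hc : Filter.Tendsto (fun t : ℝ => α + t • v) (nhds 0) (nhds α) := by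
    have : Continuous fun t : ℝ => α + t • v := by fun_prop
    simpa using this.tendsto 0
  obtain ⟨t, ht, ht0⟩ := (((hc.eventually (D.eventually_nearest_subset α)).filter_mono
    nhdsWithin_le_nhds).and (self_mem_nhdsWithin (s := Set.Ioi (0 : ℝ)))).exists
  obtain ⟨x, hx⟩ := D.nearest_nonempty (α + t • v)
  have h1 := h (α + t • v)
  have h2 := mul_pos ht0 (hpos x (ht hx))
  have h3 : D.BReal v (y - toReal x) = D.BReal v y - D.BReal v (toReal x) := (D.bilin v).map_sub _ _
  rw [h3] at h2
  rw [← D.mem_nearest.1 hx, ← D.mem_nearest.1 (ht hx)] at h1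
  simp only [excess, D.dA_add_smul] at h1
  linarith

theorem supp_add_le_of_mem {α y : Fin r → ℝ} (hy : y ∈ D.delCell α) (β : Fin r → ℝ) :
    D.supp β + D.dA β y ≤ D.supp α + D.dA α y := by
  refine convexHull_min (t := {v | D.supp β + D.dA β v ≤ D.supp α + D.dA α v}) ?_ ?_ hy
  · rintro _ ⟨c, hc, rfl⟩
    have h1 := D.lin_one_le β c
    have h2 := D.lin_one_eq_iff.2 hc
    simp only [lin] at h1 h2
    simp only [Set.mem_ofPred_eq]; push_cast at h1 h2; linarith
  · have : {v | D.supp β + D.dA β v ≤ D.supp α + D.dA α v} =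
        {v | (D.dALin β - D.dALin α) v ≤ D.supp α - D.supp β} := by
      ext v
      simp only [Set.mem_ofPred_eq, LinearMap.sub_apply, dALin_apply]
      constructor <;> intro h <;> linarith
    rw [this]
    exact convex_halfSpace_le (D.dALin β - D.dALin α).isLinear _

/-- Every point belongs to a Delaunay cell. -/
theorem exists_mem_delCell (y : Fin r → ℝ) : ∃ α, y ∈ D.delCell α := by
  obtain ⟨C, hC⟩ := D.exists_distSq_le
  obtain ⟨ε, hε, hB⟩ := D.exists_BReal_ge
  let Φ : (Fin r → ℝ) → ℝ := fun α => D.supp α + D.dA α y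
  have key (α : Fin r → ℝ) : Φ α ≤ Φ y + C / 2 - ε * ‖α - y‖ ^ 2 / 2 := by
    obtain ⟨x, hx⟩ := D.nearest_nonempty α
    obtain ⟨z, hz⟩ := D.nearest_nonempty y
    have h1 := D.distSq_eq x α
    have h2 := D.distSq_eq z y
    have h3 := hC α x hx
    have h4 := D.distSq_nonneg z y
    have h5 := hB (α - y)
    have h6 : D.BReal (α - y) (α - y) = D.BReal α α - 2 * D.BReal α y + D.BReal y y := by
      simp only [← bilin_apply, map_sub, LinearMap.sub_apply]
      simp only [bilin_apply, D.BReal_comm y α]; ring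
    rw [D.mem_nearest.1 hx] at h1
    rw [D.mem_nearest.1 hz] at h2
    simp only [Φ, dA]
    linarith
  have husc : UpperSemicontinuous Φ := by
    intro α t ht
    obtain ⟨c, hc⟩ := D.nearest_nonempty α
    have hcont : Continuous fun β => D.excess β c + D.dA β y :=
      (continuous_const.sub (D.continuous_dA _)).add (D.continuous_dA y)
    have h0 : D.excess α c + D.dA α y < t := by rw [D.mem_nearest.1 hc]; exact ht
    filter_upwards [hcont.continuousAt.eventually_lt continuousAt_const h0] with β hβ
    exact (add_le_add_left (D.supp_le β c) _).trans_lt hβ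
  obtain ⟨α, hα, hmax⟩ := (husc.upperSemicontinuousOn _).exists_isMaxOn
    (s := Metric.closedBall y (√(C / ε))) ⟨y, Metric.mem_closedBall_self (Real.sqrt_nonneg _)⟩
    (isCompact_closedBall _ _)
  refine ⟨α, D.mem_delCell_of_forall_le fun β => ?_⟩
  by_cases hβ : β ∈ Metric.closedBall y (√(C / ε))
  · exact hmax hβ
  · have h1 : Φ y ≤ Φ α := hmax (Metric.mem_closedBall_self (Real.sqrt_nonneg _))
    have h2 := key β
    rw [mem_closedBall_iff_norm, not_le] at hβ
    have h3 := Real.lt_sq_of_sqrt_lt hβ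
    rw [div_lt_iff₀ hε] at h3
    change Φ β ≤ Φ α
    linarith

/-- The intersection of two Delaunay cells. -/
theorem exists_inter_delCell {α β : Fin r → ℝ} (h : (D.delCell α ∩ D.delCell β).Nonempty) :
    ∃ γ, D.delCell γ = D.delCell α ∩ D.delCell β ∧ D.nearest γ = D.nearest α ∩ D.nearest β := by
  let γ := (1 / 2 : ℝ) • α + (1 / 2 : ℝ) • β
  have hγ (x : Fin r → ℤ) : D.excess γ x = 1 / 2 * D.excess α x + 1 / 2 * D.excess β x :=
    D.excess_combo (by norm_num) x
  have hle : 1 / 2 * D.supp α + 1 / 2 * D.supp β ≤ D.supp γ := by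
    obtain ⟨x, hx⟩ := D.nearest_nonempty γ
    rw [← D.mem_nearest.1 hx, hγ]
    have := D.supp_le α x
    have := D.supp_le β x
    linarith
  have hdA (v : Fin r → ℝ) : D.dA γ v = 1 / 2 * D.dA α v + 1 / 2 * D.dA β v :=
    D.dA_combo _ _ _ (by norm_num)
  have hmax {y} (hy : y ∈ D.delCell α ∩ D.delCell β) (δ : Fin r → ℝ) :
      D.supp δ + D.dA δ y ≤ D.supp γ + D.dA γ y := by
    rw [hdA]
    have h1 := D.supp_add_le_of_mem hy.1 δ
    have h2 := D.supp_add_le_of_mem hy.2 δ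
    linarith
  have hne : (D.nearest α ∩ D.nearest β).Nonempty := by
    obtain ⟨y, hy⟩ := h
    obtain ⟨c, hc⟩ := D.nearest_nonempty γ
    have h1 := D.supp_add_le_of_mem hy.1 γ
    have h2 := D.supp_add_le_of_mem hy.2 γ
    have h3 := D.supp_le α c
    have h4 := D.supp_le β c
    have h5 := D.mem_nearest.1 hc
    rw [hγ] at h5
    rw [hdA] at h1 h2
    exact ⟨c, D.mem_nearest.2 (by linarith), D.mem_nearest.2 (by linarith)⟩
  have hn := D.nearest_combo (s := 1 / 2) (t := 1 / 2) (by norm_num) (by norm_num) (by norm_num) hne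
  refine ⟨γ, Set.Subset.antisymm (Set.subset_inter (D.delCell_subset_iff.2 ?_)
    (D.delCell_subset_iff.2 ?_)) fun y hy => D.mem_delCell_of_forall_le (hmax hy), hn⟩
  · exact hn.subset.trans Set.inter_subset_left
  · exact hn.subset.trans Set.inter_subset_right

theorem eq_zero_of_forall_dA_le {v : Fin r → ℝ} {C : ℝ} (h : ∀ β, D.dA β v ≤ C) : v = 0 := by
  by_contra hv
  have hpos := D.BReal_self_pos hv
  have h1 := h (((C - D.lReal v / 2 + 1) / D.BReal v v) • v)
  simp only [dA, D.BReal_smul_left, div_mul_cancel₀ _ hpos.ne'] at h1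
  linarith

/-- The linear piece at `α` is maximal at `(d, x)` exactly for `x ∈ d σ`, where `σ` is the cell of `α`. -/
theorem forall_lin_le_iff {α : Fin r → ℝ} {p : ℕ × (Fin r → ℤ)} :
    (∀ β, D.lin β p ≤ D.lin α p) ↔ toReal p.2 ∈ (p.1 : ℝ) • D.delCell α := by
  obtain ⟨d, x⟩ := p
  obtain rfl | hd := Nat.eq_zero_or_pos d
  · simp only [lin, Nat.cast_zero, zero_mul, zero_add]
    rw [Set.zero_smul_set (D.delCell_nonempty α), Set.mem_zero]
    exact ⟨fun h => D.eq_zero_of_forall_dA_le h, fun h β => by rw [h, D.dA_zero, D.dA_zero]⟩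
  have hd' : (0 : ℝ) < d := by exact_mod_cast hd
  have e (β : Fin r → ℝ) : D.lin β (d, x) = d * (D.supp β + D.dA β ((d : ℝ)⁻¹ • toReal x)) := by
    rw [D.dA_smul]; simp only [lin]; field_simp
  rw [Set.mem_smul_set_iff_inv_smul_mem₀ hd'.ne']
  simp only [e, mul_le_mul_iff_right₀ hd']
  exact ⟨D.mem_delCell_of_forall_le, D.supp_add_le_of_mem⟩

theorem exists_forall_lin_le {p : ℕ × (Fin r → ℤ)} (hp : p.1 ≠ 0) : ∃ α, ∀ β, D.lin β p ≤ D.lin α p := by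
  obtain ⟨α, hα⟩ := D.exists_mem_delCell ((p.1 : ℝ)⁻¹ • toReal p.2)
  refine ⟨α, D.forall_lin_le_iff.2 ?_⟩
  rwa [Set.mem_smul_set_iff_inv_smul_mem₀ (by exact_mod_cast hp)]

/-! ### Rationality -/

theorem exists_ratLinear : ∃ f : ℝ →ₗ[ℚ] ℚ, ∀ q : ℚ, f q = q := by
  obtain ⟨f, hf⟩ := (Algebra.linearMap ℚ ℝ).exists_leftInverse_of_injective
    (LinearMap.ker_eq_bot.2 (algebraMap ℚ ℝ).injective)
  exact ⟨f, fun q => LinearMap.congr_fun hf q⟩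

theorem _root_.exists_nat_mul_eq_intCast {ι : Type*} [Fintype ι] (q : ι → ℚ) :
    ∃ N : ℕ, 0 < N ∧ ∀ i, ∃ z : ℤ, (N : ℚ) * q i = z := by
  refine ⟨∏ i, (q i).den, Finset.prod_pos fun i _ => (q i).den_pos, fun i => ?_⟩
  obtain ⟨c, hc⟩ : (q i).den ∣ ∏ i, (q i).den :=
    Finset.dvd_prod_of_mem (fun i => (q i).den) (Finset.mem_univ i)
  refine ⟨c * (q i).num, ?_⟩
  have h1 : (q i : ℚ) * (q i).den = (q i).num := Rat.mul_den_eq_num (q i)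
  rw [hc]; push_cast; rw [← h1]; ring

/-- A multiple of a lattice point of the cone over a lattice polytope is a sum of vertices. -/
theorem _root_.exists_nsmul_mem_closure {S : Set (Fin r → ℤ)} {p : ℕ × (Fin r → ℤ)}
    (hp : toReal p.2 ∈ (p.1 : ℝ) • convexHull ℝ (toReal '' S)) :
    ∃ N : ℕ, 0 < N ∧ N • p ∈ AddSubmonoid.closure ((fun c => ((1, c) : ℕ × (Fin r → ℤ))) '' S) := by
  obtain ⟨y, hy, hyx⟩ := hp
  obtain ⟨ι, _, z, w, hz, hind, hw, hw1, hwy⟩ := eq_pos_convex_span_of_mem_convexHull hy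
  choose c hcS hcz using fun i => hz (Set.mem_range_self i)
  obtain ⟨d, x⟩ := p
  obtain rfl | hd := Nat.eq_zero_or_pos d
  · refine ⟨1, one_pos, ?_⟩
    have : x = 0 := toReal_injective (by rw [toReal_zero, ← hyx]; simp)
    rw [this]
    rw [one_nsmul]
    exact zero_mem (AddSubmonoid.closure ((fun c => ((1, c) : ℕ × (Fin r → ℤ))) '' S))
  have hd' : (d : ℝ) ≠ 0 := by exact_mod_cast hd.ne'
  obtain ⟨f, hf⟩ := exists_ratLinear
  have hfw : ∀ i, ((f (w i) : ℚ) : ℝ) = w i := by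
    intro i
    have h1 : ∑ i, (((f (w i) : ℚ) : ℝ) - w i) = 0 := by
      rw [Finset.sum_sub_distrib, hw1, ← Rat.cast_sum, ← map_sum, hw1]
      have := hf 1
      rw [Rat.cast_one] at this; rw [this]; simp
    have h2 : ∑ i, (((f (w i) : ℚ) : ℝ) - w i) • z i = 0 := by
      simp only [sub_smul, Finset.sum_sub_distrib, hwy]
      rw [sub_eq_zero]
      ext j
      have hyj : y j = ((x j / d : ℚ) : ℝ) := by
        have := congrFun hyx j
        simp only [Pi.smul_apply, smul_eq_mul, toReal] at this
        push_cast; rw [← this]; field_simp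
      have h3 : ∑ i, w i * (c i j : ℝ) = y j := by
        rw [← hwy]; simp [← hcz, toReal]
      have h4 : ∑ i, f (w i) * (c i j : ℚ) = x j / d := by
        rw [← hf (x j / d : ℚ), ← hyj, ← h3, map_sum]
        refine Finset.sum_congr rfl fun i _ => ?_
        rw [mul_comm, mul_comm (w i)]
        have := f.map_smul (c i j : ℚ) (w i)
        rw [smul_eq_mul, Rat.smul_def] at this
        rw [← this]; push_cast; rfl
      rw [hyj, ← h4]
      simp [← hcz, toReal]
    have := affineIndependent_iff.1 hind Finset.univ _ h1 h2 i (Finset.mem_univ i)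
    linarith
  obtain ⟨N, hN, hNz⟩ := exists_nat_mul_eq_intCast fun i => f (w i)
  choose n hn using hNz
  have hnn (i) : 0 ≤ n i := by
    have h1 : (n i : ℝ) = N * w i := by rw [← hfw i, ← Rat.cast_natCast, ← Rat.cast_mul, hn]; simp
    have : (0 : ℝ) ≤ n i := by rw [h1]; exact mul_nonneg (Nat.cast_nonneg _) (hw i).le
    exact_mod_cast this
  have hn' (i) : (((n i).toNat : ℕ) : ℝ) = N * w i := by
    rw [← hfw i, ← Rat.cast_natCast N, ← Rat.cast_mul, hn]
    have : (((n i).toNat : ℤ)) = n i := Int.toNat_of_nonneg (hnn i)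
    simp only [Rat.cast_intCast]
    exact_mod_cast congrArg (Int.cast : ℤ → ℝ) this
  have hsum : N • ((d, x) : ℕ × (Fin r → ℤ)) =
      ∑ i, (d * (n i).toNat) • ((1, c i) : ℕ × (Fin r → ℤ)) := by
    refine Prod.ext ?_ ?_
    · rw [Prod.fst_sum]
      have : ((N * d : ℕ) : ℝ) = ((∑ i, d * (n i).toNat : ℕ) : ℝ) := by
        push_cast
        rw [← Finset.mul_sum]; simp only [hn']; rw [← Finset.mul_sum, hw1]; ring
      have := Nat.cast_injective this
      simpa using this
    · rw [Prod.snd_sum]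
      apply toReal_injective
      have hs : toReal (∑ i, (d * (n i).toNat) • c i) = ∑ i, ((d * (n i).toNat : ℕ) : ℝ) • z i := by
        rw [toReal_sum]
        exact Finset.sum_congr rfl fun i _ => by rw [toReal_nsmul, hcz]
      simp only [Prod.smul_snd]
      rw [hs, toReal_nsmul, ← hyx, ← hwy]
      simp only [Finset.smul_sum, smul_smul]
      refine Finset.sum_congr rfl fun i _ => ?_
      push_cast; rw [hn']; congr 1; ring
  refine ⟨N, hN, ?_⟩
  rw [hsum]
  exact AddSubmonoid.sum_mem _ fun i _ =>
    AddSubmonoid.nsmul_mem _ (AddSubmonoid.subset_closure (Set.mem_image_of_mem _ (hcS i))) _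

end DegenerationData
end


section
variable {O K : Type u} [CommRing O] [IsDomain O] [IsDiscreteValuationRing O] [Field K]
  [Algebra O K] [IsFractionRing O K] {r : ℕ}

namespace DegenerationData
variable (D : DegenerationData O K r)

/-! ### Cells of full dimension -/

theorem vectorSpan_delCell (α : Fin r → ℝ) :
    vectorSpan ℝ (D.delCell α) = vectorSpan ℝ (toReal '' D.nearest α) := by
  unfold delCell
  rw [← direction_affineSpan, affineSpan_convexHull, direction_affineSpan]

theorem cellDim_eq_iff {α : Fin r → ℝ} :
    cellDim (D.delCell α) = r ↔ vectorSpan ℝ (D.delCell α) = ⊤ := by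
  unfold cellDim
  refine ⟨fun h => Submodule.eq_top_of_finrank_eq (by rw [h]; simp), fun h => by rw [h]; simp⟩

/-- A linear form that vanishes on the differences of vertices vanishes on the vector span. -/
theorem eq_zero_of_mem_vectorSpan {α : Fin r → ℝ} {c : Fin r → ℤ} (hc : c ∈ D.nearest α)
    {M : Type*} [AddCommGroup M] [Module ℝ M] (f : (Fin r → ℝ) →ₗ[ℝ] M)
    (hf : ∀ x ∈ D.nearest α, f (toReal (x - c)) = 0)
    {v : Fin r → ℝ} (hv : v ∈ vectorSpan ℝ (D.delCell α)) : f v = 0 := by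
  rw [D.vectorSpan_delCell, vectorSpan_eq_span_vsub_set_right ℝ (Set.mem_image_of_mem _ hc)] at hv
  refine (Submodule.span_le (p := LinearMap.ker f)).2 ?_ hv
  rintro _ ⟨_, ⟨x, hx, rfl⟩, rfl⟩
  simp only [vsub_eq_sub, SetLike.mem_coe, LinearMap.mem_ker]
  rw [← toReal_sub, hf x hx]

theorem sub_mem_vectorSpan {α : Fin r → ℝ} {x c : Fin r → ℤ} (hx : x ∈ D.nearest α)
    (hc : c ∈ D.nearest α) : toReal (x - c) ∈ vectorSpan ℝ (D.delCell α) := by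
  rw [toReal_sub]
  exact vsub_mem_vectorSpan ℝ (D.toReal_mem_delCell.2 hx) (D.toReal_mem_delCell.2 hc)

theorem eq_of_nearest_subset {α β : Fin r → ℝ} (hα : cellDim (D.delCell α) = r)
    (h : D.nearest α ⊆ D.nearest β) : β = α := by
  by_contra hne
  obtain ⟨c, hc⟩ := D.nearest_nonempty α
  refine (D.BReal_self_pos (sub_ne_zero.2 hne)).ne' ?_
  refine D.eq_zero_of_mem_vectorSpan hc (D.bilin (β - α)) (fun x hx => ?_)
    (v := β - α) (by rw [D.cellDim_eq_iff.1 hα]; trivial)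
  rw [bilin_apply, ← D.dA_sub_left, D.dA_sub_of_mem hc hx, D.dA_sub_of_mem (h hc) (h hx), sub_self]

theorem vor_nearest_of_cellDim_eq {α : Fin r → ℝ} (hα : cellDim (D.delCell α) = r) :
    D.vor (D.nearest α) = {α} :=
  Set.Subset.antisymm (fun _ hβ => D.eq_of_nearest_subset hα hβ)
    (Set.singleton_subset_iff.2 (D.mem_vor_nearest α))

theorem cellDim_eq_of_mem_extremePoints {S : Set (Fin r → ℤ)} {β : Fin r → ℝ}
    (hβ : β ∈ (D.vor S).extremePoints ℝ) : cellDim (D.delCell β) = r := by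
  rw [D.cellDim_eq_iff]
  by_contra htop
  obtain ⟨f, hf0, hf⟩ := Submodule.exists_le_ker_of_lt_top _ (lt_top_iff_ne_top.2 htop)
  obtain ⟨v, hv⟩ := D.exists_BReal_eq f
  have hv0 : v ≠ 0 := by
    rintro rfl
    exact hf0 (LinearMap.ext fun w => by
      rw [hv, ← bilin_apply, map_zero])
  have hconst : ∀ c ∈ D.nearest β, ∀ c' ∈ D.nearest β, D.BReal v (toReal c) = D.BReal v (toReal c') := by
    intro c hc c' hc'
    have h1 := hf (D.sub_mem_vectorSpan hc hc')
    rw [LinearMap.mem_ker, toReal_sub, map_sub, hv, hv] at h1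
    linarith
  have hev := D.eventually_nearest_add_smul hconst
  obtain ⟨ε, hε, hball⟩ := Metric.eventually_nhds_iff.1 hev
  have hε2 : 0 < ε / 2 := by positivity
  have hmem (t : ℝ) (ht : |t| < ε) : β + t • v ∈ D.vor S := by
    change S ⊆ D.nearest (β + t • v)
    rw [hball (by rwa [Real.dist_eq, sub_zero])]
    exact hβ.1
  have h1 := hmem (ε / 2) (by rw [abs_of_pos hε2]; linarith)
  have h2 := hmem (-(ε / 2)) (by rw [abs_neg, abs_of_pos hε2]; linarith)
  have h3 := hβ.2 h1 h2 ⟨1 / 2, 1 / 2, by norm_num, by norm_num, by norm_num, by module⟩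
  have h4 : (ε / 2) • v = 0 := by simpa using h3
  exact hv0 ((smul_eq_zero.1 h4).resolve_left hε2.ne')

/-- A linear form attains its maximum on a Voronoi cell at the hole of a maximal cell. -/
theorem exists_forall_dA_le {S : Set (Fin r → ℤ)} (hS : S.Nonempty) (hne : (D.vor S).Nonempty)
    (v : Fin r → ℝ) :
    ∃ β ∈ D.vor S, cellDim (D.delCell β) = r ∧ ∀ γ ∈ D.vor S, D.dA γ v ≤ D.dA β v := by
  let ℓ : (Fin r → ℝ) →L[ℝ] ℝ := LinearMap.toContinuousLinearMap (D.bilin v)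
  have hℓ (β) : ℓ β = D.dA β v - D.lReal v / 2 := by
    simp only [dA, D.BReal_comm β v]; ring_nf; rfl
  have hexp : IsExposed ℝ (D.vor S) (ℓ.toExposed (D.vor S)) := ContinuousLinearMap.toExposed.isExposed
  have hcomp := D.isCompact_vor hS
  obtain ⟨β₀, hβ₀, hmax⟩ := hcomp.exists_isMaxOn hne ℓ.continuous.continuousOn
  obtain ⟨β, hβ⟩ := (hexp.isCompact hcomp).extremePoints_nonempty ⟨β₀, hβ₀, fun y hy => hmax hy⟩
  refine ⟨β, hβ.1.1, D.cellDim_eq_of_mem_extremePoints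
    (hexp.isExtreme.extremePoints_subset_extremePoints hβ), fun γ hγ => ?_⟩
  have := hβ.1.2 γ hγ
  rw [hℓ, hℓ] at this
  linarith

theorem exists_maximal_cell {S : Set (Fin r → ℤ)} (hS : S.Nonempty) (hne : (D.vor S).Nonempty) :
    ∃ β ∈ D.vor S, cellDim (D.delCell β) = r := by
  obtain ⟨β, h, h', _⟩ := D.exists_forall_dA_le hS hne 0
  exact ⟨β, h, h'⟩

theorem finite_holes (c : Fin r → ℤ) : {β | cellDim (D.delCell β) = r ∧ c ∈ D.nearest β}.Finite := by
  obtain ⟨ρ, hρ⟩ := D.exists_covering_radius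
  have hfin : {x : Fin r → ℤ | ‖toReal x‖ ≤ ρ + (ρ + ‖toReal c‖)}.Finite := finite_setOf_norm_le _
  refine Set.Finite.of_finite_image (f := D.nearest) (hfin.powerset.subset ?_) ?_
  · rintro _ ⟨β, ⟨_, hβ⟩, rfl⟩ x hx
    have h1 := hρ β x hx
    have h2 := hρ β c hβ
    have h3 := norm_sub_norm_le (toReal x) β
    have h4 := norm_sub_norm_le β (toReal c)
    rw [norm_sub_rev] at h4
    change ‖toReal x‖ ≤ _
    linarith
  · intro β hβ γ hγ h
    exact (D.eq_of_nearest_subset hβ.1 h.subset).symm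

theorem vor_singleton_nonempty (c : Fin r → ℤ) : (D.vor {c}).Nonempty :=
  ⟨toReal c, Set.singleton_subset_iff.2 (by rw [D.nearest_toReal]; rfl)⟩

theorem mem_vor_singleton {c : Fin r → ℤ} {β : Fin r → ℝ} : β ∈ D.vor {c} ↔ c ∈ D.nearest β :=
  Set.singleton_subset_iff

/-- The linear inequalities of the cone over a face of a Voronoi cell. -/
theorem exists_nat_forall_dA_le {S : Finset (Fin r → ℤ)} {c : Fin r → ℤ} (hc : c ∈ S)
    {x : Fin r → ℤ} {n : ℝ} (h : ∀ β ∈ D.vor S, D.dA β (toReal x) ≤ n) :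
    ∃ N : ℕ, ∀ β ∈ D.vor {c}, D.dA β (toReal (x + N • ∑ c' ∈ S, (c' - c))) ≤
      n + N * ∑ c' ∈ S, ((D.A c' : ℝ) - D.A c) := by
  let φ (β : Fin r → ℝ) : ℝ := ∑ c' ∈ S, ((D.A c' : ℝ) - D.A c - D.dA β (toReal (c' - c)))
  have e (β) (N : ℕ) : D.dA β (toReal (x + N • ∑ c' ∈ S, (c' - c))) =
      D.dA β (toReal x) + N * ∑ c' ∈ S, D.dA β (toReal (c' - c)) := by
    rw [toReal_add, toReal_nsmul, toReal_sum, D.dA_add, D.dA_smul, ← dALin_apply D _ (∑ c' ∈ S, _),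
      map_sum]; rfl
  have hφ (β) (N : ℕ) : D.dA β (toReal (x + N • ∑ c' ∈ S, (c' - c))) ≤
      n + N * ∑ c' ∈ S, ((D.A c' : ℝ) - D.A c) ↔ D.dA β (toReal x) - n ≤ N * φ β := by
    rw [e]
    simp only [φ, Finset.sum_sub_distrib, mul_sub]
    constructor <;> intro h <;> linarith
  have hterm {β} (hβ : c ∈ D.nearest β) (c' : Fin r → ℤ) :
      0 ≤ (D.A c' : ℝ) - D.A c - D.dA β (toReal (c' - c)) := by
    have := D.dA_sub_le_of_mem hβ c'; linarith
  have hex : ∀ β ∈ {β | cellDim (D.delCell β) = r ∧ c ∈ D.nearest β},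
      ∃ N : ℕ, ∀ M ≥ N, D.dA β (toReal x) - n ≤ M * φ β := by
    rintro β ⟨_, hβ⟩
    obtain h0 | h0 := (Finset.sum_nonneg fun c' (_ : c' ∈ S) => hterm hβ c').eq_or_lt
    · refine ⟨0, fun M _ => ?_⟩
      have hmem : β ∈ D.vor S := by
        intro c' hc'
        have h1 := (Finset.sum_eq_zero_iff_of_nonneg fun c' (_ : c' ∈ S) => hterm hβ c').1 h0.symm c' hc'
        rw [D.mem_nearest, ← D.mem_nearest.1 hβ]
        rw [toReal_sub, D.dA_sub] at h1
        simp only [excess]; linarith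
      have h2 : φ β = 0 := h0.symm
      rw [h2, mul_zero]
      linarith [h β hmem]
    · obtain ⟨N, hN⟩ := exists_nat_ge ((D.dA β (toReal x) - n) / φ β)
      refine ⟨N, fun M hM => ?_⟩
      have h3 : (0 : ℝ) < φ β := h0
      rw [← div_le_iff₀ h3]
      exact hN.trans (by exact_mod_cast hM)
  choose! N hN using hex
  refine ⟨(D.finite_holes c).toFinset.sup N, ?_⟩
  obtain ⟨β, hβ, hdim, hmax⟩ := D.exists_forall_dA_le (Set.singleton_nonempty c)
    (D.vor_singleton_nonempty c)
    (toReal (x + ((D.finite_holes c).toFinset.sup N) • ∑ c' ∈ S, (c' - c)))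
  intro γ hγ
  refine (hmax γ hγ).trans ((hφ β _).2 (hN β ⟨hdim, D.mem_vor_singleton.1 hβ⟩ _ ?_))
  exact Finset.le_sup (f := N) ((D.finite_holes c).mem_toFinset.2 ⟨hdim, D.mem_vor_singleton.1 hβ⟩)

theorem eta_spec (x c : Fin r → ℤ) : ∃ β, c ∈ D.nearest β ∧ D.eta x c = D.dA β (toReal x) ∧
    ∀ γ, c ∈ D.nearest γ → D.dA γ (toReal x) ≤ D.eta x c := by
  obtain ⟨β, hβ, hdim, hmax⟩ := D.exists_forall_dA_le (Set.singleton_nonempty c)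
    (D.vor_singleton_nonempty c) (toReal x)
  rw [D.mem_vor_singleton] at hβ
  have h : D.eta x c = D.dA β (toReal x) := by
    refine IsGreatest.csSup_eq ⟨⟨β, hdim, D.toReal_mem_delCell.2 hβ, rfl⟩, ?_⟩
    rintro _ ⟨γ, _, hγ, rfl⟩
    exact hmax γ (D.mem_vor_singleton.2 (D.toReal_mem_delCell.1 hγ))
  exact ⟨β, hβ, h, fun γ hγ => h ▸ hmax γ (D.mem_vor_singleton.2 hγ)⟩

/-- The differential of `A` at the hole of a maximal cell is rational. -/
theorem exists_denominator {α : Fin r → ℝ} (hα : cellDim (D.delCell α) = r) :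
    ∃ m : ℕ, 0 < m ∧ ∀ x, ∃ z : ℤ, m * D.dA α (toReal x) = z := by
  obtain ⟨f, hf⟩ := exists_ratLinear
  obtain ⟨c, hc⟩ := D.nearest_nonempty α
  let e (i : Fin r) : Fin r → ℝ := Pi.single i 1
  let g : (Fin r → ℝ) →ₗ[ℝ] ℝ := Fintype.linearCombination ℝ fun i => ((f (D.dA α (e i)) : ℚ) : ℝ)
  have hg (v) : g v = ∑ i, v i * ((f (D.dA α (e i)) : ℚ) : ℝ) := by
    simp [g, Fintype.linearCombination_apply]
  have hsum (v : Fin r → ℝ) : D.dA α v = ∑ i, v i * D.dA α (e i) := by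
    conv_lhs => rw [pi_eq_sum_univ' v, ← dALin_apply, map_sum]
    exact Finset.sum_congr rfl fun i _ => by
      rw [map_smul, dALin_apply, smul_eq_mul]
  have hlat (x : Fin r → ℤ) : g (toReal x) = f (D.dA α (toReal x)) := by
    rw [hg, hsum, map_sum]; push_cast
    refine Finset.sum_congr rfl fun i _ => ?_
    have := f.map_smul (x i : ℚ) (D.dA α (e i))
    rw [Rat.smul_def, smul_eq_mul] at this
    rw [toReal, ← Rat.cast_intCast, this]; push_cast; rfl
  have heq (v) : (g - D.dALin α) v = 0 := by
    refine D.eq_zero_of_mem_vectorSpan hc _ (fun x hx => ?_)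
      (by rw [D.cellDim_eq_iff.1 hα]; trivial)
    rw [LinearMap.sub_apply, dALin_apply, hlat, D.dA_sub_of_mem hc hx]
    have := hf (D.A x - D.A c)
    push_cast at this ⊢
    rw [this]; push_cast; ring
  obtain ⟨m, hm, hz⟩ := exists_nat_mul_eq_intCast fun i => f (D.dA α (e i))
  choose z hz using hz
  refine ⟨m, hm, fun x => ⟨∑ i, x i * z i, ?_⟩⟩
  have h1 := heq (toReal x)
  rw [LinearMap.sub_apply, dALin_apply, sub_eq_zero, hg] at h1
  rw [← h1, Finset.mul_sum]; push_cast
  refine Finset.sum_congr rfl fun i _ => ?_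
  have h2 : ((m : ℝ) * (f (D.dA α (e i)) : ℚ)) = z i := by exact_mod_cast hz i
  rw [← h2, toReal]; ring

/-! ### The lattice of an orbit -/

/-- An integral valued affine function on a Voronoi cell is constant. -/
theorem dA_eq_of_forall_int {S : Set (Fin r → ℤ)} {v : Fin r → ℝ} {a : ℝ}
    (h : ∀ β ∈ D.vor S, ∃ n : ℤ, a + D.dA β v = n) {α β : Fin r → ℝ} (hα : α ∈ D.vor S)
    (hβ : β ∈ D.vor S) : D.dA α v = D.dA β v := by
  have hcont : Continuous fun β => a + D.dA β v := continuous_const.add (D.continuous_dA v)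
  have hpre := D.convex_vor.isPreconnected (s := D.vor S)
  choose! f hf using h
  by_contra hne
  wlog hlt : D.dA α v < D.dA β v generalizing α β
  · exact this hβ hα (Ne.symm hne) (lt_of_le_of_ne (not_lt.1 hlt) (Ne.symm hne))
  have h1 : f α < f β := by
    have h1 := hf α hα
    have h2 := hf β hβ
    have : (f α : ℝ) < f β := by linarith
    exact_mod_cast this
  have h2 : (f α : ℝ) + 1 ≤ f β := by exact_mod_cast h1
  obtain ⟨γ, hγ, hγe⟩ := hpre.intermediate_value hα hβ hcont.continuousOn
    (show (f α : ℝ) + 1 / 2 ∈ Set.Icc _ _ by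
      simp only [hf α hα, hf β hβ]; constructor <;> linarith)
  simp only [hf γ hγ] at hγe
  have h3 : (2 * f γ : ℤ) = 2 * f α + 1 := by
    have : (2 * f γ : ℝ) = 2 * f α + 1 := by linarith
    exact_mod_cast this
  omega

/-- The characters of the orbit of the cell of `α`. -/
def orbLattice (α : Fin r → ℝ) : AddSubgroup (Fin r → ℤ) where
  carrier := {x | (∃ n : ℤ, D.dA α (toReal x) = n) ∧
    ∀ β ∈ D.vor (D.nearest α), D.dA β (toReal x) = D.dA α (toReal x)}
  zero_mem' := ⟨⟨0, by simp [toReal_zero, D.dA_zero]⟩, fun β _ => by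
    simp [toReal_zero, D.dA_zero]⟩
  add_mem' := by
    rintro x y ⟨⟨m, hm⟩, hx⟩ ⟨⟨n, hn⟩, hy⟩
    refine ⟨⟨m + n, by rw [toReal_add, D.dA_add, hm, hn]; push_cast; rfl⟩, fun β hβ => ?_⟩
    rw [toReal_add, D.dA_add, D.dA_add, hx β hβ, hy β hβ]
  neg_mem' := by
    rintro x ⟨⟨m, hm⟩, hx⟩
    refine ⟨⟨-m, by rw [toReal_neg, D.dA_neg, hm]; push_cast; rfl⟩, fun β hβ => ?_⟩
    rw [toReal_neg, D.dA_neg, D.dA_neg, hx β hβ]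

theorem inLattice_iff {α : Fin r → ℝ} {c : Fin r → ℤ} (hc : c ∈ D.nearest α) {p : ℕ × (Fin r → ℤ)} :
    D.InLattice (D.delCell α) p ↔ p.2 - p.1 • c ∈ D.orbLattice α := by
  unfold InLattice
  rw [D.voronoi_delCell]
  constructor
  · intro h
    have h1 : ∀ β ∈ D.vor (D.nearest α), ∃ n : ℤ,
        p.1 * D.A c + D.dA β (toReal (p.2 - p.1 • c)) = n :=
      fun β hβ => h β hβ c (D.toReal_mem_delCell.2 hc)
    refine ⟨?_, fun β hβ => D.dA_eq_of_forall_int h1 hβ (D.mem_vor_nearest α)⟩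
    obtain ⟨n, hn⟩ := h1 α (D.mem_vor_nearest α)
    exact ⟨n - p.1 * D.A c, by push_cast; linarith⟩
  · rintro ⟨⟨n, hn⟩, hx⟩ β hβ c' hc'
    rw [D.toReal_mem_delCell] at hc'
    rw [← D.lin_eq (hβ hc'), D.lin_eq (hβ hc), hx β hβ, hn]
    exact ⟨p.1 * D.A c + n, by push_cast; rfl⟩

theorem sub_mem_orbLattice {α : Fin r → ℝ} {c c' : Fin r → ℤ} (hc : c ∈ D.nearest α)
    (hc' : c' ∈ D.nearest α) : c' - c ∈ D.orbLattice α :=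
  ⟨⟨D.A c' - D.A c, by rw [D.dA_sub_of_mem hc hc']; push_cast; rfl⟩, fun β hβ => by
    rw [D.dA_sub_of_mem hc hc', D.dA_sub_of_mem (hβ hc) (hβ hc')]⟩

theorem span_orbLattice (α : Fin r → ℝ) :
    Submodule.span ℝ (toReal '' (D.orbLattice α : Set (Fin r → ℤ))) = vectorSpan ℝ (D.delCell α) := by
  obtain ⟨c, hc⟩ := D.nearest_nonempty α
  apply le_antisymm
  · refine Submodule.span_le.2 ?_
    rintro _ ⟨x, hx, rfl⟩
    by_contra hmem
    obtain ⟨f, hfx, hf⟩ := Submodule.exists_le_ker_of_notMem hmem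
    obtain ⟨v, hv⟩ := D.exists_BReal_eq f
    have hconst : ∀ c ∈ D.nearest α, ∀ c' ∈ D.nearest α,
        D.BReal v (toReal c) = D.BReal v (toReal c') := by
      intro c hc c' hc'
      have h1 := hf (D.sub_mem_vectorSpan hc hc')
      rw [LinearMap.mem_ker, toReal_sub, map_sub, hv, hv] at h1
      linarith
    obtain ⟨t, ht, ht0⟩ := (((D.eventually_nearest_add_smul hconst).filter_mono
      nhdsWithin_le_nhds).and (self_mem_nhdsWithin (s := Set.Ioi (0 : ℝ)))).exists
    have h1 := hx.2 (α + t • v) ht.symm.subset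
    rw [D.dA_add_smul] at h1
    have h2 : t * D.BReal v (toReal x) = 0 := by linarith
    exact hfx ((hv _).trans ((mul_eq_zero.1 h2).resolve_left (ne_of_gt ht0)))
  · rw [D.vectorSpan_delCell, vectorSpan_eq_span_vsub_set_right ℝ (Set.mem_image_of_mem _ hc)]
    refine Submodule.span_mono ?_
    rintro _ ⟨_, ⟨x, hx, rfl⟩, rfl⟩
    exact ⟨x - c, D.sub_mem_orbLattice hc hx, toReal_sub _ _⟩

/-- The rank of the lattice of an orbit. -/
theorem finrank_orbLattice (α : Fin r → ℝ) :
    Module.finrank ℤ (D.orbLattice α) = cellDim (D.delCell α) := by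
  let τ : (Fin r → ℤ) →ₗ[ℤ] (Fin r → ℝ) := (AddMonoidHom.mk' toReal toReal_add).toIntLinearMap
  let S : Set (Fin r → ℝ) := toReal '' (D.orbLattice α : Set (Fin r → ℤ))
  have hspan : Submodule.span ℤ S = (D.orbLattice α).toIntSubmodule.map τ := by
    rw [← Submodule.span_eq (Submodule.map τ _)]; rfl
  have hdisc : DiscreteTopology (Submodule.span ℤ S) := by
    have h1 : (Submodule.span ℤ S : Set (Fin r → ℝ)) ⊆
        Submodule.span ℤ (Set.range (Pi.basisFun ℝ (Fin r))) := by
      rw [hspan]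
      rintro _ ⟨x, _, rfl⟩
      have : τ x = ∑ i, x i • Pi.basisFun ℝ (Fin r) i := by
        ext j; simp [τ, toReal, Finset.sum_apply, Pi.single_apply]
      rw [this]
      exact sum_mem fun i _ => Submodule.smul_mem _ _ (Submodule.subset_span ⟨i, rfl⟩)
    exact DiscreteTopology.of_subset
      (inferInstanceAs (DiscreteTopology (Submodule.span ℤ (Set.range (Pi.basisFun ℝ (Fin r)))))) h1
  have h := Real.finrank_eq_int_finrank_of_discrete hdisc
  unfold Set.finrank at h
  rw [D.span_orbLattice] at h
  unfold cellDim
  rw [h, hspan]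
  exact ((D.orbLattice α).toIntSubmodule.equivMapOfInjective τ toReal_injective).finrank_eq

end DegenerationData
end


section
variable {O K : Type u} [CommRing O] [IsDomain O] [IsDiscreteValuationRing O] [Field K]
  [Algebra O K] [IsFractionRing O K] {r : ℕ}

namespace DegenerationData
variable (D : DegenerationData O K r)

/-! ### The coefficients -/

theorem mem_span_sPow {P : ℤ → Prop} (hP : ∀ m n, m ≤ n → P m → P n) {z : K} :
    z ∈ Submodule.span O {z | ∃ n, P n ∧ z = D.sPow n} ↔ (z ≠ 0 → P (ord O z)) := by
  have hP' (x y : K) (hx : x ≠ 0 → P (ord O x)) (hy : y ≠ 0 → P (ord O y)) (h : x + y ≠ 0) :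
      P (ord O (x + y)) := by
    by_cases hx0 : x = 0
    · subst hx0; simp only [zero_add] at h ⊢; exact hy h
    by_cases hy0 : y = 0
    · subst hy0; simp only [add_zero] at h ⊢; exact hx h
    have := le_ord_add (O := O) (z := x) (w := y) (t := min (ord O x : ℝ) (ord O y))
      (fun _ => min_le_left _ _) (fun _ => min_le_right _ _) h
    rcases min_le_iff.1 this with h1 | h1
    · exact hP _ _ (by exact_mod_cast h1) (hx hx0)
    · exact hP _ _ (by exact_mod_cast h1) (hy hy0)
  constructor
  · intro h
    induction h using Submodule.span_induction with
    | mem z hz =>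
      obtain ⟨n, hn, rfl⟩ := hz
      intro _; rwa [D.ord_sPow]
    | zero => intro h; exact absurd rfl h
    | add x y _ _ hx hy => exact hP' x y hx hy
    | smul a x _ hx =>
      intro h
      rw [Algebra.smul_def] at h ⊢
      rw [ord_mul (left_ne_zero_of_mul h) (right_ne_zero_of_mul h)]
      exact hP _ _ (by linarith [ord_algebraMap_nonneg (O := O) (K := K) a])
        (hx (right_ne_zero_of_mul h))
  · intro h
    by_cases hz : z = 0
    · subst hz; exact zero_mem _
    obtain ⟨c, hc⟩ := exists_zpow_eq D.irreducible_s (inv_ne_zero hz)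
    have h1 : ord O z⁻¹ = -ord O z := by
      have h2 := ord_mul (O := O) hz (inv_ne_zero hz)
      rw [mul_inv_cancel₀ hz] at h2
      have h3 := D.ord_sPow 0
      rw [sPow, zpow_zero] at h3
      linarith
    have h2 : z = c • D.sPow (ord O z) := by
      have h3 : algebraMap O K c * z⁻¹ = D.sPow (-ord O z) := by rw [hc, h1]; rfl
      have h4 : D.sPow (-ord O z) * D.sPow (ord O z) = 1 := by
        rw [← D.sPow_add]; simp [sPow]
      rw [Algebra.smul_def, ← mul_one z, ← h4, ← h3]
      have h5 : ord O (z * (algebraMap O K c * z⁻¹ * D.sPow (ord O z))) = ord O z := by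
        rw [h3, h4, mul_one]
      rw [h5]; field_simp
    rw [h2]
    exact Submodule.smul_mem _ _ (Submodule.subset_span ⟨_, h hz, rfl⟩)

theorem mem_coneSystem {W : Set (Fin r → ℝ)} {x : Fin r → ℤ} {z : K} :
    z ∈ (D.coneSystem W).coeff x ↔ (z ≠ 0 → ∀ β ∈ W, D.dA β (toReal x) ≤ ord O z) :=
  D.mem_span_sPow (P := fun n => ∀ β ∈ W, D.dA β (toReal x) ≤ n)
    fun m n hmn h β hβ => (h β hβ).trans (by exact_mod_cast hmn)

theorem mem_closure_lin {α : Fin r → ℝ} {q : ℕ × (Fin r → ℤ)}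
    (hq : q ∈ AddSubmonoid.closure ((fun c => ((1, c) : ℕ × (Fin r → ℤ))) '' D.nearest α)) :
    (∀ β, D.lin β q ≤ D.lin α q) ∧
    ∃ m : ℤ, m = D.lin α q ∧ AddMonoidAlgebra.single q (D.sPow m) ∈ D.preAlgebra := by
  induction hq using AddSubmonoid.closure_induction with
  | mem x hx =>
    obtain ⟨c, hc, rfl⟩ := hx
    refine ⟨fun β => ?_, D.A c, (D.lin_one_eq_iff.2 hc).symm, ?_⟩
    · rw [D.lin_one_eq_iff.2 hc]; exact D.lin_one_le β c
    · obtain ⟨t, ht⟩ := exists_zpow_eq D.irreducible_s (D.a c).ne_zero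
      have : AddMonoidAlgebra.single ((1, c) : ℕ × (Fin r → ℤ)) (D.sPow (D.A c)) =
          t • AddMonoidAlgebra.single (1, c) (D.a c : K) := by
        rw [AddMonoidAlgebra.smul_single, Algebra.smul_def, ht]; rfl
      rw [this]
      exact Subalgebra.smul_mem _ (Algebra.subset_adjoin (Set.mem_range_self c)) t
  | zero =>
    refine ⟨fun β => by rw [lin_zero, lin_zero], 0, by simp [lin_zero], ?_⟩
    have : AddMonoidAlgebra.single (0 : ℕ × (Fin r → ℤ)) (D.sPow 0) = 1 := by
      simp [sPow, AddMonoidAlgebra.one_def]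
    rw [this]; exact one_mem _
  | add x y _ _ hx hy =>
    obtain ⟨hx, m, hm, h1⟩ := hx
    obtain ⟨hy, n, hn, h2⟩ := hy
    refine ⟨fun β => ?_, m + n, ?_, ?_⟩
    · rw [lin_add, lin_add]; exact add_le_add (hx β) (hy β)
    · rw [lin_add]; push_cast; rw [hm, hn]
    · rw [D.sPow_add, ← AddMonoidAlgebra.single_mul_single]; exact mul_mem h1 h2

theorem sPow_pow (n : ℤ) (N : ℕ) : D.sPow n ^ N = D.sPow (N * n) := by
  rw [sPow, sPow, mul_comm, zpow_mul, zpow_natCast]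

theorem smul_sPow_mem {p : ℕ × (Fin r → ℤ)} {m n : ℤ} (h : m ≤ n)
    (hm : AddMonoidAlgebra.single p (D.sPow m) ∈ D.preAlgebra) :
    AddMonoidAlgebra.single p (D.sPow n) ∈ D.preAlgebra := by
  have : AddMonoidAlgebra.single p (D.sPow n) =
      (D.s ^ (n - m).toNat) • AddMonoidAlgebra.single p (D.sPow m) := by
    rw [AddMonoidAlgebra.smul_single, Algebra.smul_def, map_pow]
    congr 1
    have : (algebraMap O K D.s) ^ (n - m).toNat = D.sPow (n - m) := by
      rw [sPow, ← zpow_natCast, Int.toNat_of_nonneg (by linarith)]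
    rw [this, ← D.sPow_add]; congr 1; ring
  rw [this]
  exact Subalgebra.smul_mem _ hm _

theorem inSaturation_iff {p : ℕ × (Fin r → ℤ)} {n : ℤ} :
    D.InSaturation p n ↔ ∀ β, D.lin β p ≤ n := by
  constructor
  · intro h β
    obtain ⟨c, hc⟩ := D.nearest_nonempty β
    have := h.le D (W := {β}) (c := c) (by rintro _ rfl; exact hc) β rfl
    rw [D.lin_eq hc]
    push_cast at this; linarith
  · intro h
    have : ∃ α, toReal p.2 ∈ (p.1 : ℝ) • D.delCell α := by
      by_cases hp : p.1 = 0
      · refine ⟨0, ?_⟩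
        rw [← D.forall_lin_le_iff]
        have : toReal p.2 = 0 := D.eq_zero_of_forall_dA_le (C := n) fun β => by
          have := h β
          simpa [lin, hp] using this
        intro β; simp [lin, hp, this, D.dA_zero]
      · obtain ⟨α, hα⟩ := D.exists_forall_lin_le hp
        exact ⟨α, D.forall_lin_le_iff.1 hα⟩
    obtain ⟨α, hα⟩ := this
    obtain ⟨N, hN, hmem⟩ := exists_nsmul_mem_closure hα
    obtain ⟨_, m, hm, h1⟩ := D.mem_closure_lin hmem
    refine ⟨N, hN, ?_⟩
    rw [AddMonoidAlgebra.single_pow, D.sPow_pow]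
    refine D.smul_sPow_mem ?_ h1
    rw [D.lin_nsmul] at hm
    have h2 : (N : ℝ) * D.lin α p ≤ N * n := by gcongr; exact h α
    rw [← hm] at h2
    exact_mod_cast h2

theorem mem_saturation {p : ℕ × (Fin r → ℤ)} {z : K} :
    z ∈ D.saturation.coeff p ↔ (z ≠ 0 → ∀ β, D.lin β p ≤ ord O z) := by
  have := D.mem_span_sPow (P := fun n => D.InSaturation p n) (z := z) fun m n hmn h => by
    rw [inSaturation_iff] at h ⊢
    exact fun β => (h β).trans (by exact_mod_cast hmn)
  simp only [inSaturation_iff] at this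
  rw [← this]
  simp only [saturation, inSaturation_iff]

theorem ord_mul_sPow {z : K} (hz : z ≠ 0) (n : ℤ) : ord O (z * D.sPow n) = ord O z + n := by
  rw [ord_mul hz (D.sPow_ne_zero n), D.ord_sPow]

/-- The monomial `s^n w^x` of the ring of a cone. -/
noncomputable def coneMono (W : Set (Fin r → ℝ)) (x : Fin r → ℤ) (n : ℤ)
    (h : ∀ β ∈ W, D.dA β (toReal x) ≤ n) : D.coneRing W :=
  (D.coneSystem W).mono x ⟨D.sPow n, D.mem_coneSystem.2 fun _ => by rwa [D.ord_sPow]⟩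

theorem coneMono_mul {W : Set (Fin r → ℝ)} {x y : Fin r → ℤ} {m n : ℤ}
    (h : ∀ β ∈ W, D.dA β (toReal x) ≤ m) (h' : ∀ β ∈ W, D.dA β (toReal y) ≤ n) :
    D.coneMono W x m h * D.coneMono W y n h' = D.coneMono W (x + y) (m + n) (fun β hβ => by
      rw [toReal_add, D.dA_add]; push_cast; exact add_le_add (h β hβ) (h' β hβ)) :=
  Subtype.ext ((AddMonoidAlgebra.single_mul_single ..).trans
    (congrArg _ (D.sPow_add m n).symm))

theorem coneMono_zero {W : Set (Fin r → ℝ)} (h : ∀ β ∈ W, D.dA β (toReal 0) ≤ (0 : ℤ)) :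
    D.coneMono W 0 0 h = 1 := Subtype.ext (congrArg (AddMonoidAlgebra.single 0) (zpow_zero _))

theorem coneMono_congr {W : Set (Fin r → ℝ)} {x y : Fin r → ℤ} {m n : ℤ} {h h'}
    (hxy : x = y) (hmn : m = n) : D.coneMono W x m h = D.coneMono W y n h' := by
  subst hxy hmn; rfl

theorem isUnit_coneMono {W : Set (Fin r → ℝ)} {x : Fin r → ℤ} {n : ℤ}
    (h : ∀ β ∈ W, D.dA β (toReal x) = n) : IsUnit (D.coneMono W x n fun β hβ => (h β hβ).le) := by
  refine IsUnit.of_mul_eq_one (D.coneMono W (-x) (-n) fun β hβ => by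
    rw [toReal_neg, D.dA_neg, h β hβ]; push_cast; exact le_rfl) ?_
  rw [coneMono_mul, ← D.coneMono_zero (by simp [toReal_zero, D.dA_zero])]
  exact D.coneMono_congr (add_neg_cancel x) (add_neg_cancel n)

/-! ### The charts -/

theorem coneRing_le {W W' : Set (Fin r → ℝ)} (h : W ⊆ W') : D.coneRing W' ≤ D.coneRing W :=
  fun f hf x => D.mem_coneSystem.2 fun hz β hβ => D.mem_coneSystem.1 (hf x) hz β (h hβ)

/-- The inclusion of the rings of cones. -/
noncomputable def coneIncl {W W' : Set (Fin r → ℝ)} (h : W ⊆ W') : D.coneRing W' →+* D.coneRing W where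
  toFun f := ⟨f.1, D.coneRing_le h f.2⟩
  map_one' := Subtype.ext rfl
  map_mul' _ _ := Subtype.ext rfl
  map_zero' := Subtype.ext rfl
  map_add' _ _ := Subtype.ext rfl

theorem coneIncl_apply {W W' : Set (Fin r → ℝ)} (h : W ⊆ W') (f : D.coneRing W') :
    D.coneIncl h f = ⟨f.1, D.coneRing_le h f.2⟩ := rfl

theorem coneIncl_val {W W' : Set (Fin r → ℝ)} (h : W ⊆ W') (f : D.coneRing W') :
    (D.coneIncl h f).1 = f.1 := by rw [coneIncl_apply]

theorem coneIncl_injective {W W' : Set (Fin r → ℝ)} (h : W ⊆ W') : Function.Injective (D.coneIncl h) :=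
  fun x y e => Subtype.ext (show x.1 = y.1 by rw [← D.coneIncl_val h x, e, D.coneIncl_val])

theorem chartHom_mono {W : Set (Fin r → ℝ)} {c : Fin r → ℤ} (hc : ∀ β ∈ W, c ∈ D.nearest β)
    (p : ℕ × (Fin r → ℤ)) (a : D.saturation.coeff p) :
    (D.chartHom W c hc (D.saturation.mono p a)).1 =
      AddMonoidAlgebra.single (p.2 - p.1 • c) (a.1 * D.sPow (-(p.1 * D.A c))) :=
  D.dehomogenize_single c p a.1

theorem sub_mem_cone {W : Set (Fin r → ℝ)} {c : Fin r → ℤ} (hc : ∀ β ∈ W, c ∈ D.nearest β)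
    (c' : Fin r → ℤ) : ∀ β ∈ W, D.dA β (toReal (c' - c)) ≤ (D.A c' - D.A c : ℤ) := fun β hβ => by
  push_cast; exact D.dA_sub_le_of_mem (hc β hβ) c'

theorem chartHom_zeta {W : Set (Fin r → ℝ)} {c : Fin r → ℤ} (hc : ∀ β ∈ W, c ∈ D.nearest β)
    (c' : Fin r → ℤ) : D.chartHom W c hc (D.zeta c') =
      D.coneMono W (c' - c) (D.A c' - D.A c) (D.sub_mem_cone hc c') := by
  apply Subtype.ext
  refine (D.dehomogenize_single c (1, c') _).trans ?_
  simp only [one_smul, Nat.cast_one, one_mul]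
  have e : D.sPow (D.A c') * D.sPow (-D.A c) = D.sPow (D.A c' - D.A c) := by
    rw [← D.sPow_add, sub_eq_add_neg]
  exact congrArg (AddMonoidAlgebra.single (c' - c)) e

theorem chartHom_zeta_self {W : Set (Fin r → ℝ)} {c : Fin r → ℤ} (hc : ∀ β ∈ W, c ∈ D.nearest β) :
    D.chartHom W c hc (D.zeta c) = 1 := by
  rw [chartHom_zeta, ← D.coneMono_zero (by simp [toReal_zero, D.dA_zero])]
  exact D.coneMono_congr (sub_self c) (sub_self _)

theorem isUnit_chartHom_zeta {W : Set (Fin r → ℝ)} {c c' : Fin r → ℤ} (hc : ∀ β ∈ W, c ∈ D.nearest β)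
    (hc' : ∀ β ∈ W, c' ∈ D.nearest β) : IsUnit (D.chartHom W c hc (D.zeta c')) := by
  rw [chartHom_zeta]
  exact D.isUnit_coneMono fun β hβ => by
    rw [D.dA_sub_of_mem (hc β hβ) (hc' β hβ)]; push_cast; rfl

theorem eq_of_mem_grading {d : ℕ} {a : D.R} (ha : a ∈ D.saturation.grading d)
    {S : Type*} [CommRing S] {f g : D.R →+* S} {u : S}
    (h : ∀ x z, f (D.saturation.mono (d, x) z) = u * g (D.saturation.mono (d, x) z)) :
    f a = u * g a := by
  rw [← D.saturation.sum_mono a, map_sum, map_sum, Finset.mul_sum]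
  refine Finset.sum_congr rfl fun p hp => ?_
  obtain rfl : p.1 = d := ha p (Finsupp.mem_support_iff.1 hp)
  exact h p.2 _

theorem chartHom_eq_smul {W : Set (Fin r → ℝ)} {c c' : Fin r → ℤ} (hc : ∀ β ∈ W, c ∈ D.nearest β)
    (hc' : ∀ β ∈ W, c' ∈ D.nearest β) {d : ℕ} {a : D.R} (ha : a ∈ D.saturation.grading d) :
    D.chartHom W c hc a = D.chartHom W c hc (D.zeta c') ^ d * D.chartHom W c' hc' a := by
  refine D.eq_of_mem_grading ha fun x z => Subtype.ext ?_
  change (D.chartHom W c hc (D.saturation.mono (d, x) z)).1 =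
    (D.chartHom W c hc (D.zeta c')).1 ^ d * (D.chartHom W c' hc' (D.saturation.mono (d, x) z)).1
  rw [chartHom_mono, chartHom_mono, chartHom_zeta]
  change _ = (AddMonoidAlgebra.single _ _) ^ d * _
  rw [AddMonoidAlgebra.single_pow, AddMonoidAlgebra.single_mul_single, D.sPow_pow]
  simp only
  congr 1
  · rw [smul_sub]; abel
  · rw [mul_comm _ (z.1 * _), mul_assoc, ← D.sPow_add]; congr 2; ring

theorem chart_hasCoords (W : Set (Fin r → ℝ)) (c : Fin r → ℤ) (hc : ∀ β ∈ W, c ∈ D.nearest β) :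
    HasCoords D.saturation.grading (S := .of (D.coneRing W)) (D.chart W c hc) (D.chartHom W c hc) :=
  ⟨D.map_irrelevant W c hc, rfl⟩

theorem chart_eq_chart {W : Set (Fin r → ℝ)} {c c' : Fin r → ℤ} (hc : ∀ β ∈ W, c ∈ D.nearest β)
    (hc' : ∀ β ∈ W, c' ∈ D.nearest β) : D.chart W c hc = D.chart W c' hc' := by
  obtain ⟨_, e⟩ := (D.chart_hasCoords W c' hc').smul D.saturation.grading
    (φ' := D.chartHom W c hc) (D.isUnit_chartHom_zeta hc hc')
    fun d a ha => D.chartHom_eq_smul hc hc' ha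
  exact e.symm

theorem coneOpen_eq_range {W : Set (Fin r → ℝ)} {c : Fin r → ℤ} (hc : ∀ β ∈ W, c ∈ D.nearest β) :
    D.coneOpen W = Set.range (D.chart W c hc) := by
  ext z
  constructor
  · rintro ⟨c', hc', h⟩
    rwa [D.chart_eq_chart hc hc']
  · exact fun h => ⟨c, hc, h⟩

theorem chart_eq_comp {W W' : Set (Fin r → ℝ)} (h : W ⊆ W') {c : Fin r → ℤ}
    (hc : ∀ β ∈ W', c ∈ D.nearest β) :
    D.chart W c (fun β hβ => hc β (h hβ)) =
      Spec.map (CommRingCat.ofHom (D.coneIncl h)) ≫ D.chart W' c hc := by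
  obtain ⟨_, e⟩ := (D.chart_hasCoords W' c hc).comp D.saturation.grading
    (CommRingCat.ofHom (D.coneIncl h))
  exact e.symm

theorem chart_preimage_basicOpen {W : Set (Fin r → ℝ)} {c : Fin r → ℤ}
    (hc : ∀ β ∈ W, c ∈ D.nearest β) (c' : Fin r → ℤ) :
    D.chart W c hc ⁻¹ᵁ Proj.basicOpen D.saturation.grading (D.zeta c') =
      PrimeSpectrum.basicOpen (D.chartHom W c hc (D.zeta c')) :=
  ProjCoord.projPoint_preimage D.saturation.grading _ _ one_pos (D.zeta_mem c')

/-! ### The chart of a vertex -/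

/-- A vertex of the tiling lies in a cell together with all points nearby. -/
theorem exists_nat_forall_lin_le (c x : Fin r → ℤ) :
    ∃ d : ℕ, ∃ α, c ∈ D.nearest α ∧
      ∀ β, D.lin β (d, x + d • c) ≤ D.lin α (d, x + d • c) := by
  obtain ⟨ρ, hρ⟩ := D.exists_covering_radius
  let y (d : ℕ) : Fin r → ℝ := toReal c + ((d + 1 : ℕ) : ℝ)⁻¹ • toReal x
  have hyc : Filter.Tendsto y Filter.atTop (nhds (toReal c)) := by
    have h1 : Filter.Tendsto (fun d : ℕ => ((d + 1 : ℕ) : ℝ)⁻¹) Filter.atTop (nhds 0) :=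
      (tendsto_inv_atTop_nhds_zero_nat (𝕜 := ℝ)).comp (Filter.tendsto_add_atTop_nat 1)
    have h2 := (tendsto_const_nhds (x := toReal c)).add (h1.smul_const (toReal x))
    rwa [zero_smul, add_zero] at h2
  choose α hα using fun d => D.exists_mem_delCell (y d)
  have hdist (d) : ‖y d - α d‖ ≤ ρ := by
    have : D.delCell (α d) ⊆ Metric.closedBall (α d) ρ :=
      convexHull_min (by
        rintro _ ⟨c, hc, rfl⟩
        exact mem_closedBall_iff_norm.2 (hρ _ c hc)) (convex_closedBall _ _)
    exact mem_closedBall_iff_norm.1 (this (hα d))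
  obtain ⟨C, hC⟩ := (Metric.isBounded_range_of_tendsto y hyc).exists_norm_le
  have hb (d) : α d ∈ Metric.closedBall (0 : Fin r → ℝ) (C + ρ) := by
    rw [mem_closedBall_zero_iff]
    have h1 := norm_sub_norm_le (α d) (y d)
    rw [norm_sub_rev] at h1
    have h2 := hC _ (Set.mem_range_self d)
    linarith [hdist d]
  obtain ⟨γ, _, φ, hφ, hlim⟩ := (isCompact_closedBall _ _).tendsto_subseq hb
  have hev : ∀ᶠ d in Filter.atTop, y (φ d) ∈ D.delCell γ := by
    filter_upwards [hlim.eventually (D.eventually_nearest_subset γ)] with d hd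
    exact D.delCell_subset_iff.2 hd (hα (φ d))
  have hc : toReal c ∈ D.delCell γ :=
    (((D.finite_nearest γ).image toReal).isClosed_convexHull ℝ).mem_of_tendsto
      (hyc.comp hφ.tendsto_atTop) hev
  obtain ⟨d, hd⟩ := hev.exists
  refine ⟨φ d + 1, γ, D.toReal_mem_delCell.1 hc, D.forall_lin_le_iff.2 ?_⟩
  have h0 : ((φ d + 1 : ℕ) : ℝ) ≠ 0 := by exact_mod_cast Nat.succ_ne_zero (φ d)
  rw [Set.mem_smul_set_iff_inv_smul_mem₀ h0, toReal_add, toReal_nsmul, smul_add, smul_smul,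
    inv_mul_cancel₀ h0, one_smul, add_comm]
  exact hd

theorem isUnit_chartHom_zeta_self {W : Set (Fin r → ℝ)} {c : Fin r → ℤ}
    (hc : ∀ β ∈ W, c ∈ D.nearest β) : IsUnit (D.chartHom W c hc (D.zeta c)) := by
  rw [chartHom_zeta_self]; exact isUnit_one

theorem eq_zero_of_chartHom_eq_zero {W : Set (Fin r → ℝ)} {c : Fin r → ℤ}
    (hc : ∀ β ∈ W, c ∈ D.nearest β) {d : ℕ} {a : D.R} (ha : a ∈ D.saturation.grading d)
    (h : D.chartHom W c hc a = 0) : a = 0 := by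
  let ψ := AddMonoidAlgebra.mapDomainRingHom K (AddMonoidHom.inr ℕ (Fin r → ℤ))
  have key : a.1 = AddMonoidAlgebra.single (d, d • c) (D.sPow (d * D.A c)) * ψ (D.chartHom W c hc a).1 := by
    refine D.eq_of_mem_grading ha (f := D.R.val.toRingHom)
      (g := ψ.comp ((D.coneRing W).val.toRingHom.comp (D.chartHom W c hc))) fun x z => ?_
    change AddMonoidAlgebra.single (d, x) z.1 =
      _ * ψ (D.chartHom W c hc (D.saturation.mono (d, x) z)).1
    rw [chartHom_mono]
    have : ψ (AddMonoidAlgebra.single (x - d • c) (z.1 * D.sPow (-(d * D.A c)))) =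
      AddMonoidAlgebra.single (0, x - d • c) (z.1 * D.sPow (-(d * D.A c))) :=
        AddMonoidAlgebra.mapDomain_single
    rw [this, AddMonoidAlgebra.single_mul_single, mul_comm, mul_assoc, ← D.sPow_add]
    congr 1
    · simp
    · simp [sPow]
  rw [h, ZeroMemClass.coe_zero, map_zero, mul_zero] at key
  exact Subtype.ext key

theorem bijective_awayLift (c : Fin r → ℤ) (hc : ∀ β ∈ D.vor {c}, c ∈ D.nearest β) :
    Function.Bijective (ProjCoord.awayLift D.saturation.grading (D.chartHom (D.vor {c}) c hc)
      (D.isUnit_chartHom_zeta_self hc)) := by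
  set f := ProjCoord.awayLift D.saturation.grading (D.chartHom (D.vor {c}) c hc)
      (D.isUnit_chartHom_zeta_self hc) with hf
  have hmk (d a ha) : f (.mk _ (D.zeta_mem c) d a ha) = D.chartHom (D.vor {c}) c hc a := by
    have := ProjCoord.awayLift_mk D.saturation.grading _ (D.isUnit_chartHom_zeta_self hc)
      (D.zeta_mem c) d a ha
    rwa [chartHom_zeta_self, one_pow, mul_one] at this
  constructor
  · rw [injective_iff_map_eq_zero]
    intro x hx
    obtain ⟨d, a, ha, rfl⟩ := HomogeneousLocalization.Away.mk_surjective _ (D.zeta_mem c) x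
    rw [hmk] at hx
    have h0 := D.eq_zero_of_chartHom_eq_zero hc ha hx
    subst h0
    apply HomogeneousLocalization.val_injective
    rw [HomogeneousLocalization.Away.val_mk (hf := D.zeta_mem c), Localization.mk_zero,
      HomogeneousLocalization.val_zero]
  · intro g
    refine (D.coneSystem (D.vor {c})).mono_induction (P := fun g => ∃ x, f x = g) ⟨0, map_zero _⟩ ?_ ?_ g
    · rintro _ _ ⟨x, rfl⟩ ⟨y, rfl⟩
      exact ⟨x + y, map_add _ _ _⟩
    · intro x z
      obtain ⟨d, α, hα, hmax⟩ := D.exists_nat_forall_lin_le c x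
      have hmem : z.1 * D.sPow (d * D.A c) ∈ D.saturation.coeff (d, x + d • c) := by
        rw [mem_saturation]
        intro hz β
        have hz0 := left_ne_zero_of_mul hz
        rw [D.ord_mul_sPow hz0]
        refine (hmax β).trans ?_
        rw [D.lin_eq hα]
        have := D.mem_coneSystem.1 z.2 hz0 α (D.mem_vor_singleton.2 hα)
        simp only [add_sub_cancel_right]
        push_cast; linarith
      refine ⟨.mk _ (D.zeta_mem c) d (D.saturation.mono (d, x + d • c) ⟨_, hmem⟩)
        (by simpa using D.saturation.mono_mem_grading (d, x + d • c) ⟨_, hmem⟩), ?_⟩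
      rw [hmk]
      apply Subtype.ext
      rw [chartHom_mono]
      refine congrArg₂ AddMonoidAlgebra.single (add_sub_cancel_right _ _) ?_
      simp only
      rw [mul_assoc, ← D.sPow_add, add_neg_cancel]
      simp [sPow]

theorem chart_vertex_eq (c : Fin r → ℤ) (hc : ∀ β ∈ D.vor {c}, c ∈ D.nearest β) :
    D.chart (D.vor {c}) c hc = Spec.map (CommRingCat.ofHom (ProjCoord.awayLift D.saturation.grading
      (D.chartHom (D.vor {c}) c hc) (D.isUnit_chartHom_zeta_self hc))) ≫
        Proj.awayι D.saturation.grading (D.zeta c) (D.zeta_mem c) one_pos :=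
  ProjCoord.projPoint_away D.saturation.grading _ _ one_pos (D.zeta_mem c) _

theorem isIso_awayLift (c : Fin r → ℤ) (hc : ∀ β ∈ D.vor {c}, c ∈ D.nearest β) :
    IsIso (CommRingCat.ofHom (ProjCoord.awayLift D.saturation.grading
      (D.chartHom (D.vor {c}) c hc) (D.isUnit_chartHom_zeta_self hc))) :=
  (RingEquiv.ofBijective _ (D.bijective_awayLift c hc)).toCommRingCatIso.isIso_hom

theorem isOpenImmersion_chart_vertex (c : Fin r → ℤ) (hc : ∀ β ∈ D.vor {c}, c ∈ D.nearest β) :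
    IsOpenImmersion (D.chart (D.vor {c}) c hc) := by
  rw [chart_vertex_eq]
  have := D.isIso_awayLift c hc
  infer_instance

theorem range_chart_vertex (c : Fin r → ℤ) (hc : ∀ β ∈ D.vor {c}, c ∈ D.nearest β) :
    Set.range (D.chart (D.vor {c}) c hc) =
      (Proj.basicOpen D.saturation.grading (D.zeta c) : Set D.P) := by
  have := D.isIso_awayLift c hc
  have hs := (Spec.map (CommRingCat.ofHom (ProjCoord.awayLift D.saturation.grading
    (D.chartHom (D.vor {c}) c hc) (D.isUnit_chartHom_zeta_self hc)))).surjective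
  rw [chart_vertex_eq, Scheme.Hom.comp_base, TopCat.coe_comp, Set.range_comp, hs.range_eq, Set.image_univ,
    ← Proj.opensRange_awayι _ _ (D.zeta_mem c) one_pos]
  rfl

end DegenerationData
end


section
variable {O K : Type u} [CommRing O] [IsDomain O] [IsDiscreteValuationRing O] [Field K]
  [Algebra O K] [IsFractionRing O K] {r : ℕ}

namespace DegenerationData
variable (D : DegenerationData O K r)

/-! ### Localization at a face -/

theorem mem_of_mem_vor {S : Set (Fin r → ℤ)} {c : Fin r → ℤ} (hc : c ∈ S) :
    ∀ β ∈ D.vor S, c ∈ D.nearest β := fun _ hβ => hβ hc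

theorem vor_subset_vor_singleton {S : Set (Fin r → ℤ)} {c : Fin r → ℤ} (hc : c ∈ S) :
    D.vor S ⊆ D.vor {c} := D.vor_mono (Set.singleton_subset_iff.2 hc)

/-- The product of the coordinates `ζ_c' / ζ_c` for `c'` in `S`. -/
noncomputable def facetElt (S : Finset (Fin r → ℤ)) (c : Fin r → ℤ) : D.coneRing (D.vor {c}) :=
  ∏ c' ∈ S, D.chartHom (D.vor {c}) c (D.mem_of_mem_vor rfl) (D.zeta c')

theorem isUnit_coneIncl_chartHom {S : Set (Fin r → ℤ)} {c c' : Fin r → ℤ} (hc : c ∈ S) (hc' : c' ∈ S) :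
    IsUnit (D.coneIncl (D.vor_subset_vor_singleton hc)
      (D.chartHom (D.vor {c}) c (D.mem_of_mem_vor rfl) (D.zeta c'))) :=
  D.isUnit_chartHom_zeta (D.mem_of_mem_vor hc) (D.mem_of_mem_vor hc')

theorem facetElt_pow_val (S : Finset (Fin r → ℤ)) (c : Fin r → ℤ) (N : ℕ) :
    (D.facetElt S c ^ N).1 = AddMonoidAlgebra.single (N • ∑ c' ∈ S, (c' - c))
      (D.sPow (N * ∑ c' ∈ S, (D.A c' - D.A c))) := by
  have h : ∀ S : Finset (Fin r → ℤ), (D.facetElt S c).1 =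
      AddMonoidAlgebra.single (∑ c' ∈ S, (c' - c)) (D.sPow (∑ c' ∈ S, (D.A c' - D.A c))) := by
    classical
    intro S
    induction S using Finset.induction_on with
    | empty => simp [facetElt, sPow, AddMonoidAlgebra.one_def]
    | insert a S ha ih =>
      unfold facetElt at ih ⊢
      rw [Finset.prod_insert ha, Finset.sum_insert ha, Finset.sum_insert ha, D.sPow_add,
        ← AddMonoidAlgebra.single_mul_single, ← ih, chartHom_zeta]
      rfl
  change (D.facetElt S c).1 ^ N = _
  rw [h, AddMonoidAlgebra.single_pow, D.sPow_pow]

theorem exists_mul_facetElt_pow {S : Finset (Fin r → ℤ)} {c : Fin r → ℤ} (hc : c ∈ S)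
    (f : D.coneRing (D.vor S)) :
    ∃ (N : ℕ) (g : D.coneRing (D.vor {c})), D.coneIncl (D.vor_subset_vor_singleton hc) g =
      f * D.coneIncl (D.vor_subset_vor_singleton hc) (D.facetElt S c) ^ N := by
  set i := D.coneIncl (D.vor_subset_vor_singleton (S := (S : Set (Fin r → ℤ))) hc) with hi
  refine (D.coneSystem (D.vor S)).mono_induction
    (P := fun f => ∃ (N : ℕ) (g : D.coneRing (D.vor {c})), i g = f * i (D.facetElt S c) ^ N)
    ⟨0, 0, by simp⟩ ?_ ?_ f
  · rintro f f' ⟨N, g, hg⟩ ⟨N', g', hg'⟩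
    refine ⟨N + N', g * D.facetElt S c ^ N' + g' * D.facetElt S c ^ N, ?_⟩
    rw [map_add, map_mul, map_mul, hg, hg', map_pow, map_pow, pow_add]; ring
  · intro x z
    by_cases hz : z.1 = 0
    · obtain rfl : z = 0 := Subtype.ext hz
      exact ⟨0, 0, by rw [CoeffSystem.mono_zero]; simp⟩
    obtain ⟨N, hN⟩ := D.exists_nat_forall_dA_le hc (D.mem_coneSystem.1 z.2 hz)
    refine ⟨N, (D.coneSystem (D.vor {c})).mono (x + N • ∑ c' ∈ S, (c' - c))
      ⟨z.1 * D.sPow (N * ∑ c' ∈ S, (D.A c' - D.A c)), D.mem_coneSystem.2 fun _ β hβ => ?_⟩, ?_⟩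
    · rw [D.ord_mul_sPow hz]
      have := hN β hβ
      push_cast; exact this
    · rw [← map_pow]
      apply Subtype.ext
      have e : (i (D.facetElt S c ^ N)).1 = _ := (D.coneIncl_val _ _).trans (D.facetElt_pow_val S c N)
      refine (D.coneIncl_val _ _).trans ?_
      change _ = AddMonoidAlgebra.single x z.1 * (i (D.facetElt S c ^ N)).1
      rw [e, AddMonoidAlgebra.single_mul_single]
      rfl

theorem isLocalization_away {S : Finset (Fin r → ℤ)} {c : Fin r → ℤ} (hc : c ∈ S) :
    @IsLocalization.Away _ _ (D.facetElt S c) (D.coneRing (D.vor S)) _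
      (D.coneIncl (D.vor_subset_vor_singleton (S := (S : Set (Fin r → ℤ))) hc)).toAlgebra := by
  let i := D.coneIncl (D.vor_subset_vor_singleton (S := (S : Set (Fin r → ℤ))) hc)
  let := i.toAlgebra
  have hu : IsUnit (i (D.facetElt S c)) := by
    unfold facetElt
    rw [map_prod]
    exact (IsUnit.prod_iff).2 fun c' hc' => D.isUnit_coneIncl_chartHom (Finset.mem_coe.2 hc) hc'
  refine
    { map_units := ?_
      surj := fun f => ?_
      exists_of_eq := fun {x y} h => ⟨1, by rw [D.coneIncl_injective _ h]⟩ }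
  · rintro ⟨_, N, rfl⟩
    change IsUnit (i (D.facetElt S c ^ N))
    rw [map_pow]; exact hu.pow N
  · obtain ⟨N, g, hg⟩ := D.exists_mul_facetElt_pow hc f
    refine ⟨⟨g, ⟨D.facetElt S c ^ N, N, rfl⟩⟩, ?_⟩
    change f * i (D.facetElt S c ^ N) = i g
    rw [hg, map_pow]

theorem isOpenImmersion_coneIncl {S : Finset (Fin r → ℤ)} {c : Fin r → ℤ} (hc : c ∈ S) :
    IsOpenImmersion (Spec.map (CommRingCat.ofHom
      (D.coneIncl (D.vor_subset_vor_singleton (S := (S : Set (Fin r → ℤ))) hc)))) := by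
  let := (D.coneIncl (D.vor_subset_vor_singleton (S := (S : Set (Fin r → ℤ))) hc)).toAlgebra
  have := D.isLocalization_away hc
  exact IsOpenImmersion.of_isLocalization (S := D.coneRing (D.vor S)) (D.facetElt S c)

theorem range_coneIncl {S : Finset (Fin r → ℤ)} {c : Fin r → ℤ} (hc : c ∈ S) :
    Set.range (Spec.map (CommRingCat.ofHom
      (D.coneIncl (D.vor_subset_vor_singleton (S := (S : Set (Fin r → ℤ))) hc)))) =
      (PrimeSpectrum.basicOpen (D.facetElt S c) : Set (PrimeSpectrum (D.coneRing (D.vor {c})))) := by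
  let := (D.coneIncl (D.vor_subset_vor_singleton (S := (S : Set (Fin r → ℤ))) hc)).toAlgebra
  have := D.isLocalization_away hc
  exact PrimeSpectrum.localization_away_comap_range (D.coneRing (D.vor S)) (D.facetElt S c)

theorem isOpenImmersion_chart {S : Finset (Fin r → ℤ)} {c : Fin r → ℤ} (hc : c ∈ S)
    (h : ∀ β ∈ D.vor S, c ∈ D.nearest β) : IsOpenImmersion (D.chart (D.vor S) c h) := by
  have h1 := D.isOpenImmersion_coneIncl hc
  have h2 := D.isOpenImmersion_chart_vertex c (D.mem_of_mem_vor rfl)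
  rw [D.chart_eq_comp (D.vor_subset_vor_singleton (S := (S : Set (Fin r → ℤ))) hc) (D.mem_of_mem_vor rfl)]
  infer_instance

theorem mem_range_chart {S : Finset (Fin r → ℤ)} {c : Fin r → ℤ} (hc : c ∈ S)
    (h : ∀ β ∈ D.vor S, c ∈ D.nearest β) {z : D.P} : z ∈ Set.range (D.chart (D.vor S) c h) ↔
      ∀ c' ∈ S, z ∈ Proj.basicOpen D.saturation.grading (D.zeta c') := by
  have hpre (y : Spec (.of (D.coneRing (D.vor {c})))) (c') :
      D.chart (D.vor {c}) c (D.mem_of_mem_vor rfl) y ∈ Proj.basicOpen D.saturation.grading (D.zeta c') ↔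
        D.chartHom (D.vor {c}) c (D.mem_of_mem_vor rfl) (D.zeta c') ∉ y.asIdeal := by
    have h1 := D.chart_preimage_basicOpen (W := D.vor {c}) (D.mem_of_mem_vor rfl) c'
    exact (SetLike.ext_iff.1 h1 y)
  have hpr (y : Spec (.of (D.coneRing (D.vor {c})))) : D.facetElt S c ∉ y.asIdeal ↔
      ∀ c' ∈ S, D.chartHom (D.vor {c}) c (D.mem_of_mem_vor rfl) (D.zeta c') ∉ y.asIdeal := by
    unfold facetElt
    rw [y.isPrime.prod_mem_iff]
    push Not; rfl
  rw [D.chart_eq_comp (D.vor_subset_vor_singleton (S := (S : Set (Fin r → ℤ))) hc) (D.mem_of_mem_vor rfl),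
    Scheme.Hom.comp_base, TopCat.coe_comp, Set.range_comp, D.range_coneIncl hc]
  constructor
  · rintro ⟨y, hy, rfl⟩ c' hc'
    exact (hpre y c').2 ((hpr y).1 hy c' hc')
  · intro hz
    have h1 : z ∈ Set.range (D.chart (D.vor {c}) c (D.mem_of_mem_vor rfl)) := by
      rw [range_chart_vertex]; exact hz c hc
    obtain ⟨y, rfl⟩ := h1
    exact ⟨y, (hpr y).2 fun c' hc' => (hpre y c').1 (hz c' hc'), rfl⟩

/-- The lattice points whose coordinates do not vanish at a point. -/
def coords (z : D.P) : Set (Fin r → ℤ) :=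
  {c | z ∈ Proj.basicOpen D.saturation.grading (D.zeta c)}

theorem coneOpen_vor {S : Set (Fin r → ℤ)} (hS : S.Finite) (hne : S.Nonempty) :
    D.coneOpen (D.vor S) = {z | S ⊆ D.coords z} := by
  obtain ⟨c, hc⟩ := hne
  lift S to Finset (Fin r → ℤ) using hS
  ext z
  rw [D.coneOpen_eq_range (D.mem_of_mem_vor hc), D.mem_range_chart (Finset.mem_coe.1 hc)]
  rfl

theorem U_delCell (α : Fin r → ℝ) : D.U (D.delCell α) = {z | D.nearest α ⊆ D.coords z} := by
  unfold U
  rw [D.voronoi_delCell, D.coneOpen_vor (D.finite_nearest α) (D.nearest_nonempty α)]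

theorem exists_chart {σ : Set (Fin r → ℝ)} (hσ : D.IsDelaunay σ) :
    ∃ ι : Spec (.of (D.coneRing (D.voronoi σ))) ⟶ D.P, IsOpenImmersion ι ∧ Set.range ι = D.U σ ∧
      ∀ c, toReal c ∈ σ → ∃ h, D.chart (D.voronoi σ) c h = ι := by
  obtain ⟨α, rfl⟩ := hσ
  unfold U
  rw [D.voronoi_delCell]
  obtain ⟨c, hc⟩ := D.nearest_nonempty α
  have hi : IsOpenImmersion (D.chart (D.vor (D.nearest α)) c (D.mem_of_mem_vor hc)) := by
    have := D.isOpenImmersion_chart (S := (D.finite_nearest α).toFinset)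
      ((D.finite_nearest α).mem_toFinset.2 hc)
    rw [Set.Finite.coe_toFinset] at this
    exact this _
  refine ⟨D.chart (D.vor (D.nearest α)) c (D.mem_of_mem_vor hc), hi,
    (D.coneOpen_eq_range _).symm, fun c' hc' => ?_⟩
  rw [D.toReal_mem_delCell] at hc'
  exact ⟨D.mem_of_mem_vor hc', D.chart_eq_chart _ _⟩

theorem U_inter_U {σ₁ σ₂ : Set (Fin r → ℝ)} (h₁ : D.IsDelaunay σ₁) (h₂ : D.IsDelaunay σ₂) :
    ((D.voronoi σ₁ ∩ D.voronoi σ₂).Nonempty →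
      D.IsDelaunay (D.dualDel (D.voronoi σ₁ ∩ D.voronoi σ₂)) ∧
      D.voronoi (D.dualDel (D.voronoi σ₁ ∩ D.voronoi σ₂)) = D.voronoi σ₁ ∩ D.voronoi σ₂ ∧
      D.U σ₁ ∩ D.U σ₂ = D.U (D.dualDel (D.voronoi σ₁ ∩ D.voronoi σ₂))) ∧
    (D.voronoi σ₁ ∩ D.voronoi σ₂ = ∅ → D.U σ₁ ∩ D.U σ₂ = D.coneOpen ∅) := by
  obtain ⟨α, rfl⟩ := h₁
  obtain ⟨β, rfl⟩ := h₂
  have hne : (D.nearest α ∪ D.nearest β).Nonempty := (D.nearest_nonempty α).inl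
  have hU : D.U (D.delCell α) ∩ D.U (D.delCell β) = D.coneOpen (D.vor (D.nearest α ∪ D.nearest β)) := by
    rw [U_delCell, U_delCell, D.coneOpen_vor ((D.finite_nearest α).union (D.finite_nearest β)) hne]
    ext z; exact Set.union_subset_iff.symm
  rw [hU, D.voronoi_delCell, D.voronoi_delCell, ← D.vor_union]
  refine ⟨fun h => ?_, fun h => by rw [h]⟩
  obtain ⟨γ, hγ, _, hd⟩ := D.dualDel_vor hne h
  rw [hd]
  refine ⟨⟨γ, rfl⟩, by rw [D.voronoi_delCell, hγ], ?_⟩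
  unfold U
  rw [D.voronoi_delCell, hγ]

/-! ### The multiplicative set of a face -/

theorem eta_eq_of_mem {α : Fin r → ℝ} {c d : Fin r → ℤ} (hc : c ∈ D.nearest α)
    (hd : ∃ t : ℝ, 0 ≤ t ∧ ∃ v ∈ D.delCell α, toReal d = t • (v - toReal c)) :
    ∀ β ∈ D.vor (D.nearest α), D.dA β (toReal d) = D.eta d c := by
  obtain ⟨t, ht, v, hv, hd⟩ := hd
  intro β hβ
  obtain ⟨γ, hγ, he, hmax⟩ := D.eta_spec d c
  refine le_antisymm (hmax β (hβ hc)) ?_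
  have h1 := D.supp_add_le_of_mem (D.delCell_subset_iff.2 hβ hv) γ
  have h2 := D.mem_nearest.1 hγ
  have h3 := D.mem_nearest.1 (hβ hc)
  rw [he, hd, D.dA_smul, D.dA_smul, D.dA_sub, D.dA_sub]
  simp only [excess] at h2 h3
  refine mul_le_mul_of_nonneg_left ?_ ht
  linarith

theorem isLocalization_facetMonoid {σ : Set (Fin r → ℝ)} (hσ : D.IsDelaunay σ) (c : Fin r → ℤ)
    (hc : toReal c ∈ σ) : ∃ h : D.coneRing (D.voronoi {toReal c}) ≤ D.coneRing (D.voronoi σ),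
      @IsLocalization _ _ (D.facetMonoid σ c) (D.coneRing (D.voronoi σ)) _
        (Subalgebra.inclusion h).toRingHom.toAlgebra := by
  obtain ⟨α, rfl⟩ := hσ
  rw [D.toReal_mem_delCell] at hc
  have hle : D.coneRing (D.voronoi {toReal c}) ≤ D.coneRing (D.voronoi (D.delCell α)) := by
    rw [D.voronoi_delCell, D.voronoi_singleton]
    exact D.coneRing_le (D.vor_subset_vor_singleton hc)
  refine ⟨hle, ?_⟩
  obtain ⟨S, hS⟩ : ∃ S : Finset (Fin r → ℤ), (S : Set (Fin r → ℤ)) = D.nearest α :=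
    ⟨(D.finite_nearest α).toFinset, (D.finite_nearest α).coe_toFinset⟩
  have hcS : c ∈ S := by rw [← Finset.mem_coe, hS]; exact hc
  have e1 : D.voronoi {toReal c} = D.vor {c} := D.voronoi_singleton c
  have e2 : D.voronoi (D.delCell α) = D.vor S := by rw [D.voronoi_delCell, hS]
  unfold facetMonoid
  generalize D.voronoi {toReal c} = V₁ at *
  generalize D.voronoi (D.delCell α) = V₂ at *
  subst e1 e2
  let := (D.coneIncl (D.vor_subset_vor_singleton (S := (S : Set (Fin r → ℤ))) hcS)).toAlgebra
  have ealg : (Subalgebra.inclusion hle).toRingHom =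
      D.coneIncl (D.vor_subset_vor_singleton (S := (S : Set (Fin r → ℤ))) hcS) :=
    RingHom.ext fun f => Subtype.ext rfl
  rw [ealg]
  have := D.isLocalization_away hcS
  refine IsLocalization.of_le (Submonoid.powers (D.facetElt S c)) _ ?_ ?_
  · rw [Submonoid.powers_le]
    unfold facetElt
    refine Submonoid.prod_mem _ fun c' hc' => Submonoid.subset_closure ?_
    have hc'' : c' ∈ D.nearest α := by rw [← hS]; exact hc'
    have hcone : ∃ t : ℝ, 0 ≤ t ∧ ∃ v ∈ D.delCell α, toReal (c' - c) = t • (v - toReal c) :=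
      ⟨1, zero_le_one, toReal c', D.toReal_mem_delCell.2 hc'', by rw [one_smul, toReal_sub]⟩
    have heta : D.eta (c' - c) c = (D.A c' - D.A c : ℤ) := by
      rw [← D.eta_eq_of_mem hc hcone α (D.mem_vor_nearest α), D.dA_sub_of_mem hc hc'']; push_cast; rfl
    refine ⟨c' - c, hcone, ⟨_, heta⟩, ?_⟩
    rw [heta, Int.ceil_intCast, chartHom_zeta]
    rfl
  · intro f hf
    induction hf using Submonoid.closure_induction with
    | one => rw [map_one]; exact isUnit_one
    | mul x y _ _ hx hy => rw [map_mul]; exact hx.mul hy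
    | mem f hf =>
      obtain ⟨d, hd, ⟨m, hm⟩, hf⟩ := hf
      have h1 : ∀ β ∈ D.vor (S : Set (Fin r → ℤ)), D.dA β (toReal d) = m := by
        rw [hS, ← hm]; exact D.eta_eq_of_mem hc hd
      have h2 := D.isUnit_coneMono h1
      have h3 : algebraMap (D.coneRing (D.vor {c})) (D.coneRing (D.vor S)) f = D.coneMono (D.vor S) d m
          (fun β hβ => (h1 β hβ).le) := by
        apply Subtype.ext
        refine (D.coneIncl_val _ f).trans (hf.trans ?_)
        rw [hm, Int.ceil_intCast]; rfl
      rw [h3]; exact h2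

/-! ### The cover by the charts of the vertices -/

theorem exists_eq_add_or_mem_closure {M : Type*} [AddCommMonoid M] {T : Set M} (P : M → Prop) {q : M}
    (hq : q ∈ AddSubmonoid.closure T) :
    (∃ t ∈ T, P t ∧ ∃ q' ∈ AddSubmonoid.closure T, q = t + q') ∨
      q ∈ AddSubmonoid.closure {t ∈ T | ¬ P t} := by
  induction hq using AddSubmonoid.closure_induction with
  | mem t ht =>
    by_cases h : P t
    · exact Or.inl ⟨t, ht, h, 0, zero_mem _, (add_zero t).symm⟩
    · exact Or.inr (AddSubmonoid.subset_closure ⟨ht, h⟩)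
  | zero => exact Or.inr (zero_mem _)
  | add x y hx hy ihx ihy =>
    rcases ihx with ⟨t, ht, h, q, hq, rfl⟩ | hx'
    · exact Or.inl ⟨t, ht, h, q + y, add_mem hq hy, add_assoc _ _ _⟩
    rcases ihy with ⟨t, ht, h, q, hq, rfl⟩ | hy'
    · exact Or.inl ⟨t, ht, h, x + q, add_mem hx hq, add_left_comm _ _ _⟩
    · exact Or.inr (add_mem hx' hy')

theorem ord_pow {z : K} (hz : z ≠ 0) (N : ℕ) : ord O (z ^ N) = N * ord O z := by
  induction N with
  | zero =>
    obtain ⟨s, hs⟩ := IsDiscreteValuationRing.exists_irreducible O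
    simpa using ord_zpow (K := K) hs 0
  | succ n ih => rw [pow_succ, ord_mul (pow_ne_zero n hz) hz, ih]; push_cast; ring

theorem zeta_dvd {p : ℕ × (Fin r → ℤ)} {α : Fin r → ℝ} {N : ℕ} (hN : 0 < N) {c : Fin r → ℤ}
    (hc : c ∈ D.nearest α) {q : ℕ × (Fin r → ℤ)}
    (hq : q ∈ AddSubmonoid.closure ((fun c => ((1, c) : ℕ × (Fin r → ℤ))) '' D.nearest α))
    (h : N • p = (1, c) + q) (a : D.saturation.coeff p) :
    D.zeta c ∣ D.saturation.mono p a ^ N := by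
  by_cases ha : a.1 = 0
  · obtain rfl : a = 0 := Subtype.ext ha
    rw [CoeffSystem.mono_zero, zero_pow hN.ne']; exact dvd_zero _
  refine ⟨D.saturation.mono q ⟨a.1 ^ N * D.sPow (-D.A c), ?_⟩, ?_⟩
  · rw [mem_saturation]
    intro _ β
    rw [D.ord_mul_sPow (pow_ne_zero N ha)]
    refine ((D.mem_closure_lin hq).1 β).trans ?_
    have h1 : D.lin α (N • p) = D.A c + D.lin α q := by
      rw [h, D.lin_add, D.lin_one_eq_iff.2 hc]
    have h2 := D.mem_saturation.1 a.2 ha α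
    rw [D.lin_nsmul] at h1
    rw [ord_pow ha]; push_cast
    have h4 : (N : ℝ) * D.lin α p ≤ N * ord O a.1 := by gcongr
    linarith
  · apply Subtype.ext
    change (AddMonoidAlgebra.single p a.1) ^ N =
      AddMonoidAlgebra.single (1, c) (D.sPow (D.A c)) * AddMonoidAlgebra.single q (a.1 ^ N * D.sPow (-D.A c))
    rw [AddMonoidAlgebra.single_pow, AddMonoidAlgebra.single_mul_single, h]
    congr 1
    rw [mul_left_comm, ← D.sPow_add, add_neg_cancel]
    simp [sPow]

theorem exists_zeta_dvd {p : ℕ × (Fin r → ℤ)} (hp : p.1 ≠ 0) {α : Fin r → ℝ}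
    (hα : ∀ β, D.lin β p ≤ D.lin α p) (a : D.saturation.coeff p) :
    ∃ N : ℕ, 0 < N ∧ ∃ c ∈ D.nearest α, D.zeta c ∣ D.saturation.mono p a ^ N := by
  obtain ⟨N, hN, hmem⟩ := exists_nsmul_mem_closure (D.forall_lin_le_iff.1 hα)
  refine ⟨N, hN, ?_⟩
  rcases exists_eq_add_or_mem_closure (fun _ => True) hmem with
    ⟨_, ⟨c, hc, rfl⟩, _, q, hq, h⟩ | h
  · exact ⟨c, hc, D.zeta_dvd hN hc hq h a⟩
  · simp only [not_true_eq_false, and_false, Set.ofPred_false, AddSubmonoid.closure_empty,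
      AddSubmonoid.mem_bot] at h
    have := congrArg Prod.fst h
    simp at this; omega

theorem iSup_basicOpen_zeta : ⨆ c, Proj.basicOpen D.saturation.grading (D.zeta c) = ⊤ := by
  refine top_le_iff.1 fun x _ => Opens.mem_iSup.2 ?_
  by_contra! H
  simp only [Proj.mem_basicOpen, not_not] at H
  refine x.not_irrelevant_le fun f hf => ?_
  change f ∈ x.asHomogeneousIdeal.toIdeal
  have := x.isPrime
  rw [← D.saturation.sum_mono f]
  refine sum_mem fun p hp => ?_
  have hp0 : p.1 ≠ 0 := fun h =>
    Finsupp.mem_support_iff.1 hp (D.saturation.mono_coeffAt_mem_of_mem_irrelevant hf p h)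
  obtain ⟨α, hα⟩ := D.exists_forall_lin_le hp0
  obtain ⟨N, hN, c, _, hdvd⟩ := D.exists_zeta_dvd hp0 hα (D.saturation.coeffAt f p)
  exact this.mem_of_pow_mem N (Ideal.mem_of_dvd _ hdvd (H c))

end DegenerationData
end

noncomputable section ProjMaps
open Limits ModuleFrame SerreTwist

namespace ProjCoord
variable {A B : Type u} {σ σ' : Type*} [CommRing A] [SetLike σ A] [AddSubgroupClass σ A]
  [CommRing B] [SetLike σ' B] [AddSubgroupClass σ' B]
  (𝒜 : ℕ → σ) [GradedRing 𝒜] (ℬ : ℕ → σ') [GradedRing ℬ] (ν : A →+* B)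

theorem isClosedImmersion_of_affine_cover {X Y : Scheme.{u}} (f : X ⟶ Y) {κ : Type*}
    {U : κ → Y.Opens} (hU : ⨆ i, U i = ⊤) (haff : ∀ i, IsAffineOpen (U i))
    (haff' : ∀ i, IsAffineOpen (f ⁻¹ᵁ U i)) (hs : ∀ i, Function.Surjective (f.app (U i))) :
    IsClosedImmersion f := by
  refine IsZariskiLocalAtTarget.of_iSup_eq_top (P := @IsClosedImmersion) _ hU fun i => ?_
  have a1 : IsAffine (U i) := haff i
  have a2 : IsAffine (f ⁻¹ᵁ U i) := haff' i
  refine IsClosedImmersion.of_surjective_of_isAffine _ ?_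
  have hs' (V : Y.Opens) (hV : V = U i) : Function.Surjective (f.app V) := by subst hV; exact hs i
  rw [morphismRestrict_appTop]
  exact (ConcreteCategory.bijective_of_isIso
    (X.presheaf.map (eqToHom (image_morphismRestrict_preimage f (U i) ⊤)).op)).2.comp
    (hs' _ (Scheme.Opens.ι_image_top _))

theorem app_resO_preimage {X Y : Scheme.{u}} (f : X ⟶ Y) {U V : Y.Opens} (h : V ≤ U)
    (h' : f ⁻¹ᵁ V ≤ f ⁻¹ᵁ U) (a : Γ(Y, U)) : f.app V (resO h a) = resO h' (f.app U a) :=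
  app_resO f h a

theorem _root_.HasCoords.hom_ext {𝒜 : ℕ → σ} [GradedRing 𝒜] {S : CommRingCat.{u}}
    {p q : Spec S ⟶ Proj 𝒜} {φ : A →+* S} (hp : HasCoords 𝒜 p φ) (hq : HasCoords 𝒜 q φ) : p = q := by
  obtain ⟨_, rfl⟩ := hp; obtain ⟨_, rfl⟩ := hq; rfl

/-- In homogeneous coordinates, the morphism `f` is given by the ring homomorphism `ν`. -/
def IsCoordMap (f : Proj ℬ ⟶ Proj 𝒜) : Prop :=
  ∀ {S : CommRingCat.{u}} {p : Spec S ⟶ Proj ℬ} {φ : B →+* S}, HasCoords ℬ p φ →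
    HasCoords 𝒜 (p ≫ f) (φ.comp ν)

variable {m : ℕ} (hm : 0 < m) (hν : ∀ d, ∀ a ∈ 𝒜 d, ν a ∈ ℬ (m * d))
  {ι : Type v} {w : ι → B} (hw : ∀ i, w i ∈ ℬ 1) (hcov : ⨆ i, Proj.basicOpen ℬ (w i) = ⊤)

include hν hw in
theorem hasCoords_comp_of_eq_one {S : CommRingCat.{u}} {p : Spec S ⟶ Proj ℬ} {φ φ' : B →+* S}
    {i : ι} (h : HasCoords ℬ p φ) (hi : φ (w i) = 1) (h' : HasCoords ℬ p φ') {q : Spec S ⟶ Proj 𝒜}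
    (hq : HasCoords 𝒜 q (φ.comp ν)) : HasCoords 𝒜 q (φ'.comp ν) := by
  obtain ⟨hu, he⟩ := h.isUnit ℬ h' one_pos (hw i) (hi ▸ isUnit_one)
  refine hq.smul 𝒜 (u := φ' (w i) ^ m) (hu.pow _) fun d a ha => ?_
  have := he (m * d) (ν a) (by rw [smul_eq_mul, mul_one]; exact hν d a ha)
  rw [hi, one_pow, mul_one] at this
  simp only [RingHom.comp_apply, this]
  rw [← pow_mul, mul_comm]

theorem exists_isUnit_of_hasCoords {S : CommRingCat.{u}} {p : Spec S ⟶ Proj ℬ} {φ : B →+* S}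
    (hw : ∀ i, w i ∈ ℬ 1) (hcov : ⨆ i, Proj.basicOpen ℬ (w i) = ⊤) (h : HasCoords ℬ p φ)
    (y : PrimeSpectrum S) : ∃ i, φ (w i) ∉ y.asIdeal := by
  have hy : p y ∈ (⨆ i, Proj.basicOpen ℬ (w i) : (Proj ℬ).Opens) := hcov ▸ trivial
  obtain ⟨i, hi⟩ := Opens.mem_iSup.1 hy
  have : y ∈ p ⁻¹ᵁ Proj.basicOpen ℬ (w i) := hi
  rw [preimage_basicOpen_of_hasCoords h one_pos (hw i)] at this
  exact ⟨i, this⟩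

include hν hw hcov in
theorem exists_isCoordMap {z : ι → A} (hz : ∀ i, z i ∈ 𝒜 1) (hzw : ∀ i, ν (z i) = w i ^ m) :
    ∃ f, IsCoordMap 𝒜 ℬ ν f := by
  have irr {S : CommRingCat.{u}} {p : Spec S ⟶ Proj ℬ} {φ : B →+* S} (h : HasCoords ℬ p φ) :
      (HomogeneousIdeal.irrelevant 𝒜).toIdeal.map (φ.comp ν) = ⊤ := by
    by_contra hne
    obtain ⟨M, hM, hle⟩ := Ideal.exists_le_maximal _ hne
    obtain ⟨i, hi⟩ := exists_isUnit_of_hasCoords ℬ hw hcov h ⟨M, hM.isPrime⟩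
    refine hi (hM.isPrime.mem_of_pow_mem m (hle ?_))
    rw [← map_pow, ← hzw]
    refine Ideal.mem_map_of_mem (φ.comp ν) (?_ : z i ∈ HomogeneousIdeal.irrelevant 𝒜)
    rw [HomogeneousIdeal.mem_irrelevant_iff, GradedRing.proj_apply,
      DirectSum.decompose_of_mem_ne _ (hz i) one_ne_zero]
  obtain ⟨T, hT⟩ := exists_hom_of_affine_points (Y := Proj ℬ) (Z := Proj 𝒜)
    (fun {S} p q => ∃ (i : ι) (φ : B →+* S), HasCoords ℬ p φ ∧ φ (w i) = 1 ∧
      HasCoords 𝒜 q (φ.comp ν))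
    (fun {S T} g p q ⟨i, φ, h, hi, hq⟩ => ⟨i, g.hom.comp φ, h.comp ℬ g, by
      rw [RingHom.comp_apply, hi, map_one], hq.comp 𝒜 g⟩)
    (fun {S} p q q' ⟨i, φ, h, hi, hq⟩ ⟨j, φ', h', hj, hq'⟩ =>
      (hasCoords_comp_of_eq_one 𝒜 ℬ ν hν hw h hi h' hq).hom_ext hq')
    (degOneCover ℬ w hw hcov) (fun i => ⟨projPoint 𝒜 ((dehom ℬ (hw i)).comp ν)
      (irr (S := .of (HomogeneousLocalization.Away ℬ (w i))) (hasCoords_awayι ℬ (hw i))), i, dehom ℬ (hw i), hasCoords_awayι ℬ (hw i),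
      dehom_self ℬ (hw i), _, rfl⟩)
  refine ⟨T, fun {S p φ} h => ⟨irr h, ?_⟩⟩
  obtain ⟨𝒰, h𝒰⟩ := exists_cover_hasCoords ℬ w hw hcov p
  refine 𝒰.openCover.hom_ext _ _ fun a => ?_
  obtain ⟨i, φ', h', hi⟩ := h𝒰 a
  change 𝒰.f a ≫ p ≫ T = 𝒰.f a ≫ _
  have h1 : (𝒰.f a ≫ p) ≫ T = _ := hT _ (projPoint 𝒜 (φ'.comp ν) (irr h')) ⟨i, φ', h', hi, _, rfl⟩
  rw [← Category.assoc, h1]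
  have h2 := h.comp ℬ (Spec.preimage (𝒰.f a))
  rw [Spec.map_preimage] at h2
  have h3 := hasCoords_comp_of_eq_one 𝒜 ℬ ν hν hw h' hi h2 (q := projPoint 𝒜 (φ'.comp ν) (irr h'))
    ⟨_, rfl⟩
  have h4 := HasCoords.comp 𝒜 (⟨irr h, rfl⟩ : HasCoords 𝒜 (projPoint 𝒜 (φ.comp ν) (irr h)) _)
    (Spec.preimage (𝒰.f a))
  rw [Spec.map_preimage] at h4
  exact h3.hom_ext h4

variable {𝒜 ℬ ν} {f : Proj ℬ ⟶ Proj 𝒜} (hf : IsCoordMap 𝒜 ℬ ν f)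

include hm hν hw hcov hf in
theorem IsCoordMap.preimage_basicOpen {a : A} {d : ℕ} (hd : 0 < d) (ha : a ∈ 𝒜 d) :
    f ⁻¹ᵁ Proj.basicOpen 𝒜 a = Proj.basicOpen ℬ (ν a) := by
  ext x
  obtain ⟨y, hy⟩ := (degOneCover ℬ w hw hcov).covers x
  have h := hasCoords_awayι ℬ (hw ((degOneCover ℬ w hw hcov).idx x))
  have h1 := preimage_basicOpen_of_hasCoords (hf h) hd ha
  have h2 := preimage_basicOpen_of_hasCoords h (Nat.mul_pos hm hd) (hν d a ha)
  rw [← hy]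
  exact Iff.of_eq (congrArg (y ∈ ·) (h1.trans h2.symm))

include hm hw hcov hf in
theorem IsCoordMap.app_ratio {d : ℕ} (hd : 0 < d) (a e : 𝒜 d) (a' e' : ℬ (m * d))
    (ha : ν a = a') (he : ν e = e') (h : Proj.basicOpen ℬ (e' : B) ≤ f ⁻¹ᵁ Proj.basicOpen 𝒜 (e : A)) :
    resO h (f.app _ (ratio 𝒜 a e)) = ratio ℬ a' e' := by
  refine eq_of_affine_points (degOneCover ℬ w hw hcov) fun S i q hq => ?_
  have hc := HasCoords.comp ℬ (S := (degOneCover ℬ w hw hcov).X i)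
    (p := (degOneCover ℬ w hw hcov).f i) (hasCoords_awayι ℬ (hw i)) (Spec.preimage q)
  rw [Spec.map_preimage] at hc
  generalize q ≫ (degOneCover ℬ w hw hcov).f i = p at hc hq
  have hu := hq
  rw [preimage_basicOpen_of_hasCoords hc (Nat.mul_pos hm hd) e'.2] at hu
  have hu' := ModuleFrame.isUnit_of_basicOpen_eq_top hu
  have h1 := SerreTwist.app_ratio (Nat.mul_pos hm hd) hc a' e' hu'
  have hu2 := hu'
  rw [← he] at hu2
  have h2 := SerreTwist.app_ratio hd (hf hc) a e hu2
  rw [RingHom.comp_apply, RingHom.comp_apply, ha, he] at h2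
  have hW : p ⁻¹ᵁ Proj.basicOpen ℬ (e' : B) ≤ (p ≫ f) ⁻¹ᵁ Proj.basicOpen 𝒜 (e : A) :=
    fun _ hx => h hx
  refine (app_resO_preimage p h hW _).trans ?_
  have h3 : p.app (f ⁻¹ᵁ Proj.basicOpen 𝒜 (e : A)) (f.app _ (ratio 𝒜 a e)) =
    (p ≫ f).app _ (ratio 𝒜 a e) := by rw [Scheme.Hom.comp_app]; rfl
  refine (congrArg (resO (X := Spec S) hW) h3).trans ?_
  have h4 := congrArg (resO (X := Spec S) hW) h2
  rw [map_mul, resO_resO, resO_resO] at h4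
  exact ((hu'.map (Scheme.ΓSpecIso S).inv.hom).map (resO (X := Spec S) le_top)).mul_right_cancel
    (h4.trans h1.symm)

theorem exists_ratio_eq {e : B} {d : ℕ} (hd : 0 < d) (he : e ∈ ℬ d)
    (t : Γ(Proj ℬ, Proj.basicOpen ℬ e)) : ∃ (N : ℕ) (b : B), 0 < N ∧ b ∈ ℬ (d * N) ∧
      ∀ (k n : ℕ) (b' e' : ℬ n), (b' : B) = b * e ^ k → (e' : B) = e ^ (N + k) →
        ∀ h : Proj.basicOpen ℬ e ≤ Proj.basicOpen ℬ (e' : B), t = resO h (ratio ℬ b' e') := by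
  obtain ⟨y, rfl⟩ := (ConcreteCategory.bijective_of_isIso (Proj.basicOpenIsoAway ℬ e he hd).hom).2 t
  obtain ⟨M, a, ha, rfl⟩ := HomogeneousLocalization.Away.mk_surjective ℬ he y
  refine ⟨M + 1, a * e, M.succ_pos, ?_, fun k n b' e' hb he' h => ?_⟩
  · have := SetLike.GradedMul.mul_mem ha he
    rwa [smul_eq_mul, show M * d + d = d * (M + 1) by ring] at this
  · refine structureSheaf_ext ℬ fun x => ?_
    have h1 := eval_ratio ℬ b' e' ⟨x.1, h x.2⟩
    have hu := isUnit_fiber ℬ (e := e') (h x.2)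
    refine hu.mul_right_cancel (Eq.trans ?_ h1.symm)
    have h2 : eval ℬ x ((Proj.basicOpenIsoAway ℬ e he hd).hom
        (HomogeneousLocalization.Away.mk ℬ he M a ha)) = _ :=
      ProjectiveSpectrum.Proj.awayToSection_apply ℬ e
        (HomogeneousLocalization.Away.mk ℬ he M a ha) x
    rw [h2, HomogeneousLocalization.Away.val_mk, Localization.mk_eq_mk', IsLocalization.map_mk']
    have h3 := IsLocalization.mk'_spec (Fiber ℬ x.1) (RingHom.id B a)
      (⟨(RingHom.id B) (e ^ M),
        (idealAt ℬ x.1).primeCompl.pow_mem (not_mem_idealAt ℬ (e := ⟨e, he⟩) x.2) M⟩ :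
          (idealAt ℬ x.1).primeCompl)
    simp only [RingHom.id_apply] at h3 ⊢
    refine (congrArg (_ * algebraMap B (Fiber ℬ x.1) ·) he').trans
      (Eq.trans ?_ (congrArg (algebraMap B (Fiber ℬ x.1)) hb).symm)
    rw [mul_assoc a, ← pow_succ', map_mul (algebraMap B _) a, ← h3, mul_assoc, ← map_mul,
      ← pow_add]
    congr 3
    ring

theorem exists_pow_mul_eq_zero {n : ℕ} (hn : 0 < n) {a e : ℬ n} (h : ratio ℬ a e = 0) :
    ∃ N : ℕ, (e : B) ^ N * a = 0 := by
  have h1 : (Proj.basicOpenIsoAway ℬ (e : B) e.2 hn).hom (HomogeneousLocalization.Away.mk ℬ e.2 1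
      (a : B) (by rw [one_smul]; exact a.2)) = (Proj.basicOpenIsoAway ℬ (e : B) e.2 hn).hom 0 :=
    h.trans (map_zero _).symm
  have h2 := congrArg HomogeneousLocalization.val
    ((ConcreteCategory.bijective_of_isIso (Proj.basicOpenIsoAway ℬ (e : B) e.2 hn).hom).1 h1)
  rw [HomogeneousLocalization.Away.val_mk, HomogeneousLocalization.val_zero, Localization.mk_eq_mk',
    IsLocalization.mk'_eq_zero_iff] at h2
  obtain ⟨⟨_, N, rfl⟩, h3⟩ := h2
  exact ⟨N, h3⟩

theorem ratio_add {n : ℕ} (a b e : ℬ n) : ratio ℬ (a + b) e = ratio ℬ a e + ratio ℬ b e := by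
  refine (congrArg (Proj.awayToSection ℬ (e : B)) ?_).trans
    (map_add (Proj.awayToSection ℬ (e : B)).hom _ _)
  apply HomogeneousLocalization.val_injective
  rw [HomogeneousLocalization.val_add]
  simp only [HomogeneousLocalization.Away.val_mk, AddMemClass.coe_add]
  rw [Localization.add_mk_self]

theorem ratio_eq_zero {n : ℕ} {a e : ℬ n} {k : ℕ} (h : (e : B) ^ k * a = 0) :
    ratio ℬ a e = 0 := by
  refine structureSheaf_ext ℬ fun x => (isUnit_fiber ℬ x.2).mul_right_cancel ?_
  refine ((isUnit_fiber ℬ x.2).pow k).mul_left_cancel ?_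
  have h1 : algebraMap B (Fiber ℬ x.1) (e : B) ^ k * algebraMap B (Fiber ℬ x.1) (a : B) = 0 := by
    rw [← map_pow, ← map_mul, h, map_zero]
  have h2 : eval ℬ x 0 = 0 := map_zero (eval ℬ x)
  refine (congrArg (_ * ·) (eval_ratio ℬ a e x)).trans (h1.trans ?_)
  refine Eq.symm ((congrArg (fun y => _ * (y * _)) h2).trans ?_)
  ring

theorem resO_injective {X : Scheme.{u}} {U V : X.Opens} (h : V = U) :
    Function.Injective (resO (X := X) h.le) := by
  subst h
  intro a b hab
  rwa [resO_self, resO_self] at hab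

include hm hν hw hcov hf in
theorem IsCoordMap.resO_app {x : A} (hx : x ∈ 𝒜 1) {N : ℕ} (hN : 0 < N) (a : 𝒜 N)
    (hxN : x ^ N ∈ 𝒜 N) (a' : ℬ (m * N)) (hνN : ν x ^ N ∈ ℬ (m * N)) (ha' : ν a = a')
    (hO : Proj.basicOpen 𝒜 x ≤ Proj.basicOpen 𝒜 (x ^ N))
    (hO' : Proj.basicOpen ℬ (ν x) ≤ Proj.basicOpen ℬ (ν x ^ N))
    (hpre : Proj.basicOpen ℬ (ν x) ≤ f ⁻¹ᵁ Proj.basicOpen 𝒜 x) :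
    resO hpre (f.app (Proj.basicOpen 𝒜 x) (resO hO (ratio 𝒜 a ⟨_, hxN⟩))) =
      resO hO' (ratio ℬ a' ⟨_, hνN⟩) := by
  have hpre' := hf.preimage_basicOpen hm hν hw hcov hN hxN
  rw [map_pow] at hpre'
  have h1 := hf.app_ratio hm hw hcov hN a ⟨_, hxN⟩ a' ⟨_, hνN⟩ ha' (map_pow _ _ _) hpre'.ge
  have hW : f ⁻¹ᵁ Proj.basicOpen 𝒜 x ≤ f ⁻¹ᵁ Proj.basicOpen 𝒜 (x ^ N) := fun _ h => hO h
  refine (congrArg (resO hpre) (app_resO_preimage f hO hW _)).trans ?_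
  rw [resO_resO]
  have h2 := congrArg (resO (X := Proj ℬ) hO') h1
  rw [resO_resO] at h2
  exact h2

include hm hν hw hcov hf in
theorem IsCoordMap.app_surjective (hsurj : ∀ d, ∀ b ∈ ℬ (m * d), ∃ a ∈ 𝒜 d, ν a = b)
    {x : A} (hx : x ∈ 𝒜 1) : Function.Surjective (f.app (Proj.basicOpen 𝒜 x)) := by
  have hpre := hf.preimage_basicOpen hm hν hw hcov one_pos hx
  have hνx := hν 1 _ hx
  intro t
  obtain ⟨N, b, hN, hb, ht⟩ := exists_ratio_eq (Nat.mul_pos hm one_pos) hνx (resO hpre.ge t)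
  obtain ⟨a, ha, rfl⟩ := hsurj N b (by rwa [mul_one] at hb)
  have hxN : x ^ N ∈ 𝒜 N := by simpa using SetLike.pow_mem_graded N hx
  have hνN : ν x ^ N ∈ ℬ (m * N) := by rw [← map_pow]; exact hν N _ hxN
  have hO : Proj.basicOpen 𝒜 x ≤ Proj.basicOpen 𝒜 (x ^ N) := (Proj.basicOpen_pow 𝒜 x N hN).ge
  have hO' : Proj.basicOpen ℬ (ν x) ≤ Proj.basicOpen ℬ (ν x ^ N) :=
    (Proj.basicOpen_pow ℬ (ν x) N hN).ge
  refine ⟨resO hO (ratio 𝒜 ⟨a, ha⟩ ⟨_, hxN⟩), resO_injective hpre.symm ?_⟩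
  rw [hf.resO_app hm hν hw hcov hx hN ⟨a, ha⟩ hxN ⟨ν a, hν _ _ ha⟩ hνN rfl hO hO' hpre.ge]
  exact (ht 0 (m * N) ⟨ν a, hν _ _ ha⟩ ⟨_, hνN⟩ (by simp) (by simp) hO').symm

include hm hν hw hcov hf in
theorem IsCoordMap.isClosedImmersion (hsurj : ∀ d, ∀ b ∈ ℬ (m * d), ∃ a ∈ 𝒜 d, ν a = b)
    {κ : Type*} {x : κ → A} (hx : ∀ i, x i ∈ 𝒜 1) (hcov' : ⨆ i, Proj.basicOpen 𝒜 (x i) = ⊤) :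
    IsClosedImmersion f := by
  have hpre (i) := hf.preimage_basicOpen hm hν hw hcov one_pos (hx i)
  refine isClosedImmersion_of_affine_cover f hcov'
    (fun i => Proj.isAffineOpen_basicOpen 𝒜 (x i) (hx i) one_pos) (fun i => ?_)
    fun i => hf.app_surjective hm hν hw hcov hsurj (hx i)
  rw [hpre]
  exact Proj.isAffineOpen_basicOpen ℬ (ν (x i)) (hν 1 _ (hx i)) (Nat.mul_pos hm one_pos)

include hm hν hw hcov hf in
/-- Over a basic open set, the functions that `f` annihilates are the fractions with a numerator in
the kernel of `ν`, up to a power of the denominator. -/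
theorem IsCoordMap.app_eq_zero_iff {x : A} (hx : x ∈ 𝒜 1) {N : ℕ} (hN : 0 < N) (a : 𝒜 N)
    (hxN : x ^ N ∈ 𝒜 N) (hO : Proj.basicOpen 𝒜 x ≤ Proj.basicOpen 𝒜 (x ^ N)) :
    f.app (Proj.basicOpen 𝒜 x) (resO hO (ratio 𝒜 a ⟨_, hxN⟩)) = 0 ↔
      ∃ k, ν (x ^ k * a) = 0 := by
  have hpre := hf.preimage_basicOpen hm hν hw hcov one_pos hx
  have hνN : ν x ^ N ∈ ℬ (m * N) := by rw [← map_pow]; exact hν N _ hxN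
  have hO' : Proj.basicOpen ℬ (ν x) = Proj.basicOpen ℬ (ν x ^ N) :=
    (Proj.basicOpen_pow ℬ (ν x) N hN).symm
  have h1 := hf.resO_app hm hν hw hcov hx hN a hxN ⟨ν a, hν _ _ a.2⟩ hνN rfl hO hO'.le hpre.ge
  constructor
  · intro h
    rw [h, map_zero] at h1
    obtain ⟨k, hk⟩ := exists_pow_mul_eq_zero (Nat.mul_pos hm hN)
      (resO_injective hO' (h1.symm.trans (map_zero _).symm))
    refine ⟨N * k, ?_⟩
    rw [map_mul, pow_mul, map_pow, map_pow]
    exact hk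
  · rintro ⟨k, hk⟩
    refine resO_injective hpre.symm (h1.trans ?_)
    rw [map_zero, ratio_eq_zero (k := k), map_zero]
    change (ν x ^ N) ^ k * ν a = 0
    obtain ⟨l, hl⟩ := Nat.exists_eq_add_of_le (Nat.le_mul_of_pos_left k hN)
    rw [← pow_mul, hl, add_comm, pow_add, mul_assoc, ← map_pow ν x k, ← map_mul, hk, mul_zero]

end ProjCoord
end ProjMaps

section
variable {O K : Type u} [CommRing O] [IsDomain O] [IsDiscreteValuationRing O] [Field K]
  [Algebra O K] [IsFractionRing O K] {r : ℕ}

namespace DegenerationData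
variable (D : DegenerationData O K r)

/-- The residue class of an integral element of `K`; the junk value is `0`. -/
noncomputable def red (z : K) : D.k :=
  open Classical in if h : ∃ c : O, algebraMap O K c = z then IsLocalRing.residue O h.choose else 0

theorem red_algebraMap (c : O) : D.red (algebraMap O K c) = IsLocalRing.residue O c := by
  have h : ∃ c' : O, algebraMap O K c' = algebraMap O K c := ⟨c, rfl⟩
  rw [red, dif_pos h, IsFractionRing.injective O K h.choose_spec]

theorem exists_algebraMap_eq {n : ℤ} {z : K} (h : z ≠ 0 → n ≤ ord O z) :
    ∃ c : O, algebraMap O K c = z * D.sPow (-n) := by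
  have h1 : z ∈ Submodule.span O {z | ∃ m, n ≤ m ∧ z = D.sPow m} :=
    (D.mem_span_sPow fun a b hab ha => ha.trans hab).2 h
  induction h1 using Submodule.span_induction with
  | mem z hz =>
    obtain ⟨m, hm, rfl⟩ := hz
    refine ⟨D.s ^ (m - n).toNat, ?_⟩
    rw [← D.sPow_add, map_pow, ← zpow_natCast, Int.toNat_of_nonneg (by omega)]
    rfl
  | zero => exact ⟨0, by simp⟩
  | add x y hx hy ihx ihy =>
    obtain ⟨c, hc⟩ := ihx ((D.mem_span_sPow fun a b hab ha => ha.trans hab).1 hx)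
    obtain ⟨d, hd⟩ := ihy ((D.mem_span_sPow fun a b hab ha => ha.trans hab).1 hy)
    exact ⟨c + d, by rw [map_add, hc, hd, add_mul]⟩
  | smul t x hx ih =>
    obtain ⟨c, hc⟩ := ih ((D.mem_span_sPow fun a b hab ha => ha.trans hab).1 hx)
    exact ⟨t * c, by rw [map_mul, hc, Algebra.smul_def, mul_assoc]⟩

/-- The residue class of `z / s ^ t` for an integer `t`; it is `0` if `t` is not an integer. -/
noncomputable def lead (t : ℝ) (z : K) : D.k :=
  open Classical in if t = ⌊t⌋ then D.red (z * D.sPow (-⌊t⌋)) else 0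

theorem lead_intCast (n : ℤ) (z : K) : D.lead n z = D.red (z * D.sPow (-n)) := by
  rw [lead, Int.floor_intCast, if_pos rfl]

theorem lead_sPow (n : ℤ) (c : O) :
    D.lead n (algebraMap O K c * D.sPow n) = IsLocalRing.residue O c := by
  rw [lead_intCast, mul_assoc, ← D.sPow_add, add_neg_cancel, show D.sPow 0 = 1 by simp [sPow],
    mul_one, red_algebraMap]

theorem lead_of_forall_ne {t : ℝ} (ht : ∀ n : ℤ, t ≠ n) (z : K) : D.lead t z = 0 := by
  rw [lead, if_neg (ht _)]

theorem lead_zero (t : ℝ) : D.lead t 0 = 0 := by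
  unfold lead
  split_ifs
  · rw [zero_mul, ← map_zero (algebraMap O K), red_algebraMap, map_zero]
  · rfl

theorem lead_add {t : ℝ} {z w : K} (hz : z ≠ 0 → t ≤ ord O z) (hw : w ≠ 0 → t ≤ ord O w) :
    D.lead t (z + w) = D.lead t z + D.lead t w := by
  by_cases ht : ∃ n : ℤ, t = n
  · obtain ⟨n, rfl⟩ := ht
    obtain ⟨c, hc⟩ := D.exists_algebraMap_eq fun h => by exact_mod_cast hz h
    obtain ⟨d, hd⟩ := D.exists_algebraMap_eq fun h => by exact_mod_cast hw h
    simp only [lead_intCast, add_mul, ← hc, ← hd]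
    rw [← map_add, red_algebraMap, red_algebraMap, red_algebraMap, map_add]
  · have ht' := not_exists.1 ht
    simp only [D.lead_of_forall_ne ht', add_zero]

theorem lead_eq_zero {t : ℝ} {z : K} (h : z ≠ 0 → t < ord O z) : D.lead t z = 0 := by
  by_cases ht : ∃ n : ℤ, t = n
  · obtain ⟨n, rfl⟩ := ht
    obtain ⟨c, hc⟩ := D.exists_algebraMap_eq (n := n + 1) (z := z) fun hz => by
      have := h hz; exact_mod_cast this
    rw [lead_intCast, show -n = -(n + 1) + 1 by ring, D.sPow_add, ← mul_assoc, ← hc,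
      show D.sPow 1 = algebraMap O K D.s by simp [sPow], ← map_mul, red_algebraMap,
      IsLocalRing.residue_eq_zero_iff]
    exact Ideal.mul_mem_left _ _ ((IsLocalRing.mem_maximalIdeal _).2 D.irreducible_s.not_isUnit)
  · exact D.lead_of_forall_ne (not_exists.1 ht) z

theorem lead_mul {t t' : ℝ} {z w : K} (hz : z ≠ 0 → t ≤ ord O z) (hw : w ≠ 0 → t' ≤ ord O w) :
    D.lead (t + t') (z * w) = D.lead t z * D.lead t' w := by
  have aux {t t' : ℝ} {z w : K} (hz : z ≠ 0 → t ≤ ord O z) (hw : w ≠ 0 → t' ≤ ord O w)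
      (ht : ¬ ∃ n : ℤ, t = n) : D.lead (t + t') (z * w) = 0 := by
    refine D.lead_eq_zero fun h => ?_
    have h1 := hz (left_ne_zero_of_mul h)
    have h2 := hw (right_ne_zero_of_mul h)
    have h3 : t ≠ ord O z := fun h => ht ⟨_, h⟩
    rw [ord_mul (left_ne_zero_of_mul h) (right_ne_zero_of_mul h)]
    push_cast
    linarith [lt_of_le_of_ne h1 h3]
  by_cases ht : ∃ n : ℤ, t = n
  · by_cases ht' : ∃ n : ℤ, t' = n
    · obtain ⟨m, rfl⟩ := ht
      obtain ⟨n, rfl⟩ := ht'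
      obtain ⟨c, hc⟩ := D.exists_algebraMap_eq fun h => by exact_mod_cast hz h
      obtain ⟨d, hd⟩ := D.exists_algebraMap_eq fun h => by exact_mod_cast hw h
      rw [← Int.cast_add]
      simp only [lead_intCast]
      rw [neg_add, D.sPow_add, mul_mul_mul_comm, ← hc, ← hd, ← map_mul, red_algebraMap,
        red_algebraMap, red_algebraMap, map_mul]
    · rw [D.lead_of_forall_ne (not_exists.1 ht'), mul_zero, add_comm, mul_comm]
      exact aux hw hz ht'
  · rw [D.lead_of_forall_ne (not_exists.1 ht), zero_mul]
    exact aux hz hw ht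

theorem lead_ne_zero {z : K} (hz : z ≠ 0) : D.lead (ord O z) z ≠ 0 := by
  intro h
  obtain ⟨c, hc⟩ := D.exists_algebraMap_eq (z := z) fun _ => le_refl (ord O z)
  rw [lead_intCast, ← hc, red_algebraMap, IsLocalRing.residue_eq_zero_iff,
    D.irreducible_s.maximalIdeal_eq, Ideal.mem_span_singleton] at h
  obtain ⟨d, rfl⟩ := h
  have h1 := D.ord_mul_sPow hz (-ord O z)
  have h2 : algebraMap O K (D.s * d) ≠ 0 := hc ▸ mul_ne_zero hz (D.sPow_ne_zero _)
  rw [← hc, map_mul] at h1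
  rw [map_mul] at h2
  rw [ord_mul (left_ne_zero_of_mul h2) (right_ne_zero_of_mul h2)] at h1
  have h3 : ord O (algebraMap O K D.s) = 1 := by simpa [sPow] using D.ord_sPow 1
  have h4 := ord_algebraMap_nonneg (K := K) d
  omega

/-- The initial form with respect to a linear function `L` that is bounded by the orders of the
coefficients. -/
noncomputable def initHom {G : Type} [AddCommMonoid G] {T : Type u} [CommRing T] [Algebra D.k T]
    (Q : CoeffSystem O K G) (L : G →+ ℝ) (hL : ∀ p, ∀ z ∈ Q.coeff p, z ≠ 0 → L p ≤ ord O z)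
    (χ : G → T) (one : χ 0 = 1) (mul : ∀ p q, (∃ z ∈ Q.coeff p, D.lead (L p) z ≠ 0) →
      (∃ z ∈ Q.coeff q, D.lead (L q) z ≠ 0) → χ (p + q) = χ p * χ q) : Q.toSubalgebra →+* T :=
  Q.lift (fun p =>
    { toFun := fun a => D.lead (L p) a.1 • χ p
      map_zero' := by rw [ZeroMemClass.coe_zero, lead_zero, zero_smul]
      map_add' := fun a b => by
        rw [AddMemClass.coe_add, D.lead_add (hL p _ a.2) (hL p _ b.2), add_smul] })
    (by
      have := D.lead_sPow 0 1
      simp only [sPow, zpow_zero, mul_one, map_one, Int.cast_zero] at this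
      simp [one, this])
    (fun p q a b => by
      simp only [AddMonoidHom.coe_mk, ZeroHom.coe_mk, map_add,
        D.lead_mul (hL p _ a.2) (hL q _ b.2)]
      by_cases ha : D.lead (L p) a.1 = 0
      · simp [ha]
      by_cases hb : D.lead (L q) b.1 = 0
      · simp [hb]
      rw [mul p q ⟨_, a.2, ha⟩ ⟨_, b.2, hb⟩, smul_mul_smul_comm])

theorem initHom_mono {G : Type} [AddCommMonoid G] {T : Type u} [CommRing T] [Algebra D.k T]
    {Q : CoeffSystem O K G} {L : G →+ ℝ} {hL : ∀ p, ∀ z ∈ Q.coeff p, z ≠ 0 → L p ≤ ord O z}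
    {χ : G → T} {one : χ 0 = 1} {mul : ∀ p q, (∃ z ∈ Q.coeff p, D.lead (L p) z ≠ 0) →
      (∃ z ∈ Q.coeff q, D.lead (L q) z ≠ 0) → χ (p + q) = χ p * χ q} (p : G) (a : Q.coeff p) :
    D.initHom Q L hL χ one mul (Q.mono p a) = D.lead (L p) a.1 • χ p :=
  Q.lift_mono ..

theorem ord_eq_of_lead_ne_zero {t : ℝ} {z : K} (h : z ≠ 0 → t ≤ ord O z) (hz : D.lead t z ≠ 0) :
    z ≠ 0 ∧ t = ord O z := by
  have h0 : z ≠ 0 := by rintro rfl; exact hz (D.lead_zero t)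
  refine ⟨h0, (h h0).eq_of_not_lt fun hlt => hz (D.lead_eq_zero fun _ => hlt)⟩

theorem mem_polytopeSystem {σ : Set (Fin r → ℝ)} (hσ : D.IsDelaunay σ) {p : ℕ × (Fin r → ℤ)} {z : D.k} :
    z ∈ (D.polytopeSystem hσ).coeff p ↔ (z ≠ 0 → p ∈ D.polytopeMonoid hσ) := by
  change z ∈ Submodule.span D.k {z | p ∈ D.polytopeMonoid hσ ∧ z = 1} ↔ _
  constructor
  · intro h hz
    by_contra hp
    simp only [hp, false_and] at h
    rw [show {z : D.k | False} = ∅ from rfl, Submodule.span_empty, Submodule.mem_bot] at h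
    exact hz h
  · intro h
    by_cases hz : z = 0
    · rw [hz]; exact zero_mem _
    · rw [← mul_one z]
      exact Submodule.smul_mem _ _ (Submodule.subset_span ⟨h hz, rfl⟩)

end DegenerationData
end

section
variable {O K : Type u} [CommRing O] [IsDomain O] [IsDiscreteValuationRing O] [Field K]
  [Algebra O K] [IsFractionRing O K] {r : ℕ}

namespace DegenerationData
variable (D : DegenerationData O K r)

noncomputable def linHom (α : Fin r → ℝ) : ℕ × (Fin r → ℤ) →+ ℝ where
  toFun := D.lin α
  map_zero' := D.lin_zero α
  map_add' := D.lin_add α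

noncomputable def dAHom (α : Fin r → ℝ) : (Fin r → ℤ) →+ ℝ where
  toFun x := D.dA α (toReal x)
  map_zero' := by rw [toReal_zero, D.dA_zero]
  map_add' x y := by rw [toReal_add, D.dA_add]

theorem isDelaunay_delCell (α : Fin r → ℝ) : D.IsDelaunay (D.delCell α) := ⟨α, rfl⟩

/-- The semigroup algebra of the polytope `delCell α`. -/
noncomputable abbrev cellSystem (α : Fin r → ℝ) : CoeffSystem D.k D.k (ℕ × (Fin r → ℤ)) :=
  D.polytopeSystem (D.isDelaunay_delCell α)

theorem mem_polytopeMonoid {α : Fin r → ℝ} {p : ℕ × (Fin r → ℤ)} :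
    p ∈ D.polytopeMonoid (D.isDelaunay_delCell α) ↔
      (∀ β, D.lin β p ≤ D.lin α p) ∧ ∃ n : ℤ, D.lin α p = n := by
  obtain ⟨c, hc⟩ := D.nearest_nonempty α
  change (p = 0 ∨ toReal p.2 ∈ (p.1 : ℝ) • D.delCell α) ∧ D.InLattice (D.delCell α) p ↔ _
  have h0 : (p = 0 ∨ toReal p.2 ∈ (p.1 : ℝ) • D.delCell α) ↔ ∀ β, D.lin β p ≤ D.lin α p := by
    rw [D.forall_lin_le_iff, or_iff_right_iff_imp]
    rintro rfl
    exact D.forall_lin_le_iff.1 fun β => by rw [D.lin_zero, D.lin_zero]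
  rw [h0, D.inLattice_iff hc]
  refine and_congr_right fun h => ?_
  constructor
  · rintro ⟨⟨n, hn⟩, -⟩
    exact ⟨p.1 * D.A c + n, by rw [D.lin_eq hc, hn]; push_cast; rfl⟩
  · rintro ⟨n, hn⟩
    refine ⟨⟨n - p.1 * D.A c, ?_⟩, fun β hβ => ?_⟩
    · have := D.lin_eq hc p
      push_cast; linarith
    · have h1 := D.forall_lin_le_iff.2
        (Set.smul_set_mono (D.delCell_subset_iff.2 hβ) (D.forall_lin_le_iff.1 h)) α
      have h2 := le_antisymm (h β) h1
      rw [D.lin_eq hc, D.lin_eq (hβ hc)] at h2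
      linarith

noncomputable def cellChar (α : Fin r → ℝ) (p : ℕ × (Fin r → ℤ)) : (D.cellSystem α).toSubalgebra :=
  open Classical in if h : p ∈ D.polytopeMonoid (D.isDelaunay_delCell α) then
    (D.cellSystem α).mono p ⟨1, (D.mem_polytopeSystem _).2 fun _ => h⟩ else 0

theorem cellChar_add {α : Fin r → ℝ} {p q : ℕ × (Fin r → ℤ)}
    (hp : p ∈ D.polytopeMonoid (D.isDelaunay_delCell α))
    (hq : q ∈ D.polytopeMonoid (D.isDelaunay_delCell α)) :
    D.cellChar α (p + q) = D.cellChar α p * D.cellChar α q := by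
  rw [cellChar, cellChar, cellChar, dif_pos hp, dif_pos hq, dif_pos (add_mem hp hq),
    CoeffSystem.mono_mul]
  exact congrArg _ (Subtype.ext (one_mul _).symm)

theorem smul_cellChar {α : Fin r → ℝ} {p : ℕ × (Fin r → ℤ)} {t : D.k}
    (h : t ∈ (D.cellSystem α).coeff p) :
    t • D.cellChar α p = (D.cellSystem α).mono p ⟨t, h⟩ := by
  unfold cellChar
  split_ifs with hp
  · apply Subtype.ext
    change t • AddMonoidAlgebra.single p (1 : D.k) = AddMonoidAlgebra.single p t
    rw [AddMonoidAlgebra.smul_single, smul_eq_mul, mul_one]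
  · have : t = 0 := by
      by_contra h0
      exact hp ((D.mem_polytopeSystem _).1 h h0)
    subst this
    rw [smul_zero]
    exact ((D.cellSystem α).mono_zero p).symm

theorem mem_polytopeMonoid_of_lead {α : Fin r → ℝ} {p : ℕ × (Fin r → ℤ)} {z : K}
    (hz : z ∈ D.saturation.coeff p) (h : D.lead (D.lin α p) z ≠ 0) :
    p ∈ D.polytopeMonoid (D.isDelaunay_delCell α) := by
  have h1 := D.mem_saturation.1 hz
  obtain ⟨h0, h2⟩ := D.ord_eq_of_lead_ne_zero (fun h => h1 h α) h
  exact D.mem_polytopeMonoid.2 ⟨fun β => h2 ▸ h1 h0 β, _, h2⟩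

/-- The initial form with respect to `α`, a homomorphism from `R` onto the semigroup algebra of the
polytope `delCell α`. -/
noncomputable def cellHom (α : Fin r → ℝ) : D.R →+* (D.cellSystem α).toSubalgebra :=
  D.initHom D.saturation (D.linHom α) (fun p z hz h0 => D.mem_saturation.1 hz h0 α)
    (D.cellChar α) (by rw [cellChar, dif_pos (zero_mem _)]; exact (D.cellSystem α).mono_one)
    fun p q ⟨_, h1, h2⟩ ⟨_, h3, h4⟩ => D.cellChar_add (D.mem_polytopeMonoid_of_lead h1 h2)
      (D.mem_polytopeMonoid_of_lead h3 h4)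

theorem lead_mem {α : Fin r → ℝ} {p : ℕ × (Fin r → ℤ)} {z : K} (hz : z ∈ D.saturation.coeff p) :
    D.lead (D.lin α p) z ∈ (D.cellSystem α).coeff p :=
  (D.mem_polytopeSystem _).2 (D.mem_polytopeMonoid_of_lead hz)

theorem cellHom_mono_eq_smul (α : Fin r → ℝ) (p : ℕ × (Fin r → ℤ)) (a : D.saturation.coeff p) :
    D.cellHom α (D.saturation.mono p a) = D.lead (D.lin α p) a.1 • D.cellChar α p :=
  D.initHom_mono p a

theorem cellHom_mono (α : Fin r → ℝ) (p : ℕ × (Fin r → ℤ)) (a : D.saturation.coeff p) :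
    D.cellHom α (D.saturation.mono p a) = (D.cellSystem α).mono p ⟨_, D.lead_mem (α := α) a.2⟩ :=
  (D.cellHom_mono_eq_smul α p a).trans (D.smul_cellChar _)

theorem isMonomial_cellHom (α : Fin r → ℝ) : CoeffSystem.IsMonomial (D.cellHom α) :=
  fun p a => ⟨_, D.cellHom_mono α p a⟩

theorem coeff_cellHom (α : Fin r → ℝ) (f : D.R) (p : ℕ × (Fin r → ℤ)) :
    (D.cellHom α f).1.coeff p = D.lead (D.lin α p) (f.1.coeff p) := by
  classical
  induction f using D.saturation.mono_induction with
  | zero =>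
    rw [map_zero]
    exact (D.lead_zero _).symm
  | add f g hf hg =>
    rw [map_add]
    refine (congrArg₂ (· + ·) hf hg).trans (D.lead_add (fun h => D.mem_saturation.1 (f.2 p) h α)
      (fun h => D.mem_saturation.1 (g.2 p) h α)).symm
  | mono q a =>
    rw [cellHom_mono]
    change (AddMonoidAlgebra.single q _).coeff p = D.lead _ ((AddMonoidAlgebra.single q a.1).coeff p)
    rw [AddMonoidAlgebra.coeff_single, AddMonoidAlgebra.coeff_single, Finsupp.single_apply,
      Finsupp.single_apply]
    split_ifs with e
    · subst e; rfl
    · exact (D.lead_zero _).symm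

theorem cellHom_mem_grading (α : Fin r → ℝ) {d : ℕ} {f : D.R} (hf : f ∈ D.saturation.grading d) :
    D.cellHom α f ∈ (D.cellSystem α).grading d := (D.isMonomial_cellHom α).mem_grading hf

theorem exists_cellHom_eq (α : Fin r → ℝ) {d : ℕ} {b : (D.cellSystem α).toSubalgebra}
    (hb : b ∈ (D.cellSystem α).grading d) : ∃ a ∈ D.saturation.grading d, D.cellHom α a = b := by
  have h1 (p) (hp : p ∈ b.1.coeff.support) : ∃ a ∈ D.saturation.grading d,
      D.cellHom α a = (D.cellSystem α).mono p ((D.cellSystem α).coeffAt b p) := by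
    have h0 : b.1.coeff p ≠ 0 := Finsupp.mem_support_iff.1 hp
    obtain ⟨ht, n, hn⟩ := D.mem_polytopeMonoid.1 ((D.mem_polytopeSystem _).1 (b.2 p) h0)
    obtain ⟨c, hc⟩ := IsLocalRing.residue_surjective (b.1.coeff p)
    have hm : algebraMap O K c * D.sPow n ∈ D.saturation.coeff p := by
      rw [← Algebra.smul_def]
      refine Submodule.smul_mem _ _ (D.mem_saturation.2 fun _ β => ?_)
      rw [D.ord_sPow, ← hn]; exact ht β
    refine ⟨D.saturation.mono p ⟨_, hm⟩, hb p h0 ▸ D.saturation.mono_mem_grading p _, ?_⟩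
    rw [cellHom_mono]
    congr 1
    apply Subtype.ext
    change D.lead _ _ = b.1.coeff p
    rw [hn, D.lead_sPow, hc]
  choose! a ha ha' using h1
  refine ⟨∑ p ∈ b.1.coeff.support, a p, sum_mem ha, ?_⟩
  rw [map_sum, Finset.sum_congr rfl ha']
  exact (D.cellSystem α).sum_mono b

theorem cellHom_algebraMap (α : Fin r → ℝ) (c : O) :
    D.cellHom α (algebraMap O D.R c) =
      algebraMap D.k (D.cellSystem α).toSubalgebra (IsLocalRing.residue O c) := by
  apply Subtype.ext
  ext p
  rw [coeff_cellHom]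
  change D.lead _ ((algebraMap O (AddMonoidAlgebra K _) c).coeff p) =
    (algebraMap D.k (AddMonoidAlgebra D.k _) _).coeff p
  classical
  rw [AddMonoidAlgebra.coe_algebraMap, AddMonoidAlgebra.coe_algebraMap]
  simp only [Function.comp_apply, AddMonoidAlgebra.coeff_single, Finsupp.single_apply]
  split_ifs with e
  · subst e
    rw [D.lin_zero]
    have := D.lead_sPow 0 c
    simp only [Int.cast_zero, sPow, zpow_zero, mul_one] at this
    exact this
  · exact D.lead_zero _

theorem zeta_eq_mono (c : Fin r → ℤ) (h : D.sPow (D.A c) ∈ D.saturation.coeff (1, c)) :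
    D.zeta c = D.saturation.mono (1, c) ⟨_, h⟩ := rfl

theorem sPow_mem (c : Fin r → ℤ) : D.sPow (D.A c) ∈ D.saturation.coeff (1, c) :=
  D.mem_saturation.2 fun _ β => by rw [D.ord_sPow]; exact D.lin_one_le β c

theorem cellHom_zeta {α : Fin r → ℝ} {c : Fin r → ℤ} (hc : c ∈ D.nearest α) :
    D.cellHom α (D.zeta c) = D.cellChar α (1, c) := by
  rw [D.zeta_eq_mono c (D.sPow_mem c), cellHom_mono_eq_smul]
  have := D.lead_sPow (D.A c) 1
  rw [map_one, map_one, one_mul] at this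
  rw [D.lin_one_eq_iff.2 hc, this, one_smul]

theorem cellHom_zeta_eq_zero {α : Fin r → ℝ} {c : Fin r → ℤ} (hc : c ∉ D.nearest α) :
    D.cellHom α (D.zeta c) = 0 := by
  rw [D.zeta_eq_mono c (D.sPow_mem c), cellHom_mono_eq_smul, D.lead_eq_zero fun _ => ?_, zero_smul]
  rw [D.ord_sPow]
  exact lt_of_le_of_ne (D.lin_one_le α c) fun h => hc (D.lin_one_eq_iff.1 h)

theorem one_mem_polytopeMonoid {α : Fin r → ℝ} {c : Fin r → ℤ} (hc : c ∈ D.nearest α) :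
    (1, c) ∈ D.polytopeMonoid (D.isDelaunay_delCell α) :=
  D.mem_polytopeMonoid.2 ⟨fun β => by rw [D.lin_one_eq_iff.2 hc]; exact D.lin_one_le β c, _,
    D.lin_one_eq_iff.2 hc⟩

theorem cellChar_ne_zero {α : Fin r → ℝ} {p : ℕ × (Fin r → ℤ)}
    (hp : p ∈ D.polytopeMonoid (D.isDelaunay_delCell α)) : D.cellChar α p ≠ 0 := by
  rw [cellChar, dif_pos hp]
  intro h
  have : (AddMonoidAlgebra.single p (1 : D.k)).coeff p = 0 :=
    congrArg (fun f : (D.cellSystem α).toSubalgebra => f.1.coeff p) h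
  rw [AddMonoidAlgebra.coeff_single, Finsupp.single_eq_same] at this
  exact one_ne_zero this

/-- A monomial whose order is larger than its support function is nilpotent modulo the uniformizer. -/
theorem map_mono_eq_zero_of_lt {T : Type*} [CommRing T] [IsDomain T] (φ : D.R →+* T)
    (hs : φ (algebraMap O D.R D.s) = 0) {p : ℕ × (Fin r → ℤ)} {a : D.saturation.coeff p}
    {β : Fin r → ℝ} (hβ : ∀ γ, D.lin γ p ≤ D.lin β p) (hβa : D.lin β p < ord O a.1) :
    φ (D.saturation.mono p a) = 0 := by
  by_cases h0 : a.1 = 0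
  · obtain rfl : a = 0 := Subtype.ext h0
    rw [CoeffSystem.mono_zero, map_zero]
  obtain ⟨N, hN⟩ := exists_nat_gt (1 / (ord O a.1 - D.lin β p))
  have hpos : 0 < (ord O a.1 : ℝ) - D.lin β p := sub_pos.2 hβa
  have hN' : 1 < N * ((ord O a.1 : ℝ) - D.lin β p) := by rwa [div_lt_iff₀ hpos] at hN
  have hmem : a.1 ^ N * D.sPow (-1) ∈ D.saturation.coeff (N • p) := D.mem_saturation.2 fun _ γ => by
    rw [D.ord_mul_sPow (pow_ne_zero N h0), ord_pow h0, D.lin_nsmul]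
    have : (N : ℝ) * D.lin γ p ≤ N * D.lin β p := by gcongr; exact hβ γ
    push_cast
    linarith
  have h1 : D.saturation.mono p a ^ N =
      algebraMap O D.R D.s * D.saturation.mono (N • p) ⟨_, hmem⟩ := by
    apply Subtype.ext
    change AddMonoidAlgebra.single p a.1 ^ N = algebraMap O (AddMonoidAlgebra K _) D.s *
      AddMonoidAlgebra.single (N • p) (a.1 ^ N * D.sPow (-1))
    have h3 : a.1 ^ N = algebraMap O K D.s * (a.1 ^ N * D.sPow (-1)) := by
      rw [show algebraMap O K D.s = D.sPow 1 by simp [sPow], mul_left_comm, ← D.sPow_add]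
      simp [sPow]
    have h4 : (AddMonoidAlgebra.single (N • p) (a.1 ^ N) : AddMonoidAlgebra K _) =
        algebraMap O (AddMonoidAlgebra K _) D.s *
          AddMonoidAlgebra.single (N • p) (a.1 ^ N * D.sPow (-1)) := by
      refine Eq.trans ?_ (Algebra.smul_def D.s _)
      refine Eq.trans (congrArg _ ?_) (AddMonoidAlgebra.smul_single _ _ _).symm
      exact h3.trans (Algebra.smul_def _ _).symm
    rw [AddMonoidAlgebra.single_pow]
    exact h4
  have h2 : φ (D.saturation.mono p a) ^ N = 0 := by rw [← map_pow, h1, map_mul, hs, zero_mul]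
  exact eq_zero_of_pow_eq_zero h2

/-- A monomial that is killed by the initial form with respect to `α` is nilpotent modulo the
uniformizer and the `ζ_c` for which `c` is not nearest to `α`. -/
theorem map_mono_eq_zero {α : Fin r → ℝ} {T : Type*} [CommRing T] [IsDomain T] (φ : D.R →+* T)
    (hs : φ (algebraMap O D.R D.s) = 0) (hζ : ∀ c, c ∉ D.nearest α → φ (D.zeta c) = 0)
    {p : ℕ × (Fin r → ℤ)} {a : D.saturation.coeff p} (ha : D.lead (D.lin α p) a.1 = 0) :
    φ (D.saturation.mono p a) = 0 := by
  by_cases h0 : a.1 = 0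
  · obtain rfl : a = 0 := Subtype.ext h0
    rw [CoeffSystem.mono_zero, map_zero]
  have hle := D.mem_saturation.1 a.2 h0
  have hlt : D.lin α p < ord O a.1 := lt_of_le_of_ne (hle α) fun h => by
    rw [h] at ha; exact D.lead_ne_zero h0 ha
  have key {β : Fin r → ℝ} := D.map_mono_eq_zero_of_lt φ hs (a := a) (β := β)
  by_cases hp : p.1 = 0
  · have hx : p.2 = 0 := by
      refine toReal_injective (toReal_zero (r := r) ▸ D.eq_zero_of_forall_dA_le (C := ord O a.1)
        fun β => ?_)
      have := hle β
      rwa [lin, hp, Nat.cast_zero, zero_mul, zero_add] at this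
    obtain rfl : p = 0 := Prod.ext hp hx
    exact key (β := α) (fun γ => by rw [D.lin_zero, D.lin_zero]) hlt
  obtain ⟨β, hβ⟩ := D.exists_forall_lin_le hp
  by_cases hβa : D.lin β p < ord O a.1
  · exact key hβ hβa
  have hβe : D.lin β p = ord O a.1 := le_antisymm (hle β) (not_lt.1 hβa)
  obtain ⟨N, hN, hmem⟩ := exists_nsmul_mem_closure (D.forall_lin_le_iff.1 hβ)
  rcases exists_eq_add_or_mem_closure (fun t => t.2 ∉ D.nearest α) hmem with
    ⟨_, ⟨c, hc, rfl⟩, hcα, q, hq, h⟩ | h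
  · obtain ⟨g, hg⟩ := D.zeta_dvd hN hc hq h a
    have h2 : φ (D.saturation.mono p a) ^ N = 0 := by
      rw [← map_pow, hg, map_mul, hζ c hcα, zero_mul]
    exact eq_zero_of_pow_eq_zero h2
  · exfalso
    have h3 : D.lin α (N • p) = D.lin β (N • p) := by
      have (q) (hq : q ∈ AddSubmonoid.closure {t ∈ (fun c => ((1, c) : ℕ × (Fin r → ℤ))) '' D.nearest β |
          ¬ t.2 ∉ D.nearest α}) : D.lin α q = D.lin β q := by
        induction hq using AddSubmonoid.closure_induction with
        | mem t ht =>
          obtain ⟨⟨c, hc, rfl⟩, hcα⟩ := ht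
          rw [D.lin_one_eq_iff.2 hc, D.lin_one_eq_iff.2 (not_not.1 hcα)]
        | zero => rw [D.lin_zero, D.lin_zero]
        | add x y _ _ hx hy => rw [D.lin_add, D.lin_add, hx, hy]
      exact this _ h
    rw [D.lin_nsmul, D.lin_nsmul, hβe] at h3
    have hN' : (0 : ℝ) < N := by exact_mod_cast hN
    exact hlt.ne (mul_left_cancel₀ hN'.ne' h3)

theorem map_eq_zero_of_cellHom_eq_zero {α : Fin r → ℝ} {T : Type*} [CommRing T] [IsDomain T]
    (φ : D.R →+* T) (hs : φ (algebraMap O D.R D.s) = 0)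
    (hζ : ∀ c, c ∉ D.nearest α → φ (D.zeta c) = 0) {f : D.R} (hf : D.cellHom α f = 0) : φ f = 0 := by
  rw [← D.saturation.sum_mono f, map_sum]
  refine Finset.sum_eq_zero fun p _ => D.map_mono_eq_zero φ hs hζ ?_
  change D.lead _ (f.1.coeff p) = 0
  rw [← coeff_cellHom, hf]
  rfl

end DegenerationData
end

section ProjDomain
open Limits
namespace ProjCoord
variable {A : Type u} {σ : Type*} [CommRing A] [SetLike σ A] [AddSubgroupClass σ A]
  (𝒜 : ℕ → σ) [GradedRing 𝒜]

theorem exists_hasCoords_of_range_subset {z : A} (hz : z ∈ 𝒜 1) {S : CommRingCat.{u}}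
    {p : Spec S ⟶ Proj 𝒜} (h : Set.range p ⊆ (Proj.basicOpen 𝒜 z : Set (Proj 𝒜))) :
    ∃ φ : A →+* S, HasCoords 𝒜 p φ ∧ φ z = 1 := by
  have h' : Set.range p ⊆ Set.range (Proj.awayι 𝒜 z hz one_pos) := by
    have := congrArg (fun U : (Proj 𝒜).Opens => (U : Set (Proj 𝒜)))
      (Proj.opensRange_awayι 𝒜 z hz one_pos)
    exact h.trans this.symm.subset
  have hg : Spec.map (Spec.preimage (IsOpenImmersion.lift (Proj.awayι 𝒜 z hz one_pos) p h')) ≫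
      Proj.awayι 𝒜 z hz one_pos = p := by
    rw [Spec.map_preimage, IsOpenImmersion.lift_fac]
  have := (hasCoords_awayι 𝒜 hz).comp 𝒜
    (Spec.preimage (IsOpenImmersion.lift (Proj.awayι 𝒜 z hz one_pos) p h'))
  rw [hg] at this
  refine ⟨_, this, ?_⟩
  rw [RingHom.comp_apply, dehom_self, map_one]

theorem _root_.HasCoords.mem_basicOpen_iff {S : Type u} [Field S] {p : Spec (.of S) ⟶ Proj 𝒜}
    {φ : A →+* S} (h : HasCoords 𝒜 p φ) {a : A} {n : ℕ} (hn : 0 < n) (ha : a ∈ 𝒜 n)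
    (y : Spec (.of S)) : p y ∈ Proj.basicOpen 𝒜 a ↔ φ a ≠ 0 := by
  have e := ModuleFrame.preimage_basicOpen_of_hasCoords h hn ha
  have h1 : p y ∈ Proj.basicOpen 𝒜 a ↔ y ∈ p ⁻¹ᵁ Proj.basicOpen 𝒜 a := Iff.rfl
  rw [h1, e]
  change φ a ∉ y.asIdeal ↔ _
  have hy : y.asIdeal = ⊥ := by
    have := y.isPrime
    exact Ideal.eq_bot_of_prime (K := S) y.asIdeal
  rw [hy]
  exact Iff.rfl

theorem exists_genericPoint [IsDomain A] {w : A} (hw : w ∈ 𝒜 1) (hw0 : w ≠ 0) :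
    ∃ η : Proj 𝒜, closure {η} = Set.univ ∧ ∀ a, η ∈ Proj.basicOpen 𝒜 a ↔ a ≠ 0 := by
  let I : HomogeneousIdeal 𝒜 := ⊥
  have hI : I.toIdeal = ⊥ := rfl
  have hp : I.toIdeal.IsPrime := by rw [hI]; exact Ideal.isPrime_bot
  let η : ProjectiveSpectrum 𝒜 := ⟨I, hp, fun h => hw0 (by
    have : w ∈ HomogeneousIdeal.irrelevant 𝒜 := by
      rw [HomogeneousIdeal.mem_irrelevant_iff, GradedRing.proj_apply,
        DirectSum.decompose_of_mem_ne _ hw one_ne_zero]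
    have := h this
    exact this)⟩
  refine ⟨η, Set.eq_univ_of_forall fun x => ?_, fun a => ?_⟩
  · exact (ProjectiveSpectrum.le_iff_mem_closure 𝒜 η x).1 (bot_le : I ≤ _)
  · exact Iff.rfl

theorem isIntegral_proj [IsDomain A] {ι : Type v} [Nonempty ι] {w : ι → A}
    (hw : ∀ i, w i ∈ 𝒜 1) (hw0 : ∀ i, w i ≠ 0) (hcov : ⨆ i, Proj.basicOpen 𝒜 (w i) = ⊤) :
    IsIntegral (Proj 𝒜) := by
  obtain ⟨η, hη, -⟩ := exists_genericPoint 𝒜 (hw (Classical.arbitrary ι)) (hw0 _)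
  have : IrreducibleSpace (Proj 𝒜) :=
    { isPreirreducible_univ := by
        rw [← hη]; exact (isIrreducible_singleton.closure).isPreirreducible
      toNonempty := ⟨η⟩ }
  have : IsReduced (Proj 𝒜) := by
    have (i : (degOneCover 𝒜 w hw hcov).openCover.I₀) :
        IsReduced ((degOneCover 𝒜 w hw hcov).openCover.X i) := by
      have hdom : _root_.IsReduced (HomogeneousLocalization.Away 𝒜 (w i)) := by
        have : IsDomain (Localization.Away (w i)) :=
          IsLocalization.isDomain_localization (powers_le_nonZeroDivisors_of_noZeroDivisors (hw0 i))
        exact isReduced_of_injective (algebraMap (HomogeneousLocalization.Away 𝒜 (w i))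
          (Localization.Away (w i))) (HomogeneousLocalization.val_injective _)
      exact inferInstanceAs (IsReduced (Spec (.of (HomogeneousLocalization.Away 𝒜 (w i)))))
    exact IsReduced.of_openCover _ (degOneCover 𝒜 w hw hcov).openCover
  exact isIntegral_of_irreducibleSpace_of_isReduced _

end ProjCoord
end ProjDomain

section
open Limits ProjCoord
variable {O K : Type u} [CommRing O] [IsDomain O] [IsDiscreteValuationRing O] [Field K]
  [Algebra O K] [IsFractionRing O K] {r : ℕ}

namespace DegenerationData
variable (D : DegenerationData O K r)

theorem cellChar_mem_grading {α : Fin r → ℝ} {c : Fin r → ℤ} :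
    D.cellChar α (1, c) ∈ (D.cellSystem α).grading 1 := by
  unfold cellChar
  split_ifs
  · exact (D.cellSystem α).mono_mem_grading _ _
  · exact zero_mem _

/-- The generators of degree one of the semigroup algebra of a polytope. -/
noncomputable abbrev cellGen (α : Fin r → ℝ) (c : D.nearest α) : (D.cellSystem α).toSubalgebra :=
  D.cellChar α (1, c)

theorem cellGen_ne_zero {α : Fin r → ℝ} (c : D.nearest α) : D.cellGen α c ≠ 0 :=
  D.cellChar_ne_zero (D.one_mem_polytopeMonoid c.2)

theorem cellHom_zeta_coe {α : Fin r → ℝ} (c : D.nearest α) :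
    D.cellHom α (D.zeta c) = D.cellGen α c := D.cellHom_zeta c.2

theorem cellHom_zeta_ne_zero_iff {α : Fin r → ℝ} {c : Fin r → ℤ} :
    D.cellHom α (D.zeta c) ≠ 0 ↔ c ∈ D.nearest α := by
  refine ⟨fun h => ?_, fun h => ?_⟩
  · by_contra hc; exact h (D.cellHom_zeta_eq_zero hc)
  · rw [D.cellHom_zeta h]; exact D.cellGen_ne_zero ⟨c, h⟩

theorem iSup_basicOpen_cellGen (α : Fin r → ℝ) :
    ⨆ c, Proj.basicOpen (D.cellSystem α).grading (D.cellGen α c) = ⊤ := by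
  refine top_le_iff.1 fun x _ => Opens.mem_iSup.2 ?_
  by_contra! H
  simp only [Proj.mem_basicOpen, not_not] at H
  refine x.not_irrelevant_le fun f hf => ?_
  change f ∈ x.asHomogeneousIdeal.toIdeal
  have := x.isPrime
  rw [← (D.cellSystem α).sum_mono f]
  refine sum_mem fun p hp => ?_
  have hp0 : p.1 ≠ 0 := fun h =>
    Finsupp.mem_support_iff.1 hp ((D.cellSystem α).mono_coeffAt_mem_of_mem_irrelevant hf p h)
  obtain ⟨a, -, ha⟩ := D.exists_cellHom_eq α ((D.cellSystem α).mono_mem_grading p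
    ((D.cellSystem α).coeffAt f p))
  have hpm := (D.mem_polytopeSystem _).1 (f.2 p) (Finsupp.mem_support_iff.1 hp)
  have hmono : (D.cellSystem α).mono p ((D.cellSystem α).coeffAt f p) =
      f.1.coeff p • D.cellChar α p := (D.smul_cellChar (f.2 p)).symm
  rw [hmono]
  obtain ⟨N, hN, hmem⟩ := exists_nsmul_mem_closure
    (D.forall_lin_le_iff.1 (D.mem_polytopeMonoid.1 hpm).1)
  rw [Algebra.smul_def]
  refine Ideal.mul_mem_left _ _ (this.mem_of_pow_mem N ?_)
  have hclosure {q} (hq : q ∈ AddSubmonoid.closure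
      ((fun c => ((1, c) : ℕ × (Fin r → ℤ))) '' D.nearest α)) :
      q ∈ D.polytopeMonoid (D.isDelaunay_delCell α) := by
    refine (AddSubmonoid.closure_le.2 ?_ : _ ≤ D.polytopeMonoid _) hq
    rintro _ ⟨c, hc, rfl⟩
    exact D.one_mem_polytopeMonoid hc
  have hpow : D.cellChar α p ^ N = D.cellChar α (N • p) := by
    clear hN hmem
    induction N with
    | zero => rw [pow_zero, zero_smul, cellChar, dif_pos (zero_mem _)]; exact (CoeffSystem.mono_one _).symm
    | succ n ih => rw [pow_succ, succ_nsmul, ih, D.cellChar_add (nsmul_mem hpm n) hpm]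
  rw [hpow]
  rcases exists_eq_add_or_mem_closure (fun _ => True) hmem with
    ⟨_, ⟨c, hc, rfl⟩, _, q, hq, h⟩ | h
  · rw [h, D.cellChar_add (D.one_mem_polytopeMonoid hc) (hclosure hq)]
    exact Ideal.mul_mem_right _ _ (H ⟨c, hc⟩)
  · simp only [not_true_eq_false, and_false, Set.ofPred_false, AddSubmonoid.closure_empty,
      AddSubmonoid.mem_bot] at h
    have := congrArg Prod.fst h
    simp at this; omega

theorem exists_cellMap (α : Fin r → ℝ) : ∃ f : D.toricVariety (D.isDelaunay_delCell α) ⟶ D.P,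
    IsCoordMap D.saturation.grading (D.cellSystem α).grading (D.cellHom α) f :=
  exists_isCoordMap D.saturation.grading (D.cellSystem α).grading (D.cellHom α) (m := 1)
    (fun d a ha => by rw [one_mul]; exact D.cellHom_mem_grading α ha)
    (fun _ => D.cellChar_mem_grading) (D.iSup_basicOpen_cellGen α)
    (z := fun c : D.nearest α => D.zeta c) (fun _ => D.zeta_mem _)
    fun c => by rw [pow_one]; exact D.cellHom_zeta_coe c

/-- The morphism from the projective toric variety of the polytope `delCell α` to `P̃`. -/
noncomputable def cellMap (α : Fin r → ℝ) : D.toricVariety (D.isDelaunay_delCell α) ⟶ D.P :=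
  (D.exists_cellMap α).choose

theorem isCoordMap_cellMap (α : Fin r → ℝ) :
    IsCoordMap D.saturation.grading (D.cellSystem α).grading (D.cellHom α) (D.cellMap α) :=
  (D.exists_cellMap α).choose_spec

theorem cellMap_toBase (α : Fin r → ℝ) :
    D.cellMap α ≫ D.toBase = projToSpec (D.cellSystem α).grading ≫ D.closedPoint := by
  obtain ⟨𝒰, h𝒰⟩ := exists_cover_hasCoords (D.cellSystem α).grading (D.cellGen α)
    (fun _ => D.cellChar_mem_grading) (D.iSup_basicOpen_cellGen α) (𝟙 _)
  refine 𝒰.openCover.hom_ext _ _ fun i => ?_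
  obtain ⟨c, φ, hφ, -⟩ := h𝒰 i
  rw [Category.comp_id] at hφ
  change 𝒰.f i ≫ _ = 𝒰.f i ≫ _
  have h1 := (D.isCoordMap_cellMap α hφ).projToSpec
  have h2 := hφ.projToSpec
  rw [← Category.assoc, ← Category.assoc, h2]
  refine h1.trans ?_
  rw [← Spec.map_comp, ← CommRingCat.ofHom_comp]
  congr 2
  ext c
  exact congrArg φ (D.cellHom_algebraMap α c)

/-- The morphism from the projective toric variety of the polytope `delCell α` to the central fiber. -/
noncomputable def cellEmb (α : Fin r → ℝ) : D.toricVariety (D.isDelaunay_delCell α) ⟶ D.P₀ :=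
  pullback.lift (D.cellMap α) (projToSpec (D.cellSystem α).grading) (D.cellMap_toBase α)

theorem cellEmb_incl (α : Fin r → ℝ) : D.cellEmb α ≫ D.incl = D.cellMap α := pullback.lift_fst _ _ _

theorem cellEmb_toResidue (α : Fin r → ℝ) :
    D.cellEmb α ≫ D.toResidue = projToSpec (D.cellSystem α).grading := pullback.lift_snd _ _ _

theorem isClosedImmersion_cellMap (α : Fin r → ℝ) : IsClosedImmersion (D.cellMap α) :=
  IsCoordMap.isClosedImmersion one_pos
    (fun d a ha => by rw [one_mul]; exact D.cellHom_mem_grading α ha)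
    (fun _ => D.cellChar_mem_grading) (D.iSup_basicOpen_cellGen α) (D.isCoordMap_cellMap α)
    (fun d b hb => D.exists_cellHom_eq α (by rwa [one_mul] at hb)) D.zeta_mem D.iSup_basicOpen_zeta

instance : IsClosedImmersion D.closedPoint :=
  IsClosedImmersion.spec_of_surjective _ IsLocalRing.residue_surjective

instance : Mono D.incl := inferInstance

instance (α : Fin r → ℝ) : IsClosedImmersion (D.cellEmb α) := by
  have : IsClosedImmersion (D.cellEmb α ≫ D.incl) := by
    rw [cellEmb_incl]; exact D.isClosedImmersion_cellMap α
  exact IsClosedImmersion.of_comp _ D.incl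

instance (α : Fin r → ℝ) : IsDomain (D.cellSystem α).toSubalgebra := inferInstance

instance (α : Fin r → ℝ) : IsIntegral (D.toricVariety (D.isDelaunay_delCell α)) := by
  have := (D.nearest_nonempty α).to_subtype
  exact isIntegral_proj (D.cellSystem α).grading (w := D.cellGen α)
    (fun _ => D.cellChar_mem_grading) D.cellGen_ne_zero (D.iSup_basicOpen_cellGen α)

end DegenerationData
end

section
open Limits ProjCoord
variable {O K : Type u} [CommRing O] [IsDomain O] [IsDiscreteValuationRing O] [Field K]
  [Algebra O K] [IsFractionRing O K] {r : ℕ}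

namespace DegenerationData
variable (D : DegenerationData O K r)

theorem map_s_eq_zero_of_hasCoords {S : CommRingCat.{u}} (p : Spec S ⟶ D.P₀) {φ : D.R →+* S}
    (h : HasCoords D.saturation.grading (p ≫ D.incl) φ) : φ (algebraMap O D.R D.s) = 0 := by
  have h1 := h.projToSpec
  have h2 : (p ≫ D.incl) ≫ D.toBase =
      Spec.map (CommRingCat.ofHom (IsLocalRing.residue O) ≫ Spec.preimage (p ≫ D.toResidue)) := by
    rw [Spec.map_comp, Spec.map_preimage, Category.assoc, Category.assoc, pullback.condition]
  have h3 := Spec.map_injective (h2.symm.trans h1)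
  have h4 := congrArg (fun g => g.hom D.s) h3
  change (Spec.preimage (p ≫ D.toResidue)).hom (IsLocalRing.residue O D.s) =
    φ (algebraMap O D.R D.s) at h4
  rw [← h4, (IsLocalRing.residue_eq_zero_iff _).2, map_zero]
  rw [D.irreducible_s.maximalIdeal_eq]
  exact Ideal.mem_span_singleton_self _

theorem exists_mem_coords (z : D.P) : ∃ c, c ∈ D.coords z := by
  have hz : z ∈ (⨆ c, Proj.basicOpen D.saturation.grading (D.zeta c) : D.P.Opens) := by
    rw [iSup_basicOpen_zeta]; trivial
  exact Opens.mem_iSup.1 hz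

theorem exists_hasCoords_of_field {T : Type u} [Field T] (p : Spec (.of T) ⟶ D.P) :
    ∃ φ : D.R →+* T, HasCoords D.saturation.grading p φ := by
  let y : Spec (.of T) := (⊥ : PrimeSpectrum T)
  have : Subsingleton (Spec (.of T)) := inferInstanceAs (Subsingleton (PrimeSpectrum T))
  obtain ⟨c, hc⟩ := D.exists_mem_coords (p y)
  obtain ⟨φ, hφ, -⟩ := exists_hasCoords_of_range_subset D.saturation.grading (D.zeta_mem c) (p := p) (by
    rintro _ ⟨y', rfl⟩
    rw [Subsingleton.elim y' y]
    exact hc)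
  exact ⟨φ, hφ⟩

theorem mem_coords_iff {T : Type u} [Field T] {p : Spec (.of T) ⟶ D.P} {φ : D.R →+* T}
    (h : HasCoords D.saturation.grading p φ) (y : Spec (.of T)) {c : Fin r → ℤ} :
    c ∈ D.coords (p y) ↔ φ (D.zeta c) ≠ 0 :=
  h.mem_basicOpen_iff D.saturation.grading one_pos (D.zeta_mem c) y

theorem exists_field_point (z : D.P₀) : ∃ (T : Type u) (_ : Field T) (p : Spec (.of T) ⟶ D.P₀)
    (φ : D.R →+* T), (∀ y, p y = z) ∧ HasCoords D.saturation.grading (p ≫ D.incl) φ := by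
  obtain ⟨φ, hφ⟩ := D.exists_hasCoords_of_field (T := D.P₀.residueField z)
    (D.P₀.fromSpecResidueField z ≫ D.incl)
  refine ⟨_, inferInstance, D.P₀.fromSpecResidueField z, φ, fun y => ?_, hφ⟩
  have : D.P₀.fromSpecResidueField z y ∈ Set.range (D.P₀.fromSpecResidueField z) := ⟨y, rfl⟩
  rw [Scheme.range_fromSpecResidueField] at this
  exact this

theorem mono_congr {p q : ℕ × (Fin r → ℤ)} (hpq : p = q) {a : D.saturation.coeff p}
    {b : D.saturation.coeff q} (hab : a.1 = b.1) : D.saturation.mono p a = D.saturation.mono q b := by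
  subst hpq; rw [Subtype.ext hab]

theorem prod_zeta_eq (S : Finset (Fin r → ℤ)) : ∃ h, ∏ c ∈ S, D.zeta c =
    D.saturation.mono (∑ c ∈ S, (1, c)) ⟨D.sPow (∑ c ∈ S, D.A c), h⟩ := by
  classical
  induction S using Finset.induction_on with
  | empty =>
    have h1 : (1 : K) ∈ D.saturation.coeff 0 := D.saturation.one_mem
    have h2 : D.sPow 0 = 1 := by simp [sPow]
    refine ⟨by simpa [h2] using h1, ?_⟩
    rw [Finset.prod_empty]
    exact D.saturation.mono_one.symm.trans (D.mono_congr Finset.sum_empty.symm h2.symm)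
  | insert c S hc ih =>
    obtain ⟨h, e⟩ := ih
    have h1 := D.saturation.mul_mem _ _ _ (D.sPow_mem c) _ h
    have h2 : D.sPow (∑ c ∈ insert c S, D.A c) = D.sPow (D.A c) * D.sPow (∑ c ∈ S, D.A c) := by
      rw [Finset.sum_insert hc, D.sPow_add]
    refine ⟨by rw [h2, Finset.sum_insert hc]; exact h1, ?_⟩
    rw [Finset.prod_insert hc, e, D.zeta_eq_mono c (D.sPow_mem c), CoeffSystem.mono_mul]
    exact D.mono_congr (Finset.sum_insert hc).symm h2.symm

/-- Finitely many of the `ζ_c` that do not vanish at a point of the central fiber belong to a Delaunay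
cell. -/
theorem vor_nonempty_of_subset_coords (z : D.P₀) {S : Finset (Fin r → ℤ)} (hS : S.Nonempty)
    (h : (S : Set (Fin r → ℤ)) ⊆ D.coords (D.incl z)) : (D.vor S).Nonempty := by
  obtain ⟨T, _, p, φ, hp, hφ⟩ := D.exists_field_point z
  let y : Spec (.of T) := (⊥ : PrimeSpectrum T)
  have hne (c) (hc : c ∈ S) : φ (D.zeta c) ≠ 0 := by
    rw [← D.mem_coords_iff hφ y, Scheme.Hom.comp_apply, hp]
    exact h hc
  obtain ⟨hm, e⟩ := D.prod_zeta_eq S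
  have hne' : φ (∏ c ∈ S, D.zeta c) ≠ 0 := by
    rw [map_prod]; exact Finset.prod_ne_zero_iff.2 hne
  have hdeg : (∑ c ∈ S, ((1, c) : ℕ × (Fin r → ℤ))).1 ≠ 0 := by
    rw [Prod.fst_sum, Finset.sum_const, smul_eq_mul, mul_one]
    exact hS.card_pos.ne'
  obtain ⟨β, hβ⟩ := D.exists_forall_lin_le hdeg
  have hsum : D.lin β (∑ c ∈ S, (1, c)) = ∑ c ∈ S, D.lin β (1, c) := map_sum (D.linHom β) _ _
  refine ⟨β, ?_⟩
  change (S : Set (Fin r → ℤ)) ⊆ D.nearest β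
  by_contra hlt
  obtain ⟨c, hc, hcβ⟩ := Set.not_subset.1 hlt
  refine hne' ?_
  rw [e]
  refine D.map_mono_eq_zero_of_lt φ (D.map_s_eq_zero_of_hasCoords p hφ) hβ ?_
  rw [hsum, D.ord_sPow]
  push_cast
  exact Finset.sum_lt_sum (fun c _ => D.lin_one_le β c) ⟨c, hc, lt_of_le_of_ne (D.lin_one_le β c)
    fun h => hcβ (D.lin_one_eq_iff.1 h)⟩

theorem exists_coords_eq (z : D.P₀) : ∃ α, D.coords (D.incl z) = D.nearest α := by
  classical
  obtain ⟨c₀, hc₀⟩ := D.exists_mem_coords (D.incl z)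
  obtain ⟨ρ, hρ⟩ := D.exists_covering_radius
  have hfin : (D.coords (D.incl z)).Finite := by
    refine (finite_setOf_norm_le (ρ + (ρ + ‖toReal c₀‖))).subset fun c hc => ?_
    obtain ⟨β, hβ⟩ := D.vor_nonempty_of_subset_coords z (S := {c, c₀}) (by simp) (by
      intro x hx
      simp only [Finset.coe_insert, Finset.coe_singleton, Set.mem_insert_iff,
        Set.mem_singleton_iff] at hx
      rcases hx with rfl | rfl <;> assumption)
    have h1 := hρ β c (hβ (by simp))
    have h2 := hρ β c₀ (hβ (by simp))
    have h3 : ‖β‖ ≤ ρ + ‖toReal c₀‖ := by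
      have := norm_sub_le (toReal c₀) (toReal c₀ - β)
      rw [sub_sub_cancel] at this
      linarith
    have h4 := norm_add_le (toReal c - β) β
    rw [sub_add_cancel] at h4
    exact h4.trans (add_le_add h1 h3)
  have hne : (D.vor (D.coords (D.incl z))).Nonempty := by
    have := D.vor_nonempty_of_subset_coords z (S := hfin.toFinset) ⟨c₀, hfin.mem_toFinset.2 hc₀⟩
      (by rw [hfin.coe_toFinset])
    rwa [hfin.coe_toFinset] at this
  obtain ⟨α, hα, hmin⟩ := D.exists_vor_eq ⟨c₀, hc₀⟩ hne
  refine ⟨α, Set.Subset.antisymm hα ?_⟩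
  have hv : D.vor (D.coords (D.incl z)) = D.vor (D.nearest α) :=
    Set.Subset.antisymm (fun β hβ => hmin β hβ) (D.vor_mono hα)
  have h1 : D.incl z ∈ D.coneOpen (D.vor (D.coords (D.incl z))) := by
    rw [D.coneOpen_vor hfin ⟨c₀, hc₀⟩]; exact Set.Subset.rfl
  rw [hv, D.coneOpen_vor (D.finite_nearest α) (D.nearest_nonempty α)] at h1
  exact h1

theorem orb_delCell (α : Fin r → ℝ) :
    D.orb (D.delCell α) = {z | D.coords (D.incl z) = D.nearest α} := by
  ext z
  unfold orb
  rw [U_delCell]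
  refine ⟨fun ⟨h, h'⟩ => ?_, fun h => ⟨(Eq.ge h : _), ?_⟩⟩
  · obtain ⟨γ, hγ⟩ := D.exists_coords_eq z
    refine hγ.trans (Set.Subset.antisymm ?_ (hγ ▸ h))
    by_contra hne
    refine h' (D.delCell γ) ⟨γ, rfl⟩ ⟨D.delCell_subset_iff.2 (hγ ▸ h), fun h2 =>
      hne (D.delCell_subset_iff.1 h2)⟩ ?_
    rw [U_delCell]
    exact hγ.ge
  · rintro _ ⟨γ, rfl⟩ hlt hz
    rw [U_delCell] at hz
    have h2 : D.nearest γ ⊆ D.nearest α := h ▸ hz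
    exact hlt.2 (D.delCell_subset_iff.2 h2)

/-- The morphism from the spectrum of a field to the toric variety of a cell. -/
theorem exists_comp_cellEmb {α : Fin r → ℝ} {T : Type u} [Field T] (p : Spec (.of T) ⟶ D.P₀)
    {φ : D.R →+* T} (hφ : HasCoords D.saturation.grading (p ≫ D.incl) φ)
    (h : ∀ c, φ (D.zeta c) ≠ 0 → c ∈ D.nearest α) :
    ∃ (q : Spec (.of T) ⟶ D.toricVariety (D.isDelaunay_delCell α)) (ψ : _ →+* T),
      HasCoords (D.cellSystem α).grading q ψ ∧ ψ.comp (D.cellHom α) = φ ∧ q ≫ D.cellEmb α = p := by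
  have hs := D.map_s_eq_zero_of_hasCoords p hφ
  have hζ (c) (hc : c ∉ D.nearest α) : φ (D.zeta c) = 0 := by
    by_contra hne; exact hc (h c hne)
  have hsurj : Function.Surjective (D.cellHom α) := fun b => by
    induction b using (D.cellSystem α).mono_induction with
    | zero => exact ⟨0, map_zero _⟩
    | add f g hf hg =>
      obtain ⟨a, rfl⟩ := hf
      obtain ⟨b, rfl⟩ := hg
      exact ⟨a + b, map_add _ _ _⟩
    | mono p a =>
      obtain ⟨b, -, hb⟩ := D.exists_cellHom_eq α ((D.cellSystem α).mono_mem_grading p a)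
      exact ⟨b, hb⟩
  let ψ := RingHom.liftOfSurjective (D.cellHom α) hsurj ⟨φ, fun f hf =>
    D.map_eq_zero_of_cellHom_eq_zero φ hs hζ hf⟩
  have hψ : ψ.comp (D.cellHom α) = φ := RingHom.liftOfSurjective_comp _ _ _
  let y : Spec (.of T) := (⊥ : PrimeSpectrum T)
  obtain ⟨c, hc⟩ := D.exists_mem_coords ((p ≫ D.incl) y)
  have hcα := h c ((D.mem_coords_iff hφ y).1 hc)
  rw [D.mem_coords_iff hφ y, ← hψ, RingHom.comp_apply, D.cellHom_zeta_coe ⟨c, hcα⟩] at hc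
  have hirr := map_irrelevant_eq_top (D.cellSystem α).grading one_pos D.cellChar_mem_grading
    (isUnit_iff_ne_zero.2 hc)
  have hq : HasCoords (D.cellSystem α).grading (S := .of T)
      (projPoint (D.cellSystem α).grading (S := .of T) ψ hirr) ψ := ⟨hirr, rfl⟩
  refine ⟨_, ψ, hq, hψ, ?_⟩
  rw [← cancel_mono D.incl, Category.assoc, cellEmb_incl]
  have h1 := D.isCoordMap_cellMap α hq
  rw [hψ] at h1
  exact h1.hom_ext hφ

theorem mem_range_cellEmb {α : Fin r → ℝ} {z : D.P₀} :
    z ∈ Set.range (D.cellEmb α) ↔ D.coords (D.incl z) ⊆ D.nearest α := by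
  constructor
  · rintro ⟨t, rfl⟩ c hc
    rw [← Scheme.Hom.comp_apply, cellEmb_incl] at hc
    by_contra hcα
    have h1 : t ∈ D.cellMap α ⁻¹ᵁ Proj.basicOpen D.saturation.grading (D.zeta c) := hc
    rw [IsCoordMap.preimage_basicOpen one_pos
      (fun d a ha => by rw [one_mul]; exact D.cellHom_mem_grading α ha)
      (fun _ => D.cellChar_mem_grading) (D.iSup_basicOpen_cellGen α) (D.isCoordMap_cellMap α)
      one_pos (D.zeta_mem c), D.cellHom_zeta_eq_zero hcα, Proj.basicOpen_zero] at h1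
    exact h1
  · intro h
    obtain ⟨T, _, p, φ, hp, hφ⟩ := D.exists_field_point z
    let y : Spec (.of T) := (⊥ : PrimeSpectrum T)
    obtain ⟨q, -, -, -, hq⟩ := D.exists_comp_cellEmb (α := α) p hφ fun c hc => h (by
      rw [← D.mem_coords_iff hφ y, Scheme.Hom.comp_apply, hp] at hc
      exact hc)
    refine ⟨q y, ?_⟩
    rw [← Scheme.Hom.comp_apply, hq, hp]

theorem mem_coords_cellEmb {α : Fin r → ℝ} {t : D.toricVariety (D.isDelaunay_delCell α)}
    {c : Fin r → ℤ} : c ∈ D.coords (D.incl (D.cellEmb α t)) ↔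
      t ∈ Proj.basicOpen (D.cellSystem α).grading (D.cellHom α (D.zeta c)) := by
  have e : D.cellMap α ⁻¹ᵁ Proj.basicOpen D.saturation.grading (D.zeta c) =
      Proj.basicOpen (D.cellSystem α).grading (D.cellHom α (D.zeta c)) :=
    IsCoordMap.preimage_basicOpen one_pos
      (fun d a ha => by rw [one_mul]; exact D.cellHom_mem_grading α ha)
      (fun _ => D.cellChar_mem_grading) (D.iSup_basicOpen_cellGen α) (D.isCoordMap_cellMap α)
      one_pos (D.zeta_mem c)
  rw [← e, ← Scheme.Hom.comp_apply, cellEmb_incl]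
  exact Iff.rfl

/-- The generic point of the closure of an orbit, as the image of the generic point of the toric
variety. -/
theorem exists_generic (α : Fin r → ℝ) : ∃ η : D.toricVariety (D.isDelaunay_delCell α),
    closure {η} = Set.univ ∧ (∀ b, η ∈ Proj.basicOpen (D.cellSystem α).grading b ↔ b ≠ 0) ∧
    D.coords (D.incl (D.cellEmb α η)) = D.nearest α := by
  obtain ⟨c, hc⟩ := D.nearest_nonempty α
  obtain ⟨η, h1, h2⟩ := exists_genericPoint (D.cellSystem α).grading
    (D.cellChar_mem_grading (α := α) (c := c)) (D.cellGen_ne_zero ⟨c, hc⟩)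
  refine ⟨η, h1, h2, ?_⟩
  ext c'
  rw [mem_coords_cellEmb, h2, cellHom_zeta_ne_zero_iff]

theorem closure_singleton_cellEmb {α : Fin r → ℝ} {η : D.toricVariety (D.isDelaunay_delCell α)}
    (h : closure {η} = Set.univ) : closure {D.cellEmb α η} = Set.range (D.cellEmb α) := by
  have h1 := (D.cellEmb α).isClosedEmbedding.isClosedMap.closure_image_eq_of_continuous
    (D.cellEmb α).continuous {η}
  rw [h, Set.image_univ, Set.image_singleton] at h1
  exact h1

theorem closure_orb (α : Fin r → ℝ) :
    closure (D.orb (D.delCell α)) = Set.range (D.cellEmb α) := by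
  refine Set.Subset.antisymm ?_ ?_
  · refine closure_minimal (fun z hz => ?_) (D.cellEmb α).isClosedEmbedding.isClosed_range
    rw [orb_delCell] at hz
    exact D.mem_range_cellEmb.2 (Eq.le hz)
  · obtain ⟨η, h1, -, h3⟩ := D.exists_generic α
    rw [← D.closure_singleton_cellEmb h1]
    refine closure_mono (Set.singleton_subset_iff.2 ?_)
    rw [orb_delCell]
    exact h3

theorem mem_closure_orb {α : Fin r → ℝ} {z : D.P₀} :
    z ∈ closure (D.orb (D.delCell α)) ↔ D.coords (D.incl z) ⊆ D.nearest α := by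
  rw [closure_orb, mem_range_cellEmb]

end DegenerationData
end

section
open Limits ProjCoord
variable {O K : Type u} [CommRing O] [IsDomain O] [IsDiscreteValuationRing O] [Field K]
  [Algebra O K] [IsFractionRing O K] {r : ℕ}

namespace DegenerationData
variable (D : DegenerationData O K r)

theorem exists_orbLattice_rep {α : Fin r → ℝ} {S : Finset (Fin r → ℤ)}
    (hS : (S : Set (Fin r → ℤ)) = D.nearest α) {c : Fin r → ℤ} (hc : c ∈ D.nearest α)
    (x : D.orbLattice α) : ∃ d N : ℕ, (d, x.1 + N • ∑ c' ∈ S, (c' - c) + d • c) ∈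
      D.polytopeMonoid (D.isDelaunay_delCell α) := by
  obtain ⟨x, ⟨n, hn⟩, hx⟩ := x
  have hcS : c ∈ S := by rw [← Finset.mem_coe, hS]; exact hc
  obtain ⟨N, hN⟩ := D.exists_nat_forall_dA_le hcS (x := x) (n := n) (fun β hβ => by
    rw [hS] at hβ; rw [hx β hβ, hn])
  obtain ⟨d, γ, hγ, hmax⟩ := D.exists_nat_forall_lin_le c (x + N • ∑ c' ∈ S, (c' - c))
  refine ⟨d, N, ?_⟩
  have hsum : D.dA α (toReal (∑ c' ∈ S, (c' - c))) = ∑ c' ∈ S, ((D.A c' : ℝ) - D.A c) := by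
    rw [toReal_sum, ← dALin_apply, map_sum]
    refine Finset.sum_congr rfl fun c' hc' => ?_
    rw [dALin_apply]
    exact D.dA_sub_of_mem hc (by rw [← hS]; exact hc')
  have hlin : D.lin α (d, x + N • ∑ c' ∈ S, (c' - c) + d • c) =
      d * D.A c + (n + N * ∑ c' ∈ S, ((D.A c' : ℝ) - D.A c)) := by
    rw [D.lin_eq hc]
    simp only [add_sub_cancel_right]
    rw [toReal_add, D.dA_add, hn, toReal_nsmul, D.dA_smul, hsum]
  refine D.mem_polytopeMonoid.2 ⟨fun β => (hmax β).trans ?_,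
    d * D.A c + (n + N * ∑ c' ∈ S, (D.A c' - D.A c)), by rw [hlin]; push_cast; rfl⟩
  rw [hlin, D.lin_eq hγ]
  simp only [add_sub_cancel_right]
  exact add_le_add_right (hN γ (D.mem_vor_singleton.2 hγ)) _

/-- The element of the lattice of the torus of a cell given by an element of the semigroup. -/
def toOrbLattice {α : Fin r → ℝ} (c : D.nearest α) {p : ℕ × (Fin r → ℤ)}
    (h : p ∈ D.polytopeMonoid (D.isDelaunay_delCell α)) : D.orbLattice α :=
  ⟨p.2 - p.1 • c.1, (D.inLattice_iff c.2).1 h.2⟩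

theorem toOrbLattice_add {α : Fin r → ℝ} (c : D.nearest α) {p q : ℕ × (Fin r → ℤ)}
    (hp : p ∈ D.polytopeMonoid (D.isDelaunay_delCell α))
    (hq : q ∈ D.polytopeMonoid (D.isDelaunay_delCell α)) :
    D.toOrbLattice c (add_mem hp hq) = D.toOrbLattice c hp + D.toOrbLattice c hq :=
  Subtype.ext (by
    change (p + q).2 - (p + q).1 • c.1 = p.2 - p.1 • c.1 + (q.2 - q.1 • c.1)
    rw [Prod.snd_add, Prod.fst_add, add_smul]; abel)

open Classical in
/-- The dehomogenization of the semigroup algebra of a cell at one of its vertices. -/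
noncomputable def orbHom {α : Fin r → ℝ} (c : D.nearest α) :
    (D.cellSystem α).toSubalgebra →+* AddMonoidAlgebra D.k (D.orbLattice α) :=
  (D.cellSystem α).lift
    (fun p =>
      { toFun := fun a => if h : p ∈ D.polytopeMonoid (D.isDelaunay_delCell α) then
          AddMonoidAlgebra.single (D.toOrbLattice c h) a.1 else 0
        map_zero' := by split_ifs; exacts [AddMonoidAlgebra.single_zero _, rfl]
        map_add' := fun a b => by
          split_ifs; exacts [AddMonoidAlgebra.single_add _ _ _, (add_zero 0).symm] })
    (by
      change (if h : _ then _ else _) = _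
      rw [dif_pos (zero_mem _)]
      have : D.toOrbLattice c (zero_mem (D.polytopeMonoid (D.isDelaunay_delCell α))) = 0 :=
        Subtype.ext (by change (0 : Fin r → ℤ) - 0 • c.1 = 0; simp)
      rw [this]; rfl)
    fun p q a b => by
      change (if h : _ then _ else _) = (if h : _ then _ else _) * (if h : _ then _ else _)
      by_cases ha : a.1 = 0
      · simp only [ha, AddMonoidAlgebra.single_zero, dite_eq_ite, ite_self, zero_mul]
      by_cases hb : b.1 = 0
      · simp only [hb, AddMonoidAlgebra.single_zero, dite_eq_ite, ite_self, mul_zero]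
      have hp := (D.mem_polytopeSystem _).1 a.2 ha
      have hq := (D.mem_polytopeSystem _).1 b.2 hb
      rw [dif_pos hp, dif_pos hq, dif_pos (add_mem hp hq), AddMonoidAlgebra.single_mul_single,
        D.toOrbLattice_add c hp hq]

theorem orbHom_mono {α : Fin r → ℝ} (c : D.nearest α) {p : ℕ × (Fin r → ℤ)}
    (h : p ∈ D.polytopeMonoid (D.isDelaunay_delCell α)) (a : (D.cellSystem α).coeff p) :
    D.orbHom c ((D.cellSystem α).mono p a) = AddMonoidAlgebra.single (D.toOrbLattice c h) a.1 :=
  ((D.cellSystem α).lift_mono _ _ _ p a).trans (dif_pos h)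

theorem orbHom_cellChar {α : Fin r → ℝ} (c : D.nearest α) {p : ℕ × (Fin r → ℤ)}
    (h : p ∈ D.polytopeMonoid (D.isDelaunay_delCell α)) :
    D.orbHom c (D.cellChar α p) = AddMonoidAlgebra.single (D.toOrbLattice c h) 1 := by
  rw [cellChar, dif_pos h, D.orbHom_mono c h]

theorem orbHom_algebraMap {α : Fin r → ℝ} (c : D.nearest α) (a : D.k) :
    D.orbHom c (algebraMap D.k (D.cellSystem α).toSubalgebra a) = AddMonoidAlgebra.single 0 a := by
  have h1 : algebraMap D.k (D.cellSystem α).toSubalgebra a = a • D.cellChar α 0 := by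
    rw [cellChar, dif_pos (zero_mem _)]
    exact (Algebra.algebraMap_eq_smul_one a).trans (congrArg _ (D.cellSystem α).mono_one.symm)
  rw [h1, D.smul_cellChar ((D.mem_polytopeSystem _).2 fun _ => zero_mem _),
    D.orbHom_mono c (zero_mem _)]
  congr 1
  exact Subtype.ext (by change (0 : Fin r → ℤ) - 0 • c.1 = 0; simp)

theorem orbHom_cellGen_self {α : Fin r → ℝ} (c : D.nearest α) :
    D.orbHom c (D.cellGen α c) = 1 := by
  rw [cellGen, D.orbHom_cellChar c (D.one_mem_polytopeMonoid c.2)]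
  have : D.toOrbLattice c (D.one_mem_polytopeMonoid c.2) = 0 :=
    Subtype.ext (by change c.1 - 1 • c.1 = 0; simp)
  rw [this]; rfl

theorem isUnit_single_one {E : Type} [AddCommGroup E] {F : Type u} [CommRing F] (x : E) :
    IsUnit (AddMonoidAlgebra.single x (1 : F)) :=
  IsUnit.of_mul_eq_one (AddMonoidAlgebra.single (-x) 1) (by
    rw [AddMonoidAlgebra.single_mul_single, add_neg_cancel, one_mul]; rfl)

theorem eq_zero_of_orbHom_eq_zero {α : Fin r → ℝ} (c : D.nearest α) {d : ℕ}
    {b : (D.cellSystem α).toSubalgebra} (hb : b ∈ (D.cellSystem α).grading d)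
    (h : D.orbHom c b = 0) : b = 0 := by
  let ρ : AddMonoidAlgebra D.k (D.orbLattice α) →+ AddMonoidAlgebra D.k (ℕ × (Fin r → ℤ)) :=
    (AddMonoidAlgebra.mapDomainLinearMap D.k D.k
      fun x : D.orbLattice α => (d, x.1 + d • c.1)).toAddMonoidHom
  have key : ρ (D.orbHom c b) = b.1 := by
    conv_rhs => rw [← (D.cellSystem α).sum_mono b]
    conv_lhs => rw [← (D.cellSystem α).sum_mono b]
    rw [map_sum, map_sum, AddSubmonoidClass.coe_finsetSum]
    refine Finset.sum_congr rfl fun p hp => ?_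
    have h0 := Finsupp.mem_support_iff.1 hp
    have hpm := (D.mem_polytopeSystem _).1 (b.2 p) h0
    rw [D.orbHom_mono c hpm]
    refine (AddMonoidAlgebra.mapDomain_single ..).trans ?_
    refine congrArg (fun q => AddMonoidAlgebra.single q (b.1.coeff p)) ?_
    have hd : p.1 = d := hb p h0
    change (d, p.2 - p.1 • c.1 + d • c.1) = p
    rw [hd, sub_add_cancel, ← hd]
  rw [h, map_zero] at key
  exact Subtype.ext key.symm

/-- The product of the generators of degree one. -/
noncomputable def cellProd (α : Fin r → ℝ) : (D.cellSystem α).toSubalgebra :=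
  ∏ c ∈ (D.finite_nearest α).toFinset, D.cellChar α (1, c)

theorem cellProd_mem (α : Fin r → ℝ) :
    D.cellProd α ∈ (D.cellSystem α).grading (D.finite_nearest α).toFinset.card := by
  have := SetLike.prod_mem_graded (D.cellSystem α).grading (fun _ => 1)
    (fun c => D.cellChar α (1, c)) (F := (D.finite_nearest α).toFinset)
    (fun _ _ => D.cellChar_mem_grading)
  rwa [Finset.sum_const, smul_eq_mul, mul_one] at this

theorem isUnit_orbHom_cellProd {α : Fin r → ℝ} (c : D.nearest α) :
    IsUnit (D.orbHom c (D.cellProd α)) := by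
  rw [cellProd, map_prod]
  refine Finset.prod_induction _ IsUnit (fun _ _ => IsUnit.mul) isUnit_one fun c' hc' => ?_
  rw [D.orbHom_cellChar c (D.one_mem_polytopeMonoid ((D.finite_nearest α).mem_toFinset.1 hc'))]
  exact isUnit_single_one _

theorem orbHom_cellProd {α : Fin r → ℝ} (c : D.nearest α) :
    ∃ μ : D.orbLattice α, μ.1 = ∑ c' ∈ (D.finite_nearest α).toFinset, (c' - c.1) ∧
      D.orbHom c (D.cellProd α) = AddMonoidAlgebra.single μ 1 := by
  classical
  have (S : Finset (Fin r → ℤ)) (hS : ∀ c' ∈ S, c' ∈ D.nearest α) : ∃ μ : D.orbLattice α,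
      μ.1 = ∑ c' ∈ S, (c' - c.1) ∧
        D.orbHom c (∏ c' ∈ S, D.cellChar α (1, c')) = AddMonoidAlgebra.single μ 1 := by
    induction S using Finset.induction_on with
    | empty => exact ⟨0, by simp, by rw [Finset.prod_empty, map_one]; rfl⟩
    | insert c' S hc' ih =>
      obtain ⟨μ, h1, h2⟩ := ih fun x hx => hS x (Finset.mem_insert_of_mem hx)
      have hm := D.one_mem_polytopeMonoid (hS c' (Finset.mem_insert_self _ _))
      refine ⟨D.toOrbLattice c hm + μ, ?_, ?_⟩
      · rw [Finset.sum_insert hc', ← h1]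
        change c' - 1 • c.1 + μ.1 = _
        rw [one_smul]
      · rw [Finset.prod_insert hc', map_mul, h2, D.orbHom_cellChar c hm,
          AddMonoidAlgebra.single_mul_single, one_mul]
  exact this _ fun c' hc' => (D.finite_nearest α).mem_toFinset.1 hc'

theorem bijective_awayLift_orbHom {α : Fin r → ℝ} (c : D.nearest α) :
    Function.Bijective (awayLift (D.cellSystem α).grading (D.orbHom c) (D.isUnit_orbHom_cellProd c)) := by
  classical
  set f := awayLift (D.cellSystem α).grading (D.orbHom c) (D.isUnit_orbHom_cellProd c) with hf
  have hmk := awayLift_mk (D.cellSystem α).grading (D.orbHom c) (D.isUnit_orbHom_cellProd c)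
    (D.cellProd_mem α)
  rw [← hf] at hmk
  constructor
  · rw [injective_iff_map_eq_zero]
    intro x hx
    obtain ⟨d, b, hb, rfl⟩ := HomogeneousLocalization.Away.mk_surjective _ (D.cellProd_mem α) x
    have h1 := hmk d b hb
    rw [hx, zero_mul] at h1
    have h0 := D.eq_zero_of_orbHom_eq_zero c hb h1.symm
    subst h0
    apply HomogeneousLocalization.val_injective
    rw [HomogeneousLocalization.Away.val_mk (hf := D.cellProd_mem α), Localization.mk_zero,
      HomogeneousLocalization.val_zero]
  · intro t
    induction t using AddMonoidAlgebra.induction_linear with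
    | zero => exact ⟨0, map_zero _⟩
    | add _ _ hf hg =>
      obtain ⟨x, rfl⟩ := hf
      obtain ⟨y, rfl⟩ := hg
      exact ⟨x + y, map_add _ _ _⟩
    | single x a =>
      obtain ⟨μ, hμ, hW⟩ := D.orbHom_cellProd c
      obtain ⟨d, N, hp⟩ := D.exists_orbLattice_rep (D.finite_nearest α).coe_toFinset c.2 x
      rw [← hμ] at hp
      set S := (D.finite_nearest α).toFinset with hS
      have hcS : c.1 ∈ S := (D.finite_nearest α).mem_toFinset.2 c.2
      let W₀ := ∏ c' ∈ S.erase c.1, D.cellChar α (1, c')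
      have hW₀ : W₀ ∈ (D.cellSystem α).grading (S.card - 1) := by
        have := SetLike.prod_mem_graded (D.cellSystem α).grading (fun _ => 1)
          (fun c => D.cellChar α (1, c)) (F := S.erase c.1)
          (fun _ _ => D.cellChar_mem_grading)
        rwa [Finset.sum_const, smul_eq_mul, mul_one, Finset.card_erase_of_mem hcS] at this
      have hWW₀ : D.orbHom c W₀ = AddMonoidAlgebra.single μ 1 := by
        rw [← hW, cellProd, ← Finset.mul_prod_erase S _ hcS, map_mul, orbHom_cellGen_self, one_mul]
      have hpos : 0 < S.card := Finset.card_pos.2 ⟨_, hcS⟩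
      have hchar : D.cellChar α (d, x.1 + N • μ.1 + d • c.1) ∈ (D.cellSystem α).grading d := by
        rw [cellChar, dif_pos hp]; exact (D.cellSystem α).mono_mem_grading _ _
      let b := algebraMap D.k (D.cellSystem α).toSubalgebra a *
        D.cellChar α (d, x.1 + N • μ.1 + d • c.1) * W₀ ^ d * D.cellGen α c ^ (N * S.card)
      have hb : b ∈ (D.cellSystem α).grading ((d + N) • S.card) := by
        have h1 := SetLike.GradedMul.mul_mem (SetLike.GradedMul.mul_mem (SetLike.GradedMul.mul_mem
          (SetLike.algebraMap_mem_graded (D.cellSystem α).grading a) hchar)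
          (SetLike.pow_mem_graded d hW₀))
          (SetLike.pow_mem_graded (N * S.card) (D.cellChar_mem_grading (α := α) (c := c.1)))
        convert h1 using 1
        obtain ⟨m, hm⟩ : ∃ m, S.card = m + 1 := ⟨S.card - 1, by omega⟩
        rw [hm]
        simp only [smul_eq_mul, add_tsub_cancel_right]
        ring_nf
      have hlat : D.toOrbLattice c hp = x + N • μ := Subtype.ext (by
        change x.1 + N • μ.1 + d • c.1 - d • c.1 = x.1 + N • μ.1
        rw [add_sub_cancel_right])
      refine ⟨.mk _ (D.cellProd_mem α) (d + N) b hb, ?_⟩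
      refine ((D.isUnit_orbHom_cellProd c).pow (d + N)).mul_right_cancel ?_
      rw [hmk, hW]
      simp only [b]
      rw [map_mul, map_mul, map_mul, map_pow, map_pow, orbHom_cellGen_self, one_pow, mul_one, hWW₀,
        D.orbHom_cellChar c hp, orbHom_algebraMap, hlat, AddMonoidAlgebra.single_mul_single,
        AddMonoidAlgebra.single_pow, AddMonoidAlgebra.single_pow,
        AddMonoidAlgebra.single_mul_single, AddMonoidAlgebra.single_mul_single]
      simp only [one_pow, mul_one, zero_add]
      congr 1
      rw [add_smul]; abel

theorem map_irrelevant_orbHom {α : Fin r → ℝ} (c : D.nearest α) :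
    (HomogeneousIdeal.irrelevant (D.cellSystem α).grading).toIdeal.map (D.orbHom c) = ⊤ :=
  map_irrelevant_eq_top _ one_pos (D.cellChar_mem_grading (c := c.1))
    (by rw [orbHom_cellGen_self]; exact isUnit_one)

/-- The isomorphism of the torus of a cell with an open subset of the toric variety. -/
noncomputable def orbChart {α : Fin r → ℝ} (c : D.nearest α) :
    Spec (.of (AddMonoidAlgebra D.k (D.orbLattice α))) ⟶ D.toricVariety (D.isDelaunay_delCell α) :=
  projPoint (D.cellSystem α).grading (S := .of (AddMonoidAlgebra D.k (D.orbLattice α)))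
    (D.orbHom c) (D.map_irrelevant_orbHom c)

theorem hasCoords_orbChart {α : Fin r → ℝ} (c : D.nearest α) :
    HasCoords (D.cellSystem α).grading (S := .of (AddMonoidAlgebra D.k (D.orbLattice α)))
      (D.orbChart c) (D.orbHom c) := ⟨_, rfl⟩

theorem card_nearest_pos {α : Fin r → ℝ} : 0 < (D.finite_nearest α).toFinset.card := by
  obtain ⟨c, hc⟩ := D.nearest_nonempty α
  exact Finset.card_pos.2 ⟨c, (D.finite_nearest α).mem_toFinset.2 hc⟩

theorem orbChart_eq {α : Fin r → ℝ} (c : D.nearest α) : D.orbChart c =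
    Spec.map (CommRingCat.ofHom
      (awayLift (D.cellSystem α).grading (D.orbHom c) (D.isUnit_orbHom_cellProd c))) ≫
        Proj.awayι (D.cellSystem α).grading (D.cellProd α) (D.cellProd_mem α) D.card_nearest_pos :=
  projPoint_away (D.cellSystem α).grading _ _ D.card_nearest_pos (D.cellProd_mem α) _

theorem isIso_awayLift_orbHom {α : Fin r → ℝ} (c : D.nearest α) : IsIso (CommRingCat.ofHom
    (awayLift (D.cellSystem α).grading (D.orbHom c) (D.isUnit_orbHom_cellProd c))) :=
  (RingEquiv.ofBijective _ (D.bijective_awayLift_orbHom c)).toCommRingCatIso.isIso_hom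

instance {α : Fin r → ℝ} (c : D.nearest α) : IsOpenImmersion (D.orbChart c) := by
  rw [orbChart_eq]
  have := D.isIso_awayLift_orbHom c
  infer_instance

theorem range_orbChart {α : Fin r → ℝ} (c : D.nearest α) :
    Set.range (D.orbChart c) = {t | ∀ c' ∈ D.nearest α,
      t ∈ Proj.basicOpen (D.cellSystem α).grading (D.cellChar α (1, c'))} := by
  have := D.isIso_awayLift_orbHom c
  have hs := (Spec.map (CommRingCat.ofHom
    (awayLift (D.cellSystem α).grading (D.orbHom c) (D.isUnit_orbHom_cellProd c)))).surjective
  rw [orbChart_eq, Scheme.Hom.comp_base, TopCat.coe_comp, Set.range_comp, hs.range_eq, Set.image_univ]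
  refine (congrArg (fun U : (D.toricVariety (D.isDelaunay_delCell α)).Opens =>
    (U : Set (D.toricVariety (D.isDelaunay_delCell α))))
    (Proj.opensRange_awayι _ _ (D.cellProd_mem α) D.card_nearest_pos)).trans ?_
  ext t
  change D.cellProd α ∉ t.asHomogeneousIdeal.toIdeal ↔
    ∀ c' ∈ D.nearest α, D.cellChar α (1, c') ∉ t.asHomogeneousIdeal.toIdeal
  have := t.isPrime
  rw [cellProd, this.prod_mem_iff]
  simp only [Set.Finite.mem_toFinset, not_exists, not_and]

theorem isEmbedding_orbChart_cellEmb {α : Fin r → ℝ} (c : D.nearest α) :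
    Topology.IsEmbedding (D.orbChart c ≫ D.cellEmb α) := by
  rw [Scheme.Hom.comp_base]
  exact (D.cellEmb α).isClosedEmbedding.isEmbedding.comp (D.orbChart c).isOpenEmbedding.isEmbedding

theorem range_orbChart_cellEmb {α : Fin r → ℝ} (c : D.nearest α) :
    Set.range (D.orbChart c ≫ D.cellEmb α) = D.orb (D.delCell α) := by
  rw [orb_delCell]
  have hmem (t : D.toricVariety (D.isDelaunay_delCell α)) :
      t ∈ Set.range (D.orbChart c) ↔ D.nearest α ⊆ D.coords (D.incl (D.cellEmb α t)) := by
    rw [range_orbChart]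
    refine forall₂_congr fun c' hc' => ?_
    rw [mem_coords_cellEmb, D.cellHom_zeta hc']
  ext z
  constructor
  · rintro ⟨y, rfl⟩
    rw [Scheme.Hom.comp_apply]
    exact Set.Subset.antisymm (D.mem_range_cellEmb.1 ⟨_, rfl⟩) ((hmem _).1 ⟨y, rfl⟩)
  · intro hz
    obtain ⟨t, rfl⟩ := D.mem_range_cellEmb.2 (Eq.le hz)
    obtain ⟨y, rfl⟩ := (hmem t).2 (Eq.ge hz)
    exact ⟨y, by rw [Scheme.Hom.comp_apply]⟩

end DegenerationData
end

section GroupAlgebra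
open Limits
variable {k : Type u} [Field k]

theorem AddMonoidAlgebra.le_ringKrullDim (n : ℕ) :
    (n : WithBot ℕ∞) ≤ ringKrullDim (AddMonoidAlgebra k (Fin n → ℤ)) := by
  classical
  let π (j : ℕ) : (Fin n → ℤ) →+ (Fin n → ℤ) :=
    { toFun := fun x i => if j ≤ i then x i else 0
      map_zero' := by ext; simp
      map_add' := fun x y => by ext i; simp only [Pi.add_apply]; split_ifs <;> simp }
  let F (j : ℕ) : AddMonoidAlgebra k (Fin n → ℤ) →+* AddMonoidAlgebra k (Fin n → ℤ) :=
    AddMonoidAlgebra.mapDomainRingHom k (π j)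
  have hπ (j : ℕ) (x) : π (j + 1) (π j x) = π (j + 1) x := by
    ext i
    change (if j + 1 ≤ (i : ℕ) then (if j ≤ (i : ℕ) then x i else 0) else 0) = if j + 1 ≤ (i : ℕ) then x i else 0
    split_ifs <;> first | rfl | omega
  have hF (j : ℕ) (f) : F (j + 1) (F j f) = F (j + 1) f := by
    induction f using AddMonoidAlgebra.induction_linear with
    | zero => simp only [map_zero]
    | add f g hf hg => simp only [map_add, hf, hg]
    | single x a =>
      change AddMonoidAlgebra.mapDomain _ (AddMonoidAlgebra.mapDomain _ _) =
        AddMonoidAlgebra.mapDomain _ _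
      rw [AddMonoidAlgebra.mapDomain_single, AddMonoidAlgebra.mapDomain_single,
        AddMonoidAlgebra.mapDomain_single]
      exact congrArg (fun y => AddMonoidAlgebra.single y a) (hπ j x)
  refine Order.le_krullDim_iff.2 ⟨LTSeries.mk n (fun j => ⟨RingHom.ker (F j), RingHom.ker_isPrime _⟩)
    (Fin.strictMono_iff_lt_succ.2 fun j => ?_), rfl⟩
  refine lt_of_le_of_ne (fun f hf => ?_) fun h => ?_
  · have hf' : F j f = 0 := hf
    change F (j + 1) f = 0
    rw [← hF, hf', map_zero]
  · have h1 : F (j + 1) (AddMonoidAlgebra.single (Pi.single j 1) 1 - 1) = 0 := by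
      rw [map_sub, map_one, sub_eq_zero]
      refine (AddMonoidAlgebra.mapDomain_single ..).trans ?_
      have : π (j + 1) (Pi.single j 1) = 0 := by
        ext i
        change (if (j : ℕ) + 1 ≤ (i : ℕ) then (Pi.single j 1 : Fin n → ℤ) i else 0) = 0
        split_ifs with hi
        · rw [Pi.single_eq_of_ne]; rintro rfl; omega
        · rfl
      rw [this]; rfl
    have h2 : F j (AddMonoidAlgebra.single (Pi.single j 1) 1 - 1) = 0 := by
      have := congrArg (fun P : PrimeSpectrum (AddMonoidAlgebra k (Fin n → ℤ)) => P.asIdeal) h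
      change RingHom.ker (F j) = RingHom.ker (F (j + 1)) at this
      change _ ∈ RingHom.ker (F j)
      rw [this]; exact h1
    rw [map_sub, map_one, sub_eq_zero] at h2
    have h3 : F j (AddMonoidAlgebra.single (Pi.single j 1) 1) =
        AddMonoidAlgebra.single (π j (Pi.single j 1)) (1 : k) := AddMonoidAlgebra.mapDomain_single ..
    have h4 : π j (Pi.single j 1) ≠ 0 := fun h0 => by
      have := congrFun h0 j
      change (if (j : ℕ) ≤ (j : ℕ) then (Pi.single j 1 : Fin n → ℤ) j else 0) = 0 at this
      rw [if_pos le_rfl, Pi.single_eq_same] at this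
      exact one_ne_zero this
    rw [h3] at h2
    have h5 := congrArg (fun f : AddMonoidAlgebra k (Fin n → ℤ) => f.coeff (π j (Pi.single j 1))) h2
    change (AddMonoidAlgebra.single _ (1 : k)).coeff _ = (AddMonoidAlgebra.single 0 (1 : k)).coeff _ at h5
    rw [AddMonoidAlgebra.coeff_single, AddMonoidAlgebra.coeff_single, Finsupp.single_eq_same,
      Finsupp.single_apply, if_neg (Ne.symm h4)] at h5
    exact one_ne_zero h5

theorem AddMonoidAlgebra.ringKrullDim_le (n : ℕ) :
    ringKrullDim (AddMonoidAlgebra k (Fin n → ℤ)) ≤ n := by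
  classical
  let f : MvPolynomial (Fin n) k →ₐ[k] AddMonoidAlgebra k (Fin n → ℤ) :=
    MvPolynomial.aeval fun i => AddMonoidAlgebra.single (Pi.single i 1) 1
  have hmon (m : Fin n → ℕ) : f (∏ i, MvPolynomial.X i ^ m i) =
      AddMonoidAlgebra.single (fun i => (m i : ℤ)) 1 := by
    simp only [f, map_prod, map_pow, MvPolynomial.aeval_X, AddMonoidAlgebra.single_pow, one_pow]
    have (s : Finset (Fin n)) : ∏ i ∈ s, AddMonoidAlgebra.single (m i • (Pi.single i 1 : Fin n → ℤ)) (1 : k) =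
        AddMonoidAlgebra.single (∑ i ∈ s, m i • Pi.single i 1) 1 := by
      induction s using Finset.induction_on with
      | empty => rfl
      | insert a s ha ih =>
        rw [Finset.prod_insert ha, ih, Finset.sum_insert ha, AddMonoidAlgebra.single_mul_single, one_mul]
    rw [this]
    congr 1
    ext i
    simp [Finset.sum_apply, Pi.single_apply]
  have hu (b : AddMonoidAlgebra k (Fin n → ℤ)) : ∃ u a, IsUnit (f u) ∧ f a = b * f u := by
    induction b using AddMonoidAlgebra.induction_linear with
    | zero => exact ⟨1, 0, by rw [map_one]; exact isUnit_one, by rw [map_zero, zero_mul]⟩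
    | single x t =>
      refine ⟨∏ i, MvPolynomial.X i ^ (-x i).toNat,
        MvPolynomial.C t * ∏ i, MvPolynomial.X i ^ (x i).toNat, ?_, ?_⟩
      · rw [hmon]; exact DegenerationData.isUnit_single_one _
      · rw [map_mul, hmon, hmon, AddMonoidAlgebra.single_mul_single, mul_one,
          show f (MvPolynomial.C t) = AddMonoidAlgebra.single 0 t from f.commutes t,
          AddMonoidAlgebra.single_mul_single, mul_one, zero_add]
        congr 1
        ext i
        simp only [Pi.add_apply]
        omega
    | add b b' h h' =>
      obtain ⟨u, a, hu, h⟩ := h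
      obtain ⟨u', a', hu', h'⟩ := h'
      refine ⟨u * u', a * u' + a' * u, by rw [map_mul]; exact hu.mul hu', ?_⟩
      rw [map_add, map_mul, map_mul, map_mul, h, h']; ring
  have hmono : StrictMono (PrimeSpectrum.comap f.toRingHom) := fun P Q hPQ => by
    refine lt_of_le_not_ge (fun a ha => hPQ.le ha) fun hle => hPQ.not_ge fun b hb => ?_
    obtain ⟨u, a, hu, h⟩ := hu b
    have h1 : f a ∈ Q.asIdeal := by rw [h]; exact Ideal.mul_mem_right _ _ hb
    have h2 : f a ∈ P.asIdeal := hle h1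
    rw [h] at h2
    exact (P.isPrime.mem_or_mem h2).resolve_right fun h3 =>
      P.isPrime.ne_top (Ideal.eq_top_of_isUnit_mem _ h3 hu)
  refine (Order.krullDim_le_of_strictMono _ hmono).trans ?_
  have := MvPolynomial.ringKrullDim_of_isNoetherianRing (R := k) (ι := Fin n)
  rw [ringKrullDim_eq_zero_of_field, Nat.card_fin, zero_add] at this
  exact this.le

/-- The dimension of a split torus. -/
theorem AddMonoidAlgebra.ringKrullDim_eq {E : Type} [AddCommGroup E] [Module.Free ℤ E]
    [Module.Finite ℤ E] : ringKrullDim (AddMonoidAlgebra k E) = Module.finrank ℤ E := by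
  let e := (Module.finBasisOfFinrankEq ℤ E rfl).equivFun.toAddEquiv
  rw [ringKrullDim_eq_of_ringEquiv (AddMonoidAlgebra.mapDomainRingEquiv k e)]
  exact le_antisymm (ringKrullDim_le _) (le_ringKrullDim _)

/-- Two points of a torus, with values in an algebraically closed field, differ by a point of any larger
torus. -/
theorem AddMonoidAlgebra.exists_character_ratio {E : Type} [AddCommGroup E] (M : AddSubgroup E)
    (y y' : Spec (.of (AddMonoidAlgebra k M))) :
    ∃ (T : Type u) (_ : Field T) (g g' : AddMonoidAlgebra k M →+* T) (t : AddMonoidAlgebra k E →+* T),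
      (∀ x, Spec.map (CommRingCat.ofHom g) x = y) ∧ (∀ x, Spec.map (CommRingCat.ofHom g') x = y') ∧
      g'.comp (algebraMap k _) = g.comp (algebraMap k _) ∧
      t.comp (algebraMap k _) = g.comp (algebraMap k _) ∧
      ∀ m : M, g' (single m 1) = t (single m.1 1) * g (single m 1) := by
  obtain ⟨w, hw, hw'⟩ := Scheme.Pullback.exists_preimage_pullback (f := torusToSpec k M)
    (g := torusToSpec k M) y y' (Subsingleton.elim (α := PrimeSpectrum k) _ _)
  let P := pullback (torusToSpec k M) (torusToSpec k M)
  let T := AlgebraicClosure (P.residueField w)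
  let q : Spec (.of T) ⟶ P := Spec.map (CommRingCat.ofHom (algebraMap (P.residueField w) T)) ≫
    P.fromSpecResidueField w
  have hq (x) : q x = w := by
    have : q x ∈ Set.range (P.fromSpecResidueField w) := by
      rw [Scheme.Hom.comp_apply]; exact ⟨_, rfl⟩
    rw [Scheme.range_fromSpecResidueField] at this
    exact this
  obtain ⟨g, hg⟩ := Spec.map_surjective (q ≫ pullback.fst _ _)
  obtain ⟨g', hg'⟩ := Spec.map_surjective (q ≫ pullback.snd _ _)
  have hgg : g'.hom.comp (algebraMap k _) = g.hom.comp (algebraMap k _) := by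
    have h1 : Spec.map (CommRingCat.ofHom (algebraMap k _) ≫ g) =
        Spec.map (CommRingCat.ofHom (algebraMap k _) ≫ g') := by
      rw [Spec.map_comp, Spec.map_comp, hg, hg', Category.assoc, Category.assoc]
      exact congrArg (q ≫ ·) pullback.condition
    exact (congrArg CommRingCat.Hom.hom (Spec.map_injective h1)).symm
  let χ (g : AddMonoidAlgebra k M →+* T) : Multiplicative M →* Tˣ :=
    ((g : AddMonoidAlgebra k M →* T).comp (AddMonoidAlgebra.of k M)).toHomUnits
  have hχ (g) (m : M) : ((χ g (.ofAdd m) : Tˣ) : T) = g (single m 1) := rfl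
  let _ : DivisibleBy (Additive Tˣ) ℕ := divisibleByOfSMulRightSurj _ _ fun {n} hn u => by
    obtain ⟨z, hz⟩ := IsAlgClosed.exists_pow_nat_eq (u.toMul : T) (Nat.pos_of_ne_zero hn)
    have hz0 : z ≠ 0 := fun h => u.toMul.ne_zero (by rw [← hz, h, zero_pow hn])
    exact ⟨.ofMul (Units.mk0 z hz0), congrArg Additive.ofMul (Units.ext hz)⟩
  let _ : DivisibleBy (Additive Tˣ) ℤ := AddGroup.divisibleByIntOfDivisibleByNat _
  obtain ⟨ρ, hρ⟩ := (Module.Baer.of_divisible (Additive Tˣ)).extension_property_addMonoidHom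
    M.subtype Subtype.val_injective (MonoidHom.toAdditiveRight (χ g'.hom / χ g.hom))
  let _ : Algebra k T := (g.hom.comp (algebraMap k _)).toAlgebra
  let t : AddMonoidAlgebra k E →ₐ[k] T := AddMonoidAlgebra.lift k T E
    ((Units.coeHom T).comp (AddMonoidHom.toMultiplicativeLeft ρ))
  refine ⟨T, inferInstance, g.hom, g'.hom, t, fun x => ?_, fun x => ?_, hgg, ?_, fun m => ?_⟩
  · change Spec.map g x = y
    rw [hg, Scheme.Hom.comp_apply, hq, hw]
  · change Spec.map g' x = y'
    rw [hg', Scheme.Hom.comp_apply, hq, hw']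
  · exact t.comp_algebraMap
  · have h1 : t (single m.1 1) = ((ρ m.1).toMul : T) := by
      refine (AddMonoidAlgebra.lift_single ..).trans ?_
      rw [one_smul]; rfl
    have h2 : ρ m.1 = .ofMul (χ g'.hom (.ofAdd m) / χ g.hom (.ofAdd m)) := DFunLike.congr_fun hρ m
    change g'.hom _ = t _ * g.hom _
    rw [h1, h2, ← hχ, ← hχ, ← Units.val_mul]
    exact congrArg Units.val (div_mul_cancel _ _).symm
end GroupAlgebra

section
open Limits ProjCoord
variable {O K : Type u} [CommRing O] [IsDomain O] [IsDiscreteValuationRing O] [Field K]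
  [Algebra O K] [IsFractionRing O K] {r : ℕ}

namespace DegenerationData
variable (D : DegenerationData O K r)

theorem topologicalKrullDim_orb (α : Fin r → ℝ) :
    topologicalKrullDim (D.orb (D.delCell α)) = cellDim (D.delCell α) := by
  obtain ⟨c, hc⟩ := D.nearest_nonempty α
  let o := D.orbChart ⟨c, hc⟩ ≫ D.cellEmb α
  have he : Topology.IsEmbedding o := D.isEmbedding_orbChart_cellEmb ⟨c, hc⟩
  rw [← D.range_orbChart_cellEmb ⟨c, hc⟩]
  refine (he.toHomeomorph.isHomeomorph.topologicalKrullDim_eq).symm.trans ?_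
  have hfin : Module.Finite ℤ (D.orbLattice α) :=
    inferInstanceAs (Module.Finite ℤ (AddSubgroup.toIntSubmodule (D.orbLattice α)))
  have hfree : Module.Free ℤ (D.orbLattice α) :=
    inferInstanceAs (Module.Free ℤ (AddSubgroup.toIntSubmodule (D.orbLattice α)))
  refine (PrimeSpectrum.topologicalKrullDim_eq_ringKrullDim _).trans ?_
  rw [AddMonoidAlgebra.ringKrullDim_eq, finrank_orbLattice]

theorem isWeight_zeta (c : Fin r → ℤ) : D.saturation.IsWeight c (D.zeta c) := by
  rw [D.zeta_eq_mono c (D.sPow_mem c)]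
  exact D.saturation.isWeight_mono _ _

/-- The element `ζ_c` as a homogeneous element. -/
noncomputable abbrev zetaDeg (c : Fin r → ℤ) : D.saturation.grading 1 := ⟨D.zeta c, D.zeta_mem c⟩

theorem isTwist_act (S : D.Torus (𝟙 D.P₀)) : D.saturation.IsTwist
    (pullback.snd (torusToSpec D.k (Fin r → ℤ)) (𝟙 D.P₀ ≫ D.toResidue) ≫ D.incl) (S.act ≫ D.incl)
    (pullback.fst (torusToSpec D.k (Fin r → ℤ)) (𝟙 D.P₀ ≫ D.toResidue)) := by
  have H := (D.saturation.isTorusAction_iff D.k (𝟙 D.P₀ ≫ D.incl) (𝟙 D.P₀ ≫ D.toResidue) S.act).1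
    S.isTorusAction
  have e1 : S.act ≫ 𝟙 D.P₀ ≫ D.incl = S.act ≫ D.incl := congrArg (S.act ≫ ·) (Category.id_comp _)
  have e2 : pullback.snd (torusToSpec D.k (Fin r → ℤ)) (𝟙 D.P₀ ≫ D.toResidue) ≫ 𝟙 D.P₀ ≫ D.incl =
    pullback.snd (torusToSpec D.k (Fin r → ℤ)) (𝟙 D.P₀ ≫ D.toResidue) ≫ D.incl :=
      congrArg (_ ≫ ·) (Category.id_comp _)
  rwa [e1, e2] at H

theorem coords_act (S : D.Torus (𝟙 D.P₀)) (w : ↥(pullback (torusToSpec D.k (Fin r → ℤ)) (𝟙 D.P₀ ≫ D.toResidue))) :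
    D.coords (D.incl (S.act w)) =
      D.coords (D.incl (pullback.snd (torusToSpec D.k (Fin r → ℤ)) (𝟙 D.P₀ ≫ D.toResidue) w)) := by
  have H := D.isTwist_act S
  let Y := pullback (torusToSpec D.k (Fin r → ℤ)) (𝟙 D.P₀ ≫ D.toResidue)
  let p : Spec (.of (Y.residueField w)) ⟶ Y := Y.fromSpecResidueField w
  let y : Spec (.of (Y.residueField w)) := (⊥ : PrimeSpectrum (Y.residueField w))
  have hp : p y = w := by
    have : p y ∈ Set.range p := ⟨_, rfl⟩
    rw [Scheme.range_fromSpecResidueField] at this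
    exact this
  obtain ⟨φ, hφ⟩ := D.exists_hasCoords_of_field (p ≫ pullback.snd _ _ ≫ D.incl)
  have h1 := H _ _ _ hφ
  ext c
  have e1 := D.mem_coords_iff hφ y (c := c)
  have e2 := D.mem_coords_iff h1 y (c := c)
  rw [D.saturation.tw_of_isWeight _ _ (D.isWeight_zeta c), mul_ne_zero_iff,
    and_iff_right (CoeffSystem.isUnit_character _ _).ne_zero, ← e1] at e2
  simp only [Scheme.Hom.comp_apply, hp] at e2
  exact e2

/-- A point of a torus acts transitively on an orbit. -/
theorem exists_act_eq (S : D.Torus (𝟙 D.P₀)) {α : Fin r → ℝ} {z z' : D.P₀}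
    (hz : z ∈ D.orb (D.delCell α)) (hz' : z' ∈ D.orb (D.delCell α)) :
    z' ∈ torusOrbit S.act z := by
  obtain ⟨c, hc⟩ := D.nearest_nonempty α
  let c' : D.nearest α := ⟨c, hc⟩
  rw [← D.range_orbChart_cellEmb c'] at hz hz'
  obtain ⟨y, rfl⟩ := hz
  obtain ⟨y', rfl⟩ := hz'
  let o := D.orbChart c' ≫ D.cellEmb α
  obtain ⟨T, _, g, g', t, hg, hg', hgg, htg, hratio⟩ :=
    AddMonoidAlgebra.exists_character_ratio (D.orbLattice α) y y'
  let pt : Spec (.of T) := (⊥ : PrimeSpectrum T)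
  have hcoord (g : AddMonoidAlgebra D.k (D.orbLattice α) →+* T) : HasCoords D.saturation.grading
      ((Spec.map (CommRingCat.ofHom g) ≫ o) ≫ D.incl) ((g.comp (D.orbHom c')).comp (D.cellHom α)) := by
    have h1 := D.isCoordMap_cellMap α ((D.hasCoords_orbChart c').comp _ (CommRingCat.ofHom g))
    rw [← cellEmb_incl] at h1
    have e : (Spec.map (CommRingCat.ofHom g) ≫ o) ≫ D.incl =
        (Spec.map (CommRingCat.ofHom g) ≫ D.orbChart c') ≫ D.cellEmb α ≫ D.incl := by
      simp only [o, Category.assoc]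
    rw [e]
    exact h1
  have hτ : Spec.map (CommRingCat.ofHom t) ≫ torusToSpec D.k (Fin r → ℤ) =
      (Spec.map (CommRingCat.ofHom g) ≫ o) ≫ 𝟙 D.P₀ ≫ D.toResidue := by
    have h1 := ((D.hasCoords_orbChart c').comp _ (CommRingCat.ofHom g)).projToSpec
    rw [← cellEmb_toResidue] at h1
    rw [Category.id_comp]
    simp only [o, Category.assoc] at h1 ⊢
    rw [h1]
    refine (Spec.map_comp _ _).symm.trans (congrArg Spec.map ?_)
    rw [← CommRingCat.ofHom_comp, htg]
    congr 1
    ext a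
    exact congrArg g (D.orbHom_algebraMap c' a).symm
  let w : Spec (.of T) ⟶ pullback (torusToSpec D.k (Fin r → ℤ)) (𝟙 D.P₀ ≫ D.toResidue) :=
    pullback.lift _ _ hτ
  have hw : w ≫ pullback.snd _ _ = Spec.map (CommRingCat.ofHom g) ≫ o := pullback.lift_snd _ _ _
  have hw' : w ≫ pullback.fst _ _ = Spec.map (CommRingCat.ofHom t) := pullback.lift_fst _ _ _
  have H := D.isTwist_act S
  have h1 := H _ w _ (by rw [← Category.assoc, hw]; exact hcoord g)
  rw [hw'] at h1
  have hact : w ≫ S.act = Spec.map (CommRingCat.ofHom g') ≫ o := by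
    rw [← cancel_mono D.incl, Category.assoc]
    refine HasCoords.hom_ext (h1.smul _ (u := t (AddMonoidAlgebra.single (-c) 1))
      ((isUnit_single_one _).map t) fun d a ha => ?_) (hcoord g')
    refine D.eq_of_mem_grading ha fun x z => ?_
    have ec : CoeffSystem.charOf (Spec.map (CommRingCat.ofHom t)) (.ofAdd x) =
        t (AddMonoidAlgebra.single x 1) := CoeffSystem.charOf_map (S := .of T) _ _
    rw [CoeffSystem.tw_mono, ec]
    simp only [RingHom.comp_apply, cellHom_mono_eq_smul]
    by_cases hp : (d, x) ∈ D.polytopeMonoid (D.isDelaunay_delCell α)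
    · rw [Algebra.smul_def, map_mul, map_mul, map_mul, D.orbHom_cellChar c' hp, orbHom_algebraMap]
      have e1 : g' (AddMonoidAlgebra.single 0 (D.lead (D.lin α (d, x)) z.1)) =
        g (AddMonoidAlgebra.single 0 (D.lead (D.lin α (d, x)) z.1)) := DFunLike.congr_fun hgg _
      rw [e1, hratio]
      have e2 : t (AddMonoidAlgebra.single (D.toOrbLattice c' hp).1 1) =
          t (AddMonoidAlgebra.single (-c) 1) ^ d * t (AddMonoidAlgebra.single x 1) := by
        rw [← map_pow, ← map_mul, AddMonoidAlgebra.single_pow, AddMonoidAlgebra.single_mul_single]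
        simp only [one_pow, mul_one]
        congr 2
        change x - d • c = d • -c + x
        rw [smul_neg]; abel
      rw [e2]; ring
    · rw [cellChar, dif_neg hp]
      simp only [smul_zero, map_zero, mul_zero]
  refine ⟨w pt, ?_, ?_⟩
  · exact (congrArg (fun f => f pt) hw).trans (congrArg o (hg pt))
  · exact (congrArg (fun f => f pt) hact).trans (congrArg o (hg' pt))

theorem torusOrbit_eq (S : D.Torus (𝟙 D.P₀)) {α : Fin r → ℝ} {z : D.P₀}
    (hz : D.coords (D.incl z) = D.nearest α) : torusOrbit S.act z = D.orb (D.delCell α) := by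
  refine Set.Subset.antisymm ?_ fun z' hz' => D.exists_act_eq S (by rw [orb_delCell]; exact hz) hz'
  rintro _ ⟨w, hw, rfl⟩
  rw [orb_delCell]
  refine (D.coords_act S w).trans ?_
  rw [hw, hz]

theorem orb_nonempty (α : Fin r → ℝ) : ∃ z : D.P₀, D.coords (D.incl z) = D.nearest α := by
  obtain ⟨η, -, -, h⟩ := D.exists_generic α
  exact ⟨_, h⟩

theorem bijOn_orb (S : D.Torus (𝟙 D.P₀)) :
    Set.BijOn D.orb {σ | D.IsDelaunay σ} (Set.range (torusOrbit S.act)) := by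
  refine ⟨?_, ?_, ?_⟩
  · rintro _ ⟨α, rfl⟩
    obtain ⟨z, hz⟩ := D.orb_nonempty α
    exact ⟨z, D.torusOrbit_eq S hz⟩
  · rintro _ ⟨α, rfl⟩ _ ⟨β, rfl⟩ h
    obtain ⟨z, hz⟩ := D.orb_nonempty α
    have h1 : z ∈ D.orb (D.delCell β) := by
      rw [← h, orb_delCell]; exact hz
    rw [orb_delCell] at h1
    exact D.delCell_eq_iff.2 (hz.symm.trans h1)
  · rintro _ ⟨z, rfl⟩
    obtain ⟨α, hα⟩ := D.exists_coords_eq z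
    exact ⟨_, ⟨α, rfl⟩, (D.torusOrbit_eq S hα).symm⟩

theorem exists_torus : ∃ S₀ : D.Torus (𝟙 D.P₀), ∀ S : D.Torus (𝟙 D.P₀), S = S₀ := by
  let q := 𝟙 D.P₀ ≫ D.toResidue
  let j := 𝟙 D.P₀ ≫ D.incl
  obtain ⟨T, hT⟩ := D.saturation.exists_isTwist D.zeta D.zeta_mem D.iSup_basicOpen_zeta
    (pullback.snd (torusToSpec D.k (Fin r → ℤ)) q ≫ j) (pullback.fst (torusToSpec D.k (Fin r → ℤ)) q)
  have hTb : T ≫ D.toBase = (pullback.snd (torusToSpec D.k (Fin r → ℤ)) q ≫ q) ≫ D.closedPoint := by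
    refine (CoeffSystem.IsTwist.comp_projToSpec D.saturation D.zeta D.zeta_mem D.iSup_basicOpen_zeta hT).trans ?_
    simp only [j, q, Category.id_comp, Category.assoc]
    exact congrArg _ pullback.condition
  obtain ⟨S₀, -⟩ := D.saturation.exists_torusStructure D.k j q (z := D.zetaDeg) (x := id)
    D.isWeight_zeta D.iSup_basicOpen_zeta (pullback.lift T _ hTb)
    (by simp only [q, Category.id_comp]; exact pullback.lift_snd _ _ _)
    (by
      have : pullback.lift T _ hTb ≫ j = T := by
        simp only [j, Category.id_comp]; exact pullback.lift_fst _ _ _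
      rw [this]; exact hT)
  have : Mono j := by simp only [j, Category.id_comp]; infer_instance
  exact ⟨S₀, fun S => D.saturation.torusStructure_unique D.k j q (z := D.zetaDeg) (x := id)
    D.isWeight_zeta D.iSup_basicOpen_zeta S S₀⟩

theorem coords_subset_of_mem_closure {z z' : D.P₀} (h : z' ∈ closure {z}) :
    D.coords (D.incl z') ⊆ D.coords (D.incl z) := fun c hc => by
  have ho : IsOpen (D.incl ⁻¹ᵁ Proj.basicOpen D.saturation.grading (D.zeta c) : Set D.P₀) :=
    (D.incl ⁻¹ᵁ Proj.basicOpen D.saturation.grading (D.zeta c)).isOpen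
  obtain ⟨x, hx, hxz⟩ := mem_closure_iff.1 h _ ho hc
  rw [Set.mem_singleton_iff] at hxz
  rw [← hxz]
  exact hx

theorem isIrreducible_closure_orb (α : Fin r → ℝ) : IsIrreducible (closure (D.orb (D.delCell α))) := by
  obtain ⟨η, h1, -, -⟩ := D.exists_generic α
  rw [closure_orb, ← D.closure_singleton_cellEmb h1]
  exact isIrreducible_singleton.closure

theorem bijOn_closure_orb : Set.BijOn (fun σ => closure (D.orb σ))
    {σ | D.IsDelaunay σ ∧ cellDim σ = r} (irreducibleComponents D.P₀) := by
  rw [irreducibleComponents_eq_maximals_closed]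
  refine ⟨?_, ?_, ?_⟩
  · rintro _ ⟨⟨α, rfl⟩, hα⟩
    refine ⟨⟨isClosed_closure, D.isIrreducible_closure_orb α⟩, fun s ⟨hs, hs'⟩ hle => ?_⟩
    obtain ⟨g, hg⟩ := QuasiSober.sober hs' hs
    obtain ⟨z, hz⟩ := D.orb_nonempty α
    obtain ⟨γ, hγ⟩ := D.exists_coords_eq g
    have h1 : z ∈ closure (D.orb (D.delCell α)) := D.mem_closure_orb.2 hz.le
    have h2 : z ∈ closure {g} := by rw [hg]; exact hle h1
    have h3 := D.coords_subset_of_mem_closure h2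
    rw [hz, hγ] at h3
    obtain rfl := D.eq_of_nearest_subset hα h3
    have h4 : g ∈ closure (D.orb (D.delCell γ)) := D.mem_closure_orb.2 hγ.le
    rw [← hg]
    exact closure_minimal (Set.singleton_subset_iff.2 h4) isClosed_closure
  · rintro _ ⟨⟨α, rfl⟩, hα⟩ _ ⟨⟨β, rfl⟩, hβ⟩ h
    have hle {α β : Fin r → ℝ} (h : closure (D.orb (D.delCell α)) = closure (D.orb (D.delCell β))) :
        D.nearest α ⊆ D.nearest β := by
      obtain ⟨z, hz⟩ := D.orb_nonempty α
      rw [← hz, ← mem_closure_orb, ← h, mem_closure_orb, hz]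
    exact D.delCell_eq_iff.2 (Set.Subset.antisymm (hle h) (hle (Eq.symm h)))
  · rintro s ⟨⟨hs, hs'⟩, hmax⟩
    obtain ⟨g, hg⟩ := QuasiSober.sober hs' hs
    obtain ⟨γ, hγ⟩ := D.exists_coords_eq g
    obtain ⟨β, hβ, hdim⟩ := D.exists_maximal_cell (D.nearest_nonempty γ) ⟨γ, D.mem_vor_nearest γ⟩
    have h1 : g ∈ closure (D.orb (D.delCell β)) := D.mem_closure_orb.2 (hγ ▸ hβ)
    have h2 : s ⊆ closure (D.orb (D.delCell β)) := by
      rw [← hg]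
      exact closure_minimal (Set.singleton_subset_iff.2 h1) isClosed_closure
    exact ⟨_, ⟨⟨β, rfl⟩, hdim⟩, Set.Subset.antisymm
      (hmax ⟨isClosed_closure, D.isIrreducible_closure_orb β⟩ h2) h2⟩

end DegenerationData
end

section
open Limits ProjCoord ModuleFrame SerreTwist
variable {O K : Type u} [CommRing O] [IsDomain O] [IsDiscreteValuationRing O] [Field K]
  [Algebra O K] [IsFractionRing O K] {r : ℕ}

namespace DegenerationData
variable (D : DegenerationData O K r)

theorem idealOrb_delCell (α : Fin r → ℝ) : D.idealOrb (D.delCell α) = (D.cellEmb α).ker := by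
  have h1 : D.closureOrb (D.delCell α) = (D.cellEmb α).ker.support := by
    ext1
    rw [Scheme.Hom.support_ker]
    exact (D.closure_orb α).trans (D.cellEmb α).isClosedEmbedding.isClosed_range.closure_eq.symm
  unfold idealOrb
  rw [h1, Scheme.IdealSheafData.vanishingIdeal_support]
  ext U : 2
  change ((D.cellEmb α).ker.ideal U).radical = (D.cellEmb α).ker.ideal U
  rw [Scheme.Hom.ker_apply]
  refine Ideal.radical_eq_iff.2 fun x ⟨n, hx⟩ => ?_
  rw [RingHom.mem_ker, map_pow] at hx
  exact eq_zero_of_pow_eq_zero hx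

/-- The orbit closure is the projective toric variety of the polytope. -/
theorem exists_iso_V (α : Fin r → ℝ) : ∃ e : D.toricVariety (D.isDelaunay_delCell α) ≅ D.V (D.delCell α),
    e.hom ≫ D.inclV (D.delCell α) = D.cellEmb α := by
  have hker : (D.inclV (D.delCell α)).ker = (D.cellEmb α).ker :=
    (Scheme.IdealSheafData.ker_subschemeι _).trans (D.idealOrb_delCell α)
  have : IsClosedImmersion (D.inclV (D.delCell α)) :=
    inferInstanceAs (IsClosedImmersion (D.idealOrb (D.delCell α)).subschemeι)
  have hf := IsClosedImmersion.lift_fac (D.inclV (D.delCell α)) (D.cellEmb α) hker.le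
  have := IsClosedImmersion.isIso_of_ker_eq _ _ _ hf hker.symm
  exact ⟨asIso (IsClosedImmersion.lift _ _ hker.le), hf⟩

theorem exists_add_mem_polytopeMonoid {α : Fin r → ℝ} {p : ℕ × (Fin r → ℤ)}
    (hp : p ∈ D.polytopeMonoid (D.isDelaunay_delCell α)) (h : (D.nearest α).ncard ≤ p.1) :
    ∃ c ∈ D.nearest α, ∃ q ∈ D.polytopeMonoid (D.isDelaunay_delCell α), p = q + (1, c) := by
  rw [mem_polytopeMonoid] at hp
  obtain ⟨N, hN, hNp⟩ := exists_nsmul_mem_closure (D.forall_lin_le_iff.1 hp.1)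
  obtain ⟨l, hl, hsum⟩ := AddSubmonoid.exists_multiset_of_mem_closure hNp
  have hpos : 0 < (D.nearest α).ncard := (Set.ncard_pos (D.finite_nearest α)).2 (D.nearest_nonempty α)
  have hcard : l.card = N * p.1 := by
    have h1 : (l.map Prod.fst).sum = l.card := by
      rw [Multiset.map_congr (g := fun _ => 1) rfl fun y hy => ?_, Multiset.map_const', Multiset.sum_replicate,
        smul_eq_mul, mul_one]
      obtain ⟨c, -, rfl⟩ := hl y hy
      rfl
    rw [← h1]
    refine (Multiset.sum_hom l (AddMonoidHom.fst ℕ (Fin r → ℤ))).trans ?_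
    rw [hsum]; rfl
  have hsub : l.toFinset.card ≤ (D.nearest α).ncard := by
    rw [← Set.ncard_coe_finset]
    refine (Set.ncard_le_ncard (fun y hy => ?_) ((D.finite_nearest α).image _)).trans
      (Set.ncard_image_le (f := fun c => ((1, c) : ℕ × (Fin r → ℤ))) (D.finite_nearest α))
    exact hl y (Multiset.mem_toFinset.1 hy)
  obtain ⟨y, hy, hyN⟩ : ∃ y ∈ l.toFinset, N ≤ l.count y := by
    refine Finset.exists_le_of_sum_le (f := fun _ => N) ?_ ?_
    · rw [Multiset.toFinset_nonempty, ← Multiset.card_pos, hcard]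
      exact Nat.mul_pos hN (hpos.trans_le h)
    · rw [Finset.sum_const, smul_eq_mul, Multiset.toFinset_sum_count_eq, hcard, mul_comm]
      exact Nat.mul_le_mul_left N (hsub.trans h)
  obtain ⟨c, hc, rfl⟩ := hl y (Multiset.mem_toFinset.1 hy)
  obtain ⟨l', rfl⟩ := Multiset.le_iff_exists_add.1 (Multiset.le_count_iff_replicate_le.1 hyN)
  rw [Multiset.sum_add, Multiset.sum_replicate] at hsum
  have hpq : p = (p.1 - 1, p.2 - c) + (1, c) :=
    Prod.ext (Nat.sub_add_cancel (hpos.trans_le h)).symm (sub_add_cancel _ _).symm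
  have hq (β) : D.lin β p = D.lin β (p.1 - 1, p.2 - c) + D.lin β (1, c) := by
    rw [← lin_add, ← hpq]
  have hl' (β) : D.lin β l'.sum ≤ D.lin α l'.sum := by
    refine Multiset.sum_induction (fun p => D.lin β p ≤ D.lin α p) l' (fun a b ha hb => ?_)
      (by rw [lin_zero, lin_zero]) fun a ha => ?_
    · rw [lin_add, lin_add]; exact add_le_add ha hb
    · obtain ⟨c', hc', rfl⟩ := hl a (Multiset.mem_add.2 (Or.inr ha))
      exact (D.lin_one_le β c').trans_eq (D.lin_one_eq_iff.2 hc').symm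
  have hN' : (0 : ℝ) < N := by exact_mod_cast hN
  have hNq (β) : N * D.lin β (p.1 - 1, p.2 - c) = D.lin β l'.sum := by
    have := congrArg (D.lin β) hsum
    rw [lin_add, lin_nsmul, lin_nsmul, hq] at this
    linarith
  refine ⟨c, hc, _, D.mem_polytopeMonoid.2 ⟨fun β => ?_, ?_⟩, hpq⟩
  · rw [← mul_le_mul_iff_right₀ hN', hNq, hNq]; exact hl' β
  · obtain ⟨n, hn⟩ := hp.2
    refine ⟨n - D.A c, ?_⟩
    rw [hq, D.lin_one_eq_iff.2 hc] at hn
    push_cast; linarith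

/-- In large degrees, the elements of the semigroup of a polytope decompose. -/
theorem exists_add_eq_of_le {α : Fin r → ℝ} (j : ℕ) {p : ℕ × (Fin r → ℤ)}
    (hp : p ∈ D.polytopeMonoid (D.isDelaunay_delCell α)) (h : (D.nearest α).ncard + j ≤ p.1) :
    ∃ q ∈ D.polytopeMonoid (D.isDelaunay_delCell α), ∃ q' ∈ D.polytopeMonoid (D.isDelaunay_delCell α),
      q'.1 = j ∧ p = q + q' := by
  induction j generalizing p with
  | zero => exact ⟨p, hp, 0, zero_mem _, rfl, (add_zero p).symm⟩
  | succ j ih =>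
    obtain ⟨c, hc, q, hq, rfl⟩ := D.exists_add_mem_polytopeMonoid hp ((Nat.le_add_right _ _).trans h)
    obtain ⟨q₁, h₁, q₂, h₂, hj, rfl⟩ := ih hq (by rw [Prod.fst_add] at h; omega)
    exact ⟨q₁, h₁, q₂ + (1, c), add_mem h₂ (D.one_mem_polytopeMonoid hc), by rw [← hj]; rfl,
      add_assoc _ _ _⟩

theorem eq_zero_of_mem_polytopeMonoid {α : Fin r → ℝ} {p : ℕ × (Fin r → ℤ)}
    (hp : p ∈ D.polytopeMonoid (D.isDelaunay_delCell α)) (h : p.1 = 0) : p = 0 := by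
  have h1 := D.forall_lin_le_iff.1 (D.mem_polytopeMonoid.1 hp).1
  rw [h, Nat.cast_zero, Set.zero_smul_set (D.delCell_nonempty α), Set.mem_zero, ← toReal_zero] at h1
  exact Prod.ext h (toReal_injective h1)

theorem finite_polytopeMonoid (α : Fin r → ℝ) (m : ℕ) :
    {p | p ∈ D.polytopeMonoid (D.isDelaunay_delCell α) ∧ p.1 = m}.Finite := by
  have hb : Bornology.IsBounded ((m : ℝ) • D.delCell α) :=
    ((Set.Finite.isCompact_convexHull (𝕜 := ℝ) ((D.finite_nearest α).image toReal)).smul (m : ℝ)).isBounded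
  obtain ⟨C, hC⟩ := hb.exists_norm_le
  refine Set.Finite.subset ((finite_setOf_norm_le C).image fun x => (m, x)) ?_
  rintro ⟨d, x⟩ ⟨hp, rfl⟩
  exact ⟨x, hC _ (D.forall_lin_le_iff.1 (D.mem_polytopeMonoid.1 hp).1), rfl⟩


/-- The coordinate homomorphism of the embedding of a toric variety into a projective space by the
monomials of degree `m`. -/
noncomputable def monomialHom {α : Fin r → ℝ} {n : ℕ} (y : Fin (n + 1) → ℕ × (Fin r → ℤ)) :
    MvPolynomial (Fin (n + 1)) D.k →ₐ[D.k] (D.cellSystem α).toSubalgebra :=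
  MvPolynomial.aeval fun i => D.cellChar α (y i)

theorem cellChar_mem {α : Fin r → ℝ} {p : ℕ × (Fin r → ℤ)} :
    D.cellChar α p ∈ (D.cellSystem α).grading p.1 := by
  unfold cellChar
  split_ifs
  · exact (D.cellSystem α).mono_mem_grading p _
  · exact zero_mem _

section Embedding
variable {α : Fin r → ℝ} {m n : ℕ} {y : Fin (n + 1) → ℕ × (Fin r → ℤ)} (hy : ∀ i, (y i).1 = m)

include hy in
theorem monomialHom_mem (d : ℕ) (a : MvPolynomial (Fin (n + 1)) D.k)
    (ha : a ∈ MvPolynomial.homogeneousSubmodule (Fin (n + 1)) D.k d) :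
    D.monomialHom (α := α) y a ∈ (D.cellSystem α).grading (m * d) := by
  rw [a.as_sum, map_sum]
  refine sum_mem fun v hv => ?_
  have hd : ∑ i, v i = d := by
    have := ha (MvPolynomial.mem_support_iff.1 hv)
    rwa [Finsupp.weight_apply, Finsupp.sum_fintype _ _ (fun _ => by simp),
      Finset.sum_congr rfl fun i _ => by rw [Pi.one_apply, smul_eq_mul, mul_one]] at this
  unfold monomialHom
  rw [MvPolynomial.aeval_monomial, ← Algebra.smul_def, Finsupp.prod_fintype _ _ (fun _ => pow_zero _)]
  refine Submodule.smul_mem _ _ ?_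
  have := SetLike.prod_pow_mem_graded (D.cellSystem α).grading (F := Finset.univ) (fun _ => m)
    (fun i => D.cellChar α (y i)) v fun i _ => hy i ▸ D.cellChar_mem
  rwa [← Finset.sum_smul, hd, smul_eq_mul, mul_comm] at this

theorem exists_monomialHom_eq (hm : (D.nearest α).ncard = m)
    (hsurj : ∀ p ∈ D.polytopeMonoid (D.isDelaunay_delCell α), p.1 = m → ∃ i, y i = p) (d : ℕ)
    (b : (D.cellSystem α).toSubalgebra) (hb : b ∈ (D.cellSystem α).grading (m * d)) :
    ∃ a ∈ MvPolynomial.homogeneousSubmodule (Fin (n + 1)) D.k d, D.monomialHom (α := α) y a = b := by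
  have key (d : ℕ) : ∀ p ∈ D.polytopeMonoid (D.isDelaunay_delCell α), p.1 = m * d →
      ∃ a ∈ MvPolynomial.homogeneousSubmodule (Fin (n + 1)) D.k d,
        D.monomialHom (α := α) y a = D.cellChar α p := by
    induction d with
    | zero =>
      intro p hp h
      obtain rfl := D.eq_zero_of_mem_polytopeMonoid hp h
      refine ⟨1, MvPolynomial.isHomogeneous_one _ _, ?_⟩
      rw [map_one, cellChar, dif_pos hp]
      rfl
    | succ d ih =>
      intro p hp h
      obtain ⟨q, hq, q', hq', hqm, rfl⟩ : ∃ q ∈ D.polytopeMonoid (D.isDelaunay_delCell α),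
          ∃ q' ∈ D.polytopeMonoid (D.isDelaunay_delCell α), q'.1 = m ∧ p = q + q' := by
        obtain rfl | hd := Nat.eq_zero_or_pos d
        · exact ⟨0, zero_mem _, p, hp, by rw [h, zero_add, mul_one], (zero_add p).symm⟩
        · refine D.exists_add_eq_of_le m hp ?_
          rw [hm, h, mul_add, mul_one]
          exact Nat.add_le_add_right (Nat.le_mul_of_pos_right m hd) m
      obtain ⟨a, ha, hae⟩ := ih q hq (by rw [Prod.fst_add, hqm, mul_add, mul_one] at h; omega)
      obtain ⟨i, hi⟩ := hsurj q' hq' hqm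
      refine ⟨a * MvPolynomial.X i, MvPolynomial.IsHomogeneous.mul ha (MvPolynomial.isHomogeneous_X _ i), ?_⟩
      rw [map_mul, hae, D.cellChar_add hq hq', ← hi]
      exact congrArg _ (MvPolynomial.aeval_X _ _)
  have key' : ∀ s : Finset (ℕ × (Fin r → ℤ)), (∀ p ∈ s, p.1 = m * d) →
      ∀ t : (p : ℕ × (Fin r → ℤ)) → (D.cellSystem α).coeff p,
      ∃ a ∈ MvPolynomial.homogeneousSubmodule (Fin (n + 1)) D.k d,
        D.monomialHom (α := α) y a = ∑ p ∈ s, (D.cellSystem α).mono p (t p) := by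
    classical
    intro s hs t
    induction s using Finset.induction_on with
    | empty => exact ⟨0, zero_mem _, map_zero _⟩
    | insert p s hp ih =>
      obtain ⟨a, ha, hae⟩ := ih fun p hp => hs p (Finset.mem_insert_of_mem hp)
      obtain ⟨a', ha', hae'⟩ : ∃ a ∈ MvPolynomial.homogeneousSubmodule (Fin (n + 1)) D.k d,
          D.monomialHom (α := α) y a = (D.cellSystem α).mono p (t p) := by
        by_cases hpC : p ∈ D.polytopeMonoid (D.isDelaunay_delCell α)
        · obtain ⟨a, ha, hae⟩ := key d p hpC (hs p (Finset.mem_insert_self _ _))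
          exact ⟨(t p).1 • a, Submodule.smul_mem _ _ ha, by
            rw [map_smul, hae, D.smul_cellChar (t p).2]⟩
        · refine ⟨0, zero_mem _, ?_⟩
          rw [map_zero, ← D.smul_cellChar (t p).2, cellChar, dif_neg hpC, smul_zero]
      exact ⟨a' + a, add_mem ha' ha, by rw [map_add, hae, hae', Finset.sum_insert hp]⟩
  rw [← (D.cellSystem α).sum_mono b]
  exact key' _ (fun p hp => hb p (Finsupp.mem_support_iff.1 hp)) _

theorem _root_.MvPolynomial.iSup_basicOpen_X {k : Type u} [Field k] (n : ℕ) :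
    ⨆ i, Proj.basicOpen (MvPolynomial.homogeneousSubmodule (Fin (n + 1)) k) (MvPolynomial.X i) = ⊤ := by
  refine Proj.iSup_basicOpen_eq_top _ _ fun f hf => ?_
  rw [← Set.image_univ, MvPolynomial.mem_ideal_span_X_image]
  intro v hv
  by_contra! h
  obtain rfl : v = 0 := Finsupp.ext fun i => h i (Set.mem_univ i)
  refine MvPolynomial.mem_support_iff.1 hv ?_
  have h1 : GradedRing.proj (MvPolynomial.homogeneousSubmodule (Fin (n + 1)) k) 0 f = 0 := hf
  have h2 : MvPolynomial.homogeneousComponent 0 f = 0 := by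
    rw [← MvPolynomial.decomposition.decompose'_apply]; exact h1
  rw [MvPolynomial.homogeneousComponent_zero, MvPolynomial.C_eq_zero] at h2
  exact h2

end Embedding

theorem isAmple (α : Fin r → ℝ) :
    D.saturation.IsAmple D.k (D.inclVP (D.delCell α)) (D.VToResidue (D.delCell α)) := by
  obtain ⟨e, he⟩ := D.exists_iso_V α
  let m := (D.nearest α).ncard
  have hm : 0 < m := (Set.ncard_pos (D.finite_nearest α)).2 (D.nearest_nonempty α)
  let F := {p | p ∈ D.polytopeMonoid (D.isDelaunay_delCell α) ∧ p.1 = m}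
  have hF : F.Finite := D.finite_polytopeMonoid α m
  have hmF {c} (hc : c ∈ D.nearest α) : m • ((1, c) : ℕ × (Fin r → ℤ)) ∈ F :=
    ⟨nsmul_mem (D.one_mem_polytopeMonoid hc) m, by rw [Prod.smul_fst, smul_eq_mul, mul_one]⟩
  have : Finite F := hF
  obtain ⟨n', ⟨f⟩⟩ := Finite.exists_equiv_fin F
  obtain ⟨c₀, hc₀⟩ := D.nearest_nonempty α
  obtain ⟨n, rfl⟩ : ∃ n, n' = n + 1 :=
    Nat.exists_eq_succ_of_ne_zero fun h => by subst h; exact (f ⟨_, hmF hc₀⟩).elim0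
  let y : Fin (n + 1) → ℕ × (Fin r → ℤ) := fun i => (f.symm i).1
  have hy (i) : (y i).1 = m := (f.symm i).2.2
  have hsurj : ∀ p ∈ D.polytopeMonoid (D.isDelaunay_delCell α), p.1 = m → ∃ i, y i = p :=
    fun p hp hpm => ⟨f ⟨p, hp, hpm⟩, congrArg Subtype.val (f.symm_apply_apply _)⟩
  let ν := (D.monomialHom (α := α) y).toRingHom
  have hν := D.monomialHom_mem (α := α) hy
  have hν' := D.exists_monomialHom_eq (α := α) rfl hsurj
  choose z hz hzw using fun c : D.nearest α => hν' 1 (D.cellGen α c ^ m) (by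
    simpa using SetLike.pow_mem_graded m (D.cellChar_mem_grading (α := α) (c := c.1)))
  obtain ⟨g, hg⟩ := exists_isCoordMap _ (D.cellSystem α).grading ν hν
    (fun _ => D.cellChar_mem_grading) (D.iSup_basicOpen_cellGen α) hz hzw
  have hgc : IsClosedImmersion g := IsCoordMap.isClosedImmersion hm hν
    (fun _ => D.cellChar_mem_grading) (D.iSup_basicOpen_cellGen α) hg hν'
    (fun i => MvPolynomial.isHomogeneous_X _ i) (MvPolynomial.iSup_basicOpen_X n)
  obtain ⟨𝒰, h𝒰⟩ := exists_cover_hasCoords (D.cellSystem α).grading (D.cellGen α)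
    (fun _ => D.cellChar_mem_grading) (D.iSup_basicOpen_cellGen α) e.inv
  have he' : e.inv ≫ D.cellEmb α = D.inclV (D.delCell α) := by rw [← he, e.inv_hom_id_assoc]
  have h1 (a) : ∃ φ : (D.cellSystem α).toSubalgebra →+* 𝒰.X a,
      HasCoords (D.cellSystem α).grading (𝒰.f a ≫ e.inv) φ ∧
      HasCoords (MvPolynomial.homogeneousSubmodule (Fin (n + 1)) D.k) (𝒰.f a ≫ e.inv ≫ g) (φ.comp ν) ∧
      HasCoords D.saturation.grading (𝒰.f a ≫ D.inclVP (D.delCell α)) (φ.comp (D.cellHom α)) := by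
    obtain ⟨i, φ, hφ, -⟩ := h𝒰 a
    refine ⟨φ, hφ, ?_, ?_⟩
    · have := hg hφ
      rwa [Category.assoc] at this
    · have := D.isCoordMap_cellMap α hφ
      rw [← cellEmb_incl, Category.assoc] at this
      unfold inclVP
      rwa [← he', Category.assoc]
  refine ⟨m, n, hm, e.inv ≫ g, inferInstance, ?_, ?_⟩
  · have key (a : 𝒰.I₀) : 𝒰.f a ≫ (e.inv ≫ g) ≫ projToSpec
        (MvPolynomial.homogeneousSubmodule (Fin (n + 1)) D.k) = 𝒰.f a ≫ D.VToResidue (D.delCell α) := by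
      obtain ⟨φ, hφ, hφ', -⟩ := h1 a
      unfold VToResidue
      rw [← he', Category.assoc e.inv (D.cellEmb α), cellEmb_toResidue]
      have h2 := hφ'.projToSpec
      have h3 := hφ.projToSpec
      rw [Category.assoc] at h2 h3
      refine h2.trans (Eq.trans ?_ h3.symm)
      congr 2
      ext t
      exact congrArg φ ((D.monomialHom (α := α) y).commutes t)
    exact 𝒰.openCover.hom_ext _ _ key
  · let I := {p : MvPolynomial.homogeneousSubmodule (Fin (n + 1)) D.k 1 × D.saturation.grading m //
      ν p.1.1 = D.cellHom α p.2.1}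
    have hI : ⨆ i : I, Proj.basicOpen (MvPolynomial.homogeneousSubmodule (Fin (n + 1)) D.k)
        (i.1.1 : MvPolynomial (Fin (n + 1)) D.k) = ⊤ := by
      rw [eq_top_iff, ← MvPolynomial.iSup_basicOpen_X n]
      refine iSup_le fun i => ?_
      have h2 := hν 1 _ (MvPolynomial.isHomogeneous_X D.k i)
      rw [mul_one] at h2
      obtain ⟨a, ha, hae⟩ := D.exists_cellHom_eq α h2
      exact le_iSup (fun i : I => Proj.basicOpen (MvPolynomial.homogeneousSubmodule (Fin (n + 1)) D.k)
        (i.1.1 : MvPolynomial (Fin (n + 1)) D.k))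
        ⟨(⟨_, MvPolynomial.isHomogeneous_X _ i⟩, ⟨a, ha⟩), hae.symm⟩
    have hI' : ⨆ i : I, Proj.basicOpen D.saturation.grading (i.1.2 : D.R) = ⊤ := by
      rw [eq_top_iff, ← D.iSup_basicOpen_zeta]
      refine iSup_le fun c => ?_
      have h2 : D.zeta c ^ m ∈ D.saturation.grading m := by
        simpa using SetLike.pow_mem_graded m (D.zeta_mem c)
      obtain ⟨a, ha, hae⟩ := hν' 1 _ (by rw [mul_one]; exact D.cellHom_mem_grading α h2)
      rw [← Proj.basicOpen_pow _ _ m hm]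
      exact le_iSup (fun i : I => Proj.basicOpen D.saturation.grading (i.1.2 : D.R))
        ⟨(⟨a, ha⟩, ⟨_, h2⟩), hae⟩
    obtain ⟨Φ, -⟩ := exists_iso_of_coords (e.inv ≫ g) (D.inclVP (D.delCell α)) one_pos hm
      ((SerreTwist.isFrame _ (fun i : I => i.1.1) hI).pullback (e.inv ≫ g))
      (D.saturation.isFrame_lineBundle (D.inclVP (D.delCell α)) (fun i : I => i.1.2) hI')
      (fun _ => 1) 𝒰 fun a => by
        obtain ⟨φ, -, hφ, hφ'⟩ := h1 a
        refine ⟨_, _, 1, hφ, hφ', isUnit_one, fun i => ?_⟩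
        rw [Units.val_one, map_one, one_mul, mul_one]
        exact congrArg φ i.2
    exact ⟨Φ⟩

theorem isWeight_cellGen {α : Fin r → ℝ} (c : D.nearest α) :
    (D.cellSystem α).IsWeight c.1 (D.cellGen α c) := by
  rw [← cellHom_zeta_coe]
  exact (D.isMonomial_cellHom α).isWeight (D.isWeight_zeta c.1)

theorem exists_torus_toricVariety (α : Fin r → ℝ) :
    ∃ SX : (D.polytopeSystem (D.isDelaunay_delCell α)).TorusStructure D.k
        (𝟙 (D.toricVariety (D.isDelaunay_delCell α)))
        (projToSpec (D.polytopeSystem (D.isDelaunay_delCell α)).grading),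
      ∀ S : (D.polytopeSystem (D.isDelaunay_delCell α)).TorusStructure D.k
        (𝟙 (D.toricVariety (D.isDelaunay_delCell α)))
        (projToSpec (D.polytopeSystem (D.isDelaunay_delCell α)).grading), S = SX := by
  let Q := D.cellSystem α
  let X := D.toricVariety (D.isDelaunay_delCell α)
  let q : X ⟶ _ := projToSpec Q.grading
  let z : D.nearest α → Q.grading 1 := fun c => ⟨D.cellGen α c, D.cellChar_mem_grading⟩
  have hcov : ⨆ c, Proj.basicOpen Q.grading (z c : Q.toSubalgebra) = ⊤ := D.iSup_basicOpen_cellGen α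
  obtain ⟨T, hT⟩ := Q.exists_isTwist (fun c => (z c).1) (fun c => (z c).2) hcov
    (pullback.snd (torusToSpec D.k (Fin r → ℤ)) q ≫ 𝟙 X) (pullback.fst (torusToSpec D.k (Fin r → ℤ)) q)
  have hTb := CoeffSystem.IsTwist.comp_projToSpec Q (fun c => (z c).1) (fun c => (z c).2) hcov hT
  have e1 := Category.comp_id (pullback.snd (torusToSpec D.k (Fin r → ℤ)) q)
  obtain ⟨SX, -⟩ := Q.exists_torusStructure D.k (𝟙 X) q (z := z) D.isWeight_cellGen hcov T
    (hTb.trans (congrArg (· ≫ q) e1)) (by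
      have e2 : T ≫ 𝟙 X = T := Category.comp_id T
      rw [e2]; exact hT)
  exact ⟨SX, fun S => Q.torusStructure_unique D.k (𝟙 X) q (z := z) D.isWeight_cellGen hcov S SX⟩

theorem iSup_basicOpen_cellHom_zeta (α : Fin r → ℝ) :
    ⨆ c, Proj.basicOpen (D.cellSystem α).grading (D.cellHom α (D.zeta c)) = ⊤ := by
  rw [eq_top_iff, ← D.iSup_basicOpen_cellGen α]
  refine iSup_le fun c => ?_
  rw [← cellHom_zeta_coe]
  exact le_iSup (fun c => Proj.basicOpen (D.cellSystem α).grading (D.cellHom α (D.zeta c))) c.1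

theorem exists_torus_V (α : Fin r → ℝ) :
    ∃ SV : D.Torus (D.inclV (D.delCell α)), (∀ S : D.Torus (D.inclV (D.delCell α)), S = SV) ∧
      ∃ SX : (D.polytopeSystem (D.isDelaunay_delCell α)).TorusStructure D.k
          (𝟙 (D.toricVariety (D.isDelaunay_delCell α)))
          (projToSpec (D.polytopeSystem (D.isDelaunay_delCell α)).grading),
        (∀ S : (D.polytopeSystem (D.isDelaunay_delCell α)).TorusStructure D.k
          (𝟙 (D.toricVariety (D.isDelaunay_delCell α)))
          (projToSpec (D.polytopeSystem (D.isDelaunay_delCell α)).grading), S = SX) ∧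
        Nonempty (LinearizedIso SX.lin SV.lin) := by
  obtain ⟨e, he⟩ := D.exists_iso_V α
  obtain ⟨SX, hSX⟩ := D.exists_torus_toricVariety α
  have : IsClosedImmersion (D.inclV (D.delCell α)) :=
    inferInstanceAs (IsClosedImmersion (D.idealOrb (D.delCell α)).subschemeι)
  have : Mono (D.inclV (D.delCell α) ≫ D.incl) := mono_comp _ _
  obtain ⟨SV, hSV⟩ := CoeffSystem.exists_linearizedIso (Q := D.cellSystem α) (Q' := D.saturation)
    (k := D.k) (j := 𝟙 _) (q := projToSpec (D.cellSystem α).grading)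
    (j' := D.inclV (D.delCell α) ≫ D.incl) (q' := D.inclV (D.delCell α) ≫ D.toResidue)
    (D.isMonomial_cellHom α) e (by rw [← Category.assoc, he, cellEmb_toResidue])
    (fun S p φ hφ => by
      have h1 : p ≫ 𝟙 _ = p := Category.comp_id p
      rw [h1] at hφ
      have h2 := D.isCoordMap_cellMap α hφ
      rw [← cellEmb_incl, ← he, Category.assoc] at h2
      exact h2)
    (z := D.zetaDeg) (x := id) D.isWeight_zeta D.iSup_basicOpen_zeta
    (D.iSup_basicOpen_cellHom_zeta α) SX
  exact ⟨SV, fun S => D.saturation.torusStructure_unique D.k _ _ (z := D.zetaDeg) (x := id)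
    D.isWeight_zeta D.iSup_basicOpen_zeta S SV, SX, hSX, hSV⟩

theorem isIntegral_V (α : Fin r → ℝ) : IsIntegral (D.V (D.delCell α)) := by
  obtain ⟨e, -⟩ := D.exists_iso_V α
  have : Nonempty (D.V (D.delCell α)) :=
    ⟨e.hom (Classical.arbitrary (D.toricVariety (D.isDelaunay_delCell α)))⟩
  exact isIntegral_of_isOpenImmersion e.inv

theorem polytopeMonoid_iff_of_integral {α β : Fin r → ℝ} (h : D.delCell α ⊆ D.delCell β)
    (hβ : ∀ x, ∃ n : ℤ, D.dA β (toReal x) = n) (p : ℕ × (Fin r → ℤ)) :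
    p ∈ D.polytopeMonoid (D.isDelaunay_delCell α) ↔ p = 0 ∨ toReal p.2 ∈ (p.1 : ℝ) • D.delCell α := by
  refine ⟨fun hp => hp.1, fun hp => ?_⟩
  have h1 : ∀ γ, D.lin γ p ≤ D.lin α p := by
    rcases hp with rfl | hp
    · intro γ; rw [lin_zero, lin_zero]
    · exact D.forall_lin_le_iff.2 hp
  refine D.mem_polytopeMonoid.2 ⟨h1, ?_⟩
  obtain ⟨c, hc⟩ := D.nearest_nonempty α
  have hc' := D.delCell_subset_iff.1 h hc
  have h2 : toReal p.2 ∈ (p.1 : ℝ) • D.delCell β := Set.smul_set_mono h (D.forall_lin_le_iff.1 h1)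
  have h3 : D.lin α p = D.lin β p := le_antisymm (D.forall_lin_le_iff.2 h2 α) (h1 β)
  obtain ⟨n, hn⟩ := hβ (p.2 - p.1 • c)
  exact ⟨p.1 * D.A c + n, by rw [h3, D.lin_eq hc', hn]; push_cast; ring⟩

end DegenerationData
end

section
open Limits ProjCoord ModuleFrame SerreTwist
variable {O K : Type u} [CommRing O] [IsDomain O] [IsDiscreteValuationRing O] [Field K]
  [Algebra O K] [IsFractionRing O K] {r : ℕ}

namespace DegenerationData
variable (D : DegenerationData O K r)

theorem cellHom_mono_coeffAt_eq_zero {α : Fin r → ℝ} {f : D.R} {p : ℕ × (Fin r → ℤ)}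
    (h : D.lead (D.lin α p) (f.1.coeff p) = 0) :
    D.cellHom α (D.saturation.mono p (D.saturation.coeffAt f p)) = 0 := by
  refine (D.cellHom_mono_eq_smul α p _).trans ?_
  rw [show (D.saturation.coeffAt f p).1 = f.1.coeff p from rfl, h, zero_smul]

/-- The kernel for the intersection of two cells is the sum of the kernels. -/
theorem exists_add_of_cellHom_eq_zero {α β γ : Fin r → ℝ}
    (hγ : D.delCell γ = D.delCell α ∩ D.delCell β) {d : ℕ} {f : D.R} (hf : f ∈ D.saturation.grading d)
    (hf0 : D.cellHom γ f = 0) : ∃ f₁ ∈ D.saturation.grading d, ∃ f₂ ∈ D.saturation.grading d,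
      f = f₁ + f₂ ∧ D.cellHom α f₁ = 0 ∧ D.cellHom β f₂ = 0 := by
  classical
  have hmem (p) (hp : p ∈ f.1.coeff.support) :
      D.saturation.mono p (D.saturation.coeffAt f p) ∈ D.saturation.grading d :=
    hf p (Finsupp.mem_support_iff.1 hp) ▸ D.saturation.mono_mem_grading p _
  refine ⟨∑ p ∈ f.1.coeff.support with D.lead (D.lin α p) (f.1.coeff p) = 0,
      D.saturation.mono p (D.saturation.coeffAt f p),
    sum_mem fun p hp => hmem p (Finset.mem_filter.1 hp).1,
    ∑ p ∈ f.1.coeff.support with ¬ D.lead (D.lin α p) (f.1.coeff p) = 0,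
      D.saturation.mono p (D.saturation.coeffAt f p),
    sum_mem fun p hp => hmem p (Finset.mem_filter.1 hp).1, ?_, ?_, ?_⟩
  · exact (D.saturation.sum_mono f).symm.trans (Finset.sum_filter_add_sum_filter_not _ _ _).symm
  · rw [map_sum]
    exact Finset.sum_eq_zero fun p hp => D.cellHom_mono_coeffAt_eq_zero (Finset.mem_filter.1 hp).2
  · rw [map_sum]
    refine Finset.sum_eq_zero fun p hp => D.cellHom_mono_coeffAt_eq_zero ?_
    by_contra hβ
    have hα := (Finset.mem_filter.1 hp).2
    have h1 := (D.mem_polytopeMonoid.1 (D.mem_polytopeMonoid_of_lead (f.2 p) hα)).1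
    have h2 := (D.mem_polytopeMonoid.1 (D.mem_polytopeMonoid_of_lead (f.2 p) hβ)).1
    have h3 : ∀ δ, D.lin δ p ≤ D.lin γ p := by
      rw [forall_lin_le_iff] at h1 h2 ⊢
      rw [hγ]
      obtain hd | hd := Nat.eq_zero_or_pos p.1
      · rw [hd, Nat.cast_zero] at h1 ⊢
        rw [Set.zero_smul_set (D.delCell_nonempty α)] at h1
        rwa [Set.zero_smul_set (hγ ▸ D.delCell_nonempty γ)]
      · rw [Set.smul_set_inter₀ (by exact_mod_cast hd.ne')]
        exact ⟨h1, h2⟩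
    have h4 := congrArg (fun g => g.1.coeff p) hf0
    change (D.cellHom γ f).1.coeff p = 0 at h4
    rw [coeff_cellHom, le_antisymm (h1 γ) (h3 α)] at h4
    exact hα h4

theorem cellMap_app_eq_zero_iff (α : Fin r → ℝ) (c : Fin r → ℤ) {N : ℕ} (hN : 0 < N)
    (a : D.saturation.grading N) (hxN : D.zeta c ^ N ∈ D.saturation.grading N)
    (hO : Proj.basicOpen D.saturation.grading (D.zeta c) ≤
      Proj.basicOpen D.saturation.grading (D.zeta c ^ N)) :
    (D.cellEmb α).app _ (D.incl.app _ (resO hO (ratio D.saturation.grading a ⟨_, hxN⟩))) = 0 ↔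
      ∃ k, D.cellHom α (D.zeta c ^ k * a) = 0 := by
  have h1 := IsCoordMap.app_eq_zero_iff one_pos
    (fun d a ha => by rw [one_mul]; exact D.cellHom_mem_grading α ha)
    (fun _ => D.cellChar_mem_grading) (D.iSup_basicOpen_cellGen α) (D.isCoordMap_cellMap α)
    (D.zeta_mem c) hN a hxN hO
  rw [← h1, ← cellEmb_incl, Scheme.Hom.comp_app]
  rfl

theorem idealOrb_sup {α β γ : Fin r → ℝ} (hγ : D.delCell γ = D.delCell α ∩ D.delCell β) :
    D.idealOrb (D.delCell α) ⊔ D.idealOrb (D.delCell β) = D.idealOrb (D.delCell γ) := by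
  have hle {δ} (h : D.delCell γ ⊆ D.delCell δ) : D.idealOrb (D.delCell δ) ≤ D.idealOrb (D.delCell γ) := by
    refine Scheme.IdealSheafData.vanishingIdeal_antimono fun z hz => ?_
    exact D.mem_closure_orb.2 ((D.mem_closure_orb.1 hz).trans (D.delCell_subset_iff.1 h))
  refine le_antisymm (sup_le (hle (hγ ▸ Set.inter_subset_left)) (hle (hγ ▸ Set.inter_subset_right))) ?_
  have haff (c) : IsAffineOpen (Proj.basicOpen D.saturation.grading (D.zeta c)) :=
    Proj.isAffineOpen_basicOpen _ _ (D.zeta_mem c) one_pos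
  refine Scheme.IdealSheafData.le_of_iSup_eq_top
    (fun c => ⟨D.incl ⁻¹ᵁ Proj.basicOpen D.saturation.grading (D.zeta c), (haff c).preimage D.incl⟩)
    ?_ fun c f hf => ?_
  · change ⨆ c, D.incl ⁻¹ᵁ Proj.basicOpen D.saturation.grading (D.zeta c) = ⊤
    rw [← Scheme.Hom.preimage_iSup, D.iSup_basicOpen_zeta, Scheme.Hom.preimage_top]
  rw [idealOrb_delCell, Scheme.Hom.ker_apply] at hf
  rw [Scheme.IdealSheafData.ideal_sup, Pi.sup_apply, idealOrb_delCell, idealOrb_delCell,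
    Scheme.Hom.ker_apply, Scheme.Hom.ker_apply]
  have hf' : (D.cellEmb γ).app (D.incl ⁻¹ᵁ Proj.basicOpen D.saturation.grading (D.zeta c)) f = 0 := hf
  obtain ⟨g, rfl⟩ : ∃ g, D.incl.app _ g = f :=
    Scheme.Hom.app_surjective D.incl _ (haff c) f
  obtain ⟨N, b, hN, hb, hg⟩ := exists_ratio_eq one_pos (D.zeta_mem c) g
  rw [one_mul] at hb
  have hz (N : ℕ) : D.zeta c ^ N ∈ D.saturation.grading N := by
    simpa using SetLike.pow_mem_graded N (D.zeta_mem c)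
  have hO {N} (hN : 0 < N) : Proj.basicOpen D.saturation.grading (D.zeta c) ≤
      Proj.basicOpen D.saturation.grading (D.zeta c ^ N) := (Proj.basicOpen_pow _ _ N hN).ge
  rw [hg 0 N ⟨b, hb⟩ ⟨_, hz N⟩ (by simp) (by simp) (hO hN), cellMap_app_eq_zero_iff] at hf'
  swap; · exact hN
  obtain ⟨k, hk⟩ := hf'
  have hbk : D.zeta c ^ k * b ∈ D.saturation.grading (N + k) := by
    rw [mul_comm]; exact SetLike.mul_mem_graded hb (hz k)
  obtain ⟨f₁, h₁, f₂, h₂, hadd, h₁0, h₂0⟩ := D.exists_add_of_cellHom_eq_zero hγ hbk hk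
  have hg' := hg k (N + k) (⟨f₁, h₁⟩ + ⟨f₂, h₂⟩) ⟨_, hz (N + k)⟩
    (by rw [mul_comm, hadd]; rfl) rfl (hO (Nat.add_pos_left hN k))
  rw [ratio_add, map_add] at hg'
  rw [hg', map_add]
  refine Submodule.add_mem_sup ?_ ?_
  · exact (D.cellMap_app_eq_zero_iff α c (Nat.add_pos_left hN k) _ _ _).2
      ⟨0, by rw [pow_zero, one_mul]; exact h₁0⟩
  · exact (D.cellMap_app_eq_zero_iff β c (Nat.add_pos_left hN k) _ _ _).2
      ⟨0, by rw [pow_zero, one_mul]; exact h₂0⟩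

theorem closure_orb_inter {α β : Fin r → ℝ} : closure (D.orb (D.delCell α)) ∩ closure (D.orb (D.delCell β)) =
    {z | D.coords (D.incl z) ⊆ D.nearest α ∩ D.nearest β} := by
  ext z
  simp only [Set.mem_inter_iff, mem_closure_orb]
  exact Set.subset_inter_iff.symm

theorem closure_orb_inter_eq_empty {α β : Fin r → ℝ} (h : D.delCell α ∩ D.delCell β = ∅) :
    closure (D.orb (D.delCell α)) ∩ closure (D.orb (D.delCell β)) = ∅ := by
  rw [closure_orb_inter, Set.eq_empty_iff_forall_notMem]
  intro z hz
  obtain ⟨δ, hδ⟩ := D.exists_coords_eq z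
  obtain ⟨c, hc⟩ := D.nearest_nonempty δ
  have hc' := hz (hδ ▸ hc)
  have : toReal c ∈ D.delCell α ∩ D.delCell β :=
    ⟨D.toReal_mem_delCell.2 hc'.1, D.toReal_mem_delCell.2 hc'.2⟩
  rwa [h] at this

theorem exists_inter_orb {α β : Fin r → ℝ} (h : (D.delCell α ∩ D.delCell β).Nonempty) :
    D.IsDelaunay (D.delCell α ∩ D.delCell β) ∧
      closure (D.orb (D.delCell α)) ∩ closure (D.orb (D.delCell β)) =
        closure (D.orb (D.delCell α ∩ D.delCell β)) ∧
      D.idealOrb (D.delCell α) ⊔ D.idealOrb (D.delCell β) = D.idealOrb (D.delCell α ∩ D.delCell β) := by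
  obtain ⟨γ, hγ, hγn⟩ := D.exists_inter_delCell h
  rw [← hγ]
  refine ⟨D.isDelaunay_delCell γ, ?_, D.idealOrb_sup hγ⟩
  rw [closure_orb_inter, ← hγn]
  ext z
  exact D.mem_closure_orb.symm

end DegenerationData
end

section Length
variable {S : Type*} [CommRing S]

theorem Module.length_eq_of_forall_isUnit_or_dvd {e : S} (h : ∀ x, IsUnit x ∨ e ∣ x) {m : ℕ}
    (h0 : e ^ (m + 1) = 0) (h1 : e ^ m ≠ 0) : Module.length S S = (m + 1 : ℕ) := by
  have key (x : S) (hx : x ≠ 0) : ∃ j u, IsUnit u ∧ x = u * e ^ j := by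
    by_contra! H
    have (n : ℕ) : ∃ y, x = y * e ^ n := by
      induction n with
      | zero => exact ⟨x, by simp⟩
      | succ n ih =>
        obtain ⟨y, hy⟩ := ih
        obtain hu | ⟨z, rfl⟩ := h y
        · exact absurd hy (H n y hu)
        · exact ⟨z, by rw [hy]; ring⟩
    obtain ⟨y, hy⟩ := this (m + 1)
    exact hx (by rw [hy, h0, mul_zero])
  have hex (I : Submodule S S) : ∃ j, e ^ j ∈ I := ⟨m + 1, h0 ▸ zero_mem I⟩
  refine WithBot.coe_inj.1 ?_
  rw [Module.coe_length]
  refine le_antisymm (iSup_le fun p => ?_) (Order.le_krullDim_iff.2 ⟨LTSeries.mk (m + 1)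
    (fun i => Ideal.span {e ^ (m + 1 - i)}) (Fin.strictMono_iff_lt_succ.2 fun i => ?_), rfl⟩)
  · classical
    have anti {I J : Submodule S S} (hIJ : I < J) : Nat.find (hex J) < Nat.find (hex I) := by
      obtain ⟨x, hxJ, hxI⟩ := SetLike.exists_of_lt hIJ
      obtain ⟨j, u, hu, rfl⟩ := key x fun h => hxI (h ▸ zero_mem I)
      have h2 : e ^ j ∈ J := (Ideal.unit_mul_mem_iff_mem J hu).1 hxJ
      refine (Nat.find_min' _ h2).trans_lt (lt_of_not_ge fun hle => hxI ?_)
      exact Ideal.mul_mem_left I u (Ideal.mem_of_dvd I (pow_dvd_pow e hle) (Nat.find_spec (hex I)))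
    have hlt (I : Submodule S S) : Nat.find (hex I) < m + 2 :=
      Nat.lt_succ_of_le (Nat.find_min' _ (h0 ▸ zero_mem I))
    have := Fintype.card_le_of_injective
      (fun i : Fin (p.length + 1) => (⟨Nat.find (hex (p i)), hlt _⟩ : Fin (m + 2))) fun i j hij => by
        have hij' := congrArg Fin.val hij
        obtain h2 | h2 | h2 := lt_trichotomy i j
        · exact absurd hij' (anti (p.strictMono h2)).ne'
        · exact h2
        · exact absurd hij' (anti (p.strictMono h2)).ne
    simp only [Fintype.card_fin] at this
    exact_mod_cast (by omega : p.length ≤ m + 1)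
  · have hi := i.2
    have e1 : m + 1 - (i.castSucc : ℕ) = m - i + 1 := by rw [Fin.val_castSucc]; omega
    have e2 : m + 1 - (i.succ : ℕ) = m - i := by rw [Fin.val_succ]; omega
    rw [e1, e2]
    refine lt_of_le_of_ne (Ideal.span_singleton_le_span_singleton.2 ⟨e, pow_succ ..⟩) fun h2 => h1 ?_
    have h3 : e ^ (m - i) ∈ Ideal.span {e ^ (m - i + 1)} := h2 ▸ Ideal.mem_span_singleton_self _
    obtain ⟨y, hy⟩ := Ideal.mem_span_singleton.1 h3
    have h4 : e ^ m = y * e ^ (m + 1) := by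
      rw [show m = m - i + i by omega, pow_add, hy]; ring_nf
    rw [h4, h0, mul_zero]

theorem Module.length_eq_of_isLocalization {B : Type*} [CommRing B] (P : Ideal B) [P.IsPrime]
    [Algebra B S] [IsLocalization.AtPrime S P] {e : B} (he : ∀ b ∈ P, e ∣ b) {m : ℕ}
    (h0 : e ^ (m + 1) = 0) (h1 : ∀ t ∉ P, t * e ^ m ≠ 0) : Module.length S S = (m + 1 : ℕ) := by
  refine Module.length_eq_of_forall_isUnit_or_dvd (e := algebraMap B S e) (fun x => ?_)
    (by rw [← map_pow, h0, map_zero]) fun h => ?_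
  · obtain ⟨b, t, rfl⟩ := IsLocalization.exists_mk'_eq P.primeCompl x
    by_cases hb : b ∈ P
    · obtain ⟨d, rfl⟩ := he b hb
      exact Or.inr ⟨IsLocalization.mk' S d t, (IsLocalization.mul_mk'_eq_mk'_of_mul ..).symm⟩
    · exact Or.inl ((IsLocalization.AtPrime.isUnit_mk'_iff S P b t).2 hb)
  · rw [← map_pow, IsLocalization.map_eq_zero_iff P.primeCompl] at h
    obtain ⟨t, ht⟩ := h
    exact h1 t t.2 ht

theorem Module.length_eq_of_ringEquiv {S' : Type*} [CommRing S'] (f : S ≃+* S') :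
    Module.length S S = Module.length S' S' := by
  refine WithBot.coe_inj.1 ?_
  rw [Module.coe_length, Module.coe_length]
  exact Order.krullDim_eq_of_orderIso f.symm.idealComapOrderIso

end Length

section
variable {O K : Type u} [CommRing O] [IsDomain O] [IsDiscreteValuationRing O] [Field K]
  [Algebra O K] [IsFractionRing O K] {r : ℕ}

namespace DegenerationData
open Limits
open scoped TensorProduct
variable (D : DegenerationData O K r)

theorem mem_orbLattice_of_lead_ne_zero {α : Fin r → ℝ} (hα : cellDim (D.delCell α) = r)
    {x : Fin r → ℤ} {z : K} (h : D.lead (D.dA α (toReal x)) z ≠ 0) : x ∈ D.orbLattice α := by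
  refine ⟨by_contra fun hx => h (D.lead_of_forall_ne (fun n hn => hx ⟨n, hn⟩) z), fun β hβ => ?_⟩
  rw [D.vor_nearest_of_cellDim_eq hα] at hβ
  rw [Set.mem_singleton_iff.1 hβ]

open Classical in
/-- The character of the torus of a cell given by a lattice point, or `0`. -/
noncomputable def orbChar (α : Fin r → ℝ) (x : Fin r → ℤ) :
    AddMonoidAlgebra D.k (D.orbLattice α) :=
  if h : x ∈ D.orbLattice α then AddMonoidAlgebra.single ⟨x, h⟩ 1 else 0

theorem orbChar_of_mem {α : Fin r → ℝ} {x : Fin r → ℤ} (h : x ∈ D.orbLattice α) :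
    D.orbChar α x = AddMonoidAlgebra.single ⟨x, h⟩ 1 := dif_pos h

theorem dA_le_ord {α : Fin r → ℝ} {x : Fin r → ℤ} {z : K} (hz : z ∈ (D.coneSystem {α}).coeff x)
    (h0 : z ≠ 0) : D.dAHom α x ≤ ord O z := D.mem_coneSystem.1 hz h0 α rfl

/-- The restriction of functions from the chart at a hole to the orbit of the hole. -/
noncomputable def holeHom {α : Fin r → ℝ} (hα : cellDim (D.delCell α) = r) :
    D.coneRing {α} →+* AddMonoidAlgebra D.k (D.orbLattice α) :=
  D.initHom (D.coneSystem {α}) (D.dAHom α) (fun _ _ => D.dA_le_ord) (D.orbChar α)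
    (D.orbChar_of_mem (zero_mem _))
    fun p q ⟨_, _, h1⟩ ⟨_, _, h2⟩ => by
      have h1 := D.mem_orbLattice_of_lead_ne_zero hα h1
      have h2 := D.mem_orbLattice_of_lead_ne_zero hα h2
      rw [D.orbChar_of_mem h1, D.orbChar_of_mem h2, D.orbChar_of_mem (add_mem h1 h2)]
      refine Eq.trans ?_ (AddMonoidAlgebra.single_mul_single ..).symm
      rw [mul_one]; rfl

variable {α : Fin r → ℝ} (hα : cellDim (D.delCell α) = r)

theorem holeHom_mono (x : Fin r → ℤ) (a : (D.coneSystem {α}).coeff x) :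
    D.holeHom hα ((D.coneSystem {α}).mono x a) = D.lead (D.dA α (toReal x)) a.1 • D.orbChar α x :=
  D.initHom_mono x a

theorem holeHom_algebraMap (c : O) : D.holeHom hα (algebraMap O (D.coneRing {α}) c) =
    algebraMap O (AddMonoidAlgebra D.k (D.orbLattice α)) c := by
  have h0 : D.dA α (toReal (0 : Fin r → ℤ)) = (0 : ℤ) := by simp [toReal_zero, D.dA_zero]
  have h : algebraMap O (D.coneRing {α}) c = (D.coneSystem {α}).mono 0 ⟨algebraMap O K c,
      D.mem_coneSystem.2 fun _ β _ => by
        rw [toReal_zero, D.dA_zero]; exact_mod_cast ord_algebraMap_nonneg c⟩ := rfl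
  rw [h, holeHom_mono, h0, D.orbChar_of_mem (zero_mem _)]
  have := D.lead_sPow 0 c
  rw [sPow, zpow_zero, mul_one] at this
  rw [this]
  refine (AddMonoidAlgebra.smul_single ..).trans ?_
  rw [smul_eq_mul, mul_one]; rfl

theorem coeff_holeHom (f : D.coneRing {α}) (x : D.orbLattice α) :
    (D.holeHom hα f).coeff x = D.lead (D.dA α (toReal x.1)) (f.1.coeff x.1) := by
  refine (D.coneSystem {α}).mono_induction (P := fun f => (D.holeHom hα f).coeff x =
    D.lead (D.dA α (toReal x.1)) (f.1.coeff x.1)) ?_ (fun f g hf hg => ?_) (fun y a => ?_) f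
  · rw [map_zero]; exact (D.lead_zero _).symm
  · rw [map_add]
    refine (congrArg₂ (· + ·) hf hg).trans (D.lead_add ?_ ?_).symm
    · exact D.dA_le_ord (f.2 x.1)
    · exact D.dA_le_ord (g.2 x.1)
  · rw [holeHom_mono]
    change _ = D.lead _ ((AddMonoidAlgebra.single y a.1).coeff x.1)
    rw [AddMonoidAlgebra.coeff_single]
    by_cases h : D.lead (D.dA α (toReal y)) a.1 = 0
    · rw [h, zero_smul]
      by_cases hy : y = x.1
      · subst hy; rw [Finsupp.single_eq_same, h]; rfl
      · rw [Finsupp.single_eq_of_ne (Ne.symm hy), lead_zero]; rfl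
    · have hy := D.mem_orbLattice_of_lead_ne_zero hα h
      rw [D.orbChar_of_mem hy]
      by_cases hyx : y = x.1
      · subst hyx
        rw [Finsupp.single_eq_same]
        refine (congrArg (fun f : AddMonoidAlgebra D.k (D.orbLattice α) => f.coeff x)
          (AddMonoidAlgebra.smul_single ..)).trans ?_
        change (AddMonoidAlgebra.single x _).coeff x = _
        rw [AddMonoidAlgebra.coeff_single, Finsupp.single_eq_same, smul_eq_mul, mul_one]
      · rw [Finsupp.single_eq_of_ne (Ne.symm hyx), lead_zero]
        refine (congrArg (fun f : AddMonoidAlgebra D.k (D.orbLattice α) => f.coeff x)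
          (AddMonoidAlgebra.smul_single ..)).trans ?_
        change (AddMonoidAlgebra.single _ _).coeff x = _
        rw [AddMonoidAlgebra.coeff_single, Finsupp.single_eq_of_ne]
        exact fun h => hyx (congrArg Subtype.val h).symm

theorem dA_lt_ord_of_holeHom_eq_zero {f : D.coneRing {α}} (hf : D.holeHom hα f = 0)
    {x : Fin r → ℤ} (hx : f.1.coeff x ≠ 0) : D.dA α (toReal x) < ord O (f.1.coeff x) := by
  refine lt_of_le_of_ne (D.dA_le_ord (f.2 x) hx) fun h => D.lead_ne_zero hx ?_
  have h1 := D.coeff_holeHom hα f ⟨x, ⟨_, h⟩, fun β hβ => by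
    rw [D.vor_nearest_of_cellDim_eq hα] at hβ
    rw [Set.mem_singleton_iff.1 hβ]⟩
  rw [hf] at h1
  exact (congrArg (D.lead · _) h).symm.trans h1.symm

theorem exists_mul_sub_dA_eq_one {m : ℕ}
    (hm : IsLeast {m : ℕ | 0 < m ∧ ∀ x, ∃ z : ℤ, m * D.dA α (toReal x) = z} m) :
    ∃ (x : Fin r → ℤ) (n : ℤ), m * (n - D.dA α (toReal x)) = 1 := by
  obtain ⟨⟨hm0, hz⟩, hleast⟩ := hm
  choose z hz using hz
  let H : AddSubgroup ℤ := (AddMonoidHom.mk' (fun p : ℤ × (Fin r → ℤ) => m * p.1 - z p.2)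
    fun p q => by
      have h : ((z (p.2 + q.2) : ℤ) : ℝ) = z p.2 + z q.2 := by
        rw [← hz, ← hz, ← hz, toReal_add, D.dA_add, mul_add]
      have h : z (p.2 + q.2) = z p.2 + z q.2 := by exact_mod_cast h
      simp only [Prod.fst_add, Prod.snd_add, h]; ring).range
  have hz0 : z 0 = 0 := by
    have := hz 0
    rw [toReal_zero, D.dA_zero, mul_zero] at this
    exact_mod_cast this.symm
  obtain ⟨a, ha⟩ := Int.subgroup_cyclic H
  have hmem (n : ℤ) (x) : a ∣ m * n - z x := by
    have : m * n - z x ∈ H := ⟨(n, x), rfl⟩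
    rw [ha, AddSubgroup.mem_closure_singleton] at this
    obtain ⟨j, hj⟩ := this
    exact ⟨j, by rw [← hj, smul_eq_mul, mul_comm]⟩
  obtain ⟨q, hq⟩ : a ∣ m := by simpa [hz0] using hmem 1 0
  have hm0' : (m : ℤ) ≠ 0 := by exact_mod_cast hm0.ne'
  have ha0 : a ≠ 0 := by rintro rfl; exact hm0' (by rw [hq, zero_mul])
  have hq0 : q ≠ 0 := by rintro rfl; exact hm0' (by rw [hq, mul_zero])
  have hle : m ≤ q.natAbs := hleast ⟨Int.natAbs_pos.2 hq0, fun x => by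
    obtain ⟨w, hw⟩ : a ∣ z x := by simpa using hmem 0 x
    have h1 : (q : ℝ) * D.dA α (toReal x) = w := by
      have h2 := hz x
      rw [hw, show (m : ℝ) = a * q by exact_mod_cast hq] at h2
      push_cast at h2
      have ha' : (a : ℝ) ≠ 0 := by exact_mod_cast ha0
      exact mul_left_cancel₀ ha' (by linarith)
    obtain h | h := Int.natAbs_eq q
    · exact ⟨w, by rw [← h1, ← Int.cast_natCast (R := ℝ), ← h]⟩
    · refine ⟨-w, ?_⟩
      rw [← Int.cast_natCast (R := ℝ), show (q.natAbs : ℤ) = -q by omega, Int.cast_neg, Int.cast_neg,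
        ← h1, neg_mul]⟩
  have ha1 : a.natAbs = 1 := by
    have h1 : m = a.natAbs * q.natAbs := by rw [← Int.natAbs_mul, ← hq, Int.natAbs_natCast]
    have h2 := Int.natAbs_pos.2 ha0
    have h3 := Int.natAbs_pos.2 hq0
    nlinarith
  have h1 : (1 : ℤ) ∈ H := by
    rw [ha, AddSubgroup.mem_closure_singleton]
    obtain h | h := Int.natAbs_eq_iff.1 ha1
    · exact ⟨1, by simp [h]⟩
    · exact ⟨-1, by simp [h]⟩
  obtain ⟨⟨n, x⟩, h1⟩ := h1
  refine ⟨x, n, ?_⟩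
  rw [mul_sub, hz]
  exact_mod_cast h1

theorem coneMono_pow {W : Set (Fin r → ℝ)} {x : Fin r → ℤ} {n : ℤ}
    (h : ∀ β ∈ W, D.dA β (toReal x) ≤ n) (N : ℕ) :
    D.coneMono W x n h ^ N = D.coneMono W (N • x) (N * n) (fun β hβ => by
      rw [toReal_nsmul, D.dA_smul]; push_cast
      exact mul_le_mul_of_nonneg_left (h β hβ) N.cast_nonneg) :=
  Subtype.ext ((AddMonoidAlgebra.single_pow ..).trans (congrArg _ (D.sPow_pow n N)))

theorem exists_generator_ker_holeHom {m : ℕ}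
    (hm : IsLeast {m : ℕ | 0 < m ∧ ∀ x, ∃ z : ℤ, m * D.dA α (toReal x) = z} m) :
    ∃ e u : D.coneRing {α}, IsUnit u ∧ D.holeHom hα e = 0 ∧ (∀ f, D.holeHom hα f = 0 → e ∣ f) ∧
      e ^ m = algebraMap O _ D.s * u := by
  obtain ⟨x, n, hxn⟩ := D.exists_mul_sub_dA_eq_one hm
  obtain ⟨⟨hm0, hz⟩, -⟩ := hm
  have hm0' : (0 : ℝ) < m := by exact_mod_cast hm0
  have hlt : D.dA α (toReal x) < n := by nlinarith
  have hmx : ∀ β ∈ ({α} : Set (Fin r → ℝ)), D.dA β (toReal (m • x)) = (m * n - 1 : ℤ) := by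
    rintro _ rfl
    rw [toReal_nsmul, D.dA_smul]; push_cast; linarith
  refine ⟨D.coneMono {α} x n fun β hβ => by rw [Set.mem_singleton_iff.1 hβ]; exact hlt.le, _,
    D.isUnit_coneMono hmx, ?_, fun f hf => ?_, ?_⟩
  · refine (D.holeHom_mono hα ..).trans ?_
    rw [D.lead_eq_zero fun _ => by rw [D.ord_sPow]; exact hlt, zero_smul]
  · rw [← (D.coneSystem {α}).sum_mono f]
    refine Finset.dvd_sum fun y hy => ?_
    have hy := Finsupp.mem_support_iff.1 hy
    have h1 := D.dA_lt_ord_of_holeHom_eq_zero hα hf hy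
    obtain ⟨z, hz⟩ := hz y
    have h2 : z + 1 ≤ m * ord O (f.1.coeff y) := by
      have : (z : ℝ) < m * ord O (f.1.coeff y) := by rw [← hz]; gcongr
      exact Int.add_one_le_of_lt (by exact_mod_cast this)
    have h3 : (m : ℝ) * D.dA α (toReal y) + 1 ≤ m * ord O (f.1.coeff y) := by
      rw [hz]; exact_mod_cast h2
    refine ⟨(D.coneSystem {α}).mono (y - x) ⟨f.1.coeff y * D.sPow (-n),
      D.mem_coneSystem.2 fun _ β hβ => ?_⟩, ?_⟩
    · rw [Set.mem_singleton_iff.1 hβ, D.ord_mul_sPow hy, toReal_sub, D.dA_sub]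
      push_cast
      refine le_of_mul_le_mul_left ?_ hm0'
      linarith
    · refine Subtype.ext (Eq.trans ?_ (AddMonoidAlgebra.single_mul_single ..).symm)
      rw [add_sub_cancel, mul_left_comm, ← D.sPow_add, add_neg_cancel, sPow, zpow_zero, mul_one]
      rfl
  · rw [coneMono_pow]
    refine Subtype.ext (Eq.trans ?_ (AddMonoidAlgebra.single_mul_single ..).symm)
    rw [zero_add]
    change AddMonoidAlgebra.single _ _ = AddMonoidAlgebra.single _ (algebraMap O K D.s * D.sPow _)
    have h1 : algebraMap O K D.s = D.sPow 1 := by rw [sPow, zpow_one]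
    rw [h1, ← D.sPow_add, add_sub_cancel]

end DegenerationData
end

section
variable {O K : Type u} [CommRing O] [IsDomain O] [IsDiscreteValuationRing O] [Field K]
  [Algebra O K] [IsFractionRing O K] {r : ℕ}

namespace DegenerationData
open Limits
open scoped TensorProduct
variable (D : DegenerationData O K r) {α : Fin r → ℝ} (hα : cellDim (D.delCell α) = r)

theorem holeHom_comp_chartHom (c : D.nearest α) (h : ∀ β ∈ ({α} : Set (Fin r → ℝ)), c.1 ∈ D.nearest β) :
    (D.holeHom hα).comp (D.chartHom {α} c.1 h) = (D.orbHom c).comp (D.cellHom α) := by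
  refine D.saturation.ringHom_ext fun p a => ?_
  have h1 : D.lead (D.dA α (toReal (p.2 - p.1 • c.1))) (a.1 * D.sPow (-(p.1 * D.A c.1))) =
      D.lead (D.lin α p) a.1 := by
    have h2 := D.lead_mul (t := D.lin α p) (t' := (-(p.1 * D.A c.1) : ℤ)) (z := a.1)
      (w := D.sPow (-(p.1 * D.A c.1))) (fun h0 => D.mem_saturation.1 a.2 h0 α)
      fun _ => by rw [D.ord_sPow]
    have h3 := D.lead_sPow (-(p.1 * D.A c.1)) 1
    rw [map_one, one_mul, map_one] at h3
    rw [h3, mul_one] at h2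
    rw [← h2, D.lin_eq c.2]
    congr 1
    push_cast; ring
  have h2 : D.chartHom {α} c.1 h (D.saturation.mono p a) = (D.coneSystem {α}).mono (p.2 - p.1 • c.1)
      ⟨a.1 * D.sPow (-(p.1 * D.A c.1)), by
        have := (D.chartHom {α} c.1 h (D.saturation.mono p a)).2 (p.2 - p.1 • c.1)
        rwa [D.chartHom_mono h, AddMonoidAlgebra.coeff_single, Finsupp.single_eq_same] at this⟩ :=
    Subtype.ext (D.chartHom_mono h p a)
  rw [RingHom.comp_apply, RingHom.comp_apply, h2, holeHom_mono, cellHom_mono_eq_smul, h1]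
  by_cases h0 : D.lead (D.lin α p) a.1 = 0
  · rw [h0, zero_smul, zero_smul, map_zero]
  · have hp := D.mem_polytopeMonoid_of_lead a.2 h0
    rw [show D.orbChar α (p.2 - p.1 • c.1) = AddMonoidAlgebra.single (D.toOrbLattice c hp) 1 from
      D.orbChar_of_mem (D.toOrbLattice c hp).2, Algebra.smul_def (A := (D.cellSystem α).toSubalgebra),
      map_mul, orbHom_algebraMap, D.orbHom_cellChar c hp]
    refine (AddMonoidAlgebra.smul_single ..).trans ((AddMonoidAlgebra.single_mul_single ..).trans ?_).symm
    rw [zero_add]; rfl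

/-- The restriction of functions from the central fiber of the chart at a hole to its orbit. -/
noncomputable def holeFiberHom :
    D.coneRing {α} ⊗[O] D.k →ₐ[O] AddMonoidAlgebra D.k (D.orbLattice α) :=
  Algebra.TensorProduct.lift ⟨D.holeHom hα, D.holeHom_algebraMap hα⟩
    (IsScalarTower.toAlgHom O D.k (AddMonoidAlgebra D.k (D.orbLattice α))) fun _ _ => Commute.all _ _

theorem holeFiberHom_tmul_one (f : D.coneRing {α}) :
    D.holeFiberHom hα (f ⊗ₜ 1) = D.holeHom hα f := by
  refine (Algebra.TensorProduct.lift_tmul ..).trans ?_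
  rw [map_one, mul_one]; rfl

theorem exists_eq_tmul_one (b : D.coneRing {α} ⊗[O] D.k) : ∃ f : D.coneRing {α}, b = f ⊗ₜ 1 := by
  obtain ⟨f, rfl⟩ := Algebra.TensorProduct.includeLeft_surjective (T := D.k) O (D.coneRing {α})
    IsLocalRing.residue_surjective b
  exact ⟨f, rfl⟩

theorem dvd_of_tmul_one_eq_zero {f : D.coneRing {α}} (h : f ⊗ₜ[O] (1 : D.k) = 0) :
    algebraMap O _ D.s ∣ f := by
  let I : Ideal (D.coneRing {α}) := Ideal.span {algebraMap O _ D.s}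
  let g : D.k →ₐ[O] D.coneRing {α} ⧸ I :=
    Ideal.Quotient.liftₐ (IsLocalRing.maximalIdeal O) (Algebra.ofId O _) fun a ha => by
      rw [D.irreducible_s.maximalIdeal_eq, Ideal.mem_span_singleton] at ha
      obtain ⟨b, rfl⟩ := ha
      refine Ideal.Quotient.eq_zero_iff_mem.2 (Ideal.mem_span_singleton.2 ?_)
      rw [map_mul]
      exact Dvd.intro _ rfl
  have h1 := congrArg (Algebra.TensorProduct.lift (Ideal.Quotient.mkₐ O I) g fun x y =>
    (mul_comm (Ideal.Quotient.mkₐ O I x) (g y) :)) h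
  have h2 : Ideal.Quotient.mk I f * g 1 = 0 :=
    (Algebra.TensorProduct.lift_tmul ..).symm.trans (h1.trans (map_zero _))
  rw [map_one g, mul_one] at h2
  exact Ideal.mem_span_singleton.1 (Ideal.Quotient.eq_zero_iff_mem.1 h2)

theorem tmul_one_algebraMap_s : algebraMap O (D.coneRing {α}) D.s ⊗ₜ[O] (1 : D.k) = 0 := by
  rw [Algebra.algebraMap_eq_smul_one, TensorProduct.smul_tmul, Algebra.smul_def, mul_one]
  have : algebraMap O D.k D.s = 0 := (IsLocalRing.residue_eq_zero_iff _).2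
    (D.irreducible_s.maximalIdeal_eq ▸ Ideal.mem_span_singleton_self _)
  rw [this, TensorProduct.tmul_zero]

theorem length_localization_ker_holeFiberHom {m : ℕ}
    (hm : IsLeast {m : ℕ | 0 < m ∧ ∀ x, ∃ z : ℤ, m * D.dA α (toReal x) = z} m)
    (P : Ideal (D.coneRing {α} ⊗[O] D.k)) [P.IsPrime] (hP : ∀ b, b ∈ P ↔ D.holeFiberHom hα b = 0)
    (S : Type u) [CommRing S] [Algebra (D.coneRing {α} ⊗[O] D.k) S] [IsLocalization.AtPrime S P] :
    Module.length S S = m := by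
  obtain ⟨e, u, hu, he0, hdvd, hpow⟩ := D.exists_generator_ker_holeHom hα hm
  obtain ⟨n, rfl⟩ := Nat.exists_eq_succ_of_ne_zero hm.1.1.ne'
  have hmul (f g : D.coneRing {α}) : (f ⊗ₜ[O] (1 : D.k)) * (g ⊗ₜ 1) = (f * g) ⊗ₜ 1 := by
    rw [Algebra.TensorProduct.tmul_mul_tmul, one_mul]
  have hpw (j : ℕ) : (e ⊗ₜ[O] (1 : D.k)) ^ j = (e ^ j) ⊗ₜ 1 := by
    rw [Algebra.TensorProduct.tmul_pow, one_pow]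
  have hs : algebraMap O (D.coneRing {α}) D.s ≠ 0 := fun h =>
    D.irreducible_s.ne_zero (IsFractionRing.injective O K ((by
      have := congrArg (fun f : D.coneRing {α} => f.1.coeff 0) h
      exact Finsupp.single_eq_same.symm.trans this :
        algebraMap O K D.s = 0).trans (map_zero _).symm))
  have he : e ≠ 0 := by
    rintro rfl
    rw [zero_pow n.succ_ne_zero] at hpow
    exact hs ((hu.mul_left_eq_zero).1 hpow.symm)
  refine Module.length_eq_of_isLocalization P (e := e ⊗ₜ[O] (1 : D.k)) (fun b hb => ?_) ?_ fun t ht h => ht ?_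
  · obtain ⟨f, rfl⟩ := D.exists_eq_tmul_one b
    rw [hP, holeFiberHom_tmul_one] at hb
    obtain ⟨g, rfl⟩ := hdvd f hb
    exact ⟨g ⊗ₜ 1, (hmul e g).symm⟩
  · rw [hpw, hpow, ← hmul, tmul_one_algebraMap_s, zero_mul]
  · obtain ⟨f, rfl⟩ := D.exists_eq_tmul_one t
    rw [hpw, hmul] at h
    obtain ⟨g, hg⟩ := D.dvd_of_tmul_one_eq_zero h
    obtain ⟨v, hv⟩ := hu.exists_right_inv
    have h1 : e ^ n * f = e ^ n * (e * (v * g)) := by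
      calc e ^ n * f = algebraMap O _ D.s * (u * v) * g := by rw [hv, mul_one, ← hg, mul_comm]
        _ = e ^ (n + 1) * (v * g) := by rw [hpow]; ring
        _ = _ := by ring
    rw [hP, holeFiberHom_tmul_one, mul_left_cancel₀ (pow_ne_zero n he) h1, map_mul, he0, zero_mul]

include hα in
theorem isOpenImmersion_chart_hole {c : Fin r → ℤ} (hc : ∀ β ∈ ({α} : Set (Fin r → ℝ)), c ∈ D.nearest β) :
    IsOpenImmersion (D.chart {α} c hc) := by
  have h (W : Set (Fin r → ℝ)) (hW : W = D.vor ((D.finite_nearest α).toFinset : Set (Fin r → ℤ)))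
      (hc' : ∀ β ∈ W, c ∈ D.nearest β) : IsOpenImmersion (D.chart W c hc') := by
    subst hW
    exact D.isOpenImmersion_chart ((D.finite_nearest α).mem_toFinset.2 (hc α rfl)) hc'
  exact h _ (by rw [Set.Finite.coe_toFinset, D.vor_nearest_of_cellDim_eq hα]) hc

theorem chartHom_comp_algebraMap {W : Set (Fin r → ℝ)} {c : Fin r → ℤ}
    (hc : ∀ β ∈ W, c ∈ D.nearest β) :
    (D.chartHom W c hc).comp (algebraMap O D.R) = algebraMap O (D.coneRing W) := by
  refine RingHom.ext fun a => Subtype.ext ((D.dehomogenize_single c 0 (algebraMap O K a)).trans ?_)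
  have h1 : (0 : ℕ × (Fin r → ℤ)).2 - (0 : ℕ × (Fin r → ℤ)).1 • c = 0 := by simp
  have h2 : algebraMap O K a * D.sPow (-((0 : ℕ × (Fin r → ℤ)).1 * D.A c)) = algebraMap O K a := by
    simp [sPow]
  rw [h1, h2]; rfl

theorem chart_toBase {W : Set (Fin r → ℝ)} {c : Fin r → ℤ} (hc : ∀ β ∈ W, c ∈ D.nearest β) :
    D.chart W c hc ≫ D.toBase = Spec.map (CommRingCat.ofHom (algebraMap O (D.coneRing W))) :=
  (D.chart_hasCoords W c hc).projToSpec.trans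
    (congrArg (fun f => Spec.map (CommRingCat.ofHom f)) (D.chartHom_comp_algebraMap hc))

include hα in
theorem exists_chart_fiber {c : Fin r → ℤ} (hc : ∀ β ∈ ({α} : Set (Fin r → ℝ)), c ∈ D.nearest β) :
    ∃ h : Spec (.of (D.coneRing {α} ⊗[O] D.k)) ⟶ D.P₀, IsOpenImmersion h ∧
      h ≫ D.incl = Spec.map (CommRingCat.ofHom Algebra.TensorProduct.includeLeftRingHom) ≫
        D.chart {α} c hc := by
  have := D.isOpenImmersion_chart_hole hα hc
  refine ⟨(pullbackSpecIso O (D.coneRing {α}) D.k).inv ≫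
    pullback.map _ _ D.toBase D.closedPoint (D.chart {α} c hc) (𝟙 _) (𝟙 _)
      ((Category.comp_id _).trans (D.chart_toBase hc).symm)
      ((Category.comp_id _).trans (Category.id_comp D.closedPoint).symm), inferInstance, ?_⟩
  rw [Category.assoc, ← pullbackSpecIso_inv_fst, Category.assoc]
  exact congrArg (_ ≫ ·) (pullback.lift_fst _ _ _)

theorem holeFiberHom_comp_chart (c : D.nearest α)
    {h : Spec (.of (D.coneRing {α} ⊗[O] D.k)) ⟶ D.P₀}
    (hc : ∀ β ∈ ({α} : Set (Fin r → ℝ)), c.1 ∈ D.nearest β)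
    (hh : h ≫ D.incl = Spec.map (CommRingCat.ofHom Algebra.TensorProduct.includeLeftRingHom) ≫
        D.chart {α} c.1 hc) :
    Spec.map (CommRingCat.ofHom (D.holeFiberHom hα).toRingHom) ≫ h = D.orbChart c ≫ D.cellEmb α := by
  have h1 := (D.chart_hasCoords {α} c.1 hc).comp _ (CommRingCat.ofHom (D.holeHom hα))
  have h2 := D.isCoordMap_cellMap α (D.hasCoords_orbChart c)
  rw [← D.holeHom_comp_chartHom hα c hc] at h2
  refine (cancel_mono D.incl).1 ?_
  refine Eq.trans ?_ ((h1.hom_ext h2).trans ?_)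
  · rw [Category.assoc, hh, ← Category.assoc, ← Spec.map_comp, ← CommRingCat.ofHom_comp]
    exact congrArg (fun f => Spec.map (CommRingCat.ofHom f) ≫ D.chart {α} c.1 hc)
      (RingHom.ext fun f => D.holeFiberHom_tmul_one hα f)
  · rw [Category.assoc, cellEmb_incl]

instance (α : Fin r → ℝ) : IsDomain (AddMonoidAlgebra D.k (D.orbLattice α)) := by
  have : TwoUniqueSums (D.orbLattice α) :=
    TwoUniqueSums.of_injective_addHom (D.orbLattice α).subtype.toAddHom Subtype.val_injective inferInstance
  have : NoZeroDivisors (AddMonoidAlgebra D.k (D.orbLattice α)) := inferInstance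
  exact NoZeroDivisors.to_isDomain _

include hα in
/-- The generic point of the orbit closure of a maximal cell and the length of its local ring. -/
theorem exists_length_stalk : ∃ p : D.P₀, IsGenericPoint p (closure (D.orb (D.delCell α))) ∧
    ∃ m : ℕ, Module.length (D.P₀.presheaf.stalk p) (D.P₀.presheaf.stalk p) = m ∧
      IsLeast {m : ℕ | 0 < m ∧ ∀ x, ∃ z : ℤ, m * D.dA α (toReal x) = z} m := by
  obtain ⟨c, hc⟩ := D.nearest_nonempty α
  obtain ⟨h, hh, hfst⟩ := D.exists_chart_fiber hα (c := c) (by rintro _ rfl; exact hc)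
  have hcomp := D.holeFiberHom_comp_chart hα ⟨c, hc⟩ _ hfst
  let o := D.orbChart ⟨c, hc⟩ ≫ D.cellEmb α
  let ξ : Spec (.of (AddMonoidAlgebra D.k (D.orbLattice α))) :=
    (⊥ : PrimeSpectrum (AddMonoidAlgebra D.k (D.orbLattice α)))
  let y : Spec (.of (D.coneRing {α} ⊗[O] D.k)) :=
    Spec.map (CommRingCat.ofHom (D.holeFiberHom hα).toRingHom) ξ
  have hy : h y = o ξ := congrArg (fun f => (f : _ ⟶ D.P₀) ξ) hcomp
  have hξ : IsGenericPoint ξ Set.univ := by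
    refine (PrimeSpectrum.closure_singleton _).trans ?_
    exact PrimeSpectrum.zeroLocus_bot
  obtain ⟨m, hm⟩ : ∃ m, IsLeast {m : ℕ | 0 < m ∧ ∀ x, ∃ z : ℤ, m * D.dA α (toReal x) = z} m := by
    classical
    have hex := D.exists_denominator hα
    exact ⟨Nat.find hex, Nat.find_spec hex, fun n hn => Nat.find_min' hex hn⟩
  refine ⟨h y, ?_, m, ?_, hm⟩
  · have h1 := hξ.image o.continuous
    rw [Set.image_univ, D.range_orbChart_cellEmb] at h1
    rw [hy]; exact h1
  · rw [Module.length_eq_of_ringEquiv (asIso (h.stalkMap y)).commRingCatIsoToRingEquiv]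
    let alg : Algebra (D.coneRing {α} ⊗[O] D.k) ((Spec (.of (D.coneRing {α} ⊗[O] D.k))).presheaf.stalk y) :=
      StructureSheaf.stalkAlgebra (D.coneRing {α} ⊗[O] D.k) y
    have : y.asIdeal.IsPrime := y.isPrime
    have : IsLocalization.AtPrime ((Spec (.of (D.coneRing {α} ⊗[O] D.k))).presheaf.stalk y) y.asIdeal :=
      StructureSheaf.IsLocalization.to_stalk (D.coneRing {α} ⊗[O] D.k) y
    exact D.length_localization_ker_holeFiberHom hα hm y.asIdeal (fun _ => Ideal.mem_bot) _

end DegenerationData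
end

theorem mainTheorem9 {O K : Type u} [CommRing O] [IsDomain O] [IsDiscreteValuationRing O]
    [Field K] [Algebra O K] [IsFractionRing O K] {r : ℕ} (D : DegenerationData O K r) :
    -- the open subsets `U(σ) = Spec R(σ)` and their intersections
    ((∀ σ, D.IsDelaunay σ → ∃ ι : Spec (.of (D.coneRing (D.voronoi σ))) ⟶ D.P,
        IsOpenImmersion ι ∧ Set.range ι = D.U σ ∧
        ∀ c, toReal c ∈ σ → ∃ h, D.chart (D.voronoi σ) c h = ι) ∧
      ∀ σ₁ σ₂, D.IsDelaunay σ₁ → D.IsDelaunay σ₂ →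
        ((D.voronoi σ₁ ∩ D.voronoi σ₂).Nonempty →
          D.IsDelaunay (D.dualDel (D.voronoi σ₁ ∩ D.voronoi σ₂)) ∧
          D.voronoi (D.dualDel (D.voronoi σ₁ ∩ D.voronoi σ₂)) = D.voronoi σ₁ ∩ D.voronoi σ₂ ∧
          D.U σ₁ ∩ D.U σ₂ = D.U (D.dualDel (D.voronoi σ₁ ∩ D.voronoi σ₂))) ∧
        (D.voronoi σ₁ ∩ D.voronoi σ₂ = ∅ → D.U σ₁ ∩ D.U σ₂ = D.coneOpen ∅)) ∧
    -- `R(σ)` is a localization of `R(c)`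
    (∀ σ, D.IsDelaunay σ → ∀ c, toReal c ∈ σ →
      ∃ h : D.coneRing (D.voronoi {toReal c}) ≤ D.coneRing (D.voronoi σ),
        @IsLocalization _ _ (D.facetMonoid σ c) (D.coneRing (D.voronoi σ)) _
          (Subalgebra.inclusion h).toRingHom.toAlgebra) ∧
    -- the orbits and the components of the central fiber
    (∃ S₀ : D.Torus (𝟙 D.P₀), (∀ S : D.Torus (𝟙 D.P₀), S = S₀) ∧
      Set.BijOn D.orb {σ | D.IsDelaunay σ} (Set.range (torusOrbit S₀.act)) ∧
      (∀ σ, D.IsDelaunay σ → topologicalKrullDim (D.orb σ) = cellDim σ) ∧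
      Set.BijOn (fun σ => closure (D.orb σ)) {σ | D.IsDelaunay σ ∧ cellDim σ = r}
        (irreducibleComponents D.P₀)) ∧
    -- the orbit closures are the projective toric varieties of the polytopes
    (∀ σ, ∀ hσ : D.IsDelaunay σ,
      IsIntegral (D.V σ) ∧
      (∃ SV : D.Torus (D.inclV σ), (∀ S : D.Torus (D.inclV σ), S = SV) ∧
        ∃ SX : (D.polytopeSystem hσ).TorusStructure D.k (𝟙 (D.toricVariety hσ))
            (projToSpec (D.polytopeSystem hσ).grading),
          (∀ S : (D.polytopeSystem hσ).TorusStructure D.k (𝟙 (D.toricVariety hσ))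
            (projToSpec (D.polytopeSystem hσ).grading), S = SX) ∧
          Nonempty (LinearizedIso SX.lin SV.lin)) ∧
      D.saturation.IsAmple D.k (D.inclVP σ) (D.VToResidue σ) ∧
      ((∃ α, σ ⊆ D.delCell α ∧ cellDim (D.delCell α) = r ∧ ∀ x, ∃ n : ℤ, D.dA α (toReal x) = n) →
        ∀ p, p ∈ D.polytopeMonoid hσ ↔ p = 0 ∨ toReal p.2 ∈ (p.1 : ℝ) • σ)) ∧
    -- the intersections of the orbit closures
    (∀ σ₁ σ₂, D.IsDelaunay σ₁ → D.IsDelaunay σ₂ →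
      (σ₁ ∩ σ₂ = ∅ → closure (D.orb σ₁) ∩ closure (D.orb σ₂) = ∅) ∧
      ((σ₁ ∩ σ₂).Nonempty → D.IsDelaunay (σ₁ ∩ σ₂) ∧
        closure (D.orb σ₁) ∩ closure (D.orb σ₂) = closure (D.orb (σ₁ ∩ σ₂)) ∧
        D.idealOrb σ₁ ⊔ D.idealOrb σ₂ = D.idealOrb (σ₁ ∩ σ₂))) ∧
    -- the multiplicities of the components
    (∀ α, cellDim (D.delCell α) = r →
      ∃ p : D.P₀, IsGenericPoint p (closure (D.orb (D.delCell α))) ∧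
        ∃ m : ℕ, Module.length (D.P₀.presheaf.stalk p) (D.P₀.presheaf.stalk p) = m ∧
          IsLeast {m : ℕ | 0 < m ∧ ∀ x, ∃ z : ℤ, m * D.dA α (toReal x) = z} m) := by
  refine ⟨⟨fun σ hσ => D.exists_chart hσ, fun σ₁ σ₂ h₁ h₂ => D.U_inter_U h₁ h₂⟩,
    fun σ hσ c hc => D.isLocalization_facetMonoid hσ c hc, ?_, ?_, ?_,
    fun α hα => D.exists_length_stalk hα⟩
  · obtain ⟨S₀, hS₀⟩ := D.exists_torus
    refine ⟨S₀, hS₀, D.bijOn_orb S₀, ?_, D.bijOn_closure_orb⟩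
    rintro _ ⟨α, rfl⟩
    exact D.topologicalKrullDim_orb α
  · rintro _ ⟨α, rfl⟩
    exact ⟨D.isIntegral_V α, D.exists_torus_V α, D.isAmple α,
      fun ⟨β, h, _, hβ⟩ p => D.polytopeMonoid_iff_of_integral h hβ p⟩
  · rintro _ _ ⟨α, rfl⟩ ⟨β, rfl⟩
    exact ⟨D.closure_orb_inter_eq_empty, D.exists_inter_orb⟩
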